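/- **Setting.** Fix $T\in(0,\infty)$. Let $k(t,x):=(2\pi t)^{-1/2}e^{-x^2/(2t)}\mathbf 1_{\{t>0\}}$ be the heat kernel. Fix an initial condition $$q_{\mathrm{ic}}=\sum_{j=1}^{n}e^{\beta_j}\delta_{\zeta_j}+f,\qquad \zeta_1<\dots<\zeta_n,\ \ \beta_j\in\mathbb R,\ \ f\ge 0,\qquad \sup_{x\in\mathbb R} f(x)e^{-\beta|x|}<\infty\ \text{ for all real }\beta>\beta_*,$$ where $\beta_*\in\{-\infty\}\cup\mathbb R$ ($n=0$ or $f=0$ is allowed), and assume $\int_{\mathbb R} q_{\mathrm{ic}}(x)\,dx>0$. Fix $\xi_1<\dots<\xi_m$ and $\alpha_1,\dots,\alpha_m$ in $\mathbb R$. For $w\in L^2([0,T]\times\mathbb R)$, let $q=q[w]$ be the solution of $\partial_t q=\frac12\partial_{xx}q+wq$ with initial condition $q_{\mathrm{ic}}$ in the Duhamel sense: $q\in C((0,T]\times\mathbb R)$ and, for all $(t,x)\in(0,T]\times\mathbb R$, $$q(t,x)=\int_{\mathbb R} k(t,x-y)\,q_{\mathrm{ic}}(dy)+\int_{[0,T]\times\mathbb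 R}k(t-s,x-y)\,(wq)(s,y)\,ds\,dy,$$ the last integral converging absolutely. Similarly, for $\gamma_1,\dots,\gamma_m\in\mathbb R$, $p$ solves $-\partial_t p=\frac12\partial_{xx}p+pw$ with terminal condition $p(T,\cdot)=\sum_i\gamma_i\delta_{\xi_i}$ in the Duhamel sense if $p\in C([0,T)\times\mathbb R)$ and, for all $(t,x)\in[0,T)\times\mathbb R$, $$p(t,x)=\sum_{i=1}^m\gamma_i\,k(T-t,\xi_i-x)+\int_{[0,T]\times\mathbb R}(pw)(s,y)\,k(s-t,y-x)\,ds\,dy,$$ the last integral converging absolutely. Consider the variational problem $$\inf\Big\{\tfrac12\|w\|_{L^2([0,T]\times\mathbb R)}^2 : w\in L^2([0,T]\times\mathbb R),\ q[w](T,\xi_i)=e^{\alpha_i},\ i=1,\dots,m\Big\}.\tag{V}$$ **Theorem.** A minimizer of (V) exists. Let $w$ be any minimizer and set $q:=q[w]$. Then $q>0$ on $(0,T]\times\mathbb R$ and, after redefining $w$ on a Lebesgue-null set, $p:=w/q$ has the following properties for some $\gamma_1,\dots,\gamma_m\in\mathbb R$. 1. $q,p\in C^\infty((0,T)\times\mathbb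 R)$. 2. For all $\delta>0$ and $\kappa\in\mathbb Z_{\ge0}$ there is a constant $c$, depending only on $T$, $\|w\|_2$, $\delta$, $\kappa$, $q_{\mathrm{ic}}$ and $(\xi_i,\alpha_i)_{i}$ (in particular the same for all minimizers), such that $$|\partial_x^\kappa p(t,x)|\le c\sum_{i=1}^m\exp\Big(-\frac{(\xi_i-x)^2}{12(T-t)}\Big)\ \text{ for }(t,x)\in D,\qquad |\partial_x^\kappa q(t,x)|\le c\,e^{c|x|}\ \text{ for }(t,x)\in E,$$ the derivatives existing at all these points. With $\Lambda_\delta:=\bigcup_{i=1}^m[T-\delta^2,T]\times[\xi_i-\delta,\xi_i+\delta]$, here $D=([0,T]\times\mathbb R)\setminus\Lambda_\delta$ and $E=(\delta,T]\times\mathbb R$ when $\kappa=0$, and $D=E=((\delta,T]\times\mathbb R)\setminus\Lambda_\delta$ when $\kappa\ge1$. (At $t=T$ the right side of the first bound is read as $0$.) 3. The pair solves the imaginary-time nonlinear Schrödinger equations $$\partial_t q=\tfrac12\partial_{xx}q+wq=\tfrac12\partial_{xx}q+pq^2,\quad q(0,\cdot)=q_{\mathrm{ic}},\qquad -\partial_t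 p=\tfrac12\partial_{xx}p+pw=\tfrac12\partial_{xx}p+p^2q,\quad p(T,\cdot)=\sum_{i=1}^m\gamma_i\delta_{\xi_i},$$ in the Duhamel sense, and the equations hold classically in $(0,T)\times\mathbb R$. -/

import Mathlib

open Set MeasureTheory
open scoped ContDiff

namespace WeakNoise

noncomputable section

/-- The heat kernel `(2πt)^{-1/2} exp(-x²/(2t))`, truncated to be zero for `t ≤ 0`. -/
def hk (t x : ℝ) : ℝ :=
  if 0 < t then (Real.sqrt (2 * Real.pi * t))⁻¹ * Real.exp (-(x ^ 2) / (2 * t)) else 0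

/-- The space-time strip `[0,T] × ℝ`; a point is `(t, x)`. -/
def strip (T : ℝ) : Set (ℝ × ℝ) := Icc 0 T ×ˢ univ

/-- `w ∈ L²([0,T] × ℝ)`. -/
def InL2 (T : ℝ) (w : ℝ × ℝ → ℝ) : Prop := MemLp w 2 (volume.restrict (strip T))

/-- The cost `½ ‖w‖₂²`, the norm being that of `L²([0,T] × ℝ)`. -/
def cost (T : ℝ) (w : ℝ × ℝ → ℝ) : ℝ := (1 / 2) * ∫ z in strip T, w z ^ 2

/-- `sup_x f(x) / e^{b|x|} < ∞` for every real `b > β₀`, where `β₀ ∈ {-∞} ∪ ℝ`. -/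
def ExpBounded (β₀ : WithBot ℝ) (f : ℝ → ℝ) : Prop :=
  ∀ b : ℝ, β₀ < (b : WithBot ℝ) → ∃ C : ℝ, ∀ x : ℝ, f x ≤ C * Real.exp (b * |x|)

/-- The initial condition `∑ⱼ e^{βⱼ} δ_{ζⱼ} + f(x) dx`, as a measure on `ℝ` (for `f ≥ 0`). -/
def initMeasure {n : ℕ} (ζ β : Fin n → ℝ) (f : ℝ → ℝ) : Measure ℝ :=
  (∑ j, ENNReal.ofReal (Real.exp (β j)) • Measure.dirac (ζ j)) +
    volume.withDensity (fun x => ENNReal.ofReal (f x))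

/-- `q` solves `∂ₜ q = ½ ∂ₓₓ q + w q` with initial condition `μ`, in the Duhamel sense. Only the
values of `q` on `(0,T] × ℝ` matter. -/
structure IsDuhamelForward (T : ℝ) (μ : Measure ℝ) (w q : ℝ × ℝ → ℝ) : Prop where
  continuousOn : ContinuousOn q (Ioc 0 T ×ˢ univ)
  integrable : ∀ t ∈ Ioc 0 T, ∀ x : ℝ,
    IntegrableOn (fun z : ℝ × ℝ => hk (t - z.1) (x - z.2) * (w z * q z)) (strip T)
  eq : ∀ t ∈ Ioc 0 T, ∀ x : ℝ,
    q (t, x) = (∫ y, hk t (x - y) ∂μ) +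
      ∫ z in strip T, hk (t - z.1) (x - z.2) * (w z * q z)

/-- `p` solves `-∂ₜ p = ½ ∂ₓₓ p + p w` with terminal condition `∑ᵢ γᵢ δ_{ξᵢ}`, in the Duhamel
sense. Only the values of `p` on `[0,T) × ℝ` matter. -/
structure IsDuhamelBackward (T : ℝ) {m : ℕ} (ξ γ : Fin m → ℝ) (w p : ℝ × ℝ → ℝ) : Prop where
  continuousOn : ContinuousOn p (Ico 0 T ×ˢ univ)
  integrable : ∀ t ∈ Ico 0 T, ∀ x : ℝ,
    IntegrableOn (fun z : ℝ × ℝ => p z * w z * hk (z.1 - t) (z.2 - x)) (strip T)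
  eq : ∀ t ∈ Ico 0 T, ∀ x : ℝ,
    p (t, x) = (∑ i, γ i * hk (T - t) (ξ i - x)) +
      ∫ z in strip T, p z * w z * hk (z.1 - t) (z.2 - x)

/-- The set over which the cost is minimized: the `w ∈ L²([0,T] × ℝ)` whose driven solution `q`
has the values `q(T, ξᵢ) = e^{αᵢ}`. -/
def admissible (T : ℝ) (μ : Measure ℝ) {m : ℕ} (ξ α : Fin m → ℝ) : Set (ℝ × ℝ → ℝ) :=
  {w | InL2 T w ∧ ∃ q : ℝ × ℝ → ℝ, IsDuhamelForward T μ w q ∧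
    ∀ i, q (T, ξ i) = Real.exp (α i)}

/-- `w` attains the infimum of the cost over the admissible set. -/
def IsMinimizer (T : ℝ) (μ : Measure ℝ) {m : ℕ} (ξ α : Fin m → ℝ) (w : ℝ × ℝ → ℝ) : Prop :=
  w ∈ admissible T μ ξ α ∧ ∀ w' ∈ admissible T μ ξ α, cost T w ≤ cost T w'

/-- The union over `i` of the boxes `[T-δ², T] × [ξᵢ-δ, ξᵢ+δ]`. -/
def boxes (T : ℝ) {m : ℕ} (ξ : Fin m → ℝ) (δ : ℝ) : Set (ℝ × ℝ) :=
  ⋃ i, Icc (T - δ ^ 2) T ×ˢ Icc (ξ i - δ) (ξ i + δ)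

/-- The domain of the bound on `∂ₓᵏ p`. -/
def domP (T : ℝ) {m : ℕ} (ξ : Fin m → ℝ) (δ : ℝ) (k : ℕ) : Set (ℝ × ℝ) :=
  if k = 0 then strip T \ boxes T ξ δ else (Ioc δ T ×ˢ univ) \ boxes T ξ δ

/-- The domain of the bound on `∂ₓᵏ q`. -/
def domQ (T : ℝ) {m : ℕ} (ξ : Fin m → ℝ) (δ : ℝ) (k : ℕ) : Set (ℝ × ℝ) :=
  if k = 0 then Ioc δ T ×ˢ univ else (Ioc δ T ×ˢ univ) \ boxes T ξ δ

/-- The weight `∑ᵢ exp(-(ξᵢ-x)² / (12 (T-t)))` for `t < T`. For `t = T` it is `0`, the limit as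
`t ↑ T`, since it is only used at points with `x ≠ ξᵢ` for all `i` when `t = T`. -/
def weightP (T : ℝ) {m : ℕ} (ξ : Fin m → ℝ) (t x : ℝ) : ℝ :=
  if t < T then ∑ i, Real.exp (-((ξ i - x) ^ 2) / (12 * (T - t))) else 0

/-- `k`-th derivative in the space variable. -/
def dx (k : ℕ) (g : ℝ × ℝ → ℝ) (t x : ℝ) : ℝ := iteratedDeriv k (fun y => g (t, y)) x

/-- Derivative in the time variable. -/
def dt (g : ℝ × ℝ → ℝ) (t x : ℝ) : ℝ := deriv (fun s => g (s, x)) t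

/-- The derivative bounds on `p` and `q`, with constants `c δ k`. The derivatives are part of the
claim: they exist at every point of the respective domain, also at `t = T`. -/
def DerivBounds (T : ℝ) {m : ℕ} (ξ : Fin m → ℝ) (c : ℝ → ℕ → ℝ) (q p : ℝ × ℝ → ℝ) : Prop :=
  ∀ δ : ℝ, 0 < δ → ∀ k : ℕ,
    (∀ t x : ℝ, (t, x) ∈ domP T ξ δ k →
      ContDiffAt ℝ k (fun y => p (t, y)) x ∧ |dx k p t x| ≤ c δ k * weightP T ξ t x) ∧
    (∀ t x : ℝ, (t, x) ∈ domQ T ξ δ k →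
      ContDiffAt ℝ k (fun y => q (t, y)) x ∧ |dx k q t x| ≤ c δ k * Real.exp (c δ k * |x|))

end

end WeakNoise

/-!
A potential `w ∈ L²` is subcritical in one space dimension: by the semigroup property and the bound
`k² ≤ k/√t`, the weighted norm `∫ (k(a-z) e^{-l(a-z)} k(z-b))² dz` is at most `l^{-1/2} k(a-b)²`
(`lintegral_ehk_sq_le`), and the estimate passes to superpositions `N` of heat kernels. By the
Cauchy–Schwarz inequality the Duhamel operator `g ↦ ∫ k w g` is therefore a contraction on functions
bounded by `e^{lt} N`, once `l` is large compared to `‖w‖₂⁴` (`Dominating.lintegral_le`). All of the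
linear theory rests on this. The solution is a Neumann series `sol`, bounded by a multiple of the
free solution (`abs_sol_le'`), continuous (`continuousAt_sol`), and unique without a growth condition
(`eq_zero_of_le_lintegral`), because the convergence of the Duhamel integral itself makes it a
superposition of heat kernels. It is also bounded below by a multiple of the free solution
(`sol_lower_bound`), hence positive. Backward solutions arise by time reversal (`back`, `bwd`), and
testing the fundamental solution of one potential against the solution of another expresses
their difference exactly (`sol_sub_sol`).

A minimizer exists by the direct method (`exists_isMinimizer`). Adding bumps to the free solution and
reading the potential off the equation gives an admissible potential (`admissible_nonempty`); each
term of the Neumann series is weakly continuous in the potential, so the constraints pass to weak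
limits (`tendsto_sol`).

By `sol_sub_sol`, the value `q(T, ξᵢ)` is strictly differentiable in `w`, with gradient
`back · fwd` (`hasStrictFDerivAt_sol`). Shortly before the time `T`, near `ξᵢ`, the backward solution
ending at `ξᵢ` exceeds the other ones, so these gradients are linearly independent, with a constant
that depends on the norm of `w` only (`exists_sq_le_integral`). The Lagrange multiplier rule then
gives `w = p q` with multipliers that are bounded uniformly over the minimizers, as these share their
norm (`exists_critical`).

Given `w = p q`, the pair solves a coupled system with continuous sources `p q²` and `p² q`. A smooth
function is controlled in its space derivative at a point by its values and those of its image
under the heat operator on the past half of a neighbourhood (`exists_abs_Dx_le`). Applied to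
mollifications this gives a weak solution one space derivative more than its source; the system then
yields all space derivatives, and with the equations all derivatives (`system_regular`). Applied to
the space derivatives of the solutions it yields the bounds by induction on the order
(`exists_Dx_iterate_le`). In each step the point moves within a small neighbourhood, which costs a part
of the exponent of the Gaussian weight: the exponents range in `(0, 1/2)`, where `1/2` is that of the
heat kernel, so that `1/12` is attained at every order. Only past neighbourhoods of `q`, and future ones
of `p`, are used, so the bounds hold up to the time `T`.
-/

namespace WeakNoise

noncomputable section

open Filter Topology
open scoped ENNReal NNReal

/-! ### The heat kernel -/

theorem hk_of_pos {t : ℝ} (ht : 0 < t) (x : ℝ) :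
    hk t x = (Real.sqrt (2 * Real.pi * t))⁻¹ * Real.exp (-(x ^ 2) / (2 * t)) := if_pos ht

theorem hk_of_nonpos {t : ℝ} (ht : t ≤ 0) (x : ℝ) : hk t x = 0 := if_neg (not_lt.2 ht)

theorem hk_nonneg (t x : ℝ) : 0 ≤ hk t x := by
  unfold hk; split_ifs <;> positivity

theorem hk_pos {t : ℝ} (ht : 0 < t) (x : ℝ) : 0 < hk t x := by
  rw [hk_of_pos ht]; positivity

theorem hk_neg (t x : ℝ) : hk t (-x) = hk t x := by
  unfold hk; simp

theorem hk_sub_comm (t x y : ℝ) : hk t (x - y) = hk t (y - x) := by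
  rw [← hk_neg, neg_sub]

theorem measurable_hk : Measurable (fun z : ℝ × ℝ => hk z.1 z.2) := by
  unfold hk
  refine Measurable.ite (measurableSet_lt measurable_const measurable_fst) ?_ measurable_const
  fun_prop

theorem measurable_hk_comp {α : Type*} [MeasurableSpace α] {f g : α → ℝ} (hf : Measurable f)
    (hg : Measurable g) : Measurable (fun a => hk (f a) (g a)) :=
  measurable_hk.comp (hf.prodMk hg)

theorem hk_eq_gaussianPDFReal {t : ℝ} (ht : 0 < t) (x : ℝ) :
    hk t x = ProbabilityTheory.gaussianPDFReal 0 ⟨t, ht.le⟩ x := by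
  rw [hk_of_pos ht]
  simp [ProbabilityTheory.gaussianPDFReal]
  rfl

theorem integrable_hk (t : ℝ) : Integrable (hk t) := by
  rcases lt_or_ge 0 t with ht | ht
  · have := ProbabilityTheory.integrable_gaussianPDFReal 0 ⟨t, ht.le⟩
    exact this.congr (Eventually.of_forall fun x => (hk_eq_gaussianPDFReal ht x).symm)
  · have : hk t = 0 := funext fun x => hk_of_nonpos ht x
    rw [this]; exact integrable_zero _ _ _

theorem integral_hk {t : ℝ} (ht : 0 < t) : ∫ x, hk t x = 1 := by
  rw [← ProbabilityTheory.integral_gaussianPDFReal_eq_one 0 (v := ⟨t, ht.le⟩)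
    (fun h => ht.ne' (congrArg NNReal.toReal h))]
  exact integral_congr_ae (Eventually.of_forall fun x => hk_eq_gaussianPDFReal ht x)

theorem lintegral_hk {t : ℝ} (ht : 0 < t) (m : ℝ) :
    ∫⁻ x, ENNReal.ofReal (hk t (x - m)) = 1 := by
  rw [lintegral_sub_right_eq_self (fun x => ENNReal.ofReal (hk t x)) m,
    ← ofReal_integral_eq_lintegral_ofReal (integrable_hk t)
    (Eventually.of_forall (hk_nonneg t)), integral_hk ht, ENNReal.ofReal_one]

/-- Completing the square. -/
theorem hk_mul_hk {a b : ℝ} (ha : 0 < a) (hb : 0 < b) (x y : ℝ) :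
    hk a (x - y) * hk b y = hk (a + b) x * hk (a * b / (a + b)) (y - b * x / (a + b)) := by
  have hab : 0 < a + b := by positivity
  have hc : 0 < a * b / (a + b) := by positivity
  rw [hk_of_pos ha, hk_of_pos hb, hk_of_pos hab, hk_of_pos hc]
  have e1 : Real.exp (-(x - y) ^ 2 / (2 * a)) * Real.exp (-y ^ 2 / (2 * b)) =
      Real.exp (-x ^ 2 / (2 * (a + b))) *
        Real.exp (-(y - b * x / (a + b)) ^ 2 / (2 * (a * b / (a + b)))) := by
    rw [← Real.exp_add, ← Real.exp_add]
    congr 1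
    field_simp
    ring
  have e2 : Real.sqrt (2 * Real.pi * a) * Real.sqrt (2 * Real.pi * b) =
      Real.sqrt (2 * Real.pi * (a + b)) * Real.sqrt (2 * Real.pi * (a * b / (a + b))) := by
    rw [← Real.sqrt_mul (by positivity), ← Real.sqrt_mul (by positivity)]
    congr 1
    field_simp
  calc _ = (Real.sqrt (2 * Real.pi * a) * Real.sqrt (2 * Real.pi * b))⁻¹ *
        (Real.exp (-(x - y) ^ 2 / (2 * a)) * Real.exp (-y ^ 2 / (2 * b))) := by
        rw [mul_inv]; ring
    _ = _ := by rw [e1, e2, mul_inv]; ring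

theorem hk_sq {t : ℝ} (ht : 0 < t) (x : ℝ) :
    hk t x ^ 2 = (Real.sqrt (4 * Real.pi * t))⁻¹ * hk (t / 2) x := by
  have h1 : Real.sqrt (2 * Real.pi * t) ^ 2 =
      Real.sqrt (4 * Real.pi * t) * Real.sqrt (2 * Real.pi * (t / 2)) := by
    rw [← Real.sqrt_mul (by positivity), Real.sq_sqrt (by positivity),
      show 4 * Real.pi * t * (2 * Real.pi * (t / 2)) = (2 * Real.pi * t) ^ 2 by ring,
      Real.sqrt_sq (by positivity)]
  rw [hk_of_pos ht, hk_of_pos (half_pos ht), mul_pow, inv_pow, h1, mul_inv, ← Real.exp_nat_mul]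
  rw [mul_assoc]
  congr 3
  push_cast
  field_simp

/-- The Chapman–Kolmogorov identity. -/
theorem lintegral_hk_mul_hk {a b : ℝ} (ha : 0 < a) (hb : 0 < b) (x z : ℝ) :
    ∫⁻ y, ENNReal.ofReal (hk a (x - y)) * ENNReal.ofReal (hk b (y - z)) =
      ENNReal.ofReal (hk (a + b) (x - z)) := by
  have : ∀ y, ENNReal.ofReal (hk a (x - y)) * ENNReal.ofReal (hk b (y - z)) =
      ENNReal.ofReal (hk (a + b) (x - z)) *
        ENNReal.ofReal (hk (a * b / (a + b)) (y - (z + b * (x - z) / (a + b)))) := fun y => by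
    rw [← ENNReal.ofReal_mul (hk_nonneg _ _), ← ENNReal.ofReal_mul (hk_nonneg _ _)]
    have := hk_mul_hk ha hb (x - z) (y - z)
    rw [sub_sub_sub_cancel_right] at this
    rw [this, sub_sub]
  simp_rw [this]
  rw [lintegral_const_mul _ ((measurable_hk_comp measurable_const (by fun_prop)).ennreal_ofReal),
    lintegral_hk (by positivity), mul_one]

theorem lintegral_sq_hk_mul_hk {a b : ℝ} (ha : 0 < a) (hb : 0 < b) (x z : ℝ) :
    ∫⁻ y, ENNReal.ofReal ((hk a (x - y) * hk b (y - z)) ^ 2) =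
      ENNReal.ofReal (hk (a + b) (x - z) ^ 2 *
        ((Real.sqrt (4 * Real.pi))⁻¹ * Real.sqrt ((a + b) / (a * b)))) := by
  have hc : 0 < a * b / (a + b) := by positivity
  have : ∀ y, ENNReal.ofReal ((hk a (x - y) * hk b (y - z)) ^ 2) =
      ENNReal.ofReal (hk (a + b) (x - z) ^ 2 *
          ((Real.sqrt (4 * Real.pi))⁻¹ * Real.sqrt ((a + b) / (a * b)))) *
        ENNReal.ofReal (hk (a * b / (a + b) / 2) (y - (z + b * (x - z) / (a + b)))) := fun y => by
    rw [← ENNReal.ofReal_mul (by positivity)]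
    have := hk_mul_hk ha hb (x - z) (y - z)
    rw [sub_sub_sub_cancel_right] at this
    rw [this, sub_sub, mul_pow, hk_sq hc]
    congr 1
    rw [Real.sqrt_mul (by positivity) (a * b / (a + b)), mul_inv, ← Real.sqrt_inv (a * b / _),
      inv_div]
    ring
  simp_rw [this]
  rw [lintegral_const_mul _ ((measurable_hk_comp measurable_const (by fun_prop)).ennreal_ofReal),
    lintegral_hk (by positivity), mul_one]

/-! ### The weighted space-time `L²` estimate -/

/-- The heat kernel of space-time, with values in `[0, ∞]`. -/
def ehk (z : ℝ × ℝ) : ℝ≥0∞ := ENNReal.ofReal (hk z.1 z.2)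

theorem measurable_ehk : Measurable ehk := measurable_hk.ennreal_ofReal

/-- The weight `exp (-l (a - z))` in the time variable. -/
def ew (l : ℝ) (a z : ℝ × ℝ) : ℝ≥0∞ := ENNReal.ofReal (Real.exp (-(l * (a.1 - z.1))))

theorem lintegral_exp_mul_inv_sqrt {l : ℝ} (hl : 0 < l) :
    ∫⁻ r in Ioi (0 : ℝ), ENNReal.ofReal (Real.exp (-(2 * l * r)) * (Real.sqrt r)⁻¹) =
      ENNReal.ofReal (Real.sqrt (Real.pi / (2 * l))) := by
  have h := Real.integral_rpow_mul_exp_neg_mul_Ioi (a := 1 / 2) (r := 2 * l) (by norm_num)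
    (by positivity)
  have h0 : ∀ r ∈ Ioi (0 : ℝ), r ^ ((1 / 2 : ℝ) - 1) * Real.exp (-(2 * l * r)) =
      Real.exp (-(2 * l * r)) * (Real.sqrt r)⁻¹ := fun r hr => by
    rw [mul_comm, Real.sqrt_eq_rpow, ← Real.rpow_neg (le_of_lt hr)]; norm_num
  rw [setIntegral_congr_fun measurableSet_Ioi h0, Real.Gamma_one_half_eq,
    ← Real.sqrt_eq_rpow, ← Real.sqrt_mul (by positivity), one_div, inv_mul_eq_div] at h
  rw [← h, ofReal_integral_eq_lintegral_ofReal]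
  · by_contra hc
    rw [integral_undef hc] at h
    exact (Real.sqrt_pos.2 (by positivity)).ne h
  · exact ae_of_all _ fun r => by positivity

/-- The time integral behind the weighted estimate: `k (t-s) k (s-r)` has the singularity
`(t-s)^(-1/2) (s-r)^(-1/2)`, which is integrable, and the weight gains the factor `l^(-1/2)`. -/
theorem lintegral_time_weight {l r t : ℝ} (hl : 0 < l) :
    ∫⁻ s in Ioo r t, ENNReal.ofReal (Real.exp (-(2 * l * (t - s))) *
        Real.sqrt ((t - r) / ((t - s) * (s - r)))) ≤
      ENNReal.ofReal (2 * Real.sqrt (Real.pi / l)) := by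
  set F : ℝ → ℝ≥0∞ := fun a => (Ioi (0 : ℝ)).indicator
    (fun a => ENNReal.ofReal (Real.exp (-(2 * l * a)) * (Real.sqrt a)⁻¹)) a with hF
  have hFm : Measurable F := Measurable.indicator (by fun_prop) measurableSet_Ioi
  have key : ∀ s ∈ Ioo r t, ENNReal.ofReal (Real.exp (-(2 * l * (t - s))) *
      Real.sqrt ((t - r) / ((t - s) * (s - r)))) ≤
        ENNReal.ofReal (Real.sqrt 2) * (F (t - s) + F (s - r)) := by
    rintro s ⟨h1, h2⟩
    have ha : 0 < t - s := sub_pos.2 h2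
    have hb : 0 < s - r := sub_pos.2 h1
    rw [hF]
    simp only [indicator_of_mem (mem_Ioi.2 ha), indicator_of_mem (mem_Ioi.2 hb)]
    rw [← ENNReal.ofReal_add (by positivity) (by positivity),
      ← ENNReal.ofReal_mul (by positivity)]
    apply ENNReal.ofReal_le_ofReal
    rw [mul_add]
    -- the larger of the two intervals is at least half of the total
    rcases le_total (t - s) (s - r) with hle | hle
    · have : Real.sqrt ((t - r) / ((t - s) * (s - r))) ≤ Real.sqrt 2 * (Real.sqrt (t - s))⁻¹ := by
        rw [← Real.sqrt_inv, ← Real.sqrt_mul (by positivity)]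
        apply Real.sqrt_le_sqrt
        rw [div_le_iff₀ (by positivity)]
        field_simp
        linarith
      have h3 := mul_le_mul_of_nonneg_left this (Real.exp_pos (-(2 * l * (t - s)))).le
      have h4 : 0 ≤ Real.sqrt 2 * (Real.exp (-(2 * l * (s - r))) * (Real.sqrt (s - r))⁻¹) := by
        positivity
      linarith
    · have : Real.sqrt ((t - r) / ((t - s) * (s - r))) ≤ Real.sqrt 2 * (Real.sqrt (s - r))⁻¹ := by
        rw [← Real.sqrt_inv, ← Real.sqrt_mul (by positivity)]
        apply Real.sqrt_le_sqrt
        rw [div_le_iff₀ (by positivity)]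
        field_simp
        linarith
      have h5 : Real.exp (-(2 * l * (t - s))) ≤ Real.exp (-(2 * l * (s - r))) := by
        apply Real.exp_le_exp.2
        nlinarith
      have h3 := mul_le_mul h5 this (by positivity) (by positivity)
      have h4 : 0 ≤ Real.sqrt 2 * (Real.exp (-(2 * l * (t - s))) * (Real.sqrt (t - s))⁻¹) := by
        positivity
      linarith
  have hFi : ∫⁻ a, F a = ENNReal.ofReal (Real.sqrt (Real.pi / (2 * l))) := by
    rw [hF, lintegral_indicator measurableSet_Ioi, lintegral_exp_mul_inv_sqrt hl]
  calc _ ≤ ∫⁻ s in Ioo r t, ENNReal.ofReal (Real.sqrt 2) * (F (t - s) + F (s - r)) :=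
        setLIntegral_mono' measurableSet_Ioo key
    _ ≤ ∫⁻ s, ENNReal.ofReal (Real.sqrt 2) * (F (t - s) + F (s - r)) :=
        setLIntegral_le_lintegral _ _
    _ = ENNReal.ofReal (Real.sqrt 2) * (ENNReal.ofReal (Real.sqrt (Real.pi / (2 * l))) +
          ENNReal.ofReal (Real.sqrt (Real.pi / (2 * l)))) := by
        rw [lintegral_const_mul _ (by fun_prop), lintegral_add_left (by fun_prop),
          lintegral_sub_left_eq_self F t, lintegral_sub_right_eq_self F r, hFi]
    _ = _ := by
        rw [← ENNReal.ofReal_add (by positivity) (by positivity),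
          ← ENNReal.ofReal_mul (by positivity), ← two_mul, mul_left_comm,
          ← Real.sqrt_mul (by positivity), show 2 * (Real.pi / (2 * l)) = Real.pi / l by field_simp]

/-- The two factors of heat kernels through an intermediate point `z` are, in weighted `L²(dz)`,
a small multiple of the kernel that joins the end points. This is what makes a potential in
`L²` subcritical in one space dimension. -/
theorem lintegral_ehk_sq_le (a b : ℝ × ℝ) {l : ℝ} (hl : 0 < l) :
    ∫⁻ z, (ehk (a - z) * ew l a z * ehk (z - b)) ^ 2 ≤
      ENNReal.ofReal (Real.sqrt l)⁻¹ * ehk (a - b) ^ 2 := by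
  obtain ⟨t, x⟩ := a
  obtain ⟨r, x'⟩ := b
  have hm : Measurable fun z : ℝ × ℝ => (ehk ((t, x) - z) * ew l (t, x) z * ehk (z - (r, x'))) ^ 2 :=
    by
      have h1 : Measurable fun z : ℝ × ℝ => ehk ((t, x) - z) := measurable_ehk.comp (by fun_prop)
      have h2 : Measurable fun z : ℝ × ℝ => ehk (z - (r, x')) := measurable_ehk.comp (by fun_prop)
      have h3 : Measurable fun z : ℝ × ℝ => ew l (t, x) z := by unfold ew; fun_prop
      exact ((h1.mul h3).mul h2).pow_const 2
  rw [Measure.volume_eq_prod, lintegral_prod _ (by exact hm.aemeasurable)]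
  have inner : ∀ s, ∫⁻ y, (ehk ((t, x) - (s, y)) * ew l (t, x) (s, y) * ehk ((s, y) - (r, x'))) ^ 2
      = (Ioo r t).indicator (fun s => ENNReal.ofReal (hk (t - r) (x - x') ^ 2 *
        (Real.sqrt (4 * Real.pi))⁻¹) * ENNReal.ofReal (Real.exp (-(2 * l * (t - s))) *
        Real.sqrt ((t - r) / ((t - s) * (s - r))))) s := by
    intro s
    by_cases hs : s ∈ Ioo r t
    · rw [indicator_of_mem hs]
      have ha : 0 < t - s := sub_pos.2 hs.2
      have hb : 0 < s - r := sub_pos.2 hs.1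
      have : ∀ y, (ehk ((t, x) - (s, y)) * ew l (t, x) (s, y) * ehk ((s, y) - (r, x'))) ^ 2 =
          ENNReal.ofReal (Real.exp (-(2 * l * (t - s)))) *
            ENNReal.ofReal ((hk (t - s) (x - y) * hk (s - r) (y - x')) ^ 2) := fun y => by
        simp only [ehk, ew, Prod.mk_sub_mk]
        have n1 := hk_nonneg (t - s) (x - y)
        have n2 := hk_nonneg (s - r) (y - x')
        rw [← ENNReal.ofReal_mul (by positivity), ← ENNReal.ofReal_mul (by positivity),
          ← ENNReal.ofReal_mul (by positivity), ← ENNReal.ofReal_pow (by positivity)]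
        congr 1
        rw [show -(2 * l * (t - s)) = -(l * (t - s)) + -(l * (t - s)) by ring, Real.exp_add]
        ring
      simp_rw [this]
      rw [lintegral_const_mul _ (by
        exact (((measurable_hk_comp measurable_const (by fun_prop)).mul
          (measurable_hk_comp measurable_const (by fun_prop))).pow_const 2).ennreal_ofReal),
        lintegral_sq_hk_mul_hk ha hb, sub_add_sub_cancel, ← ENNReal.ofReal_mul (by positivity),
        ← ENNReal.ofReal_mul (by positivity)]
      congr 1
      ring
    · rw [indicator_of_notMem hs]
      rw [lintegral_eq_zero_iff' (by
        exact (hm.comp (measurable_const.prodMk measurable_id)).aemeasurable)]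
      refine Eventually.of_forall fun y => ?_
      rw [mem_Ioo, not_and_or, not_lt, not_lt] at hs
      rcases hs with hs | hs
      · simp [ehk, hk_of_nonpos (sub_nonpos.2 hs)]
      · simp [ehk, hk_of_nonpos (sub_nonpos.2 hs)]
  simp_rw [inner]
  rw [lintegral_indicator measurableSet_Ioo, lintegral_const_mul _ (by fun_prop)]
  refine (mul_le_mul_right (lintegral_time_weight hl) _).trans (le_of_eq ?_)
  rw [ehk, ← ENNReal.ofReal_pow (hk_nonneg _ _), ← ENNReal.ofReal_mul (by positivity),
    ← ENNReal.ofReal_mul (by positivity)]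
  congr 1
  simp only [Prod.mk_sub_mk]
  have : (Real.sqrt (4 * Real.pi))⁻¹ * (2 * Real.sqrt (Real.pi / l)) = (Real.sqrt l)⁻¹ := by
    rw [Real.sqrt_div (by positivity), Real.sqrt_mul (by positivity),
      show (4 : ℝ) = 2 ^ 2 by norm_num, Real.sqrt_sq (by positivity)]
    have : Real.sqrt Real.pi ≠ 0 := (Real.sqrt_pos.2 Real.pi_pos).ne'
    field_simp
  rw [mul_assoc, this, mul_comm]

theorem sq_lintegral_mul_le {α : Type*} [MeasurableSpace α] {ν : Measure α} {f g : α → ℝ≥0∞}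
    (hf : AEMeasurable f ν) (hg : AEMeasurable g ν) :
    (∫⁻ a, f a * g a ∂ν) ^ 2 ≤ (∫⁻ a, f a ^ 2 ∂ν) * ∫⁻ a, g a ^ 2 ∂ν := by
  have h := ENNReal.lintegral_mul_le_Lp_mul_Lq ν Real.HolderConjugate.two_two hf hg
  have h2 := pow_le_pow_left' h 2
  simp only [Pi.mul_apply, ENNReal.rpow_two] at h2
  refine h2.trans (le_of_eq ?_)
  rw [mul_pow, ← ENNReal.rpow_two, ← ENNReal.rpow_two, ← ENNReal.rpow_mul, ← ENNReal.rpow_mul]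
  norm_num

/-- A `[0, ∞]`-valued function on space-time that satisfies the weighted `L²` estimate of the
heat kernel. Every superposition of heat kernels does. -/
structure Dominating (N : ℝ × ℝ → ℝ≥0∞) : Prop where
  measurable : Measurable N
  lintegral_sq_le : ∀ (a : ℝ × ℝ) (l : ℝ), 0 < l →
    ∫⁻ z, (ehk (a - z) * ew l a z * N z) ^ 2 ≤ ENNReal.ofReal (Real.sqrt l)⁻¹ * N a ^ 2

theorem measurable_ehk_sub : Measurable fun p : (ℝ × ℝ) × (ℝ × ℝ) => ehk (p.1 - p.2) :=
  measurable_ehk.comp (measurable_fst.sub measurable_snd)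

theorem measurable_ehk_sub_left (a : ℝ × ℝ) : Measurable fun z => ehk (a - z) :=
  measurable_ehk.comp (measurable_const.sub measurable_id)

theorem measurable_ew_right (l : ℝ) (a : ℝ × ℝ) : Measurable fun z => ew l a z := by
  unfold ew; fun_prop

/-- The heat potential of a measure on space-time. -/
def potential (ν : Measure (ℝ × ℝ)) (a : ℝ × ℝ) : ℝ≥0∞ := ∫⁻ b, ehk (a - b) ∂ν

/-- Minkowski's inequality for a superposition of functions in `L²`. -/
theorem lintegral_sq_lintegral_le {α β : Type*} [MeasurableSpace α] [MeasurableSpace β]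
    (μ : Measure α) [SFinite μ] (ν : Measure β) [SFinite ν] {G : α → β → ℝ≥0∞} {h : β → ℝ≥0∞}
    {c : ℝ≥0∞} (hG : Measurable (Function.uncurry G)) (hh : Measurable h)
    (hle : ∀ b, ∫⁻ z, G z b ^ 2 ∂μ ≤ c * h b ^ 2) :
    ∫⁻ z, (∫⁻ b, G z b ∂ν) ^ 2 ∂μ ≤ c * (∫⁻ b, h b ∂ν) ^ 2 := by
  have hGz : ∀ z, Measurable (G z) := fun z => hG.comp (measurable_const.prodMk measurable_id)
  have hGb : ∀ b, Measurable fun z => G z b := fun b =>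
    hG.comp (measurable_id.prodMk measurable_const)
  -- expand the square as a double integral
  have e1 : ∀ z, (∫⁻ b, G z b ∂ν) ^ 2 = ∫⁻ b, ∫⁻ b', G z b * G z b' ∂ν ∂ν := fun z => by
    rw [pow_two, ← lintegral_mul_const _ (hGz z)]
    refine lintegral_congr fun b => ?_
    rw [lintegral_const_mul _ (hGz z)]
  have hC : ∀ b, Measurable fun p : α × β => G p.1 b * G p.1 p.2 := fun b =>
    ((hGb b).comp measurable_fst).mul hG
  have hD : Measurable fun p : (α × β) × β => G p.1.1 p.1.2 * G p.1.1 p.2 :=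
    (hG.comp measurable_fst).mul (hG.comp
      ((measurable_fst.comp measurable_fst).prodMk measurable_snd))
  have hle2 : ∀ b b', ∫⁻ z, G z b * G z b' ∂μ ≤ c * (h b * h b') := fun b b' => by
    rw [← ENNReal.pow_le_pow_left_iff two_ne_zero]
    refine (sq_lintegral_mul_le (hGb b).aemeasurable (hGb b').aemeasurable).trans ?_
    refine (mul_le_mul' (hle b) (hle b')).trans (le_of_eq ?_)
    ring
  calc ∫⁻ z, (∫⁻ b, G z b ∂ν) ^ 2 ∂μ = ∫⁻ z, ∫⁻ b, ∫⁻ b', G z b * G z b' ∂ν ∂ν ∂μ :=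
        lintegral_congr e1
    _ = ∫⁻ b, ∫⁻ z, ∫⁻ b', G z b * G z b' ∂ν ∂μ ∂ν :=
        lintegral_lintegral_swap (Measurable.lintegral_prod_right' hD).aemeasurable
    _ = ∫⁻ b, ∫⁻ b', ∫⁻ z, G z b * G z b' ∂μ ∂ν ∂ν :=
        lintegral_congr fun b => lintegral_lintegral_swap (hC b).aemeasurable
    _ ≤ ∫⁻ b, ∫⁻ b', c * (h b * h b') ∂ν ∂ν :=
        lintegral_mono fun b => lintegral_mono fun b' => hle2 b b'
    _ = c * (∫⁻ b, h b ∂ν) ^ 2 := by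
        simp_rw [lintegral_const_mul _ (hh.const_mul _), lintegral_const_mul _ hh]
        rw [lintegral_const_mul _ (hh.mul_const _), lintegral_mul_const _ hh, pow_two]

theorem dominating_potential (ν : Measure (ℝ × ℝ)) [SFinite ν] : Dominating (potential ν) := by
  have hm : Measurable (potential ν) := measurable_ehk_sub.lintegral_prod_right'
  refine ⟨hm, fun a l hl => ?_⟩
  have hA : Measurable fun z => ehk (a - z) * ew l a z :=
    (measurable_ehk_sub_left a).mul (measurable_ew_right l a)
  have hAB : Measurable fun p : (ℝ × ℝ) × (ℝ × ℝ) =>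
      ehk (a - p.1) * ew l a p.1 * ehk (p.1 - p.2) :=
    (hA.comp measurable_fst).mul measurable_ehk_sub
  have h := lintegral_sq_lintegral_le volume ν
    (G := fun z b => ehk (a - z) * ew l a z * ehk (z - b)) hAB (measurable_ehk_sub_left a)
    (fun b => lintegral_ehk_sq_le a b hl)
  refine le_trans (le_of_eq (lintegral_congr fun z => ?_)) h
  rw [potential, lintegral_const_mul _
    (measurable_ehk_sub_left z)]

/-- The integral operator with kernel `hk` and an `L²` potential is bounded by a small multiple on
functions dominated by `N`, in the norm weighted by `exp (-l t)`. -/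
theorem Dominating.lintegral_le {N : ℝ × ℝ → ℝ≥0∞} (hN : Dominating N) {W : ℝ × ℝ → ℝ≥0∞}
    (hW : AEMeasurable W) {R l θ : ℝ} (hl : 0 < l) (hθ : 0 ≤ θ)
    (hR : ∫⁻ z, W z ^ 2 ≤ ENNReal.ofReal (R ^ 2)) (hRθ : R ^ 2 ≤ θ ^ 2 * Real.sqrt l)
    (a : ℝ × ℝ) :
    ∫⁻ z, ehk (a - z) * W z * (ENNReal.ofReal (Real.exp (l * z.1)) * N z) ≤
      ENNReal.ofReal θ * (ENNReal.ofReal (Real.exp (l * a.1)) * N a) := by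
  have hA : Measurable fun z => ehk (a - z) * ew l a z * N z :=
    ((measurable_ehk_sub_left a).mul (measurable_ew_right l a)).mul hN.measurable
  have e : ∀ z, ehk (a - z) * W z * (ENNReal.ofReal (Real.exp (l * z.1)) * N z) =
      ENNReal.ofReal (Real.exp (l * a.1)) * (W z * (ehk (a - z) * ew l a z * N z)) := fun z => by
    have : ENNReal.ofReal (Real.exp (l * z.1)) = ENNReal.ofReal (Real.exp (l * a.1)) * ew l a z := by
      rw [ew, ← ENNReal.ofReal_mul (by positivity), ← Real.exp_add]
      congr 2; ring
    rw [this]; ring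
  simp_rw [e]
  rw [lintegral_const_mul' _ _ ENNReal.ofReal_ne_top]
  have h2 : (∫⁻ z, W z * (ehk (a - z) * ew l a z * N z)) ≤ ENNReal.ofReal θ * N a := by
    rw [← ENNReal.pow_le_pow_left_iff two_ne_zero]
    refine (sq_lintegral_mul_le hW hA.aemeasurable).trans ?_
    refine (mul_le_mul' hR (hN.lintegral_sq_le a l hl)).trans ?_
    rw [← mul_assoc, mul_pow, ← ENNReal.ofReal_pow hθ, ← ENNReal.ofReal_mul (by positivity)]
    gcongr
    rw [← div_eq_mul_inv, div_le_iff₀ (Real.sqrt_pos.2 hl)]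
    exact hRθ
  calc _ ≤ ENNReal.ofReal (Real.exp (l * a.1)) * (ENNReal.ofReal θ * N a) := by gcongr
    _ = _ := by ring

/-! ### The Duhamel equation as a Neumann series -/

/-- The potential `w` on the whole space-time is measurable with `L²` norm at most `R`. -/
structure PotBound (w : ℝ × ℝ → ℝ) (R : ℝ) : Prop where
  aesm : AEStronglyMeasurable w volume
  nonneg : 0 ≤ R
  lintegral_le : ∫⁻ z, ‖w z‖ₑ ^ 2 ≤ ENNReal.ofReal (R ^ 2)

/-- A nonnegative finite function that satisfies the weighted `L²` estimate. It serves as the free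
part of a Duhamel equation. -/
structure FreeSol (g : ℝ × ℝ → ℝ) : Prop where
  nonneg : ∀ z, 0 ≤ g z
  dominating : Dominating fun z => ENNReal.ofReal (g z)

theorem FreeSol.measurable {g : ℝ × ℝ → ℝ} (hg : FreeSol g) : Measurable g := by
  have : g = fun z => (ENNReal.ofReal (g z)).toReal :=
    funext fun z => (ENNReal.toReal_ofReal (hg.nonneg z)).symm
  rw [this]
  exact hg.dominating.measurable.ennreal_toReal

/-- The Duhamel operator `g ↦ ∫ k (a - z) w(z) g(z) dz`. -/
def volterra (w g : ℝ × ℝ → ℝ) (a : ℝ × ℝ) : ℝ :=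
  ∫ z, hk (a.1 - z.1) (a.2 - z.2) * (w z * g z)

theorem measurable_hk_sub (a : ℝ × ℝ) :
    Measurable fun z : ℝ × ℝ => hk (a.1 - z.1) (a.2 - z.2) :=
  measurable_hk_comp (by fun_prop) (by fun_prop)

theorem enorm_hk_sub_mul (a z : ℝ × ℝ) (u v : ℝ) :
    ‖hk (a.1 - z.1) (a.2 - z.2) * (u * v)‖ₑ = ehk (a - z) * ‖u‖ₑ * ‖v‖ₑ := by
  rw [enorm_mul, enorm_mul, ehk, Real.enorm_of_nonneg (hk_nonneg _ _), mul_assoc]; rfl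

section

variable {w : ℝ × ℝ → ℝ} {R l θ A : ℝ} {g g₀ : ℝ × ℝ → ℝ}

theorem lintegral_hk_mul_le (hw : PotBound w R) (hg₀ : FreeSol g₀) (hl : 0 < l) (hθ : 0 ≤ θ)
    (hRθ : R ^ 2 ≤ θ ^ 2 * Real.sqrt l)
    (hA : 0 ≤ A) (hg : ∀ z, |g z| ≤ A * (Real.exp (l * z.1) * g₀ z)) (a : ℝ × ℝ) :
    ∫⁻ z, ‖hk (a.1 - z.1) (a.2 - z.2) * (w z * g z)‖ₑ ≤
      ENNReal.ofReal (A * θ * (Real.exp (l * a.1) * g₀ a)) := by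
  have h := hg₀.dominating.lintegral_le hw.aesm.enorm hl hθ hw.lintegral_le hRθ a
  have e : ∀ z, ‖hk (a.1 - z.1) (a.2 - z.2) * (w z * g z)‖ₑ ≤ ENNReal.ofReal A *
      (ehk (a - z) * ‖w z‖ₑ * (ENNReal.ofReal (Real.exp (l * z.1)) * ENNReal.ofReal (g₀ z))) := by
    intro z
    rw [enorm_hk_sub_mul]
    have h1 : ‖g z‖ₑ ≤ ENNReal.ofReal A *
        (ENNReal.ofReal (Real.exp (l * z.1)) * ENNReal.ofReal (g₀ z)) := by
      rw [← ENNReal.ofReal_mul (by positivity), ← ENNReal.ofReal_mul hA, ← ofReal_norm]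
      exact ENNReal.ofReal_le_ofReal (hg z)
    calc _ ≤ ehk (a - z) * ‖w z‖ₑ * (ENNReal.ofReal A *
        (ENNReal.ofReal (Real.exp (l * z.1)) * ENNReal.ofReal (g₀ z))) := by gcongr
      _ = _ := by ring
  refine (lintegral_mono e).trans ?_
  rw [lintegral_const_mul' _ _ ENNReal.ofReal_ne_top]
  calc _ ≤ ENNReal.ofReal A * (ENNReal.ofReal θ * (ENNReal.ofReal (Real.exp (l * a.1)) *
        ENNReal.ofReal (g₀ a))) := by gcongr
    _ = _ := by
      rw [← ENNReal.ofReal_mul (by positivity), ← ENNReal.ofReal_mul hθ, ← ENNReal.ofReal_mul hA,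
        mul_assoc]

theorem integrable_hk_mul (hw : PotBound w R) (hg₀ : FreeSol g₀) (hl : 0 < l) (hθ : 0 ≤ θ)
    (hRθ : R ^ 2 ≤ θ ^ 2 * Real.sqrt l) (hgm : AEStronglyMeasurable g volume)
    (hA : 0 ≤ A) (hg : ∀ z, |g z| ≤ A * (Real.exp (l * z.1) * g₀ z)) (a : ℝ × ℝ) :
    Integrable fun z : ℝ × ℝ => hk (a.1 - z.1) (a.2 - z.2) * (w z * g z) :=
  ⟨(measurable_hk_sub a).aestronglyMeasurable.mul (hw.aesm.mul hgm),
    (lintegral_hk_mul_le hw hg₀ hl hθ hRθ hA hg a).trans_lt ENNReal.ofReal_lt_top⟩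

theorem integral_abs_hk_mul_le (hw : PotBound w R) (hg₀ : FreeSol g₀) (hl : 0 < l) (hθ : 0 ≤ θ)
    (hRθ : R ^ 2 ≤ θ ^ 2 * Real.sqrt l) (hgm : AEStronglyMeasurable g volume)
    (hA : 0 ≤ A) (hg : ∀ z, |g z| ≤ A * (Real.exp (l * z.1) * g₀ z)) (a : ℝ × ℝ) :
    ∫ z, ‖hk (a.1 - z.1) (a.2 - z.2) * (w z * g z)‖ ≤
      A * θ * (Real.exp (l * a.1) * g₀ a) := by
  rw [integral_norm_eq_lintegral_enorm (integrable_hk_mul hw hg₀ hl hθ hRθ hgm hA hg a).1]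
  have := hg₀.nonneg a
  exact ENNReal.toReal_le_of_le_ofReal (by positivity)
    (lintegral_hk_mul_le hw hg₀ hl hθ hRθ hA hg a)

theorem abs_volterra_le (hw : PotBound w R) (hg₀ : FreeSol g₀) (hl : 0 < l) (hθ : 0 ≤ θ)
    (hRθ : R ^ 2 ≤ θ ^ 2 * Real.sqrt l) (hgm : AEStronglyMeasurable g volume)
    (hA : 0 ≤ A) (hg : ∀ z, |g z| ≤ A * (Real.exp (l * z.1) * g₀ z)) (a : ℝ × ℝ) :
    |volterra w g a| ≤ A * θ * (Real.exp (l * a.1) * g₀ a) :=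
  (norm_integral_le_integral_norm _).trans
    (integral_abs_hk_mul_le hw hg₀ hl hθ hRθ hgm hA hg a)

theorem aestronglyMeasurable_volterra (hw : AEStronglyMeasurable w volume)
    (hg : AEStronglyMeasurable g volume) : AEStronglyMeasurable (volterra w g) volume := by
  have : AEStronglyMeasurable (fun p : (ℝ × ℝ) × (ℝ × ℝ) =>
      hk (p.1.1 - p.2.1) (p.1.2 - p.2.2) * (w p.2 * g p.2)) (volume.prod volume) :=
    (measurable_hk_comp (by fun_prop) (by fun_prop)).aestronglyMeasurable.mul
      (hw.comp_snd.mul hg.comp_snd)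
  exact this.integral_prod_right'

theorem aestronglyMeasurable_iterate (hw : AEStronglyMeasurable w volume)
    (hg : AEStronglyMeasurable g volume) (n : ℕ) :
    AEStronglyMeasurable ((volterra w)^[n] g) volume := by
  induction n with
  | zero => exact hg
  | succ n ih => rw [Function.iterate_succ_apply']; exact aestronglyMeasurable_volterra hw ih

theorem abs_iterate_le (hw : PotBound w R) (hg₀ : FreeSol g₀) (hl : 0 < l) (hθ : 0 ≤ θ)
    (hRθ : R ^ 2 ≤ θ ^ 2 * Real.sqrt l) (hgm : AEStronglyMeasurable g volume)
    (hA : 0 ≤ A) (hg : ∀ z, |g z| ≤ A * (Real.exp (l * z.1) * g₀ z)) (n : ℕ) (a : ℝ × ℝ) :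
    |(volterra w)^[n] g a| ≤ A * θ ^ n * (Real.exp (l * a.1) * g₀ a) := by
  induction n generalizing a with
  | zero => simpa using hg a
  | succ n ih =>
    rw [Function.iterate_succ_apply', pow_succ, ← mul_assoc A]
    exact abs_volterra_le hw hg₀ hl hθ hRθ (aestronglyMeasurable_iterate hw.aesm hgm n)
      (by positivity) ih a

/-- A function that satisfies the integral inequality up to an error `B` is bounded in terms of
`B` only. -/
theorem abs_le_of_contraction (hw : PotBound w R) (hg₀ : FreeSol g₀) (hl : 0 < l) (hθ : 0 ≤ θ)
    (hθ2 : θ ≤ 1 / 2)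
    (hRθ : R ^ 2 ≤ θ ^ 2 * Real.sqrt l) {d : ℝ × ℝ → ℝ} (hd : AEStronglyMeasurable d volume)
    (hA : 0 ≤ A) (hdA : ∀ z, |d z| ≤ A * (Real.exp (l * z.1) * g₀ z)) {B : ℝ} (hB : 0 ≤ B)
    (hdB : ∀ a, |d a| ≤ B * (Real.exp (l * a.1) * g₀ a) +
      ∫ z, ‖hk (a.1 - z.1) (a.2 - z.2) * (w z * d z)‖) (a : ℝ × ℝ) :
    |d a| ≤ 2 * B * (Real.exp (l * a.1) * g₀ a) := by
  -- inserting the bound into the inequality halves the dependence on `A`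
  have key : ∀ n : ℕ, ∀ a, |d a| ≤ (A * (1 / 2) ^ n + 2 * B) * (Real.exp (l * a.1) * g₀ a) := by
    intro n
    induction n with
    | zero =>
      intro a
      refine (hdA a).trans ?_
      have := hg₀.nonneg a
      gcongr
      simp [hB]
    | succ n ih =>
      intro a
      refine (hdB a).trans ?_
      have h1 := integral_abs_hk_mul_le hw hg₀ hl hθ hRθ hd (by positivity) ih a
      have := hg₀.nonneg a
      have h2 : (A * (1 / 2) ^ n + 2 * B) * θ * (Real.exp (l * a.1) * g₀ a) ≤
          (A * (1 / 2) ^ n + 2 * B) * (1 / 2) * (Real.exp (l * a.1) * g₀ a) := by gcongr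
      refine (add_le_add_right (h1.trans h2) _).trans (le_of_eq ?_)
      ring
  have hlim : Tendsto (fun n : ℕ => (A * (1 / 2) ^ n + 2 * B) * (Real.exp (l * a.1) * g₀ a)) atTop
      (𝓝 ((A * 0 + 2 * B) * (Real.exp (l * a.1) * g₀ a))) :=
    (((tendsto_pow_atTop_nhds_zero_of_lt_one (by norm_num) (by norm_num)).const_mul A).add_const
      _).mul_const _
  have := ge_of_tendsto' hlim fun n => key n a
  simpa using this

end

/-- The solution of the Duhamel equation with free part `g`, as a Neumann series. -/
def sol (w g : ℝ × ℝ → ℝ) (a : ℝ × ℝ) : ℝ := ∑' n : ℕ, (volterra w)^[n] g a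

/-- The rate `16 R⁴ + 1` makes the Duhamel operator a contraction by the factor `1/2`. -/
theorem rate_le (R : ℝ) : R ^ 2 ≤ (1 / 2) ^ 2 * Real.sqrt (16 * R ^ 4 + 1) := by
  have : 4 * R ^ 2 ≤ Real.sqrt (16 * R ^ 4 + 1) :=
    Real.le_sqrt_of_sq_le (by nlinarith)
  linarith

section

variable {w : ℝ × ℝ → ℝ} {R l θ : ℝ} {g : ℝ × ℝ → ℝ}

theorem abs_le_exp_mul (hg : FreeSol g) (hg0 : ∀ z : ℝ × ℝ, z.1 ≤ 0 → g z = 0) (hl : 0 < l)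
    (z : ℝ × ℝ) : |g z| ≤ 1 * (Real.exp (l * z.1) * g z) := by
  rw [abs_of_nonneg (hg.nonneg z), one_mul]
  rcases le_or_gt z.1 0 with h | h
  · simp [hg0 z h]
  · exact le_mul_of_one_le_left (hg.nonneg z) (Real.one_le_exp (by positivity))

/-- The terms of the Neumann series decay geometrically in the weighted norm. -/
theorem abs_iterate_le' (hw : PotBound w R) (hg : FreeSol g)
    (hg0 : ∀ z : ℝ × ℝ, z.1 ≤ 0 → g z = 0) (hl : 0 < l) (hθ : 0 ≤ θ)
    (hRθ : R ^ 2 ≤ θ ^ 2 * Real.sqrt l) (n : ℕ) (a : ℝ × ℝ) :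
    |(volterra w)^[n] g a| ≤ θ ^ n * (Real.exp (l * a.1) * g a) := by
  simpa using abs_iterate_le hw hg hl hθ hRθ hg.measurable.aestronglyMeasurable zero_le_one
    (abs_le_exp_mul hg hg0 hl) n a

theorem hasSum_sol (hw : PotBound w R) (hg : FreeSol g)
    (hg0 : ∀ z : ℝ × ℝ, z.1 ≤ 0 → g z = 0) (a : ℝ × ℝ) :
    HasSum (fun n => (volterra w)^[n] g a) (sol w g a) := by
  refine (Summable.of_norm_bounded (g := fun n : ℕ => (1 / 2 : ℝ) ^ n *
    (Real.exp ((16 * R ^ 4 + 1) * a.1) * g a)) ?_ fun n => ?_).hasSum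
  · exact (summable_geometric_of_lt_one (by norm_num) (by norm_num)).mul_right _
  · exact abs_iterate_le' hw hg hg0 (by positivity) (by norm_num) (rate_le R) n a

theorem aestronglyMeasurable_sol (hw : PotBound w R) (hg : FreeSol g)
    (hg0 : ∀ z : ℝ × ℝ, z.1 ≤ 0 → g z = 0) : AEStronglyMeasurable (sol w g) volume := by
  refine aestronglyMeasurable_of_tendsto_ae atTop
    (f := fun n a => ∑ i ∈ Finset.range n, (volterra w)^[i] g a) (fun n => ?_)
    (ae_of_all _ fun a => (hasSum_sol hw hg hg0 a).tendsto_sum_nat)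
  exact Finset.aestronglyMeasurable_fun_sum _ fun i _ =>
    aestronglyMeasurable_iterate hw.aesm hg.measurable.aestronglyMeasurable i

/-- The solution is close to its free part when the contraction factor `θ` is small. -/
theorem abs_sol_sub_le (hw : PotBound w R) (hg : FreeSol g)
    (hg0 : ∀ z : ℝ × ℝ, z.1 ≤ 0 → g z = 0) (hl : 0 < l) (hθ : 0 ≤ θ) (hθ2 : θ ≤ 1 / 2)
    (hRθ : R ^ 2 ≤ θ ^ 2 * Real.sqrt l) (a : ℝ × ℝ) :
    |sol w g a - g a| ≤ 2 * θ * (Real.exp (l * a.1) * g a) := by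
  have hs := hasSum_sol hw hg hg0 a
  have h1 : HasSum (fun n => (volterra w)^[n + 1] g a) (sol w g a - g a) := by
    have := (hasSum_nat_add_iff' 1).2 hs
    simpa using this
  have h2 : HasSum (fun n : ℕ => θ ^ (n + 1) * (Real.exp (l * a.1) * g a))
      ((1 - θ)⁻¹ * θ * (Real.exp (l * a.1) * g a)) := by
    simp_rw [pow_succ]
    exact ((hasSum_geometric_of_lt_one hθ (by linarith)).mul_right θ).mul_right _
  have h3 : |sol w g a - g a| ≤ (1 - θ)⁻¹ * θ * (Real.exp (l * a.1) * g a) := by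
    rw [← h1.tsum_eq]
    exact tsum_of_norm_bounded h2 fun n => by
      rw [Real.norm_eq_abs]; exact abs_iterate_le' hw hg hg0 hl hθ hRθ (n + 1) a
  refine h3.trans ?_
  have := hg.nonneg a
  have h4 : (1 - θ)⁻¹ ≤ 2 := by
    rw [inv_le_comm₀ (by linarith) (by norm_num)]; linarith
  gcongr

theorem abs_sol_le (hw : PotBound w R) (hg : FreeSol g)
    (hg0 : ∀ z : ℝ × ℝ, z.1 ≤ 0 → g z = 0) (hl : 0 < l) (hθ : 0 ≤ θ) (hθ2 : θ ≤ 1 / 2)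
    (hRθ : R ^ 2 ≤ θ ^ 2 * Real.sqrt l) (a : ℝ × ℝ) :
    |sol w g a| ≤ 2 * (Real.exp (l * a.1) * g a) := by
  have h1 := abs_sol_sub_le hw hg hg0 hl hθ hθ2 hRθ a
  have h2 := abs_le_exp_mul hg hg0 hl a
  have h3 := abs_sub_abs_le_abs_sub (sol w g a) (g a)
  have : 0 ≤ Real.exp (l * a.1) * g a := mul_nonneg (Real.exp_pos _).le (hg.nonneg a)
  nlinarith

/-- The bound on the solution with the rate used throughout. -/
theorem abs_sol_le' (hw : PotBound w R) (hg : FreeSol g)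
    (hg0 : ∀ z : ℝ × ℝ, z.1 ≤ 0 → g z = 0) (a : ℝ × ℝ) :
    |sol w g a| ≤ 2 * (Real.exp ((16 * R ^ 4 + 1) * a.1) * g a) :=
  abs_sol_le hw hg hg0 (by positivity) (by norm_num) le_rfl (rate_le R) a

theorem integrable_hk_mul_sol (hw : PotBound w R) (hg : FreeSol g)
    (hg0 : ∀ z : ℝ × ℝ, z.1 ≤ 0 → g z = 0) (a : ℝ × ℝ) :
    Integrable fun z : ℝ × ℝ => hk (a.1 - z.1) (a.2 - z.2) * (w z * sol w g z) :=
  integrable_hk_mul hw hg (by positivity) (by norm_num) (rate_le R)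
    (aestronglyMeasurable_sol hw hg hg0) zero_le_two (abs_sol_le' hw hg hg0) a

theorem sol_eq (hw : PotBound w R) (hg : FreeSol g)
    (hg0 : ∀ z : ℝ × ℝ, z.1 ≤ 0 → g z = 0) (a : ℝ × ℝ) :
    sol w g a = g a + volterra w (sol w g) a := by
  have hs := hasSum_sol hw hg hg0
  have hl : 0 < 16 * R ^ 4 + 1 := by positivity
  have hi := fun n => abs_iterate_le' hw hg hg0 hl (by norm_num) (rate_le R) n
  have hm := fun n => aestronglyMeasurable_iterate hw.aesm hg.measurable.aestronglyMeasurable n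
  have hint := fun n => integrable_hk_mul hw hg hl (by norm_num) (rate_le R) (hm n)
    (by positivity) (hi n) a
  have hle := fun n => integral_abs_hk_mul_le hw hg hl (by norm_num) (rate_le R) (hm n)
    (by positivity) (hi n) a
  have h1 := integral_tsum_of_summable_integral_norm hint (by
    refine Summable.of_nonneg_of_le (fun n => by positivity) hle ?_
    exact ((summable_geometric_of_lt_one (by norm_num) (by norm_num)).mul_right _).mul_right _)
  have h2 : volterra w (sol w g) a = ∑' n, (volterra w)^[n + 1] g a := by
    rw [volterra]
    simp_rw [Function.iterate_succ_apply']
    refine Eq.trans ?_ h1.symm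
    refine integral_congr_ae (ae_of_all _ fun z => ?_)
    simp only
    rw [tsum_mul_left, tsum_mul_left, sol]
  rw [h2, sol, (hs a).summable.tsum_eq_zero_add]
  rfl

theorem sol_of_nonpos (hw : PotBound w R) (hg : FreeSol g)
    (hg0 : ∀ z : ℝ × ℝ, z.1 ≤ 0 → g z = 0) {z : ℝ × ℝ} (hz : z.1 ≤ 0) : sol w g z = 0 := by
  have := abs_sol_le' hw hg hg0 z
  rw [hg0 z hz, mul_zero, mul_zero] at this
  exact abs_nonpos_iff.1 this

/-- Uniqueness: a function bounded by its own Duhamel integral vanishes. No growth condition is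
needed besides the convergence of that integral, which is itself a heat potential. -/
theorem eq_zero_of_le_lintegral (hw : PotBound w R) {d : ℝ × ℝ → ℝ}
    (hd : AEStronglyMeasurable d volume) (hd0 : ∀ z, d z ≠ 0 → 0 ≤ z.1)
    (hfin : ∀ a, d a ≠ 0 → ∫⁻ z, ehk (a - z) * ‖w z * d z‖ₑ ≠ ⊤)
    (hle : ∀ a, ‖d a‖ₑ ≤ ∫⁻ z, ehk (a - z) * ‖w z * d z‖ₑ) (a : ℝ × ℝ) : d a = 0 := by
  -- the integral is the heat potential of `|w d|`, a dominating function
  set ν : Measure (ℝ × ℝ) := volume.withDensity fun z => ‖w z * d z‖ₑ with hν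
  have hwd : AEMeasurable (fun z => ‖w z * d z‖ₑ) := (hw.aesm.mul hd).enorm
  have hM : ∀ a, ∫⁻ z, ehk (a - z) * ‖w z * d z‖ₑ = potential ν a := fun a => by
    rw [potential, hν, lintegral_withDensity_eq_lintegral_mul₀ hwd
      (measurable_ehk_sub_left a).aemeasurable]
    simp only [Pi.mul_apply, mul_comm]
  simp_rw [hM] at hfin hle
  have hdom := dominating_potential ν
  set l := 16 * R ^ 4 + 1 with hl
  have hlpos : 0 < l := by positivity
  have key : ∀ n : ℕ, ∀ a, ‖d a‖ₑ ≤ ENNReal.ofReal (1 / 2) ^ n *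
      (ENNReal.ofReal (Real.exp (l * a.1)) * potential ν a) := by
    intro n
    induction n with
    | zero =>
      intro a
      by_cases h : d a = 0
      · simp [h]
      · refine (hle a).trans ?_
        rw [pow_zero, one_mul]
        refine le_mul_of_one_le_left' ?_
        rw [ENNReal.one_le_ofReal]
        exact Real.one_le_exp (mul_nonneg hlpos.le (hd0 a h))
    | succ n ih =>
      intro a
      refine (hle a).trans ?_
      refine (hM a).symm.le.trans ?_
      calc ∫⁻ z, ehk (a - z) * ‖w z * d z‖ₑ
          ≤ ∫⁻ z, ENNReal.ofReal (1 / 2) ^ n * (ehk (a - z) * ‖w z‖ₑ *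
              (ENNReal.ofReal (Real.exp (l * z.1)) * potential ν z)) := by
            refine lintegral_mono fun z => ?_
            rw [enorm_mul]
            calc _ ≤ ehk (a - z) * (‖w z‖ₑ * (ENNReal.ofReal (1 / 2) ^ n *
                  (ENNReal.ofReal (Real.exp (l * z.1)) * potential ν z))) := by
                  gcongr; exact ih z
              _ = _ := by ring
        _ ≤ _ := by
            rw [lintegral_const_mul' _ _ (ENNReal.pow_ne_top ENNReal.ofReal_ne_top), pow_succ,
              mul_assoc]
            gcongr
            exact hdom.lintegral_le hw.aesm.enorm hlpos (by norm_num) hw.lintegral_le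
              (rate_le R) a
  by_contra hne
  have hfin' := ENNReal.mul_ne_top (ENNReal.ofReal_ne_top (r := Real.exp (l * a.1))) (hfin a hne)
  have hlim : Tendsto (fun n : ℕ => ENNReal.ofReal (1 / 2) ^ n *
      (ENNReal.ofReal (Real.exp (l * a.1)) * potential ν a)) atTop
      (𝓝 (0 * (ENNReal.ofReal (Real.exp (l * a.1)) * potential ν a))) := by
    refine ENNReal.Tendsto.mul_const ?_ (Or.inr hfin')
    refine ENNReal.tendsto_pow_atTop_nhds_zero_of_lt_one ?_
    rw [ENNReal.ofReal_lt_one]; norm_num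
  have := ge_of_tendsto' hlim fun n => key n a
  rw [zero_mul, nonpos_iff_eq_zero, enorm_eq_zero] at this
  exact hne this

end

/-! ### Continuity of heat potentials -/

/-- Off the diagonal the heat kernel vanishes as `t → 0`, at the rate `√t`. -/
theorem hk_le_sqrt_div (t : ℝ) {x : ℝ} (hx : x ≠ 0) : hk t x ≤ Real.sqrt t / x ^ 2 := by
  rcases le_or_gt t 0 with ht | ht
  · rw [hk_of_nonpos ht]; positivity
  rw [hk_of_pos ht]
  have hx2 : 0 < x ^ 2 := by positivity
  have h1 : Real.exp (-(x ^ 2) / (2 * t)) ≤ 2 * t / x ^ 2 := by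
    rw [neg_div, Real.exp_neg, inv_le_comm₀ (Real.exp_pos _) (by positivity), inv_div]
    linarith [Real.add_one_le_exp (x ^ 2 / (2 * t))]
  have h2 : 2 * Real.sqrt t ≤ Real.sqrt (2 * Real.pi * t) := by
    rw [Real.sqrt_mul (by positivity)]
    gcongr
    rw [Real.le_sqrt (by norm_num) (by positivity)]
    linarith [Real.pi_gt_three]
  have h3 : 0 < Real.sqrt t := Real.sqrt_pos.2 ht
  calc _ ≤ (2 * Real.sqrt t)⁻¹ * (2 * t / x ^ 2) := by gcongr
    _ = (2 * Real.sqrt t)⁻¹ * (2 * (Real.sqrt t * Real.sqrt t) / x ^ 2) := by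
        rw [Real.mul_self_sqrt ht.le]
    _ = _ := by field_simp

theorem continuousAt_hk {z : ℝ × ℝ} (hz : z ≠ 0) :
    ContinuousAt (fun z : ℝ × ℝ => hk z.1 z.2) z := by
  rcases lt_trichotomy z.1 0 with h | h | h
  · have : (fun z : ℝ × ℝ => hk z.1 z.2) =ᶠ[𝓝 z] fun _ => 0 := by
      filter_upwards [continuousAt_fst.eventually_lt continuousAt_const h] with y hy
      exact hk_of_nonpos (le_of_lt hy) _
    exact continuousAt_const.congr this.symm
  · have hx : z.2 ≠ 0 := fun h2 => hz (Prod.ext h h2)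
    have h0 : hk z.1 z.2 = 0 := hk_of_nonpos h.le _
    rw [ContinuousAt, h0]
    have hlim : Tendsto (fun y : ℝ × ℝ => Real.sqrt y.1 / y.2 ^ 2) (𝓝 z) (𝓝 0) := by
      have : ContinuousAt (fun y : ℝ × ℝ => Real.sqrt y.1 / y.2 ^ 2) z :=
        (Real.continuous_sqrt.continuousAt.comp continuousAt_fst).div
          (continuousAt_snd.pow 2) (by positivity)
      have h2 := this.tendsto
      simpa [h] using h2
    refine tendsto_of_tendsto_of_tendsto_of_le_of_le' tendsto_const_nhds hlim
      (Eventually.of_forall fun y => hk_nonneg _ _) ?_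
    filter_upwards [continuousAt_snd.eventually_ne hx] with y hy
    exact hk_le_sqrt_div _ hy
  · have : (fun z : ℝ × ℝ => hk z.1 z.2) =ᶠ[𝓝 z] fun z =>
        (Real.sqrt (2 * Real.pi * z.1))⁻¹ * Real.exp (-(z.2 ^ 2) / (2 * z.1)) := by
      filter_upwards [continuousAt_const.eventually_lt continuousAt_fst h] with y hy
      exact hk_of_pos hy _
    refine ContinuousAt.congr ?_ this.symm
    have h1 : Real.sqrt (2 * Real.pi * z.1) ≠ 0 := (Real.sqrt_pos.2 (by positivity)).ne'
    have h2 : 2 * z.1 ≠ 0 := by positivity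
    fun_prop (disch := assumption)

/-- Comparison of heat kernels at different times and nearby points. -/
theorem hk_le_const_mul_hk {ε M : ℝ} (hε : 0 < ε) :
    ∃ C, 0 ≤ C ∧ ∀ t t' x x', ε ≤ t → t ≤ M → t + 1 / 2 ≤ t' → t' ≤ M + 1 → |x - x'| ≤ 1 →
      hk t x ≤ C * hk t' x' := by
  refine ⟨Real.sqrt ((M + 1) / ε) * Real.exp ((1 + 2 * M) / (2 * ε)), by positivity, ?_⟩
  intro t t' x x' h1 h2 h3 h4 h5
  have ht : 0 < t := hε.trans_le h1
  have ht' : 0 < t' := by linarith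
  have hM : 0 < M := ht.trans_le h2
  rw [hk_of_pos ht, hk_of_pos ht']
  have hexp : Real.exp (-(x ^ 2) / (2 * t)) ≤
      Real.exp ((1 + 2 * M) / (2 * ε)) * Real.exp (-(x' ^ 2) / (2 * t')) := by
    rw [← Real.exp_add]
    apply Real.exp_le_exp.2
    have hy : x' ^ 2 ≤ (1 + 1 / (2 * M)) * x ^ 2 + (1 + 2 * M) := by
      have h6 := (sq_le_one_iff_abs_le_one _).2 h5
      have h7 : 0 ≤ (x / (2 * M) + (x - x')) ^ 2 * (2 * M) := by positivity
      have h8 : (x / (2 * M) + (x - x')) ^ 2 * (2 * M) =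
          x ^ 2 / (2 * M) + 2 * x * (x - x') + (x - x') ^ 2 * (2 * M) := by field_simp; ring
      have h9 : (1 + 1 / (2 * M)) * x ^ 2 = x ^ 2 + x ^ 2 / (2 * M) := by field_simp
      nlinarith
    have ha : x' ^ 2 / (2 * t') ≤ ((1 + 1 / (2 * M)) * x ^ 2 + (1 + 2 * M)) / (2 * t') := by gcongr
    have hb : (1 + 1 / (2 * M)) * x ^ 2 / (2 * t') ≤ x ^ 2 / (2 * t) := by
      rw [div_le_div_iff₀ (by positivity) (by positivity)]
      have h10 : (1 + 1 / (2 * M)) * t ≤ t' := by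
        have : t / (2 * M) ≤ 1 / 2 := by rw [div_le_iff₀ (by positivity)]; linarith
        calc _ = t + t / (2 * M) := by field_simp
          _ ≤ t' := by linarith
      nlinarith [sq_nonneg x]
    have hc : (1 + 2 * M) / (2 * t') ≤ (1 + 2 * M) / (2 * ε) := by
      gcongr; linarith
    rw [add_div] at ha
    rw [neg_div, neg_div]
    linarith
  have hs : (Real.sqrt (2 * Real.pi * t))⁻¹ ≤
      Real.sqrt ((M + 1) / ε) * (Real.sqrt (2 * Real.pi * t'))⁻¹ := by
    rw [← Real.sqrt_inv, ← Real.sqrt_inv, ← Real.sqrt_mul (by positivity)]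
    apply Real.sqrt_le_sqrt
    rw [← div_eq_mul_inv, inv_eq_one_div, div_div, div_le_div_iff₀ (by positivity) (by positivity)]
    have : ε * t' ≤ (M + 1) * t := by
      nlinarith
    have hpi := Real.pi_pos
    nlinarith
  calc _ ≤ (Real.sqrt ((M + 1) / ε) * (Real.sqrt (2 * Real.pi * t'))⁻¹) *
        (Real.exp ((1 + 2 * M) / (2 * ε)) * Real.exp (-(x' ^ 2) / (2 * t'))) := by gcongr
    _ = _ := by ring

/-- The potential of sources that lie in the past, at a positive distance in time, is continuous. -/
theorem continuousAt_integral_hk_mul {ν : Measure (ℝ × ℝ)} {h : ℝ × ℝ → ℝ} {a₀ : ℝ × ℝ} {ε : ℝ}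
    (hε : 0 < ε) (hsupp : ∀ z, h z ≠ 0 → 0 ≤ z.1 ∧ z.1 ≤ a₀.1 - ε)
    (hint : Integrable (fun z : ℝ × ℝ => hk (a₀.1 + 1 - z.1) (a₀.2 - z.2) * h z) ν)
    (hm : AEStronglyMeasurable h ν) :
    ContinuousAt (fun a : ℝ × ℝ => ∫ z, hk (a.1 - z.1) (a.2 - z.2) * h z ∂ν) a₀ := by
  obtain ⟨C, hC, hCle⟩ := hk_le_const_mul_hk (ε := ε / 2) (M := a₀.1 + 1 / 2) (half_pos hε)
  have e1 : ∀ᶠ a : ℝ × ℝ in 𝓝 a₀, |a.1 - a₀.1| ≤ min (ε / 2) (1 / 2) ∧ |a.2 - a₀.2| ≤ 1 := by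
    have hpos : 0 < min (ε / 2) (1 / 2) := lt_min (half_pos hε) (by norm_num)
    filter_upwards [Metric.ball_mem_nhds a₀ (lt_min hpos one_pos)] with a ha
    rw [Metric.mem_ball, Prod.dist_eq, max_lt_iff, Real.dist_eq, Real.dist_eq] at ha
    exact ⟨(ha.1.trans_le (min_le_left _ _)).le, (ha.2.trans_le (min_le_right _ _)).le⟩
  refine continuousAt_of_dominated (bound := fun z => C *
    ‖hk (a₀.1 + 1 - z.1) (a₀.2 - z.2) * h z‖) ?_ ?_ (hint.norm.const_mul C) ?_
  · exact Eventually.of_forall fun a => (measurable_hk_sub a).aestronglyMeasurable.mul hm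
  · filter_upwards [e1] with a ha
    refine ae_of_all _ fun z => ?_
    by_cases hz : h z = 0
    · simp [hz]
    · obtain ⟨h1, h2⟩ := hsupp z hz
      obtain ⟨h3, h4⟩ := ha
      rw [le_min_iff, abs_le, abs_le] at h3
      rw [norm_mul, norm_mul, ← mul_assoc]
      gcongr
      rw [Real.norm_of_nonneg (hk_nonneg _ _), Real.norm_of_nonneg (hk_nonneg _ _)]
      apply hCle <;> try linarith
      rw [sub_sub_sub_cancel_right]; exact h4
  · refine ae_of_all _ fun z => ?_
    by_cases hz : h z = 0
    · simp only [hz, mul_zero]; exact continuousAt_const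
    · obtain ⟨h1, h2⟩ := hsupp z hz
      have hne : ((a₀.1 - z.1, a₀.2 - z.2) : ℝ × ℝ) ≠ 0 := by
        intro h; have := congrArg Prod.fst h; simp at this; linarith
      have hf : ContinuousAt (fun a : ℝ × ℝ => ((a.1 - z.1, a.2 - z.2) : ℝ × ℝ)) a₀ := by fun_prop
      exact (ContinuousAt.comp (f := fun a : ℝ × ℝ => ((a.1 - z.1, a.2 - z.2) : ℝ × ℝ))
        (g := fun z : ℝ × ℝ => hk z.1 z.2) (continuousAt_hk hne) hf).mul
        continuousAt_const

theorem PotBound.indicator {w : ℝ × ℝ → ℝ} {R : ℝ} (hw : PotBound w R) {s : Set (ℝ × ℝ)}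
    (hs : MeasurableSet s) : PotBound (s.indicator w) R := by
  refine ⟨hw.aesm.indicator hs, hw.nonneg, le_trans (lintegral_mono fun z => ?_) hw.lintegral_le⟩
  gcongr
  exact enorm_indicator_le_enorm_self _ _

/-- The `L²` norm of the potential over a thin time slab is small. -/
theorem PotBound.exists_slab {w : ℝ × ℝ → ℝ} {R : ℝ} (hw : PotBound w R) (t₀ : ℝ) {η : ℝ}
    (hη : 0 < η) : ∃ ε > 0, PotBound ({z : ℝ × ℝ | |z.1 - t₀| < ε}.indicator w) η := by
  set ν : Measure (ℝ × ℝ) := volume.withDensity fun z => ‖w z‖ₑ ^ 2 with hν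
  set S : ℕ → Set (ℝ × ℝ) := fun n => {z | |z.1 - t₀| < 1 / ((n : ℝ) + 1)} with hS
  have hSm : ∀ n, MeasurableSet (S n) := fun n => measurableSet_lt (by fun_prop) (by fun_prop)
  have hνS : ∀ n, ν (S n) = ∫⁻ z, ‖(S n).indicator w z‖ₑ ^ 2 := fun n => by
    rw [hν, withDensity_apply _ (hSm n), ← lintegral_indicator (hSm n)]
    refine lintegral_congr fun z => ?_
    by_cases h : z ∈ S n <;> simp [h]
  have hlim : Tendsto (fun n => ν (S n)) atTop (𝓝 (ν (⋂ n, S n))) := by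
    refine tendsto_measure_iInter_atTop (fun n => (hSm n).nullMeasurableSet) ?_ ⟨0, ?_⟩
    · intro m n hmn z hz
      refine lt_of_lt_of_le (show |z.1 - t₀| < _ from hz) ?_
      exact one_div_le_one_div_of_le (by positivity) (by simpa using hmn)
    · rw [hνS]
      exact (((hw.indicator (hSm 0)).lintegral_le).trans_lt ENNReal.ofReal_lt_top).ne
  have hzero : ν (⋂ n, S n) = 0 := by
    refine withDensity_absolutelyContinuous _ _ ?_
    refine measure_mono_null (t := {t₀} ×ˢ univ) ?_ ?_
    · intro z hz
      rw [mem_iInter] at hz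
      refine ⟨?_, mem_univ _⟩
      have h0 : |z.1 - t₀| ≤ 0 :=
        ge_of_tendsto' tendsto_one_div_add_atTop_nhds_zero_nat fun n => (le_of_lt (hz n))
      exact sub_eq_zero.1 (abs_nonpos_iff.1 h0)
    · rw [Measure.volume_eq_prod, Measure.prod_prod]; simp
  rw [hzero] at hlim
  have hη2 : (0 : ℝ≥0∞) < ENNReal.ofReal (η ^ 2) := ENNReal.ofReal_pos.2 (by positivity)
  obtain ⟨n, hn⟩ := (hlim.eventually_lt_const hη2).exists
  refine ⟨1 / ((n : ℝ) + 1), by positivity, (hw.aesm.indicator (hSm n)), hη.le, ?_⟩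
  rw [← hνS]; exact hn.le

/-- A solution is continuous wherever its free part is. The contribution of the sources in a thin
slab about the time of the point is uniformly small, and the one of the earlier sources is
continuous. -/
theorem continuousAt_sol {w : ℝ × ℝ → ℝ} {R : ℝ} {g : ℝ × ℝ → ℝ} (hw : PotBound w R)
    (hg : FreeSol g) (hg0 : ∀ z : ℝ × ℝ, z.1 ≤ 0 → g z = 0) {a₀ : ℝ × ℝ}
    (hgc : ContinuousAt g a₀) : ContinuousAt (sol w g) a₀ := by
  set l := 16 * R ^ 4 + 1 with hl
  have hlpos : 0 < l := by positivity
  have hl1 : 1 ≤ Real.sqrt l := by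
    rw [Real.one_le_sqrt, hl]; nlinarith [sq_nonneg (R ^ 2)]
  set h : ℝ × ℝ → ℝ := fun z => w z * sol w g z with hh
  have hhm : AEStronglyMeasurable h volume := hw.aesm.mul (aestronglyMeasurable_sol hw hg hg0)
  have hhint : ∀ a : ℝ × ℝ, Integrable fun z : ℝ × ℝ => hk (a.1 - z.1) (a.2 - z.2) * h z :=
    integrable_hk_mul_sol hw hg hg0
  refine continuousAt_of_locally_uniform_approx_of_continuousAt fun u hu => ?_
  obtain ⟨δ, hδ, hδu⟩ := Metric.mem_uniformity_dist.1 hu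
  -- an upper bound for the free part near `a₀`
  set B : ℝ := Real.exp (l * (a₀.1 + 1)) * (g a₀ + 1) with hB
  have hBpos : 0 < B := by have := hg.nonneg a₀; positivity
  obtain ⟨ε, hε, hslab⟩ := hw.exists_slab a₀.1 (η := δ / (4 * B)) (by positivity)
  set P : Set (ℝ × ℝ) := {z | z.1 ≤ a₀.1 - ε} with hP
  have hPm : MeasurableSet P := measurableSet_le (by fun_prop) (by fun_prop)
  refine ⟨{a | g a < g a₀ + 1 ∧ |a.1 - a₀.1| < min ε 1}, ?_,
    fun a => g a + ∫ z, hk (a.1 - z.1) (a.2 - z.2) * P.indicator h z, ?_, ?_⟩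
  · refine (hgc.eventually_lt continuousAt_const (lt_add_one _)).and ?_
    have : ContinuousAt (fun a : ℝ × ℝ => |a.1 - a₀.1|) a₀ := by fun_prop
    refine this.eventually_lt continuousAt_const ?_
    simpa using hε
  · refine hgc.add (continuousAt_integral_hk_mul hε ?_ ?_ (hhm.indicator hPm))
    · intro z hz
      rw [indicator_apply_ne_zero, mem_inter_iff] at hz
      refine ⟨?_, hz.1⟩
      by_contra hneg
      exact hz.2 (by simp [hh, sol_of_nonpos hw hg hg0 (not_le.1 hneg).le])
    · have := (hhint (a₀.1 + 1, a₀.2)).indicator hPm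
      refine this.congr (ae_of_all _ fun z => ?_)
      by_cases hz : z ∈ P <;> simp [hz]
  · rintro a ⟨h1, h2⟩
    rw [lt_min_iff] at h2
    apply hδu
    have hsplit : sol w g a = g a + ((∫ z, hk (a.1 - z.1) (a.2 - z.2) * P.indicator h z) +
        ∫ z, hk (a.1 - z.1) (a.2 - z.2) *
          ({z : ℝ × ℝ | |z.1 - a₀.1| < ε}.indicator w z * sol w g z)) := by
      rw [← integral_add, sol_eq hw hg hg0 a, volterra]
      · congr 1
        refine integral_congr_ae (ae_of_all _ fun z => ?_)
        simp only [← mul_add]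
        by_cases hz : z ∈ P
        · have hz2 : z ∉ {z : ℝ × ℝ | |z.1 - a₀.1| < ε} := by
            intro hz3
            have h4 := (abs_lt.1 (show |z.1 - a₀.1| < ε from hz3)).1
            have h5 : z.1 ≤ a₀.1 - ε := hz
            linarith
          simp [hz, hz2, hh]
        · by_cases hz2 : z ∈ {z : ℝ × ℝ | |z.1 - a₀.1| < ε}
          · simp [hz, hz2]
          · have hz3 : a₀.1 - ε < z.1 := not_le.1 hz
            have hz4 : a.1 ≤ z.1 := by
              have h6 : ε ≤ |z.1 - a₀.1| := not_lt.1 hz2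
              have h7 := (abs_lt.1 h2.1).2
              rcases le_abs.1 h6 with h | h <;> linarith
            simp [hk_of_nonpos (sub_nonpos.2 hz4)]
      · have := (hhint a).indicator hPm
        refine this.congr (ae_of_all _ fun z => ?_)
        by_cases hz : z ∈ P <;> simp [hz]
      · exact integrable_hk_mul hslab hg hlpos hslab.nonneg
          (le_mul_of_one_le_right (sq_nonneg _) hl1) (aestronglyMeasurable_sol hw hg hg0)
          zero_le_two (abs_sol_le' hw hg hg0) a
    have hsmall := abs_volterra_le hslab hg hlpos hslab.nonneg
          (le_mul_of_one_le_right (sq_nonneg _) hl1) (aestronglyMeasurable_sol hw hg hg0)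
          zero_le_two (abs_sol_le' hw hg hg0) a
    rw [volterra] at hsmall
    rw [Real.dist_eq, hsplit, add_sub_add_left_eq_sub, add_sub_cancel_left]
    refine hsmall.trans_lt ?_
    have h8 : Real.exp (l * a.1) * g a ≤ B := by
      have := hg.nonneg a
      have := (abs_lt.1 h2.2).2
      rw [hB]
      gcongr
      linarith
    calc 2 * (δ / (4 * B)) * (Real.exp (l * a.1) * g a) ≤ 2 * (δ / (4 * B)) * B := by gcongr
      _ = δ / 2 := by field_simp; norm_num
      _ < δ := half_lt_self hδ

/-! ### Heat flows of measures -/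

/-- The heat flow that starts from the measure `μ` at time `s`. -/
def heatFlow (s : ℝ) (μ : Measure ℝ) (z : ℝ × ℝ) : ℝ := ∫ y, hk (z.1 - s) (z.2 - y) ∂μ

/-- The heat flow of `μ` is finite at all times. -/
def HeatFinite (μ : Measure ℝ) : Prop := ∀ t x, ∫⁻ y, ENNReal.ofReal (hk t (x - y)) ∂μ ≠ ⊤

section

variable {μ : Measure ℝ} {s : ℝ}

theorem measurable_hk_sub_right (t x : ℝ) : Measurable fun y => hk t (x - y) :=
  measurable_hk_comp measurable_const (by fun_prop)

theorem HeatFinite.integrable (hμ : HeatFinite μ) (t x : ℝ) :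
    Integrable (fun y => hk t (x - y)) μ := by
  refine ⟨(measurable_hk_sub_right t x).aestronglyMeasurable, ?_⟩
  rw [hasFiniteIntegral_iff_ofReal (ae_of_all _ fun y => hk_nonneg _ _)]
  exact (hμ t x).lt_top

theorem heatFlow_nonneg (z : ℝ × ℝ) : 0 ≤ heatFlow s μ z :=
  integral_nonneg fun _ => hk_nonneg _ _

theorem heatFlow_of_le {z : ℝ × ℝ} (hz : z.1 ≤ s) : heatFlow s μ z = 0 := by
  simp [heatFlow, hk_of_nonpos (sub_nonpos.2 hz)]

theorem ofReal_heatFlow (hμ : HeatFinite μ) (z : ℝ × ℝ) :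
    ENNReal.ofReal (heatFlow s μ z) = ∫⁻ y, ENNReal.ofReal (hk (z.1 - s) (z.2 - y)) ∂μ :=
  ofReal_integral_eq_lintegral_ofReal (hμ.integrable _ _) (ae_of_all _ fun _ => hk_nonneg _ _)

theorem freeSol_heatFlow [SFinite μ] (hμ : HeatFinite μ) : FreeSol (heatFlow s μ) := by
  refine ⟨heatFlow_nonneg, ?_⟩
  have : (fun z => ENNReal.ofReal (heatFlow s μ z)) = potential (μ.map fun y => (s, y)) := by
    funext z
    rw [ofReal_heatFlow hμ, potential, lintegral_map (measurable_ehk_sub_left z) (by fun_prop)]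
    rfl
  rw [this]
  exact dominating_potential _

theorem heatFlow_pos (hμ : HeatFinite μ) (h0 : μ ≠ 0) {z : ℝ × ℝ} (hz : s < z.1) :
    0 < heatFlow s μ z := by
  rw [heatFlow, integral_pos_iff_support_of_nonneg (fun _ => hk_nonneg _ _) (hμ.integrable _ _)]
  have : (Function.support fun y => hk (z.1 - s) (z.2 - y)) = univ :=
    eq_univ_of_forall fun y => (hk_pos (sub_pos.2 hz) _).ne'
  rw [this]
  exact (Measure.measure_univ_ne_zero.2 h0).bot_lt

theorem continuousAt_heatFlow (hμ : HeatFinite μ) {z : ℝ × ℝ} (hz : 0 < z.1) :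
    ContinuousAt (heatFlow 0 μ) z := by
  have hmap : Measurable fun y : ℝ => ((0, y) : ℝ × ℝ) := by fun_prop
  set h : ℝ × ℝ → ℝ := ({0} ×ˢ univ : Set (ℝ × ℝ)).indicator 1 with hh
  have hhm : Measurable h := measurable_one.indicator
    ((measurableSet_singleton 0).prod MeasurableSet.univ)
  have h1 : ∀ y : ℝ, h (0, y) = 1 := fun y => by simp [hh]
  have e : ∀ a : ℝ × ℝ, ∫ z, hk (a.1 - z.1) (a.2 - z.2) * h z ∂(μ.map fun y => ((0, y) : ℝ × ℝ)) =
      heatFlow 0 μ a := fun a => by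
    rw [integral_map hmap.aemeasurable
      (by exact ((measurable_hk_sub a).mul hhm).aestronglyMeasurable)]
    simp [h1, heatFlow]
  have := continuousAt_integral_hk_mul (ν := μ.map fun y => ((0, y) : ℝ × ℝ)) (h := h) (a₀ := z) hz
    (fun y hy => ?_) ?_ hhm.aestronglyMeasurable
  · simp_rw [e] at this; exact this
  · have : y ∈ ({0} ×ˢ univ : Set (ℝ × ℝ)) := by
      by_contra h; exact hy (indicator_of_notMem h _)
    have h0 : y.1 = 0 := this.1
    simp [h0]
  · rw [integrable_map_measure
      (by exact ((measurable_hk_sub (z.1 + 1, z.2)).mul hhm).aestronglyMeasurable) hmap.aemeasurable]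
    refine (hμ.integrable (z.1 + 1) z.2).congr (ae_of_all _ fun y => ?_)
    simp [h1]

theorem heatFinite_dirac (ξ : ℝ) : HeatFinite (Measure.dirac ξ) := fun t x => by
  rw [lintegral_dirac' _ (measurable_hk_sub_right t x).ennreal_ofReal]
  exact ENNReal.ofReal_ne_top

theorem heatFlow_dirac (s ξ : ℝ) (z : ℝ × ℝ) :
    heatFlow s (Measure.dirac ξ) z = hk (z.1 - s) (z.2 - ξ) := by
  rw [heatFlow, integral_dirac]

end

/-! ### Duality -/

/-- The heat kernel that starts from `ξ` at time `0`; after time reversal it is the free backward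
solution with a point mass as terminal condition. -/
def kern (ξ : ℝ) (z : ℝ × ℝ) : ℝ := hk z.1 (z.2 - ξ)

theorem freeSol_kern (ξ : ℝ) : FreeSol (kern ξ) := by
  have : kern ξ = heatFlow 0 (Measure.dirac ξ) := funext fun z => by
    rw [heatFlow_dirac, sub_zero]; rfl
  rw [this]; exact freeSol_heatFlow (heatFinite_dirac ξ)

theorem kern_of_nonpos (ξ : ℝ) (z : ℝ × ℝ) (hz : z.1 ≤ 0) : kern ξ z = 0 := hk_of_nonpos hz _

/-- Time reversal about `T`. -/
def refl (T : ℝ) (z : ℝ × ℝ) : ℝ × ℝ := (T - z.1, z.2)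

@[simp] theorem refl_refl (T : ℝ) (z : ℝ × ℝ) : refl T (refl T z) = z := by simp [refl]

theorem measurePreserving_refl (T : ℝ) : MeasurePreserving (refl T) volume volume :=
  (Measure.measurePreserving_sub_left volume T).prod (MeasurePreserving.id volume)

theorem continuous_refl (T : ℝ) : Continuous (refl T) := by unfold refl; fun_prop

theorem measurableEmbedding_refl (T : ℝ) : MeasurableEmbedding (refl T) :=
  (MeasurableEquiv.ofInvolutive (refl T) (refl_refl T)
    (continuous_refl T).measurable).measurableEmbedding

theorem integral_comp_refl (T : ℝ) (f : ℝ × ℝ → ℝ) : ∫ z, f (refl T z) = ∫ z, f z :=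
  (measurePreserving_refl T).integral_comp (measurableEmbedding_refl T) f

theorem PotBound.refl {w : ℝ × ℝ → ℝ} {R : ℝ} (hw : PotBound w R) (T : ℝ) :
    PotBound (fun z => w (refl T z)) R := by
  refine ⟨hw.aesm.comp_measurePreserving (measurePreserving_refl T), hw.nonneg, ?_⟩
  rw [(measurePreserving_refl T).lintegral_comp_emb (measurableEmbedding_refl T)
    (fun z => ‖w z‖ₑ ^ 2)]
  exact hw.lintegral_le

/-- The fundamental solution with end point `e`, as a function of the starting point. -/
def back (w : ℝ × ℝ → ℝ) (e z : ℝ × ℝ) : ℝ :=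
  sol (fun y => w (refl e.1 y)) (kern e.2) (refl e.1 z)

section

variable {w w' : ℝ × ℝ → ℝ} {R D : ℝ} {g : ℝ × ℝ → ℝ}

theorem kern_refl (e z : ℝ × ℝ) : kern e.2 (refl e.1 z) = hk (e.1 - z.1) (e.2 - z.2) := by
  rw [kern, refl, hk_sub_comm]

theorem abs_back_le (hw : PotBound w R) (e z : ℝ × ℝ) :
    |back w e z| ≤
      2 * (Real.exp ((16 * R ^ 4 + 1) * (e.1 - z.1)) * hk (e.1 - z.1) (e.2 - z.2)) := by
  have := abs_sol_le' (hw.refl e.1) (freeSol_kern e.2) (kern_of_nonpos e.2) (refl e.1 z)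
  rw [kern_refl] at this
  exact this

theorem aestronglyMeasurable_back (hw : PotBound w R) (e : ℝ × ℝ) :
    AEStronglyMeasurable (back w e) volume :=
  (aestronglyMeasurable_sol (hw.refl e.1) (freeSol_kern e.2)
    (kern_of_nonpos e.2)).comp_measurePreserving (measurePreserving_refl e.1)

theorem integrable_back (hw : PotBound w R) (e z : ℝ × ℝ) :
    Integrable fun y : ℝ × ℝ => hk (y.1 - z.1) (y.2 - z.2) * (w y * back w e y) := by
  have h := integrable_hk_mul_sol (hw.refl e.1) (freeSol_kern e.2) (kern_of_nonpos e.2)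
    (refl e.1 z)
  have h2 := (measurePreserving_refl e.1).integrable_comp_of_integrable h
  refine h2.congr (ae_of_all _ fun y => ?_)
  simp only [Function.comp, refl_refl, back]
  rw [show (refl e.1 z).1 - (refl e.1 y).1 = y.1 - z.1 by simp [refl],
    show (refl e.1 z).2 - (refl e.1 y).2 = z.2 - y.2 by simp [refl], hk_sub_comm]

theorem back_eq (hw : PotBound w R) (e z : ℝ × ℝ) :
    back w e z = hk (e.1 - z.1) (e.2 - z.2) +
      ∫ y, hk (y.1 - z.1) (y.2 - z.2) * (w y * back w e y) := by
  rw [back, sol_eq (hw.refl e.1) (freeSol_kern e.2) (kern_of_nonpos e.2), kern_refl, volterra,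
    ← integral_comp_refl e.1]
  congr 1
  refine integral_congr_ae (ae_of_all _ fun y => ?_)
  simp only [refl_refl, back]
  rw [show (refl e.1 z).1 - (refl e.1 y).1 = y.1 - z.1 by simp [refl],
    show (refl e.1 z).2 - (refl e.1 y).2 = z.2 - y.2 by simp [refl], hk_sub_comm]

/-- The rate of exponential growth in time that belongs to potentials of norm at most `R`. -/
def rate (R : ℝ) : ℝ := 16 * R ^ 4 + 1

theorem rate_pos (R : ℝ) : 0 < rate R := by unfold rate; positivity

theorem one_le_sqrt_rate (R : ℝ) : 1 ≤ Real.sqrt (rate R) := by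
  rw [Real.one_le_sqrt, rate]; nlinarith [sq_nonneg (R ^ 2)]

theorem le_sq_mul_sqrt_rate (D R : ℝ) : D ^ 2 ≤ D ^ 2 * Real.sqrt (rate R) :=
  le_mul_of_one_le_right (sq_nonneg _) (one_le_sqrt_rate R)

theorem abs_back_mul_sol_le (hw : PotBound w R) (hw' : PotBound w' R) (hg : FreeSol g)
    (hg0 : ∀ z : ℝ × ℝ, z.1 ≤ 0 → g z = 0) (e z : ℝ × ℝ) :
    |back w e z * sol w' g z| ≤
      4 * Real.exp (rate R * e.1) * (hk (e.1 - z.1) (e.2 - z.2) * g z) := by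
  have h1 := abs_back_le hw e z
  have h2 := abs_sol_le' hw' hg hg0 z
  have h3 := hk_nonneg (e.1 - z.1) (e.2 - z.2)
  rw [abs_mul]
  calc _ ≤ (2 * (Real.exp ((16 * R ^ 4 + 1) * (e.1 - z.1)) * hk (e.1 - z.1) (e.2 - z.2))) *
        (2 * (Real.exp ((16 * R ^ 4 + 1) * z.1) * g z)) := by gcongr
    _ = 4 * (Real.exp ((16 * R ^ 4 + 1) * (e.1 - z.1)) * Real.exp ((16 * R ^ 4 + 1) * z.1)) *
        (hk (e.1 - z.1) (e.2 - z.2) * g z) := by ring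
    _ = _ := by rw [← Real.exp_add, rate]; congr 3; ring

theorem integrable_back_mul_mul_sol {v : ℝ × ℝ → ℝ} (hw : PotBound w R) (hw' : PotBound w' R)
    (hv : PotBound v D) (hg : FreeSol g)
    (hg0 : ∀ z : ℝ × ℝ, z.1 ≤ 0 → g z = 0) (e : ℝ × ℝ) :
    Integrable fun z => back w e z * v z * sol w' g z := by
  have h1 := integrable_hk_mul hv hg (rate_pos R) hv.nonneg (le_sq_mul_sqrt_rate D R)
    hg.measurable.aestronglyMeasurable zero_le_one (abs_le_exp_mul hg hg0 (rate_pos R)) e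
  refine (h1.norm.const_mul (4 * Real.exp (rate R * e.1))).mono'
    (((aestronglyMeasurable_back hw e).mul hv.aesm).mul (aestronglyMeasurable_sol hw' hg hg0))
    (ae_of_all _ fun z => ?_)
  have h2 := abs_back_mul_sol_le hw hw' hg hg0 e z
  have h3 := hk_nonneg (e.1 - z.1) (e.2 - z.2)
  rw [Real.norm_eq_abs, mul_right_comm, abs_mul, norm_mul, norm_mul, Real.norm_of_nonneg h3,
    Real.norm_of_nonneg (hg.nonneg z), Real.norm_eq_abs]
  calc _ ≤ 4 * Real.exp (rate R * e.1) * (hk (e.1 - z.1) (e.2 - z.2) * g z) * |v z| := by gcongr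
    _ = _ := by ring

theorem integral_abs_hk_mul_free_le {v : ℝ × ℝ → ℝ} (hv : PotBound v D) (hg : FreeSol g)
    (hg0 : ∀ z : ℝ × ℝ, z.1 ≤ 0 → g z = 0) (e : ℝ × ℝ) (R : ℝ) :
    ∫ z, ‖hk (e.1 - z.1) (e.2 - z.2) * (v z * g z)‖ ≤ D * (Real.exp (rate R * e.1) * g e) := by
  have := integral_abs_hk_mul_le hv hg (rate_pos R) hv.nonneg (le_sq_mul_sqrt_rate D R)
    hg.measurable.aestronglyMeasurable zero_le_one (abs_le_exp_mul hg hg0 (rate_pos R)) e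
  rwa [one_mul] at this

/-- The double integral in the duality formula converges absolutely, as Fubini's theorem requires.
-/
theorem integrable_duality (hw : PotBound w R) (hw' : PotBound w' R) (hg : FreeSol g)
    (hg0 : ∀ z : ℝ × ℝ, z.1 ≤ 0 → g z = 0) (e : ℝ × ℝ) :
    Integrable (fun p : (ℝ × ℝ) × (ℝ × ℝ) => (w p.1 * back w e p.1) *
      (hk (p.1.1 - p.2.1) (p.1.2 - p.2.2) * (w' p.2 * sol w' g p.2))) (volume.prod volume) := by
  have hm1 := hw.aesm.mul (aestronglyMeasurable_back hw e)
  have hm2 := hw'.aesm.mul (aestronglyMeasurable_sol hw' hg hg0)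
  have hm : AEStronglyMeasurable (fun p : (ℝ × ℝ) × (ℝ × ℝ) => (w p.1 * back w e p.1) *
      (hk (p.1.1 - p.2.1) (p.1.2 - p.2.2) * (w' p.2 * sol w' g p.2))) (volume.prod volume) :=
    hm1.comp_fst.mul ((measurable_hk_comp (by fun_prop) (by fun_prop)).aestronglyMeasurable.mul
      hm2.comp_snd)
  rw [integrable_prod_iff hm]
  refine ⟨ae_of_all _ fun y => by
    exact (integrable_hk_mul_sol hw' hg hg0 y).const_mul (w y * back w e y), ?_⟩
  have hle := fun y => integral_abs_hk_mul_le hw' hg (rate_pos R) (by norm_num) (rate_le R)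
    (aestronglyMeasurable_sol hw' hg hg0) zero_le_two (abs_sol_le' hw' hg hg0) y
  -- the inner integral is dominated by the free solution, so that the outer one converges
  have h1 := integrable_hk_mul hw hg (rate_pos R) hw.nonneg (le_sq_mul_sqrt_rate R R)
    hg.measurable.aestronglyMeasurable zero_le_one (abs_le_exp_mul hg hg0 (rate_pos R)) e
  refine (h1.norm.const_mul (2 * Real.exp (rate R * e.1))).mono' hm.norm.integral_prod_right'
    (ae_of_all _ fun y => ?_)
  have h2 := abs_back_le hw e y
  have h3 := hk_nonneg (e.1 - y.1) (e.2 - y.2)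
  simp only [norm_mul, integral_const_mul]
  rw [Real.norm_of_nonneg (integral_nonneg fun _ => by positivity)]
  have hle' := hle y
  simp only [norm_mul] at hle'
  have hgy := hg.nonneg y
  simp only [norm_norm]
  calc _ ≤ |w y| * (2 * (Real.exp ((16 * R ^ 4 + 1) * (e.1 - y.1)) *
          hk (e.1 - y.1) (e.2 - y.2))) * (2 * (1 / 2) * (Real.exp (rate R * y.1) * g y)) := by
        simp only [Real.norm_eq_abs] at hle' ⊢
        gcongr
    _ = 2 * (Real.exp ((16 * R ^ 4 + 1) * (e.1 - y.1)) * Real.exp ((16 * R ^ 4 + 1) * y.1)) *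
        (hk (e.1 - y.1) (e.2 - y.2) * (|w y| * g y)) := by rw [rate]; ring
    _ = _ := by
      rw [← Real.exp_add, rate, Real.norm_of_nonneg h3, Real.norm_of_nonneg hgy, Real.norm_eq_abs]
      congr 3; ring

/-- The duality formula before it is symmetrized: in the Duhamel equation of `sol w' g`, the heat
kernel is replaced with the fundamental solution of `w`, by `back_eq`, and the correction is
integrated by Fubini's theorem. -/
theorem sol_sub_free_eq (hw : PotBound w R) (hw' : PotBound w' R) (hg : FreeSol g)
    (hg0 : ∀ z : ℝ × ℝ, z.1 ≤ 0 → g z = 0) (e : ℝ × ℝ) :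
    sol w' g e - g e = (∫ z, back w e z * w' z * sol w' g z) -
      ((∫ z, back w e z * w z * sol w' g z) - ∫ z, w z * back w e z * g z) := by
  have hgi : Integrable fun z => w z * back w e z * g z := by
    have h1 := integrable_hk_mul hw hg (rate_pos R) hw.nonneg (le_sq_mul_sqrt_rate R R)
      (A := 2 * Real.exp (rate R * |e.1|))
      (g := fun z => 2 * Real.exp (rate R * (e.1 - z.1)) * g z)
      (Measurable.aestronglyMeasurable (by have := hg.measurable; fun_prop)) (by positivity)
      (fun z => ?_) e
    · refine h1.norm.mono'
        ((hw.aesm.mul (aestronglyMeasurable_back hw e)).mul hg.measurable.aestronglyMeasurable)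
        (ae_of_all _ fun z => ?_)
      have h2 := abs_back_le hw e z
      have h3 := hk_nonneg (e.1 - z.1) (e.2 - z.2)
      have h4 := hg.nonneg z
      simp only [norm_mul, Real.norm_eq_abs, Real.abs_exp, abs_of_nonneg h3, abs_of_nonneg h4,
        abs_two]
      calc _ ≤ |w z| * (2 * (Real.exp ((16 * R ^ 4 + 1) * (e.1 - z.1)) *
          hk (e.1 - z.1) (e.2 - z.2))) * g z := by gcongr
        _ = _ := by rw [rate]; ring
    · have h4 := hg.nonneg z
      rw [abs_of_nonneg (by positivity)]
      rcases le_or_gt z.1 0 with hz | hz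
      · simp [hg0 z hz]
      · have hr := rate_pos R
        have e1 : Real.exp (rate R * (e.1 - z.1)) ≤
            Real.exp (rate R * |e.1|) * Real.exp (rate R * z.1) := by
          rw [← Real.exp_add]
          apply Real.exp_le_exp.2
          have := le_abs_self e.1
          nlinarith
        calc 2 * Real.exp (rate R * (e.1 - z.1)) * g z ≤
            2 * (Real.exp (rate R * |e.1|) * Real.exp (rate R * z.1)) * g z := by gcongr
          _ = _ := by ring
  have h1 : sol w' g e - g e = ∫ z, (back w e z * w' z * sol w' g z -
      (∫ y, hk (y.1 - z.1) (y.2 - z.2) * (w y * back w e y)) * (w' z * sol w' g z)) := by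
    rw [sol_eq hw' hg hg0 e, add_sub_cancel_left, volterra]
    refine integral_congr_ae (ae_of_all _ fun z => ?_)
    simp only
    have := back_eq hw e z
    rw [this]; ring
  have hF := integrable_duality hw hw' hg hg0 e
  have h2 : ∀ z, (∫ y, hk (y.1 - z.1) (y.2 - z.2) * (w y * back w e y)) * (w' z * sol w' g z) =
      ∫ y, (w y * back w e y) * (hk (y.1 - z.1) (y.2 - z.2) * (w' z * sol w' g z)) := fun z => by
    rw [← integral_mul_const]
    refine integral_congr_ae (ae_of_all _ fun y => ?_)
    simp only; ring
  have h3 : ∫ z, (∫ y, hk (y.1 - z.1) (y.2 - z.2) * (w y * back w e y)) * (w' z * sol w' g z) =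
      (∫ z, back w e z * w z * sol w' g z) - ∫ z, w z * back w e z * g z := by
    simp_rw [h2]
    rw [← integral_sub (integrable_back_mul_mul_sol hw hw' hw hg hg0 e) hgi,
      integral_integral_swap (f := fun z y => (w y * back w e y) *
        (hk (y.1 - z.1) (y.2 - z.2) * (w' z * sol w' g z))) hF.swap]
    refine integral_congr_ae (ae_of_all _ fun y => ?_)
    simp only
    rw [integral_const_mul]
    have := sol_eq hw' hg hg0 y
    rw [volterra] at this
    rw [eq_sub_of_add_eq' this.symm]; ring
  rw [h1, integral_sub (integrable_back_mul_mul_sol hw hw' hw' hg hg0 e), h3]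
  simp_rw [h2]
  exact hF.swap.integral_prod_left

/-- The dependence of the solution on the potential, exactly: the fundamental solution of one
potential tested against the difference. -/
theorem sol_sub_sol (hw : PotBound w R) (hw' : PotBound w' R) (hg : FreeSol g)
    (hg0 : ∀ z : ℝ × ℝ, z.1 ≤ 0 → g z = 0) (e : ℝ × ℝ) :
    sol w' g e - sol w g e = ∫ z, back w e z * (w' z - w z) * sol w' g z := by
  have h1 := sol_sub_free_eq hw hw' hg hg0 e
  have h2 := sol_sub_free_eq hw hw hg hg0 e
  have h3 : ∫ z, back w e z * (w' z - w z) * sol w' g z = (∫ z, back w e z * w' z * sol w' g z) -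
      ∫ z, back w e z * w z * sol w' g z := by
    rw [← integral_sub (integrable_back_mul_mul_sol hw hw' hw' hg hg0 e)
      (integrable_back_mul_mul_sol hw hw' hw hg hg0 e)]
    congr 1; funext z; ring
  rw [h3]; linarith

/-- The solution is Lipschitz in the potential, relative to the free solution. -/
theorem abs_sol_sub_sol_le (hw : PotBound w R) (hw' : PotBound w' R)
    (hD : PotBound (fun z => w' z - w z) D) (hg : FreeSol g)
    (hg0 : ∀ z : ℝ × ℝ, z.1 ≤ 0 → g z = 0) (e : ℝ × ℝ) :
    |sol w' g e - sol w g e| ≤ 4 * D * (Real.exp (2 * rate R * e.1) * g e) := by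
  rw [sol_sub_sol hw hw' hg hg0 e, ← Real.norm_eq_abs]
  refine (norm_integral_le_integral_norm _).trans ?_
  have h1 := integral_abs_hk_mul_free_le hD hg hg0 e R
  have h0 := integrable_hk_mul hD hg (rate_pos R) hD.nonneg (le_sq_mul_sqrt_rate D R)
    hg.measurable.aestronglyMeasurable zero_le_one (abs_le_exp_mul hg hg0 (rate_pos R)) e
  calc _ ≤ ∫ z, (4 * Real.exp (rate R * e.1)) *
        ‖hk (e.1 - z.1) (e.2 - z.2) * ((w' z - w z) * g z)‖ := by
        refine integral_mono (integrable_back_mul_mul_sol hw hw' hD hg hg0 e).norm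
          (h0.norm.const_mul _) fun z => ?_
        have h2 := abs_back_mul_sol_le hw hw' hg hg0 e z
        have h3 := hk_nonneg (e.1 - z.1) (e.2 - z.2)
        have h4 := hg.nonneg z
        simp only
        rw [Real.norm_eq_abs, mul_right_comm, abs_mul, norm_mul, norm_mul, Real.norm_of_nonneg h3,
          Real.norm_of_nonneg h4, Real.norm_eq_abs]
        calc _ ≤ 4 * Real.exp (rate R * e.1) * (hk (e.1 - z.1) (e.2 - z.2) * g z) *
              |w' z - w z| := by gcongr
          _ = _ := by ring
    _ ≤ 4 * Real.exp (rate R * e.1) * (D * (Real.exp (rate R * e.1) * g e)) := by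
        rw [integral_const_mul]; gcongr
    _ = 4 * D * ((Real.exp (rate R * e.1) * Real.exp (rate R * e.1)) * g e) := by ring
    _ = _ := by rw [← Real.exp_add]; congr 4; ring

end

theorem volterra_congr_ae {w w' : ℝ × ℝ → ℝ} (h : w =ᵐ[volume] w') : volterra w = volterra w' := by
  funext g a
  refine integral_congr_ae ?_
  filter_upwards [h] with z hz
  rw [hz]

theorem sol_congr_ae {w w' : ℝ × ℝ → ℝ} (h : w =ᵐ[volume] w') : sol w = sol w' := by
  funext g a
  rw [sol, sol, volterra_congr_ae h]

theorem back_congr_ae {w w' : ℝ × ℝ → ℝ} (h : w =ᵐ[volume] w') : back w = back w' := by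
  funext e z
  have : (fun y => w (refl e.1 y)) =ᵐ[volume] fun y => w' (refl e.1 y) :=
    (measurePreserving_refl e.1).quasiMeasurePreserving.ae_eq_comp h
  rw [back, back, sol_congr_ae this]

/-! ### The lower bound -/

theorem integrable_hk_mul_hk {a b : ℝ} (ha : 0 < a) (hb : 0 < b) (x z : ℝ) :
    Integrable fun y => hk a (x - y) * hk b (y - z) := by
  refine ⟨((measurable_hk_sub_right a x).mul
    (measurable_hk_comp measurable_const (by fun_prop))).aestronglyMeasurable, ?_⟩
  rw [hasFiniteIntegral_iff_ofReal (ae_of_all _ fun y => mul_nonneg (hk_nonneg _ _) (hk_nonneg _ _))]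
  simp_rw [ENNReal.ofReal_mul (hk_nonneg _ _)]
  rw [lintegral_hk_mul_hk ha hb]
  exact ENNReal.ofReal_lt_top

theorem integral_hk_mul_hk {a b : ℝ} (ha : 0 < a) (hb : 0 < b) (x z : ℝ) :
    ∫ y, hk a (x - y) * hk b (y - z) = hk (a + b) (x - z) := by
  rw [integral_eq_lintegral_of_nonneg_ae
    (ae_of_all _ fun y => mul_nonneg (hk_nonneg _ _) (hk_nonneg _ _))
    (integrable_hk_mul_hk ha hb x z).1]
  simp_rw [ENNReal.ofReal_mul (hk_nonneg _ _)]
  rw [lintegral_hk_mul_hk ha hb, ENNReal.toReal_ofReal (hk_nonneg _ _)]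

theorem heatFlow_zero {μ : Measure ℝ} (z : ℝ × ℝ) (hz : z.1 ≤ 0) : heatFlow 0 μ z = 0 :=
  heatFlow_of_le hz

section

variable {μ : Measure ℝ} [SFinite μ] {w : ℝ × ℝ → ℝ} {R : ℝ}

theorem lintegral_hk_mul_heatFlow (hμ : HeatFinite μ) {s t : ℝ} (hs : 0 < s) (ht : 0 < t) (x : ℝ) :
    ∫⁻ y, ENNReal.ofReal (hk t (x - y)) * ENNReal.ofReal (heatFlow 0 μ (s, y)) =
      ENNReal.ofReal (heatFlow 0 μ (t + s, x)) := by
  simp_rw [ofReal_heatFlow hμ, sub_zero]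
  simp_rw [← lintegral_const_mul _ (measurable_hk_sub_right s _).ennreal_ofReal]
  rw [lintegral_lintegral_swap]
  · exact lintegral_congr fun y => lintegral_hk_mul_hk ht hs x y
  · refine Measurable.aemeasurable ?_
    exact (measurable_hk_comp measurable_const (by fun_prop)).ennreal_ofReal.mul
      (measurable_hk_comp measurable_const (by fun_prop)).ennreal_ofReal

theorem integrable_hk_mul_heatFlow (hμ : HeatFinite μ) {s t : ℝ} (hs : 0 < s) (ht : 0 < t) (x : ℝ) :
    Integrable fun y => hk t (x - y) * heatFlow 0 μ (s, y) := by
  have hm := (freeSol_heatFlow (s := 0) hμ).measurable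
  refine ⟨((measurable_hk_sub_right t x).mul
    (hm.comp (measurable_const.prodMk measurable_id))).aestronglyMeasurable, ?_⟩
  rw [hasFiniteIntegral_iff_ofReal (ae_of_all _ fun y =>
    mul_nonneg (hk_nonneg _ _) (heatFlow_nonneg _))]
  simp_rw [ENNReal.ofReal_mul (hk_nonneg _ _)]
  rw [lintegral_hk_mul_heatFlow hμ hs ht]
  exact ENNReal.ofReal_lt_top

theorem integral_hk_mul_heatFlow (hμ : HeatFinite μ) {s t : ℝ} (hs : 0 < s) (ht : 0 < t) (x : ℝ) :
    ∫ y, hk t (x - y) * heatFlow 0 μ (s, y) = heatFlow 0 μ (t + s, x) := by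
  rw [integral_eq_lintegral_of_nonneg_ae
    (ae_of_all _ fun y => mul_nonneg (hk_nonneg _ _) (heatFlow_nonneg _))
    (integrable_hk_mul_heatFlow hμ hs ht x).1]
  simp_rw [ENNReal.ofReal_mul (hk_nonneg _ _)]
  rw [lintegral_hk_mul_heatFlow hμ hs ht, ENNReal.toReal_ofReal (heatFlow_nonneg _)]

theorem continuous_sol_slice (hw : PotBound w R) (hμ : HeatFinite μ) {s : ℝ} (hs : 0 < s) :
    Continuous fun y => sol w (heatFlow 0 μ) (s, y) := by
  refine continuous_iff_continuousAt.2 fun y => ?_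
  have h1 : ContinuousAt (sol w (heatFlow 0 μ)) (s, y) :=
    continuousAt_sol hw (freeSol_heatFlow hμ) heatFlow_zero (continuousAt_heatFlow hμ hs)
  exact h1.comp (f := fun y => (s, y)) (by fun_prop)

/-- The Duhamel equation restarted at the time `s`. -/
theorem sol_restart (hw : PotBound w R) (hμ : HeatFinite μ) {s : ℝ} (hs : 0 < s) {z : ℝ × ℝ}
    (hz : s < z.1) :
    Integrable (fun y => hk (z.1 - s) (z.2 - y) * sol w (heatFlow 0 μ) (s, y)) ∧
    sol w (heatFlow 0 μ) z = (∫ y, hk (z.1 - s) (z.2 - y) * sol w (heatFlow 0 μ) (s, y)) +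
      ∫ y, hk (z.1 - y.1) (z.2 - y.2) *
        (w y * ({y : ℝ × ℝ | s < y.1}.indicator (sol w (heatFlow 0 μ)) y)) := by
  set q := sol w (heatFlow 0 μ) with hq
  have hg := freeSol_heatFlow (s := 0) hμ
  have hg0 := heatFlow_zero (μ := μ)
  have hqm := aestronglyMeasurable_sol hw hg hg0
  set S : Set (ℝ × ℝ) := {y | s < y.1} with hS
  have hSm : MeasurableSet S := measurableSet_lt measurable_const measurable_fst
  have hzs : 0 < z.1 - s := sub_pos.2 hz
  have hint := integrable_hk_mul_sol hw hg hg0 z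
  rw [← hq] at hint hqm
  -- Chapman–Kolmogorov in the past of `s`
  have hck : ∀ y : ℝ × ℝ, y.1 < s → ∫ x, hk (z.1 - s) (z.2 - x) * hk (s - y.1) (x - y.2) =
      hk (z.1 - y.1) (z.2 - y.2) := fun y hy => by
    rw [integral_hk_mul_hk hzs (sub_pos.2 hy), sub_add_sub_cancel]
  have hFm : AEStronglyMeasurable (fun p : (ℝ × ℝ) × ℝ => hk (z.1 - s) (z.2 - p.2) *
      (hk (s - p.1.1) (p.2 - p.1.2) * (w p.1 * q p.1))) (volume.prod volume) :=
    (measurable_hk_comp measurable_const (by fun_prop)).aestronglyMeasurable.mul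
      ((measurable_hk_comp (by fun_prop) (by fun_prop)).aestronglyMeasurable.mul
        (hw.aesm.mul hqm).comp_fst)
  have hFi : Integrable (fun p : (ℝ × ℝ) × ℝ => hk (z.1 - s) (z.2 - p.2) *
      (hk (s - p.1.1) (p.2 - p.1.2) * (w p.1 * q p.1))) (volume.prod volume) := by
    rw [integrable_prod_iff hFm]
    constructor
    · refine ae_of_all _ fun y => ?_
      simp only
      rcases lt_or_ge y.1 s with hy | hy
      · have := (integrable_hk_mul_hk hzs (sub_pos.2 hy) z.2 y.2).mul_const (w y * q y)
        simpa only [mul_assoc] using this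
      · simp [hk_of_nonpos (sub_nonpos.2 hy)]
    · refine hint.norm.mono' hFm.norm.integral_prod_right' (ae_of_all _ fun y => ?_)
      simp only
      rw [Real.norm_of_nonneg (integral_nonneg fun _ => norm_nonneg _)]
      rcases lt_or_ge y.1 s with hy | hy
      · simp_rw [← mul_assoc, norm_mul, Real.norm_of_nonneg (hk_nonneg _ _)]
        simp_rw [mul_assoc, ← mul_assoc (hk (z.1 - s) _)]
        rw [integral_mul_const, hck y hy]
      · simp only [hk_of_nonpos (sub_nonpos.2 hy), zero_mul, mul_zero, norm_zero, integral_zero]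
        positivity
  have hsum : ∀ x, hk (z.1 - s) (z.2 - x) * q (s, x) =
      hk (z.1 - s) (z.2 - x) * heatFlow 0 μ (s, x) +
        ∫ y : ℝ × ℝ, hk (z.1 - s) (z.2 - x) * (hk (s - y.1) (x - y.2) * (w y * q y)) := fun x => by
    rw [hq, sol_eq hw hg hg0 (s, x), integral_const_mul, mul_add, volterra]
  have hi1 := integrable_hk_mul_heatFlow hμ hs hzs z.2
  have hi2 : Integrable fun x => ∫ y : ℝ × ℝ, hk (z.1 - s) (z.2 - x) *
      (hk (s - y.1) (x - y.2) * (w y * q y)) := hFi.swap.integral_prod_left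
  refine ⟨(hi1.add hi2).congr (ae_of_all _ fun x => (hsum x).symm), ?_⟩
  have h1 : ∫ x, hk (z.1 - s) (z.2 - x) * q (s, x) = heatFlow 0 μ z +
      ∫ y : ℝ × ℝ, hk (z.1 - y.1) (z.2 - y.2) * (w y * (Sᶜ.indicator q y)) := by
    simp_rw [hsum]
    rw [integral_add hi1 hi2, integral_hk_mul_heatFlow hμ hs hzs, sub_add_cancel,
      integral_integral_swap (f := fun x (y : ℝ × ℝ) => hk (z.1 - s) (z.2 - x) *
      (hk (s - y.1) (x - y.2) * (w y * q y))) hFi.swap]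
    congr 1
    have hne : ∀ᵐ y : ℝ × ℝ, y.1 ≠ s := by
      have : (volume : Measure (ℝ × ℝ)) ({s} ×ˢ univ) = 0 := by
        rw [Measure.volume_eq_prod, Measure.prod_prod]; simp
      refine measure_mono_null (fun y hy => ?_) this
      simp only [mem_compl_iff, ne_eq] at hy
      exact ⟨by simpa using hy, mem_univ _⟩
    refine integral_congr_ae ?_
    filter_upwards [hne] with y hy
    rcases lt_or_gt_of_ne hy with h | h
    · have hyS : y ∈ Sᶜ := fun hc => lt_asymm h hc
      simp_rw [indicator_of_mem hyS, ← mul_assoc (hk (z.1 - s) _)]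
      rw [integral_mul_const, hck y h]
    · have hyS : y ∉ Sᶜ := fun hc => hc h
      simp [indicator_of_notMem hyS, hk_of_nonpos (sub_nonpos.2 h.le)]
  have e1 : ∀ y : ℝ × ℝ, hk (z.1 - y.1) (z.2 - y.2) * (w y * (Sᶜ.indicator q y)) =
      Sᶜ.indicator (fun y : ℝ × ℝ => hk (z.1 - y.1) (z.2 - y.2) * (w y * q y)) y := fun y => by
    by_cases hy : y ∈ Sᶜ
    · simp only [indicator_of_mem hy]
    · simp only [indicator_of_notMem hy, mul_zero]
  have e2 : ∀ y : ℝ × ℝ, hk (z.1 - y.1) (z.2 - y.2) * (w y * (S.indicator q y)) =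
      S.indicator (fun y : ℝ × ℝ => hk (z.1 - y.1) (z.2 - y.2) * (w y * q y)) y := fun y => by
    by_cases hy : y ∈ S
    · simp only [indicator_of_mem hy]
    · simp only [indicator_of_notMem hy, mul_zero]
  rw [h1]
  simp_rw [e1, e2]
  rw [integral_indicator hSm.compl, integral_indicator hSm, hq, sol_eq hw hg hg0 z, ← hq, add_assoc,
    add_comm (∫ y in Sᶜ, _), integral_add_compl hSm hint]
  rfl

/-- Half of the free evolution survives over a short time, uniformly in the potential. -/
theorem sol_lower_step (hw : PotBound w R) (hμ : HeatFinite μ) {s c : ℝ} (hs : 0 ≤ s) (hc : 0 < c)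
    (hc1 : c ≤ 1)
    (hlow : ∀ z : ℝ × ℝ, z.1 ≤ s → c * heatFlow 0 μ z ≤ sol w (heatFlow 0 μ) z) :
    ∀ z : ℝ × ℝ, z.1 ≤ s + 1 / ((144 * R ^ 2) ^ 2 + 1) →
      c / 2 * heatFlow 0 μ z ≤ sol w (heatFlow 0 μ) z := by
  set q := sol w (heatFlow 0 μ) with hq
  -- this rate yields the contraction factor `1/12`; over a time of length `1/l` the weights differ
  -- by at most `e < 3`, so that the correction is at most `2 · 3 / 12 = 1/2` of the free part
  set l := (144 * R ^ 2) ^ 2 + 1 with hl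
  have hlpos : 0 < l := by positivity
  have hg := freeSol_heatFlow (s := 0) hμ
  have hg0 := heatFlow_zero (μ := μ)
  have hqm := aestronglyMeasurable_sol hw hg hg0
  rw [← hq] at hqm
  have hRθ : R ^ 2 ≤ (1 / 12) ^ 2 * Real.sqrt l := by
    have : 144 * R ^ 2 ≤ Real.sqrt l := Real.le_sqrt_of_sq_le (by rw [hl]; linarith)
    linarith
  -- the free evolution of `q` from the time `s` on
  obtain ⟨g₁, hg₁, hg₁0, hg₁c, heq⟩ : ∃ g₁ : ℝ × ℝ → ℝ, FreeSol g₁ ∧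
      (∀ z : ℝ × ℝ, z.1 ≤ s → g₁ z = 0) ∧
      (∀ z : ℝ × ℝ, s < z.1 → c * heatFlow 0 μ z ≤ g₁ z) ∧
      (∀ z : ℝ × ℝ, s < z.1 → q z = g₁ z + ∫ y, hk (z.1 - y.1) (z.2 - y.2) *
        (w y * ({y : ℝ × ℝ | s < y.1}.indicator q y))) := by
    rcases hs.eq_or_lt with rfl | hs
    · refine ⟨heatFlow 0 μ, hg, hg0, fun z _ => ?_, fun z hz => ?_⟩
      · exact mul_le_of_le_one_left (heatFlow_nonneg z) hc1
      · rw [hq, sol_eq hw hg hg0 z, ← hq, volterra]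
        congr 1
        refine integral_congr_ae (ae_of_all _ fun y => ?_)
        simp only
        by_cases hy : 0 < y.1
        · rw [indicator_of_mem (show y ∈ {y : ℝ × ℝ | 0 < y.1} from hy)]
        · rw [indicator_of_notMem (show y ∉ {y : ℝ × ℝ | 0 < y.1} from hy), hq,
            sol_of_nonpos hw hg hg0 (not_lt.1 hy)]
    · have hqpos : ∀ x, 0 ≤ q (s, x) := fun x =>
        (mul_nonneg hc.le (heatFlow_nonneg _)).trans (hlow (s, x) le_rfl)
      have hqc : Measurable fun x => ENNReal.ofReal (q (s, x)) :=
        (continuous_sol_slice hw hμ hs).measurable.ennreal_ofReal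
      set μ₁ : Measure ℝ := volume.withDensity fun x => ENNReal.ofReal (q (s, x)) with hμ₁
      have hfin : HeatFinite μ₁ := fun t x => by
        rcases le_or_gt t 0 with ht | ht
        · simp [hk_of_nonpos ht]
        · rw [hμ₁, lintegral_withDensity_eq_lintegral_mul _ hqc
            (measurable_hk_sub_right t x).ennreal_ofReal]
          refine ne_top_of_le_ne_top (b := ENNReal.ofReal (2 * Real.exp ((16 * R ^ 4 + 1) * s)) *
            ENNReal.ofReal (heatFlow 0 μ (t + s, x)))
            (ENNReal.mul_ne_top ENNReal.ofReal_ne_top ENNReal.ofReal_ne_top) ?_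
          rw [← lintegral_hk_mul_heatFlow hμ hs ht x, ← lintegral_const_mul' _ _
            ENNReal.ofReal_ne_top]
          refine lintegral_mono fun y => ?_
          simp only [Pi.mul_apply]
          have h1 := (le_abs_self _).trans (abs_sol_le' hw hg hg0 (s, y))
          have h2 := ENNReal.ofReal_le_ofReal h1
          rw [← mul_assoc, ENNReal.ofReal_mul (by positivity)] at h2
          calc _ ≤ (ENNReal.ofReal (2 * Real.exp ((16 * R ^ 4 + 1) * s)) *
                ENNReal.ofReal (heatFlow 0 μ (s, y))) * ENNReal.ofReal (hk t (x - y)) := by gcongr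
            _ = _ := by ring
      have hval : ∀ z, heatFlow s μ₁ z = ∫ y, hk (z.1 - s) (z.2 - y) * q (s, y) := fun z => by
        rw [heatFlow, hμ₁, integral_withDensity_eq_integral_toReal_smul hqc
          (ae_of_all _ fun _ => ENNReal.ofReal_lt_top)]
        refine integral_congr_ae (ae_of_all _ fun y => ?_)
        simp only [smul_eq_mul]
        rw [ENNReal.toReal_ofReal (hqpos y), mul_comm]
      refine ⟨heatFlow s μ₁, freeSol_heatFlow hfin, fun z hz => heatFlow_of_le hz,
        fun z hz => ?_, fun z hz => ?_⟩
      · have hzs : 0 < z.1 - s := sub_pos.2 hz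
        have h1 := integral_hk_mul_heatFlow hμ hs hzs z.2
        rw [sub_add_cancel] at h1
        rw [hval, ← h1, ← integral_const_mul]
        refine integral_mono ((integrable_hk_mul_heatFlow hμ hs hzs z.2).const_mul _)
          (sol_restart hw hμ hs hz).1 fun y => ?_
        have h2 := hlow (s, y) le_rfl
        have h3 := hk_nonneg (z.1 - s) (z.2 - y)
        calc _ = hk (z.1 - s) (z.2 - y) * (c * heatFlow 0 μ (s, y)) := by ring
          _ ≤ _ := by gcongr
      · rw [hval]; exact (sol_restart hw hμ hs hz).2
  set S : Set (ℝ × ℝ) := {y | s < y.1 ∧ y.1 ≤ s + 1 / l} with hS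
  have hSm : MeasurableSet S := (measurableSet_lt measurable_const measurable_fst).inter
    (measurableSet_le measurable_fst measurable_const)
  set u : ℝ × ℝ → ℝ := S.indicator q with hu
  have hum : AEStronglyMeasurable u volume := hqm.indicator hSm
  have heq' : ∀ z ∈ S, u z = g₁ z + ∫ y, hk (z.1 - y.1) (z.2 - y.2) * (w y * u y) := by
    intro z hz
    rw [hu, indicator_of_mem hz, heq z hz.1]
    congr 1
    refine integral_congr_ae (ae_of_all _ fun y => ?_)
    simp only
    by_cases hy : y.1 ≤ s + 1 / l
    · by_cases hy2 : s < y.1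
      · rw [indicator_of_mem (show y ∈ {y : ℝ × ℝ | s < y.1} from hy2),
          indicator_of_mem (show y ∈ S from ⟨hy2, hy⟩)]
      · rw [indicator_of_notMem (show y ∉ {y : ℝ × ℝ | s < y.1} from hy2),
          indicator_of_notMem (show y ∉ S from fun h => hy2 h.1)]
    · have : z.1 - y.1 ≤ 0 := by linarith [hz.2, not_le.1 hy]
      simp [hk_of_nonpos this]
  set A : ℝ := 2 * Real.exp ((16 * R ^ 4 + 1) * (s + 1 / l)) / c with hA
  have hApos : 0 ≤ A := by positivity
  have hbd : ∀ z, |u z| ≤ A * (Real.exp (l * z.1) * g₁ z) := by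
    intro z
    have hg1z := hg₁.nonneg z
    by_cases hz : z ∈ S
    · rw [hu, indicator_of_mem hz]
      refine (abs_sol_le' hw hg hg0 z).trans ?_
      have h1 : heatFlow 0 μ z ≤ g₁ z / c := by
        rw [le_div_iff₀ hc, mul_comm]; exact hg₁c z hz.1
      have h2 : (1 : ℝ) ≤ Real.exp (l * z.1) :=
        Real.one_le_exp (mul_nonneg hlpos.le (hs.trans hz.1.le))
      calc _ ≤ 2 * (Real.exp ((16 * R ^ 4 + 1) * (s + 1 / l)) * (g₁ z / c)) := by
            gcongr
            · exact heatFlow_nonneg z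
            · exact hz.2
        _ = A * (1 * g₁ z) := by rw [hA]; ring
        _ ≤ _ := by gcongr
    · rw [hu, indicator_of_notMem hz]; simp only [abs_zero]; positivity
  have hB : ∀ a, |u a| ≤ Real.exp (-(l * s)) * (Real.exp (l * a.1) * g₁ a) +
      ∫ z, ‖hk (a.1 - z.1) (a.2 - z.2) * (w z * u z)‖ := by
    intro a
    have hg1a := hg₁.nonneg a
    by_cases ha : a ∈ S
    · rw [heq' a ha]
      refine (abs_add_le _ _).trans (add_le_add ?_ (by
        rw [← Real.norm_eq_abs]; exact norm_integral_le_integral_norm _))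
      rw [abs_of_nonneg hg1a, ← mul_assoc, ← Real.exp_add]
      refine le_mul_of_one_le_left hg1a (Real.one_le_exp ?_)
      nlinarith [ha.1]
    · rw [hu, indicator_of_notMem ha, abs_zero]
      have : 0 ≤ ∫ z, ‖hk (a.1 - z.1) (a.2 - z.2) * (w z * u z)‖ :=
        integral_nonneg fun _ => norm_nonneg _
      positivity
  have hbd2 := abs_le_of_contraction hw hg₁ hlpos (by norm_num) (by norm_num) hRθ hum hApos hbd
    (Real.exp_pos _).le hB
  intro z hz
  by_cases hzs : z.1 ≤ s
  · refine le_trans ?_ (hlow z hzs)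
    have := heatFlow_nonneg (s := 0) (μ := μ) z
    nlinarith
  · have hzS : z ∈ S := ⟨not_le.1 hzs, hz⟩
    have h1 := abs_volterra_le hw hg₁ hlpos (by norm_num) hRθ hum (by positivity) hbd2 z
    have h2 := heq' z hzS
    have hg1z := hg₁.nonneg z
    rw [hu, indicator_of_mem hzS, ← hu] at h2
    change q z = g₁ z + volterra w u z at h2
    have h3 : Real.exp (-(l * s)) * Real.exp (l * z.1) ≤ 3 := by
      rw [← Real.exp_add]
      refine le_trans (Real.exp_le_exp.2 (?_ : _ ≤ (1 : ℝ))) Real.exp_one_lt_three.le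
      have : l * z.1 ≤ l * (s + 1 / l) := by gcongr
      have h4 : l * (s + 1 / l) = l * s + 1 := by field_simp
      linarith
    have h4 : 2 * Real.exp (-(l * s)) * (1 / 12) * (Real.exp (l * z.1) * g₁ z) ≤ 1 / 2 * g₁ z := by
      calc _ = (Real.exp (-(l * s)) * Real.exp (l * z.1)) * (1 / 6) * g₁ z := by ring
        _ ≤ 3 * (1 / 6) * g₁ z := by gcongr
        _ = _ := by ring
    have h5 := neg_le_of_abs_le (h1.trans h4)
    have h6 := hg₁c z hzS.1
    rw [h2]
    linarith

/-- The solution is bounded below by a multiple of the free evolution, which depends only on the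
norm of the potential and on the time horizon: half of it survives each of finitely many short
steps. -/
theorem sol_lower_bound (R T : ℝ) : ∃ c, 0 < c ∧ ∀ (w : ℝ × ℝ → ℝ) (μ : Measure ℝ) [SFinite μ],
    PotBound w R → HeatFinite μ → ∀ z : ℝ × ℝ, z.1 ≤ T →
      c * heatFlow 0 μ z ≤ sol w (heatFlow 0 μ) z := by
  set ε := 1 / ((144 * R ^ 2) ^ 2 + 1) with hε
  have hεpos : 0 < ε := by positivity
  obtain ⟨k, hk⟩ := exists_nat_ge (T / ε)
  refine ⟨(1 / 2) ^ k, by positivity, fun w μ _ hw hμ z hz => ?_⟩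
  have key : ∀ k : ℕ, ∀ z : ℝ × ℝ, z.1 ≤ k * ε →
      (1 / 2) ^ k * heatFlow 0 μ z ≤ sol w (heatFlow 0 μ) z := by
    intro k
    induction k with
    | zero =>
      intro z hz
      rw [Nat.cast_zero, zero_mul] at hz
      rw [heatFlow_zero z hz, sol_of_nonpos hw (freeSol_heatFlow hμ) heatFlow_zero hz, mul_zero]
    | succ k ih =>
      intro z hz
      have := sol_lower_step hw hμ (s := k * ε) (by positivity) (by positivity)
        (pow_le_one₀ (by norm_num) (by norm_num)) ih z (by push_cast at hz; linarith)
      rwa [pow_succ, ← div_eq_mul_one_div]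
  refine key k z (hz.trans ?_)
  rwa [div_le_iff₀ hεpos] at hk

theorem sol_pos (hw : PotBound w R) (hμ : HeatFinite μ) (h0 : μ ≠ 0) {z : ℝ × ℝ} (hz : 0 < z.1) :
    0 < sol w (heatFlow 0 μ) z := by
  obtain ⟨c, hc, h⟩ := sol_lower_bound R z.1
  exact (mul_pos hc (heatFlow_pos hμ h0 hz)).trans_le (h w μ hw hμ z le_rfl)

end

/-! ### Partial derivatives on space-time -/

/-- The derivative in time, as a function on space-time. -/
def Dt (u : ℝ × ℝ → ℝ) (z : ℝ × ℝ) : ℝ := deriv (fun s => u (s, z.2)) z.1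

/-- The derivative in space, as a function on space-time. -/
def Dx (u : ℝ × ℝ → ℝ) (z : ℝ × ℝ) : ℝ := deriv (fun y => u (z.1, y)) z.2

/-- The heat operator `∂ₜ - ½ ∂ₓₓ`. -/
def heatOp (u : ℝ × ℝ → ℝ) (z : ℝ × ℝ) : ℝ := Dt u z - 1 / 2 * Dx (Dx u) z

section

variable {u v : ℝ × ℝ → ℝ} {z : ℝ × ℝ} {U : Set (ℝ × ℝ)} {n m : ℕ∞ω}

theorem hasDerivAt_slice_snd (h : DifferentiableAt ℝ u z) :
    HasDerivAt (fun y => u (z.1, y)) (fderiv ℝ u z (0, 1)) z.2 := by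
  have h1 : HasDerivAt (fun y : ℝ => ((z.1, y) : ℝ × ℝ)) (0, 1) z.2 :=
    (hasDerivAt_const z.2 z.1).prodMk (hasDerivAt_id z.2)
  exact (h.hasFDerivAt (x := (z.1, z.2))).comp_hasDerivAt z.2 h1

theorem hasDerivAt_slice_fst (h : DifferentiableAt ℝ u z) :
    HasDerivAt (fun s => u (s, z.2)) (fderiv ℝ u z (1, 0)) z.1 := by
  have h1 : HasDerivAt (fun s : ℝ => ((s, z.2) : ℝ × ℝ)) (1, 0) z.1 :=
    (hasDerivAt_id z.1).prodMk (hasDerivAt_const z.1 z.2)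
  exact (h.hasFDerivAt (x := (z.1, z.2))).comp_hasDerivAt z.1 h1

theorem Dx_eq_fderiv (h : DifferentiableAt ℝ u z) : Dx u z = fderiv ℝ u z (0, 1) :=
  (hasDerivAt_slice_snd h).deriv

theorem Dt_eq_fderiv (h : DifferentiableAt ℝ u z) : Dt u z = fderiv ℝ u z (1, 0) :=
  (hasDerivAt_slice_fst h).deriv

theorem hasDerivAt_Dx (h : DifferentiableAt ℝ u z) :
    HasDerivAt (fun y => u (z.1, y)) (Dx u z) z.2 :=
  Dx_eq_fderiv h ▸ hasDerivAt_slice_snd h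

theorem hasDerivAt_Dt (h : DifferentiableAt ℝ u z) :
    HasDerivAt (fun s => u (s, z.2)) (Dt u z) z.1 :=
  Dt_eq_fderiv h ▸ hasDerivAt_slice_fst h

theorem contDiffAt_Dx (h : ContDiffAt ℝ n u z) (hm : m + 1 ≤ n) : ContDiffAt ℝ m (Dx u) z := by
  have h1 : ContDiffAt ℝ m (fun y => fderiv ℝ u y (0, 1)) z :=
    (h.fderiv_right hm).clm_apply contDiffAt_const
  refine h1.congr_of_eventuallyEq ?_
  have h2 : ContDiffAt ℝ 1 u z := h.of_le (le_trans le_add_self hm)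
  filter_upwards [h2.eventually (by simp)] with y hy
  exact Dx_eq_fderiv (hy.differentiableAt (by simp))

theorem contDiffAt_Dt (h : ContDiffAt ℝ n u z) (hm : m + 1 ≤ n) : ContDiffAt ℝ m (Dt u) z := by
  have h1 : ContDiffAt ℝ m (fun y => fderiv ℝ u y (1, 0)) z :=
    (h.fderiv_right hm).clm_apply contDiffAt_const
  refine h1.congr_of_eventuallyEq ?_
  have h2 : ContDiffAt ℝ 1 u z := h.of_le (le_trans le_add_self hm)
  filter_upwards [h2.eventually (by simp)] with y hy
  exact Dt_eq_fderiv (hy.differentiableAt (by simp))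

theorem contDiffAt_Dx_infty (h : ContDiffAt ℝ ∞ u z) : ContDiffAt ℝ ∞ (Dx u) z :=
  contDiffAt_Dx h le_rfl

theorem contDiffAt_Dt_infty (h : ContDiffAt ℝ ∞ u z) : ContDiffAt ℝ ∞ (Dt u) z :=
  contDiffAt_Dt h le_rfl

theorem contDiff_Dx (h : ContDiff ℝ ∞ u) : ContDiff ℝ ∞ (Dx u) :=
  contDiff_iff_contDiffAt.2 fun _ => contDiffAt_Dx_infty h.contDiffAt

theorem contDiff_Dt (h : ContDiff ℝ ∞ u) : ContDiff ℝ ∞ (Dt u) :=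
  contDiff_iff_contDiffAt.2 fun _ => contDiffAt_Dt_infty h.contDiffAt

theorem contDiff_heatOp (h : ContDiff ℝ ∞ u) : ContDiff ℝ ∞ (heatOp u) :=
  (contDiff_Dt h).sub (contDiff_const.mul (contDiff_Dx (contDiff_Dx h)))

theorem eventually_slice_snd {p : ℝ × ℝ → Prop} (h : ∀ᶠ y in 𝓝 z, p y) :
    ∀ᶠ y in 𝓝 z.2, p (z.1, y) :=
  (show Tendsto (fun y : ℝ => ((z.1, y) : ℝ × ℝ)) (𝓝 z.2) (𝓝 z) from
    (Continuous.prodMk_right z.1).tendsto z.2).eventually h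

theorem eventually_slice_fst {p : ℝ × ℝ → Prop} (h : ∀ᶠ y in 𝓝 z, p y) :
    ∀ᶠ s in 𝓝 z.1, p (s, z.2) :=
  (show Tendsto (fun s : ℝ => ((s, z.2) : ℝ × ℝ)) (𝓝 z.1) (𝓝 z) from
    (Continuous.prodMk_left z.2).tendsto z.1).eventually h

theorem Dx_congr (h : u =ᶠ[𝓝 z] v) : Dx u z = Dx v z :=
  Filter.EventuallyEq.deriv_eq (eventually_slice_snd h)

theorem Dt_congr (h : u =ᶠ[𝓝 z] v) : Dt u z = Dt v z :=
  Filter.EventuallyEq.deriv_eq (eventually_slice_fst h)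

theorem Dx_eventuallyEq (h : u =ᶠ[𝓝 z] v) : Dx u =ᶠ[𝓝 z] Dx v := by
  filter_upwards [h.eventuallyEq_nhds] with y hy
  exact Dx_congr hy

theorem heatOp_congr (h : u =ᶠ[𝓝 z] v) : heatOp u z = heatOp v z := by
  rw [heatOp, heatOp, Dt_congr h, Dx_congr (Dx_eventuallyEq h)]

theorem Dx_zero : Dx 0 = 0 := by funext z; simp [Dx]

theorem Dt_zero : Dt 0 = 0 := by funext z; simp [Dt]

theorem tsupport_Dx_subset (u : ℝ × ℝ → ℝ) : tsupport (Dx u) ⊆ tsupport u := by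
  refine closure_minimal (fun z hz => ?_) (isClosed_tsupport u)
  by_contra h
  rw [notMem_tsupport_iff_eventuallyEq] at h
  exact hz (by rw [Dx_congr h, Dx_zero]; rfl)

theorem tsupport_Dt_subset (u : ℝ × ℝ → ℝ) : tsupport (Dt u) ⊆ tsupport u := by
  refine closure_minimal (fun z hz => ?_) (isClosed_tsupport u)
  by_contra h
  rw [notMem_tsupport_iff_eventuallyEq] at h
  exact hz (by rw [Dt_congr h, Dt_zero]; rfl)

theorem tsupport_heatOp_subset (u : ℝ × ℝ → ℝ) : tsupport (heatOp u) ⊆ tsupport u := by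
  refine closure_minimal (fun z hz => ?_) (isClosed_tsupport u)
  by_contra h
  rw [notMem_tsupport_iff_eventuallyEq] at h
  refine hz ?_
  rw [heatOp_congr h, heatOp, Dt_zero, Dx_zero, Dx_zero]; simp

theorem hasCompactSupport_Dx (h : HasCompactSupport u) : HasCompactSupport (Dx u) :=
  h.of_isClosed_subset (isClosed_tsupport _) (tsupport_Dx_subset u)

theorem hasCompactSupport_Dt (h : HasCompactSupport u) : HasCompactSupport (Dt u) :=
  h.of_isClosed_subset (isClosed_tsupport _) (tsupport_Dt_subset u)

theorem hasCompactSupport_heatOp (h : HasCompactSupport u) : HasCompactSupport (heatOp u) :=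
  h.of_isClosed_subset (isClosed_tsupport _) (tsupport_heatOp_subset u)

theorem Dx_Dt_comm (h : ContDiffAt ℝ 2 u z) : Dx (Dt u) z = Dt (Dx u) z := by
  have h1 : ContDiffAt ℝ 1 u z := h.of_le (by norm_num)
  have hd : DifferentiableAt ℝ (fderiv ℝ u) z :=
    (h.fderiv_right (m := 1) (by norm_num)).differentiableAt (by simp)
  have ev : ∀ᶠ y in 𝓝 z, DifferentiableAt ℝ u y := by
    filter_upwards [h1.eventually (by simp)] with y hy
    exact hy.differentiableAt (by simp)
  have e1 : Dt u =ᶠ[𝓝 z] fun y => fderiv ℝ u y (1, 0) := by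
    filter_upwards [ev] with y hy using Dt_eq_fderiv hy
  have e2 : Dx u =ᶠ[𝓝 z] fun y => fderiv ℝ u y (0, 1) := by
    filter_upwards [ev] with y hy using Dx_eq_fderiv hy
  have hdd : ∀ w : ℝ × ℝ, HasFDerivAt (fun y => fderiv ℝ u y w)
      ((fderiv ℝ (fderiv ℝ u) z).flip w) z := fun w => by
    have := hd.hasFDerivAt.clm_apply (hasFDerivAt_const w z)
    refine this.congr_fderiv ?_
    ext <;> simp
  rw [Dx_congr e1, Dt_congr e2, Dx_eq_fderiv (hdd _).differentiableAt,
    Dt_eq_fderiv (hdd _).differentiableAt, (hdd _).fderiv, (hdd _).fderiv]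
  exact (h.isSymmSndFDerivAt (by simp)).eq _ _

theorem Dx_heatOp (h : ContDiffAt ℝ 3 u z) : Dx (heatOp u) z = heatOp (Dx u) z := by
  have h2 : DifferentiableAt ℝ (Dt u) z :=
    (contDiffAt_Dt (m := 2) h (by norm_num)).differentiableAt (by simp)
  have h3 : DifferentiableAt ℝ (Dx (Dx u)) z :=
    (contDiffAt_Dx (m := 1) (contDiffAt_Dx (m := 2) h (by norm_num)) (by norm_num)).differentiableAt
      (by simp)
  rw [heatOp, ← Dx_Dt_comm (h.of_le (by norm_num))]
  exact ((hasDerivAt_Dx h2).sub ((hasDerivAt_Dx h3).const_mul (1 / 2))).deriv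

theorem Dx_mul (hu : DifferentiableAt ℝ u z) (hv : DifferentiableAt ℝ v z) :
    Dx (fun y => u y * v y) z = Dx u z * v z + u z * Dx v z :=
  ((hasDerivAt_Dx hu).mul (hasDerivAt_Dx hv)).deriv

theorem Dt_mul (hu : DifferentiableAt ℝ u z) (hv : DifferentiableAt ℝ v z) :
    Dt (fun y => u y * v y) z = Dt u z * v z + u z * Dt v z :=
  ((hasDerivAt_Dt hu).mul (hasDerivAt_Dt hv)).deriv

/-- The product rule for the heat operator, with the first order term in divergence form. -/
theorem heatOp_mul (hu : ContDiffAt ℝ ∞ u z) (hv : ContDiffAt ℝ ∞ v z) :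
    heatOp (fun y => u y * v y) z = u z * heatOp v z + (Dt u z + 1 / 2 * Dx (Dx u) z) * v z -
      Dx (fun y => Dx u y * v y) z := by
  have du : ∀ᶠ y in 𝓝 z, DifferentiableAt ℝ u y := by
    filter_upwards [(hu.of_le (m := 1) (by exact_mod_cast le_top)).eventually (by simp)] with y hy
    exact hy.differentiableAt (by simp)
  have dv : ∀ᶠ y in 𝓝 z, DifferentiableAt ℝ v y := by
    filter_upwards [(hv.of_le (m := 1) (by exact_mod_cast le_top)).eventually (by simp)] with y hy
    exact hy.differentiableAt (by simp)
  have hxu := (contDiffAt_Dx_infty hu).differentiableAt (by simp)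
  have hxv := (contDiffAt_Dx_infty hv).differentiableAt (by simp)
  have e1 : Dx (fun y => u y * v y) =ᶠ[𝓝 z] fun y => Dx u y * v y + u y * Dx v y := by
    filter_upwards [du, dv] with y h1 h2 using Dx_mul h1 h2
  have h1 : Dx (fun y => Dx u y * v y + u y * Dx v y) z =
      (Dx (Dx u) z * v z + Dx u z * Dx v z) + (Dx u z * Dx v z + u z * Dx (Dx v) z) :=
    (((hasDerivAt_Dx hxu).mul (hasDerivAt_Dx dv.self_of_nhds)).add
      ((hasDerivAt_Dx du.self_of_nhds).mul (hasDerivAt_Dx hxv))).deriv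
  rw [heatOp, Dx_congr e1, h1, Dt_mul du.self_of_nhds dv.self_of_nhds,
    Dx_mul hxu dv.self_of_nhds, heatOp]
  ring

end

/-! ### Derivatives of the heat kernel -/

/-- The space derivative of the heat kernel. -/
def hkx (t x : ℝ) : ℝ := -(x / t) * hk t x

/-- The second space derivative of the heat kernel. -/
def hkxx (t x : ℝ) : ℝ := (x ^ 2 / t ^ 2 - 1 / t) * hk t x

theorem hkx_of_nonpos {t : ℝ} (ht : t ≤ 0) (x : ℝ) : hkx t x = 0 := by
  rw [hkx, hk_of_nonpos ht, mul_zero]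

theorem hasDerivAt_hk (t x : ℝ) : HasDerivAt (hk t) (hkx t x) x := by
  rcases le_or_gt t 0 with ht | ht
  · have : hk t = fun _ => 0 := funext fun x => hk_of_nonpos ht x
    rw [this, hkx_of_nonpos ht]; exact hasDerivAt_const _ _
  · have h1 : hk t = fun x => (Real.sqrt (2 * Real.pi * t))⁻¹ * Real.exp (-(x ^ 2) / (2 * t)) :=
      funext fun x => hk_of_pos ht x
    rw [hkx, h1]
    have h2 : HasDerivAt (fun x : ℝ => -(x ^ 2) / (2 * t)) (-(2 * x) / (2 * t)) x := by
      have := ((hasDerivAt_pow 2 x).neg).div_const (2 * t)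
      exact this.congr_deriv (by ring)
    refine (h2.exp.const_mul _).congr_deriv ?_
    field_simp

theorem hasDerivAt_hkx (t x : ℝ) : HasDerivAt (hkx t) (hkxx t x) x := by
  have h1 : HasDerivAt (fun x : ℝ => -(x / t)) (-(1 / t)) x := ((hasDerivAt_id x).div_const t).neg
  refine (h1.mul (hasDerivAt_hk t x)).congr_deriv ?_
  rw [hkxx, hkx]
  ring

theorem continuous_hk (t : ℝ) : Continuous (hk t) :=
  continuous_iff_continuousAt.2 fun x => (hasDerivAt_hk t x).continuousAt

theorem continuous_hkx (t : ℝ) : Continuous (hkx t) :=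
  continuous_iff_continuousAt.2 fun x => (hasDerivAt_hkx t x).continuousAt

theorem continuous_hkxx (t : ℝ) : Continuous (hkxx t) := by
  have := continuous_hk t
  unfold hkxx; fun_prop

theorem measurable_hkx : Measurable (fun z : ℝ × ℝ => hkx z.1 z.2) := by
  unfold hkx
  exact ((measurable_snd.div measurable_fst).neg).mul measurable_hk

theorem abs_hkx_le {t : ℝ} (ht : 0 < t) (x : ℝ) :
    |hkx t x| ≤ Real.sqrt 2 / Real.sqrt t * hk (2 * t) x := by
  have hst : 0 < Real.sqrt t := Real.sqrt_pos.2 ht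
  rw [hkx, abs_mul, abs_of_nonneg (hk_nonneg t x), abs_neg, abs_div, abs_of_pos ht,
    hk_of_pos ht, hk_of_pos (by positivity)]
  have h1 : |x| / Real.sqrt t * Real.exp (-(x ^ 2) / (2 * t)) ≤
      Real.exp (-(x ^ 2) / (2 * (2 * t))) := by
    have e1 : Real.exp (-(x ^ 2) / (2 * t)) =
        Real.exp (-(x ^ 2) / (2 * (2 * t))) * Real.exp (-(x ^ 2) / (2 * (2 * t))) := by
      rw [← Real.exp_add]; congr 1; field_simp; ring
    have e2 : |x| / Real.sqrt t * Real.exp (-(x ^ 2) / (2 * (2 * t))) ≤ 1 := by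
      rw [neg_div, Real.exp_neg, ← div_eq_mul_inv, div_le_one (Real.exp_pos _)]
      have e3 : x ^ 2 / (2 * (2 * t)) = (|x| / Real.sqrt t) ^ 2 / 4 := by
        rw [div_pow, sq_abs, Real.sq_sqrt ht.le]; field_simp; norm_num
      rw [e3]
      nlinarith [Real.add_one_le_exp ((|x| / Real.sqrt t) ^ 2 / 4),
        sq_nonneg (|x| / Real.sqrt t / 2 - 1)]
    calc _ = (|x| / Real.sqrt t * Real.exp (-(x ^ 2) / (2 * (2 * t)))) *
          Real.exp (-(x ^ 2) / (2 * (2 * t))) := by rw [e1]; ring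
      _ ≤ 1 * Real.exp (-(x ^ 2) / (2 * (2 * t))) := by gcongr
      _ = _ := one_mul _
  have h2 : Real.sqrt (2 * Real.pi * (2 * t)) = Real.sqrt 2 * Real.sqrt (2 * Real.pi * t) := by
    rw [← Real.sqrt_mul (by norm_num)]; congr 1; ring
  have h3 : |x| / t = |x| / Real.sqrt t / Real.sqrt t := by
    rw [div_div, Real.mul_self_sqrt ht.le]
  rw [h2, h3]
  have hs2 : Real.sqrt 2 ≠ 0 := (Real.sqrt_pos.2 (by norm_num)).ne'
  calc _ = (Real.sqrt (2 * Real.pi * t))⁻¹ / Real.sqrt t *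
        (|x| / Real.sqrt t * Real.exp (-(x ^ 2) / (2 * t))) := by ring
    _ ≤ (Real.sqrt (2 * Real.pi * t))⁻¹ / Real.sqrt t *
        Real.exp (-(x ^ 2) / (2 * (2 * t))) := by gcongr
    _ = _ := by field_simp

/-- The second space derivative of the heat kernel is bounded away from the origin. -/
theorem abs_hkxx_le {ρ : ℝ} (hρ : 0 < ρ) :
    ∃ K, 0 ≤ K ∧ ∀ t x, 0 < t → (ρ ≤ t ∨ ρ ≤ |x|) → |hkxx t x| ≤ K := by
  set c := (ρ ^ 2)⁻¹ with hc
  have hcpos : 0 < c := by positivity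
  set K₁ := 3 / ρ * (1 + 1 / ρ) with hK₁
  set K₂ := 8 * c + 48 * c ^ 2 + 2 * c + 8 * c ^ 2 with hK₂
  refine ⟨K₁ + K₂, by positivity, fun t x ht h => ?_⟩
  set u := x ^ 2 / (2 * t) with hu
  have hu0 : 0 ≤ u := by positivity
  have hs : (Real.sqrt (2 * Real.pi * t))⁻¹ ≤ 1 + 1 / t := by
    have h1 : Real.sqrt t ≤ Real.sqrt (2 * Real.pi * t) := by
      apply Real.sqrt_le_sqrt; nlinarith [Real.pi_gt_three]
    have h2 : 0 < Real.sqrt t := Real.sqrt_pos.2 ht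
    have h3 : (Real.sqrt t)⁻¹ ≤ 1 + 1 / t := by
      have h4 : 1 / t = (Real.sqrt t)⁻¹ ^ 2 := by
        rw [inv_pow, Real.sq_sqrt ht.le, one_div]
      rw [h4]
      nlinarith [sq_nonneg ((Real.sqrt t)⁻¹ - 1), sq_nonneg ((Real.sqrt t)⁻¹)]
    exact (inv_anti₀ h2 h1).trans h3
  have hexp : Real.exp (-(x ^ 2) / (2 * t)) = Real.exp (-u) := by rw [neg_div]
  have h0 : |hkxx t x| ≤ (2 * u + 1) / t * ((1 + 1 / t) * Real.exp (-u)) := by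
    rw [hkxx, abs_mul, abs_of_nonneg (hk_nonneg t x), hk_of_pos ht, hexp]
    have h1 : |x ^ 2 / t ^ 2 - 1 / t| ≤ (2 * u + 1) / t := by
      have e : x ^ 2 / t ^ 2 = 2 * u / t := by rw [hu]; field_simp
      rw [e, add_div, abs_le]
      have := div_nonneg (mul_nonneg zero_le_two hu0) ht.le
      have := one_div_pos.2 ht
      constructor <;> linarith
    gcongr
  -- powers are absorbed by the exponential
  have p1 : u * Real.exp (-u) ≤ 1 := by
    rw [Real.exp_neg, ← div_eq_mul_inv, div_le_one (Real.exp_pos _)]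
    linarith [Real.add_one_le_exp u]
  have p2 : u ^ 2 * Real.exp (-u) ≤ 2 := by
    have := Real.pow_div_factorial_le_exp u hu0 2
    rw [Real.exp_neg, ← div_eq_mul_inv, div_le_iff₀ (Real.exp_pos _)]
    norm_num [Nat.factorial] at this; linarith
  have p3 : u ^ 3 * Real.exp (-u) ≤ 6 := by
    have := Real.pow_div_factorial_le_exp u hu0 3
    rw [Real.exp_neg, ← div_eq_mul_inv, div_le_iff₀ (Real.exp_pos _)]
    norm_num [Nat.factorial] at this; linarith
  have p0 : Real.exp (-u) ≤ 1 := Real.exp_le_one_iff.2 (by linarith)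
  have hK1 : 0 ≤ K₁ := by positivity
  have hK2 : 0 ≤ K₂ := by positivity
  refine h0.trans ?_
  rcases h with h | h
  · have hle : (1 + 1 / t) ≤ 1 + 1 / ρ := by gcongr
    have h1 : (2 * u + 1) / t * ((1 + 1 / t) * Real.exp (-u)) =
        (2 * (u * Real.exp (-u)) + Real.exp (-u)) / t * (1 + 1 / t) := by ring
    rw [h1]
    calc _ ≤ (2 * 1 + 1) / ρ * (1 + 1 / ρ) := by gcongr
      _ = K₁ := by rw [hK₁]; norm_num
      _ ≤ _ := by linarith
  · have hx2 : ρ ^ 2 ≤ x ^ 2 := by rw [← sq_abs x]; gcongr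
    have h1t : 1 / t ≤ 2 * c * u := by
      rw [hc, hu, div_le_iff₀ ht]
      have : 2 * (ρ ^ 2)⁻¹ * (x ^ 2 / (2 * t)) * t = (ρ ^ 2)⁻¹ * x ^ 2 := by field_simp
      rw [this, inv_mul_eq_div, one_le_div (by positivity)]; exact hx2
    calc (2 * u + 1) / t * ((1 + 1 / t) * Real.exp (-u))
        = (2 * u + 1) * (1 / t) * ((1 + 1 / t) * Real.exp (-u)) := by ring
      _ ≤ (2 * u + 1) * (2 * c * u) * ((1 + 2 * c * u) * Real.exp (-u)) := by gcongr
      _ = 4 * c * (u ^ 2 * Real.exp (-u)) + 8 * c ^ 2 * (u ^ 3 * Real.exp (-u)) +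
          2 * c * (u * Real.exp (-u)) + 4 * c ^ 2 * (u ^ 2 * Real.exp (-u)) := by ring
      _ ≤ 4 * c * 2 + 8 * c ^ 2 * 6 + 2 * c * 1 + 4 * c ^ 2 * 2 := by gcongr
      _ = K₂ := by rw [hK₂]; ring
      _ ≤ _ := by linarith

/-! ### Heat potentials of bounded sources -/

/-- A kernel that vanishes for nonpositive times and is integrable over short times. -/
structure ShortKernel (κ : ℝ × ℝ → ℝ) : Prop where
  measurable : Measurable κ
  zero : ∀ z, z.1 ≤ 0 → κ z = 0
  integrable : ∀ M : ℝ, Integrable ({z : ℝ × ℝ | z.1 < M}.indicator κ)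

/-- A kernel is short as soon as the `L¹` norms of its time slices are integrable over short times.
-/
theorem shortKernel_of_slices {κ : ℝ × ℝ → ℝ} (hm : Measurable κ) (h0 : ∀ z, z.1 ≤ 0 → κ z = 0)
    {c : ℝ → ℝ} (hc : ∀ M, IntegrableOn c (Ioo 0 M))
    (hi : ∀ t, 0 < t → Integrable fun x => κ (t, x))
    (hle : ∀ t, 0 < t → ∫ x, ‖κ (t, x)‖ ≤ c t) : ShortKernel κ := by
  refine ⟨hm, h0, fun M => ?_⟩
  have hS : MeasurableSet {z : ℝ × ℝ | z.1 < M} := measurableSet_lt measurable_fst measurable_const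
  have hm' := (hm.indicator hS).aestronglyMeasurable (μ := (volume : Measure ℝ).prod volume)
  rw [Measure.volume_eq_prod, integrable_prod_iff hm']
  have hcase : ∀ t, (t ∈ Ioo 0 M ∧ ∀ x, {z : ℝ × ℝ | z.1 < M}.indicator κ (t, x) = κ (t, x)) ∨
      (t ∉ Ioo 0 M ∧ ∀ x, {z : ℝ × ℝ | z.1 < M}.indicator κ (t, x) = 0) := fun t => by
    by_cases ht : t ∈ Ioo 0 M
    · exact Or.inl ⟨ht, fun x => indicator_of_mem (show (t, x) ∈ {z : ℝ × ℝ | z.1 < M} from ht.2) _⟩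
    · refine Or.inr ⟨ht, fun x => ?_⟩
      by_cases h2 : t < M
      · rw [indicator_of_mem (show (t, x) ∈ {z : ℝ × ℝ | z.1 < M} from h2)]
        exact h0 _ (not_lt.1 fun h => ht ⟨h, h2⟩)
      · exact indicator_of_notMem (show (t, x) ∉ {z : ℝ × ℝ | z.1 < M} from h2) _
  constructor
  · refine ae_of_all _ fun t => ?_
    rcases hcase t with ⟨h1, h2⟩ | ⟨h1, h2⟩
    · simp_rw [h2]; exact hi t h1.1
    · simp_rw [h2]; exact integrable_zero _ _ _
  · refine ((hc M).integrable_indicator measurableSet_Ioo).mono' hm'.norm.integral_prod_right'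
      (ae_of_all _ fun t => ?_)
    rw [Real.norm_of_nonneg (integral_nonneg fun _ => norm_nonneg _)]
    rcases hcase t with ⟨h1, h2⟩ | ⟨h1, h2⟩
    · simp_rw [h2]; rw [indicator_of_mem h1]; exact hle t h1.1
    · simp_rw [h2]; rw [indicator_of_notMem h1]; simp

theorem shortKernel_hk : ShortKernel fun z => hk z.1 z.2 := by
  refine shortKernel_of_slices (c := fun _ => 1) measurable_hk (fun z hz => hk_of_nonpos hz _)
    (fun M => by simp) (fun t _ => integrable_hk t) fun t ht => ?_
  simp_rw [Real.norm_of_nonneg (hk_nonneg _ _)]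
  exact (integral_hk ht).le

theorem integrable_hkx {t : ℝ} (ht : 0 < t) : Integrable (hkx t) :=
  ((integrable_hk (2 * t)).const_mul (Real.sqrt 2 / Real.sqrt t)).mono'
    (continuous_hkx t).aestronglyMeasurable (ae_of_all _ fun x => abs_hkx_le ht x)

theorem shortKernel_hkx : ShortKernel fun z => hkx z.1 z.2 := by
  refine shortKernel_of_slices (c := fun t => Real.sqrt 2 * t ^ (-(1 / 2) : ℝ)) measurable_hkx
    (fun z hz => hkx_of_nonpos hz _) (fun M => ?_) (fun t ht => integrable_hkx ht) fun t ht => ?_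
  · refine Integrable.const_mul ?_ _
    rcases le_or_gt M 0 with hM | hM
    · simp [Ioo_eq_empty (not_lt.2 hM)]
    · have := (intervalIntegral.intervalIntegrable_rpow' (a := 0) (b := M) (r := -(1 / 2))
        (by norm_num)).1
      exact this.mono_set Ioo_subset_Ioc_self
  · calc ∫ x, ‖hkx t x‖ ≤ ∫ x, Real.sqrt 2 / Real.sqrt t * hk (2 * t) x :=
          integral_mono (integrable_hkx ht).norm ((integrable_hk (2 * t)).const_mul _)
            fun x => abs_hkx_le ht x
      _ = _ := by
        rw [integral_const_mul, integral_hk (by positivity), mul_one, Real.rpow_neg ht.le,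
          ← Real.sqrt_eq_rpow, div_eq_mul_inv]

section

variable {κ F : ℝ × ℝ → ℝ} {C M : ℝ} {a : ℝ × ℝ}

theorem ShortKernel.integrable_mul (hκ : ShortKernel κ) (hF : AEStronglyMeasurable F volume)
    (hC : ∀ z : ℝ × ℝ, z.1 < a.1 → |F z| ≤ C) (hM : ∀ z : ℝ × ℝ, z.1 ≤ a.1 - M → F z = 0) :
    Integrable (fun z => κ (a - z) * F z) ∧ ∫ z, ‖κ (a - z) * F z‖ ≤
      C * ∫ z, ‖{z : ℝ × ℝ | z.1 < M}.indicator κ z‖ := by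
  have h1 : Integrable fun z => ‖{z : ℝ × ℝ | z.1 < M}.indicator κ (a - z)‖ * C :=
    ((hκ.integrable M).comp_sub_left a).norm.mul_const C
  have hle : ∀ z, ‖κ (a - z) * F z‖ ≤ ‖{z : ℝ × ℝ | z.1 < M}.indicator κ (a - z)‖ * C := fun z => by
    rw [norm_mul]
    by_cases h2 : a.1 ≤ z.1
    · have h0 : κ (a - z) = 0 := hκ.zero _ (sub_nonpos.2 h2)
      have : {z : ℝ × ℝ | z.1 < M}.indicator κ (a - z) = 0 := by
        by_cases hm : a - z ∈ {z : ℝ × ℝ | z.1 < M}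
        · rw [indicator_of_mem hm, h0]
        · exact indicator_of_notMem hm _
      simp [h0, this]
    · have h4 : 0 ≤ C := (abs_nonneg _).trans (hC z (not_le.1 h2))
      by_cases h3 : z.1 ≤ a.1 - M
      · rw [hM z h3, norm_zero, mul_zero]; positivity
      · have : a - z ∈ {z : ℝ × ℝ | z.1 < M} := by
          change a.1 - z.1 < M; linarith
        rw [indicator_of_mem this]
        gcongr
        exact hC z (not_le.1 h2)
  have hint : Integrable (fun z => κ (a - z) * F z) :=
    h1.mono' ((hκ.measurable.comp (measurable_const.sub measurable_id)).aestronglyMeasurable.mul hF)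
      (ae_of_all _ hle)
  refine ⟨hint, (integral_mono hint.norm h1 hle).trans (le_of_eq ?_)⟩
  rw [integral_mul_const, mul_comm]
  congr 1
  exact integral_sub_left_eq_self (fun z => ‖{z : ℝ × ℝ | z.1 < M}.indicator κ z‖) volume a

theorem exists_bounds_of_compact (hF : Continuous F) (hc : HasCompactSupport F) (a : ℝ × ℝ) :
    ∃ C M, 0 ≤ C ∧ 0 < M ∧ (∀ z, |F z| ≤ C) ∧ ∀ z : ℝ × ℝ, M ≤ |z.1 - a.1| → F z = 0 := by
  obtain ⟨C, hC⟩ := hc.exists_bound_of_continuous hF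
  obtain ⟨M, hM⟩ := (hc.isCompact.image (f := fun z : ℝ × ℝ => |z.1 - a.1|)
    (by fun_prop)).bddAbove
  refine ⟨C, max (M + 1) 1, (norm_nonneg _).trans (hC a), by positivity, hC, fun z hz => ?_⟩
  by_contra h
  have h1 : |z.1 - a.1| ≤ M := hM ⟨z, subset_tsupport _ h, rfl⟩
  linarith [le_max_left (M + 1) 1]

theorem ShortKernel.integrable_mul_of_compact (hκ : ShortKernel κ) (hF : Continuous F)
    (hc : HasCompactSupport F) (a : ℝ × ℝ) : Integrable fun z => κ (a - z) * F z := by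
  obtain ⟨C, M, -, hM, hC, hz⟩ := exists_bounds_of_compact hF hc a
  refine (hκ.integrable_mul (C := C) (M := M) hF.aestronglyMeasurable (fun z _ => hC z) fun z h => ?_).1
  exact hz z (by rw [abs_sub_comm]; exact le_trans (by linarith) (le_abs_self _))

end

theorem integral_slice_by_parts {f f' φ φ' : ℝ → ℝ} (hf : ∀ y, HasDerivAt f (f' y) y)
    (hf' : Continuous f') (hφ : ∀ y, HasDerivAt φ (φ' y) y) (hφ' : Continuous φ')
    (hc : HasCompactSupport φ) : ∫ y, f y * φ' y = -∫ y, f' y * φ y := by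
  have cf : Continuous f := continuous_iff_continuousAt.2 fun x => (hf x).continuousAt
  have cφ : Continuous φ := continuous_iff_continuousAt.2 fun x => (hφ x).continuousAt
  have hd : deriv φ = φ' := funext fun y => (hφ y).deriv
  have hc' : HasCompactSupport φ' := hd ▸ hc.deriv
  exact integral_mul_deriv_eq_deriv_mul_of_integrable (fun y _ => hf y) (fun y _ => hφ y)
    ((cf.mul hφ').integrable_of_hasCompactSupport hc'.mul_left)
    ((hf'.mul cφ).integrable_of_hasCompactSupport hc.mul_left)
    ((cf.mul cφ).integrable_of_hasCompactSupport hc.mul_left)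

theorem hasCompactSupport_slice {u : ℝ × ℝ → ℝ} (hc : HasCompactSupport u) (s : ℝ) :
    HasCompactSupport fun y => u (s, y) := by
  refine HasCompactSupport.intro (hc.isCompact.image continuous_snd) fun y hy => ?_
  by_contra h
  exact hy ⟨(s, y), subset_tsupport _ h, rfl⟩

section

variable {u : ℝ × ℝ → ℝ}

theorem slice_by_parts_hk (hu : ContDiff ℝ ∞ u) (hc : HasCompactSupport u) (a : ℝ × ℝ) (s : ℝ) :
    ∫ y, hk (a.1 - s) (a.2 - y) * Dx u (s, y) = ∫ y, hkx (a.1 - s) (a.2 - y) * u (s, y) := by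
  have h1 : ∀ y, HasDerivAt (fun y => hk (a.1 - s) (a.2 - y)) (-hkx (a.1 - s) (a.2 - y)) y :=
    fun y => by
      have := (hasDerivAt_hk (a.1 - s) (a.2 - y)).comp y ((hasDerivAt_id y).const_sub a.2)
      exact this.congr_deriv (by ring)
  rw [integral_slice_by_parts h1 ((continuous_hkx _).comp (by fun_prop)).neg
    (φ := fun y => u (s, y))
    (fun y => hasDerivAt_Dx (z := (s, y)) (hu.differentiable (by simp) _))
    ((contDiff_Dx hu).continuous.comp (by fun_prop)) (hasCompactSupport_slice hc s)]
  simp [integral_neg]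

theorem slice_by_parts_hkx (hu : ContDiff ℝ ∞ u) (hc : HasCompactSupport u) (a : ℝ × ℝ) (s : ℝ) :
    ∫ y, hkx (a.1 - s) (a.2 - y) * Dx u (s, y) = ∫ y, hkxx (a.1 - s) (a.2 - y) * u (s, y) := by
  have h1 : ∀ y, HasDerivAt (fun y => hkx (a.1 - s) (a.2 - y)) (-hkxx (a.1 - s) (a.2 - y)) y :=
    fun y => by
      have := (hasDerivAt_hkx (a.1 - s) (a.2 - y)).comp y ((hasDerivAt_id y).const_sub a.2)
      exact this.congr_deriv (by ring)
  rw [integral_slice_by_parts h1 ((continuous_hkxx _).comp (by fun_prop)).neg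
    (φ := fun y => u (s, y))
    (fun y => hasDerivAt_Dx (z := (s, y)) (hu.differentiable (by simp) _))
    ((contDiff_Dx hu).continuous.comp (by fun_prop)) (hasCompactSupport_slice hc s)]
  simp [integral_neg]

theorem integral_hk_mul_Dx (hu : ContDiff ℝ ∞ u) (hc : HasCompactSupport u) (a : ℝ × ℝ) :
    ∫ z : ℝ × ℝ, hk (a.1 - z.1) (a.2 - z.2) * Dx u z =
      ∫ z : ℝ × ℝ, hkx (a.1 - z.1) (a.2 - z.2) * u z := by
  have h1 := shortKernel_hk.integrable_mul_of_compact (contDiff_Dx hu).continuous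
    (hasCompactSupport_Dx hc) a
  have h2 := shortKernel_hkx.integrable_mul_of_compact hu.continuous hc a
  rw [Measure.volume_eq_prod, integral_prod _ (by exact h1), integral_prod _ (by exact h2)]
  exact integral_congr_ae (ae_of_all _ fun s => slice_by_parts_hk hu hc a s)

end

/-! ### The fundamental solution of the heat operator -/

/-- The heat average of `F` over the time `τ` in the past of `a`, with the Gaussian normalized to
unit variance. -/
def heatAvg (F : ℝ × ℝ → ℝ) (a : ℝ × ℝ) (τ : ℝ) : ℝ :=
  ∫ v, hk 1 v * F (a.1 - τ, a.2 - Real.sqrt τ * v)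

section

variable {u F : ℝ × ℝ → ℝ}

theorem continuous_heatAvg (hF : Continuous F) (hc : HasCompactSupport F) (a : ℝ × ℝ) :
    Continuous (heatAvg F a) := by
  obtain ⟨C, M, -, -, hC, -⟩ := exists_bounds_of_compact hF hc a
  refine continuous_of_dominated (bound := fun v => hk 1 v * C) (fun τ => ?_) (fun τ => ?_)
    ((integrable_hk 1).mul_const C) (ae_of_all _ fun v => ?_)
  · have := continuous_hk 1
    exact Continuous.aestronglyMeasurable (by fun_prop)
  · refine ae_of_all _ fun v => ?_
    rw [norm_mul, Real.norm_of_nonneg (hk_nonneg _ _)]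
    exact mul_le_mul_of_nonneg_left (hC _) (hk_nonneg _ _)
  · have := Real.continuous_sqrt
    fun_prop

theorem heatAvg_zero (F : ℝ × ℝ → ℝ) (a : ℝ × ℝ) : heatAvg F a 0 = F a := by
  simp only [heatAvg, Real.sqrt_zero, zero_mul, sub_zero]
  rw [integral_mul_const, integral_hk one_pos, one_mul]

theorem heatAvg_eq {τ : ℝ} (hτ : 0 < τ) (F : ℝ × ℝ → ℝ) (a : ℝ × ℝ) :
    heatAvg F a τ = ∫ y, hk τ (a.2 - y) * F (a.1 - τ, y) := by
  have hs : 0 < Real.sqrt τ := Real.sqrt_pos.2 hτ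
  have h1 : ∀ v, hk 1 v = Real.sqrt τ * hk τ (Real.sqrt τ * v) := fun v => by
    rw [hk_of_pos one_pos, hk_of_pos hτ, mul_pow, Real.sq_sqrt hτ.le, mul_one,
      Real.sqrt_mul (by positivity) τ, ← mul_assoc, mul_inv, mul_left_comm, mul_inv_cancel₀ hs.ne',
      mul_one]
    congr 2
    rw [mul_one]
    field_simp
  have h2 := Measure.integral_comp_mul_left
    (fun v => hk τ v * F (a.1 - τ, a.2 - v)) (Real.sqrt τ)
  rw [smul_eq_mul, abs_of_pos (inv_pos.2 hs)] at h2
  simp only [heatAvg, h1, mul_assoc]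
  rw [integral_const_mul, h2, ← mul_assoc, mul_inv_cancel₀ hs.ne', one_mul,
    ← integral_sub_left_eq_self _ volume a.2]
  simp

/-- The averages of a test function change with the time lag by the averages of its image under the
heat operator. The derivative falls on `√τ v`; one factor `v` of the Gaussian is traded for a second
space derivative by an integration by parts. -/
theorem hasDerivAt_heatAvg (hu : ContDiff ℝ ∞ u) (hc : HasCompactSupport u) (a : ℝ × ℝ) {τ : ℝ}
    (hτ : 0 < τ) : HasDerivAt (heatAvg u a) (-heatAvg (heatOp u) a τ) τ := by
  have hDt := contDiff_Dt hu
  have hDx := contDiff_Dx hu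
  have hcDt := hasCompactSupport_Dt hc
  have hcDx := hasCompactSupport_Dx hc
  obtain ⟨C₁, -, -, -, hC₁, -⟩ := exists_bounds_of_compact hDt.continuous hcDt a
  obtain ⟨C₂, -, hC₂0, -, hC₂, -⟩ := exists_bounds_of_compact hDx.continuous hcDx a
  have hC₁0 : 0 ≤ C₁ := (abs_nonneg _).trans (hC₁ a)
  have hk1 := continuous_hk 1
  have hsq := Real.continuous_sqrt
  have hcu := hu.continuous
  have hct := hDt.continuous
  have hcx := hDx.continuous
  have hcxx := (contDiff_Dx hDx).continuous
  set F' : ℝ → ℝ → ℝ := fun σ v => hk 1 v * (-Dt u (a.1 - σ, a.2 - Real.sqrt σ * v) -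
    v / (2 * Real.sqrt σ) * Dx u (a.1 - σ, a.2 - Real.sqrt σ * v)) with hF'
  have hderiv : ∀ v, ∀ σ ∈ Metric.ball τ (τ / 2), HasDerivAt
      (fun σ => hk 1 v * u (a.1 - σ, a.2 - Real.sqrt σ * v)) (F' σ v) σ := by
    intro v σ hσ
    rw [Metric.mem_ball, Real.dist_eq, abs_lt] at hσ
    have hσ0 : 0 < σ := by linarith
    have h1 : HasDerivAt (fun σ : ℝ => ((a.1 - σ, a.2 - Real.sqrt σ * v) : ℝ × ℝ))
        (-1, -(1 / (2 * Real.sqrt σ) * v)) σ :=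
      ((hasDerivAt_id σ).const_sub a.1).prodMk
        (((Real.hasDerivAt_sqrt hσ0.ne').mul_const v).const_sub a.2)
    have hd : DifferentiableAt ℝ u (a.1 - σ, a.2 - Real.sqrt σ * v) :=
      hu.differentiable (by simp) _
    have h2 := hd.hasFDerivAt.comp_hasDerivAt σ h1
    refine (h2.const_mul (hk 1 v)).congr_deriv ?_
    rw [hF']
    simp only
    rw [Dt_eq_fderiv hd, Dx_eq_fderiv hd]
    have e : ((-1, -(1 / (2 * Real.sqrt σ) * v)) : ℝ × ℝ) =
        (-1 : ℝ) • ((1, 0) : ℝ × ℝ) + (-(v / (2 * Real.sqrt σ))) • ((0, 1) : ℝ × ℝ) := by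
      ext <;> simp; ring
    rw [e, map_add, map_smul, map_smul, smul_eq_mul, smul_eq_mul]
    ring
  -- the first moment of the Gaussian
  have hmom : Integrable fun v => |v| * hk 1 v := by
    refine (integrable_hkx one_pos).norm.congr (ae_of_all _ fun v => ?_)
    simp [hkx, abs_of_nonneg (hk_nonneg _ _)]
  have hbi : Integrable fun v => hk 1 v * C₁ + |v| * hk 1 v * (C₂ / (2 * Real.sqrt (τ / 2))) :=
    ((integrable_hk 1).mul_const _).add (hmom.mul_const _)
  have hmeas : ∀ σ, AEStronglyMeasurable (fun v => hk 1 v * u (a.1 - σ, a.2 - Real.sqrt σ * v))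
      volume := fun σ => Continuous.aestronglyMeasurable (by fun_prop)
  have hFint : Integrable (fun v => hk 1 v * u (a.1 - τ, a.2 - Real.sqrt τ * v)) := by
    obtain ⟨C₀, -, -, -, hC₀, -⟩ := exists_bounds_of_compact hcu hc a
    refine ((integrable_hk 1).mul_const C₀).mono' (hmeas τ) (ae_of_all _ fun v => ?_)
    rw [norm_mul, Real.norm_of_nonneg (hk_nonneg _ _)]
    exact mul_le_mul_of_nonneg_left (hC₀ _) (hk_nonneg _ _)
  have hmain := (hasDerivAt_integral_of_dominated_loc_of_deriv_le
    (F := fun σ v => hk 1 v * u (a.1 - σ, a.2 - Real.sqrt σ * v)) (F' := F')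
    (bound := fun v => hk 1 v * C₁ + |v| * hk 1 v * (C₂ / (2 * Real.sqrt (τ / 2))))
    (Metric.ball_mem_nhds τ (half_pos hτ)) (Eventually.of_forall hmeas) hFint
    (Continuous.aestronglyMeasurable (by rw [hF']; fun_prop))
    (ae_of_all _ fun v σ hσ => ?_) hbi (ae_of_all _ hderiv))
  · refine hmain.2.congr_deriv ?_
    have hs : 0 < Real.sqrt τ := Real.sqrt_pos.2 hτ
    -- integrate by parts against the Gaussian
    have hparts : ∫ v, hk 1 v * (-Real.sqrt τ * Dx (Dx u) (a.1 - τ, a.2 - Real.sqrt τ * v)) =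
        -∫ v, hkx 1 v * Dx u (a.1 - τ, a.2 - Real.sqrt τ * v) := by
      refine integral_slice_by_parts (hasDerivAt_hk 1) (continuous_hkx 1)
        (φ := fun v => Dx u (a.1 - τ, a.2 - Real.sqrt τ * v)) (fun v => ?_) (by fun_prop) ?_
      · have h3 := hasDerivAt_Dx (z := (a.1 - τ, a.2 - Real.sqrt τ * v))
          (hDx.differentiable (by simp) _)
        have h4 : HasDerivAt (fun v : ℝ => a.2 - Real.sqrt τ * v) (-(Real.sqrt τ * 1)) v :=
          ((hasDerivAt_id v).const_mul _).const_sub _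
        exact (h3.comp v h4).congr_deriv (g' := -Real.sqrt τ *
          Dx (Dx u) (a.1 - τ, a.2 - Real.sqrt τ * v)) (by ring)
      · refine HasCompactSupport.intro (hcDx.isCompact.image
          (f := fun z : ℝ × ℝ => (a.2 - z.2) / Real.sqrt τ) (by fun_prop)) fun v hv => ?_
        by_contra h
        refine hv ⟨_, subset_tsupport _ h, ?_⟩
        simp only
        field_simp
        ring
    have bd : ∀ G : ℝ × ℝ → ℝ, Continuous G → HasCompactSupport G →
        Integrable fun v => hk 1 v * G (a.1 - τ, a.2 - Real.sqrt τ * v) := fun G hG hGc => by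
      obtain ⟨C₀, -, -, -, hC₀, -⟩ := exists_bounds_of_compact hG hGc a
      refine ((integrable_hk 1).mul_const C₀).mono' (Continuous.aestronglyMeasurable (by fun_prop))
        (ae_of_all _ fun v => ?_)
      rw [norm_mul, Real.norm_of_nonneg (hk_nonneg _ _)]
      exact mul_le_mul_of_nonneg_left (hC₀ _) (hk_nonneg _ _)
    have i1 := bd _ hct hcDt
    have i2 := bd _ hcxx (hasCompactSupport_Dx hcDx)
    have i3 : Integrable fun v => hkx 1 v * Dx u (a.1 - τ, a.2 - Real.sqrt τ * v) := by
      refine ((integrable_hkx one_pos).norm.mul_const C₂).mono'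
        (((continuous_hkx 1).mul (by fun_prop)).aestronglyMeasurable) (ae_of_all _ fun v => ?_)
      rw [norm_mul]
      exact mul_le_mul_of_nonneg_left (hC₂ _) (norm_nonneg _)
    have e1 : ∫ v, F' τ v = -(∫ v, hk 1 v * Dt u (a.1 - τ, a.2 - Real.sqrt τ * v)) +
        1 / (2 * Real.sqrt τ) * ∫ v, hkx 1 v * Dx u (a.1 - τ, a.2 - Real.sqrt τ * v) := by
      rw [← integral_neg, ← integral_const_mul, ← integral_add (by exact i1.neg) (i3.const_mul _)]
      refine integral_congr_ae (ae_of_all _ fun v => ?_)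
      simp only [hF', hkx]
      field_simp
      ring
    have e2 : ∫ v, hk 1 v * (-Real.sqrt τ * Dx (Dx u) (a.1 - τ, a.2 - Real.sqrt τ * v)) =
        -Real.sqrt τ * ∫ v, hk 1 v * Dx (Dx u) (a.1 - τ, a.2 - Real.sqrt τ * v) := by
      rw [← integral_const_mul]
      refine integral_congr_ae (ae_of_all _ fun v => ?_)
      simp only; ring
    have e3 : heatAvg (heatOp u) a τ = (∫ v, hk 1 v * Dt u (a.1 - τ, a.2 - Real.sqrt τ * v)) -
        1 / 2 * ∫ v, hk 1 v * Dx (Dx u) (a.1 - τ, a.2 - Real.sqrt τ * v) := by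
      rw [heatAvg, ← integral_const_mul, ← integral_sub i1 (i2.const_mul _)]
      refine integral_congr_ae (ae_of_all _ fun v => ?_)
      simp only [heatOp]; ring
    rw [e2] at hparts
    rw [e1, e3, ← neg_eq_iff_eq_neg.2 hparts]
    field_simp
    ring
  · rw [Metric.mem_ball, Real.dist_eq, abs_lt] at hσ
    have hσ0 : 0 < σ := by linarith
    have hs : 0 < Real.sqrt σ := Real.sqrt_pos.2 hσ0
    have hs2 : 0 < Real.sqrt (τ / 2) := Real.sqrt_pos.2 (half_pos hτ)
    have hs3 : Real.sqrt (τ / 2) ≤ Real.sqrt σ := Real.sqrt_le_sqrt (by linarith)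
    simp only [hF', norm_mul, Real.norm_eq_abs, abs_of_nonneg (hk_nonneg _ _)]
    have h1 := hC₁ (a.1 - σ, a.2 - Real.sqrt σ * v)
    have h2 := hC₂ (a.1 - σ, a.2 - Real.sqrt σ * v)
    have h3 : |v / (2 * Real.sqrt σ) * Dx u (a.1 - σ, a.2 - Real.sqrt σ * v)| ≤
        |v| / (2 * Real.sqrt (τ / 2)) * C₂ := by
      rw [abs_mul, abs_div, abs_of_pos (by positivity : 0 < 2 * Real.sqrt σ)]
      gcongr
    have h4 := (abs_sub (-Dt u (a.1 - σ, a.2 - Real.sqrt σ * v))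
      (v / (2 * Real.sqrt σ) * Dx u (a.1 - σ, a.2 - Real.sqrt σ * v)))
    rw [abs_neg] at h4
    calc _ ≤ hk 1 v * (C₁ + |v| / (2 * Real.sqrt (τ / 2)) * C₂) := by
          refine mul_le_mul_of_nonneg_left ?_ (hk_nonneg _ _)
          linarith
      _ = _ := by ring

/-- A heat potential as an integral of heat averages over the time lag. -/
theorem integral_hk_mul_eq (hF : Continuous F) (hc : HasCompactSupport F) (a : ℝ × ℝ) {M : ℝ}
    (hM : 0 ≤ M) (hMF : ∀ z : ℝ × ℝ, M ≤ |z.1 - a.1| → F z = 0) :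
    ∫ z : ℝ × ℝ, hk (a.1 - z.1) (a.2 - z.2) * F z = ∫ τ in (0 : ℝ)..M, heatAvg F a τ := by
  rw [Measure.volume_eq_prod,
    integral_prod _ (by exact shortKernel_hk.integrable_mul_of_compact hF hc a),
    intervalIntegral.integral_of_le hM, ← integral_indicator measurableSet_Ioc,
    ← integral_sub_left_eq_self _ volume a.1]
  refine integral_congr_ae (ae_of_all _ fun τ => ?_)
  simp only [sub_sub_cancel]
  by_cases hτ : τ ∈ Ioc 0 M
  · rw [indicator_of_mem hτ, heatAvg_eq hτ.1]
  · rw [indicator_of_notMem hτ]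
    rw [mem_Ioc, not_and_or, not_lt, not_le] at hτ
    rcases hτ with h | h
    · simp [hk_of_nonpos h]
    · have : ∀ y, F (a.1 - τ, y) = 0 := fun y => hMF _ (by
        rw [sub_sub_cancel_left, abs_neg]; exact h.le.trans (le_abs_self _))
      simp [this]

/-- A test function is the heat potential of its image under the heat operator. -/
theorem eq_integral_hk_mul_heatOp (hu : ContDiff ℝ ∞ u) (hc : HasCompactSupport u) (a : ℝ × ℝ) :
    ∫ z : ℝ × ℝ, hk (a.1 - z.1) (a.2 - z.2) * heatOp u z = u a := by
  obtain ⟨-, M, -, hM, -, hMu⟩ := exists_bounds_of_compact hu.continuous hc a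
  obtain ⟨-, M', -, hM', -, hMu'⟩ :=
    exists_bounds_of_compact (contDiff_heatOp hu).continuous (hasCompactSupport_heatOp hc) a
  have hN : 0 ≤ max M M' := hM.le.trans (le_max_left _ _)
  rw [integral_hk_mul_eq (contDiff_heatOp hu).continuous (hasCompactSupport_heatOp hc) a
    hN fun z hz => hMu' z ((le_max_right _ _).trans hz)]
  have hcont := continuous_heatAvg (contDiff_heatOp hu).continuous (hasCompactSupport_heatOp hc) a
  have h1 := intervalIntegral.integral_eq_sub_of_hasDerivAt_of_le hN
    (f := fun τ => -heatAvg u a τ) (f' := heatAvg (heatOp u) a)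
    (continuous_heatAvg hu.continuous hc a).neg.continuousOn
    (fun τ hτ => (hasDerivAt_heatAvg hu hc a hτ.1).neg.congr_deriv (neg_neg _))
    (hcont.intervalIntegrable _ _)
  have h2 : heatAvg u a (max M M') = 0 := by
    rw [heatAvg]
    have : ∀ y, u (a.1 - max M M', y) = 0 := fun y => hMu _ (by
      rw [sub_sub_cancel_left, abs_neg]; exact (le_max_left _ _).trans (le_abs_self _))
    simp [this]
  rw [h1, heatAvg_zero, h2]; ring

end

/-! ### An interior gradient bound -/

theorem Dx_comp_sub (u : ℝ × ℝ → ℝ) (a : ℝ × ℝ) :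
    Dx (fun z => u (z - a)) = fun z => Dx u (z - a) := by
  funext z
  exact deriv_comp_sub_const (f := fun y => u (z.1 - a.1, y)) a.2 z.2

theorem Dt_comp_sub (u : ℝ × ℝ → ℝ) (a : ℝ × ℝ) :
    Dt (fun z => u (z - a)) = fun z => Dt u (z - a) := by
  funext z
  exact deriv_comp_sub_const (f := fun y => u (y, z.2 - a.2)) a.1 z.1

theorem contDiff_mul_of_tsupport {χ v : ℝ × ℝ → ℝ} (hχ : ContDiff ℝ ∞ χ)
    (hv : ∀ z ∈ tsupport χ, ContDiffAt ℝ ∞ v z) : ContDiff ℝ ∞ fun z => χ z * v z := by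
  refine contDiff_iff_contDiffAt.2 fun z => ?_
  by_cases hz : z ∈ tsupport χ
  · exact hχ.contDiffAt.mul (hv z hz)
  · refine (contDiffAt_const (c := (0 : ℝ))).congr_of_eventuallyEq ?_
    filter_upwards [notMem_tsupport_iff_eventuallyEq.1 hz] with y hy
    simp [hy]

theorem heatOp_mul_of_tsupport {χ v : ℝ × ℝ → ℝ} (hχ : ContDiff ℝ ∞ χ)
    (hv : ∀ z ∈ tsupport χ, ContDiffAt ℝ ∞ v z) (z : ℝ × ℝ) :
    heatOp (fun y => χ y * v y) z = (χ z * heatOp v z + (Dt χ z + 1 / 2 * Dx (Dx χ) z) * v z) -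
      Dx (fun y => Dx χ y * v y) z := by
  by_cases hz : z ∈ tsupport χ
  · exact heatOp_mul hχ.contDiffAt (hv z hz)
  · have h0 : χ =ᶠ[𝓝 z] 0 := notMem_tsupport_iff_eventuallyEq.1 hz
    have h1 : Dx χ =ᶠ[𝓝 z] 0 := by simpa [Dx_zero] using Dx_eventuallyEq h0
    have h2 : Dx (Dx χ) z = 0 := by rw [Dx_congr h1, Dx_zero]; rfl
    have h3 : Dt χ z = 0 := by rw [Dt_congr h0, Dt_zero]; rfl
    have h4 : (fun y => χ y * v y) =ᶠ[𝓝 z] 0 := by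
      filter_upwards [h0] with y hy; simp [hy]
    have h5 : (fun y => Dx χ y * v y) =ᶠ[𝓝 z] 0 := by
      filter_upwards [h1] with y hy; simp [hy]
    have h6 : Dx (fun y => Dx χ y * v y) z = 0 := by rw [Dx_congr h5, Dx_zero]; rfl
    have h7 : heatOp (fun y => χ y * v y) z = 0 := by
      rw [heatOp_congr h4, heatOp, Dt_zero, Dx_zero, Dx_zero]; simp
    rw [h7, h6, h2, h3, h0.self_of_nhds]; simp

/-- A smooth function is controlled, together with its heat operator, on the past half of a box
by its values; the space derivative at the centre is then controlled as well. -/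
theorem exists_abs_Dx_le {r : ℝ} (hr : 0 < r) : ∃ C, 0 ≤ C ∧ ∀ (a : ℝ × ℝ) (v : ℝ × ℝ → ℝ) (A : ℝ),
    ContDiffOn ℝ ∞ v (Metric.ball a (2 * r)) →
    (∀ z ∈ Metric.ball a (2 * r), z.1 ≤ a.1 → |v z| ≤ A ∧ |heatOp v z| ≤ A) →
    |Dx v a| ≤ C * A := by
  let χ₀ : ContDiffBump (0 : ℝ × ℝ) := ⟨r / 2, r, by positivity, by linarith⟩
  have hs₀ : ContDiff ℝ ∞ χ₀ := χ₀.contDiff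
  have hc₀ : HasCompactSupport χ₀ := χ₀.hasCompactSupport
  obtain ⟨M₁, hM₁⟩ := (hasCompactSupport_Dx hc₀).exists_bound_of_continuous
    (contDiff_Dx hs₀).continuous
  obtain ⟨M₂, hM₂⟩ := (hasCompactSupport_Dx (hasCompactSupport_Dx hc₀)).exists_bound_of_continuous
    (contDiff_Dx (contDiff_Dx hs₀)).continuous
  obtain ⟨M₃, hM₃⟩ := (hasCompactSupport_Dt hc₀).exists_bound_of_continuous
    (contDiff_Dt hs₀).continuous
  have hM₁0 := (norm_nonneg _).trans (hM₁ 0)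
  have hM₂0 := (norm_nonneg _).trans (hM₂ 0)
  have hM₃0 := (norm_nonneg _).trans (hM₃ 0)
  obtain ⟨K, hK0, hK⟩ := abs_hkxx_le (ρ := r / 2) (by positivity)
  set J := ∫ z, ‖{z : ℝ × ℝ | z.1 < 2 * r}.indicator (fun z => hkx z.1 z.2) z‖ with hJ
  have hJ0 : 0 ≤ J := integral_nonneg fun _ => norm_nonneg _
  refine ⟨(1 + (M₃ + 1 / 2 * M₂)) * J + (K * M₁ * (4 * r)) * (2 * r), by positivity,
    fun a v A hv hA => ?_⟩
  have hA0 : 0 ≤ A := (abs_nonneg _).trans (hA a (Metric.mem_ball_self (by positivity)) le_rfl).1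
  set χ : ℝ × ℝ → ℝ := fun z => χ₀ (z - a) with hχdef
  have hs : ContDiff ℝ ∞ χ := hs₀.comp (contDiff_id.sub contDiff_const)
  have hzero : ∀ z, r ≤ dist z a → χ z = 0 := fun z hz =>
    χ₀.zero_of_le_dist (by rw [dist_zero_right, ← dist_eq_norm]; exact hz)
  have htsub : tsupport χ ⊆ Metric.closedBall a r := by
    refine closure_minimal (fun z hz => ?_) Metric.isClosed_closedBall
    by_contra h
    exact hz (hzero z (not_le.1 h).le)
  have hcχ : HasCompactSupport χ :=
    (isCompact_closedBall a r).of_isClosed_subset (isClosed_tsupport _) htsub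
  have hball : Metric.closedBall a r ⊆ Metric.ball a (2 * r) :=
    Metric.closedBall_subset_ball (by linarith)
  have hvat : ∀ z ∈ tsupport χ, ContDiffAt ℝ ∞ v z := fun z hz =>
    hv.contDiffAt (Metric.isOpen_ball.mem_nhds (hball (htsub hz)))
  have hDxχ : ∀ z, |Dx χ z| ≤ M₁ := fun z => by rw [hχdef, Dx_comp_sub]; exact hM₁ _
  have hDxxχ : ∀ z, |Dx (Dx χ) z| ≤ M₂ := fun z => by
    rw [hχdef, Dx_comp_sub, Dx_comp_sub]; exact hM₂ _
  have hDtχ : ∀ z, |Dt χ z| ≤ M₃ := fun z => by rw [hχdef, Dt_comp_sub]; exact hM₃ _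
  have hχ1 : ∀ z, |χ z| ≤ 1 := fun z => by
    rw [abs_of_nonneg χ₀.nonneg]; exact χ₀.le_one
  -- the heat operator of the cut-off function is `g₁ - Dx g₂`, where `Dx v` does not occur
  set u : ℝ × ℝ → ℝ := fun z => χ z * v z with hu
  set g₂ : ℝ × ℝ → ℝ := fun z => Dx χ z * v z with hg₂
  set g₁ : ℝ × ℝ → ℝ := fun z => χ z * heatOp v z + (Dt χ z + 1 / 2 * Dx (Dx χ) z) * v z with hg₁
  have hus : ContDiff ℝ ∞ u := contDiff_mul_of_tsupport hs hvat
  have hucs : HasCompactSupport u := hcχ.mul_right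
  have hg₂s : ContDiff ℝ ∞ g₂ :=
    contDiff_mul_of_tsupport (contDiff_Dx hs) fun z hz => hvat z (tsupport_Dx_subset χ hz)
  have hg₂c : HasCompactSupport g₂ := (hasCompactSupport_Dx hcχ).mul_right
  have hL : ∀ z, heatOp u z = g₁ z - Dx g₂ z := heatOp_mul_of_tsupport hs hvat
  have hg₁c : Continuous g₁ := by
    have : g₁ = fun z => heatOp u z + Dx g₂ z := funext fun z => by rw [hL]; ring
    rw [this]
    exact (contDiff_heatOp hus).continuous.add (contDiff_Dx hg₂s).continuous
  -- outside the support everything vanishes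
  have hoff : ∀ z, z ∉ tsupport χ → χ z = 0 ∧ Dx χ z = 0 ∧ Dx (Dx χ) z = 0 ∧ Dt χ z = 0 :=
    fun z hz => by
      refine ⟨image_eq_zero_of_notMem_tsupport hz, image_eq_zero_of_notMem_tsupport fun h =>
        hz (tsupport_Dx_subset _ h), image_eq_zero_of_notMem_tsupport fun h =>
        hz (tsupport_Dx_subset _ (tsupport_Dx_subset _ h)), image_eq_zero_of_notMem_tsupport fun h =>
        hz (tsupport_Dt_subset _ h)⟩
  have hfar : ∀ z : ℝ × ℝ, z.1 ≤ a.1 - 2 * r → z ∉ tsupport χ := fun z hz h => by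
    have h1 := htsub h
    rw [Metric.mem_closedBall, Prod.dist_eq, max_le_iff, Real.dist_eq, abs_le] at h1
    linarith [h1.1.1]
  have hg₁b : ∀ z : ℝ × ℝ, z.1 < a.1 → |g₁ z| ≤ (1 + (M₃ + 1 / 2 * M₂)) * A := fun z hz => by
    by_cases h : z ∈ tsupport χ
    · obtain ⟨b1, b2⟩ := hA z (hball (htsub h)) hz.le
      have b3 : |Dt χ z + 1 / 2 * Dx (Dx χ) z| ≤ M₃ + 1 / 2 * M₂ := by
        refine (abs_add_le _ _).trans (add_le_add (hDtχ z) ?_)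
        rw [abs_mul, abs_of_pos (by norm_num : (0 : ℝ) < 1 / 2)]
        gcongr; exact hDxxχ z
      calc |g₁ z| ≤ |χ z * heatOp v z| + |(Dt χ z + 1 / 2 * Dx (Dx χ) z) * v z| := abs_add_le _ _
        _ ≤ 1 * A + (M₃ + 1 / 2 * M₂) * A := by
          rw [abs_mul, abs_mul]
          have := hχ1 z
          gcongr
        _ = _ := by ring
    · obtain ⟨e1, -, e3, e4⟩ := hoff z h
      rw [hg₁]; simp only [e1, e3, e4]; simp; positivity
  have hg₁0 : ∀ z : ℝ × ℝ, z.1 ≤ a.1 - 2 * r → g₁ z = 0 := fun z hz => by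
    obtain ⟨e1, -, e3, e4⟩ := hoff z (hfar z hz)
    rw [hg₁]; simp only [e1, e3, e4]; simp
  have hI₁ := shortKernel_hkx.integrable_mul (M := 2 * r) hg₁c.aestronglyMeasurable hg₁b hg₁0
  have hI₂ := shortKernel_hkx.integrable_mul_of_compact (contDiff_Dx hg₂s).continuous
    (hasCompactSupport_Dx hg₂c) a
  have hDxua : Dx u a = Dx v a := by
    refine Dx_congr ?_
    filter_upwards [Metric.ball_mem_nhds a (half_pos hr)] with z hz
    have : χ z = 1 := χ₀.one_of_mem_closedBall (by
      rw [mem_closedBall_zero_iff, ← dist_eq_norm]; exact (Metric.mem_ball.1 hz).le)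
    rw [hu]; simp [this]
  -- `Dx u` is the heat potential of `Dx (g₁ - Dx g₂)`; one derivative moves to the kernel
  have hrep : Dx v a = ∫ z : ℝ × ℝ, hkx (a.1 - z.1) (a.2 - z.2) * g₁ z -
      hkx (a.1 - z.1) (a.2 - z.2) * Dx g₂ z := by
    rw [← hDxua, ← eq_integral_hk_mul_heatOp (contDiff_Dx hus) (hasCompactSupport_Dx hucs) a]
    have : heatOp (Dx u) = Dx (heatOp u) := funext fun z =>
      (Dx_heatOp (contDiff_infty.1 hus 3).contDiffAt).symm
    rw [this, integral_hk_mul_Dx (contDiff_heatOp hus) (hasCompactSupport_heatOp hucs) a]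
    refine integral_congr_ae (ae_of_all _ fun z => ?_)
    simp only [hL]; ring
  -- the term with two derivatives on the kernel only sees points away from `a`
  have hg₂b : ∀ s y : ℝ, |hkxx (a.1 - s) (a.2 - y) * g₂ (s, y)| ≤
      (Icc (a.2 - 2 * r) (a.2 + 2 * r)).indicator (fun _ =>
        (Ioo (a.1 - 2 * r) a.1).indicator (fun _ => K * M₁ * A) s) y := fun s y => by
    have hnn : 0 ≤ (Icc (a.2 - 2 * r) (a.2 + 2 * r)).indicator (fun _ =>
        (Ioo (a.1 - 2 * r) a.1).indicator (fun _ => K * M₁ * A) s) y :=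
      indicator_nonneg (fun _ _ => indicator_nonneg (fun _ _ => by positivity) _) _
    by_cases h0 : hkxx (a.1 - s) (a.2 - y) * g₂ (s, y) = 0
    · rw [h0, abs_zero]; exact hnn
    have hts : (s, y) ∈ tsupport χ := by
      by_contra h
      exact h0 (by rw [hg₂]; simp only [(hoff _ h).2.1]; simp)
    have hlt : s < a.1 := by
      by_contra h
      exact h0 (by rw [hkxx, hk_of_nonpos (by linarith)]; simp)
    have h1 := htsub hts
    rw [Metric.mem_closedBall, Prod.dist_eq, max_le_iff, Real.dist_eq, Real.dist_eq, abs_le,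
      abs_le] at h1
    have hy : y ∈ Icc (a.2 - 2 * r) (a.2 + 2 * r) := ⟨by linarith [h1.2.1], by linarith [h1.2.2]⟩
    have hs' : s ∈ Ioo (a.1 - 2 * r) a.1 := ⟨by linarith [h1.1.1], hlt⟩
    rw [indicator_of_mem hy, indicator_of_mem hs', abs_mul]
    have hd : r / 2 ≤ a.1 - s ∨ r / 2 ≤ |a.2 - y| := by
      by_contra! h
      refine h0 ?_
      have : Dx χ (s, y) = 0 := by
        have hev : χ =ᶠ[𝓝 (s, y)] fun _ => 1 := by
          have hm : (s, y) ∈ Metric.ball a (r / 2) := by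
            rw [Metric.mem_ball, Prod.dist_eq, max_lt_iff, Real.dist_eq, Real.dist_eq,
              abs_sub_comm, abs_sub_comm y]
            exact ⟨by rw [abs_of_pos (by linarith)]; exact h.1, h.2⟩
          filter_upwards [Metric.isOpen_ball.mem_nhds hm] with z hz
          exact χ₀.one_of_mem_closedBall (by
            rw [mem_closedBall_zero_iff, ← dist_eq_norm]; exact (Metric.mem_ball.1 hz).le)
        rw [Dx_congr hev]; simp [Dx]
      rw [hg₂]; simp only [this]; simp
    have b1 := hK (a.1 - s) (a.2 - y) (by linarith) hd
    have b2 : |g₂ (s, y)| ≤ M₁ * A := by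
      rw [hg₂]; simp only [abs_mul]
      have := (hA _ (hball (htsub hts)) hlt.le).1
      have := hDxχ (s, y)
      gcongr
    calc _ ≤ K * (M₁ * A) := by gcongr
      _ = _ := by ring
  have hsl : ∀ s, ‖∫ y, hkx (a.1 - s) (a.2 - y) * Dx g₂ (s, y)‖ ≤
      (Ioo (a.1 - 2 * r) a.1).indicator (fun _ => K * M₁ * A * (4 * r)) s := fun s => by
    rw [slice_by_parts_hkx hg₂s hg₂c]
    refine (norm_integral_le_of_norm_le (integrableOn_const (by simp) |>.integrable_indicator
      measurableSet_Icc) (ae_of_all _ fun y => hg₂b s y)).trans (le_of_eq ?_)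
    rw [integral_indicator measurableSet_Icc, setIntegral_const, measureReal_def, Real.volume_Icc,
      ENNReal.toReal_ofReal (by linarith), smul_eq_mul]
    by_cases h : s ∈ Ioo (a.1 - 2 * r) a.1
    · rw [indicator_of_mem h, indicator_of_mem h]; ring
    · rw [indicator_of_notMem h, indicator_of_notMem h, mul_zero]
  have h2 : |∫ z : ℝ × ℝ, hkx (a.1 - z.1) (a.2 - z.2) * Dx g₂ z| ≤
      K * M₁ * A * (4 * r) * (2 * r) := by
    rw [Measure.volume_eq_prod, integral_prod _ (by exact hI₂), ← Real.norm_eq_abs]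
    refine (norm_integral_le_of_norm_le (integrableOn_const
      (by simp [ENNReal.mul_eq_top]) |>.integrable_indicator measurableSet_Ioo) (ae_of_all _ hsl)).trans (le_of_eq ?_)
    rw [integral_indicator measurableSet_Ioo, setIntegral_const, measureReal_def, Real.volume_Ioo,
      ENNReal.toReal_ofReal (by linarith), smul_eq_mul]
    ring
  have h1 : |∫ z : ℝ × ℝ, hkx (a.1 - z.1) (a.2 - z.2) * g₁ z| ≤
      (1 + (M₃ + 1 / 2 * M₂)) * A * J := by
    rw [← Real.norm_eq_abs]
    exact (norm_integral_le_integral_norm _).trans hI₁.2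
  rw [hrep, integral_sub (by exact hI₁.1) (by exact hI₂)]
  calc _ ≤ _ := abs_sub _ _
    _ ≤ (1 + (M₃ + 1 / 2 * M₂)) * A * J + K * M₁ * A * (4 * r) * (2 * r) := add_le_add h1 h2
    _ = _ := by ring

/-! ### Weak solutions and their mollification -/

open scoped Convolution in
/-- The convolution of a real function `V` on space-time with a kernel `f`. -/
def conv (f V : ℝ × ℝ → ℝ) : ℝ × ℝ → ℝ := f ⋆[ContinuousLinearMap.lsmul ℝ ℝ, volume] V

section

variable {f V : ℝ × ℝ → ℝ}

theorem conv_apply (f V : ℝ × ℝ → ℝ) (z : ℝ × ℝ) : conv f V z = ∫ y, f (z - y) * V y :=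
  convolution_lsmul_swap

theorem contDiff_conv (hf : ContDiff ℝ ∞ f) (hc : HasCompactSupport f)
    (hV : LocallyIntegrable V) : ContDiff ℝ ∞ (conv f V) :=
  hc.contDiff_convolution_left _ hf hV

theorem fderiv_conv_apply (hf : ContDiff ℝ ∞ f) (hc : HasCompactSupport f)
    (hV : LocallyIntegrable V) (z e : ℝ × ℝ) :
    fderiv ℝ (conv f V) z e = conv (fun y => fderiv ℝ f y e) V z := by
  have hf1 : ContDiff ℝ 1 f := hf.of_le (by exact_mod_cast le_top)
  have hex := (hc.fderiv (𝕜 := ℝ)).convolutionExists_left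
    ((ContinuousLinearMap.lsmul ℝ ℝ : ℝ →L[ℝ] ℝ →L[ℝ] ℝ).precompL (ℝ × ℝ))
    (hf1.continuous_fderiv (by simp)) hV
  rw [conv, (hc.hasFDerivAt_convolution_left _ hf1 hV z).fderiv, conv, convolution, convolution,
    ContinuousLinearMap.integral_apply (hex z)]
  rfl

theorem Dx_conv (hf : ContDiff ℝ ∞ f) (hc : HasCompactSupport f) (hV : LocallyIntegrable V) :
    Dx (conv f V) = conv (Dx f) V := by
  funext z
  rw [Dx_eq_fderiv ((contDiff_conv hf hc hV).differentiable (by simp) z),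
    fderiv_conv_apply hf hc hV]
  congr 1
  funext y
  exact (Dx_eq_fderiv (hf.differentiable (by simp) y)).symm

theorem Dt_conv (hf : ContDiff ℝ ∞ f) (hc : HasCompactSupport f) (hV : LocallyIntegrable V) :
    Dt (conv f V) = conv (Dt f) V := by
  funext z
  rw [Dt_eq_fderiv ((contDiff_conv hf hc hV).differentiable (by simp) z),
    fderiv_conv_apply hf hc hV]
  congr 1
  funext y
  exact (Dt_eq_fderiv (hf.differentiable (by simp) y)).symm

end

theorem Dx_comp_const_sub (u : ℝ × ℝ → ℝ) (a : ℝ × ℝ) :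
    Dx (fun z => u (a - z)) = fun z => -Dx u (a - z) := by
  funext z
  exact deriv_comp_const_sub (f := fun y => u (a.1 - z.1, y)) a.2 z.2

theorem Dt_comp_const_sub (u : ℝ × ℝ → ℝ) (a : ℝ × ℝ) :
    Dt (fun z => u (a - z)) = fun z => -Dt u (a - z) := by
  funext z
  exact deriv_comp_const_sub (f := fun y => u (y, a.2 - z.2)) a.1 z.1

theorem Dx_neg (u : ℝ × ℝ → ℝ) : Dx (fun z => -u z) = fun z => -Dx u z := by
  funext z; exact deriv.fun_neg

/-- The equation `∂ₜ v = c ∂ₓₓ v + G` on `U`, tested against smooth functions. Both `c = 1/2` and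
`c = 0` are used: the latter expresses that `G` is the weak time derivative of `v`. -/
structure WeakEq (c : ℝ) (U : Set (ℝ × ℝ)) (v G : ℝ × ℝ → ℝ) : Prop where
  continuousOn : ContinuousOn v U
  continuousOn_source : ContinuousOn G U
  eq : ∀ φ : ℝ × ℝ → ℝ, ContDiff ℝ ∞ φ → HasCompactSupport φ → tsupport φ ⊆ U →
    ∫ z, v z * (-Dt φ z - c * Dx (Dx φ) z) = ∫ z, G z * φ z

theorem exists_uniform_modulus {U : Set (ℝ × ℝ)} {v : ℝ × ℝ → ℝ} (hv : ContinuousOn v U)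
    {z₀ : ℝ × ℝ} {ρ ε : ℝ} (hU : Metric.closedBall z₀ ρ ⊆ U) (hε : 0 < ε) :
    ∃ η > 0, ∀ x ∈ Metric.closedBall z₀ ρ, ∀ y ∈ Metric.closedBall z₀ ρ, dist x y < η →
      dist (v x) (v y) ≤ ε := by
  have h := (isCompact_closedBall z₀ ρ).uniformContinuousOn_of_continuous (hv.mono hU)
  obtain ⟨η, hη, h1⟩ := Metric.uniformContinuousOn_iff.1 h ε hε
  exact ⟨η, hη, fun x hx y hy hxy => (h1 x hx y hy hxy).le⟩

/-- A weak solution is, near each point, a uniform limit of smooth functions whose images under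
the operator converge uniformly to the source: its mollifications. -/
theorem WeakEq.exists_smooth {c : ℝ} {U : Set (ℝ × ℝ)} {v G : ℝ × ℝ → ℝ} (h : WeakEq c U v G)
    {z₀ : ℝ × ℝ} {ρ ε : ℝ} (hρ : 0 < ρ) (hU : Metric.closedBall z₀ (2 * ρ) ⊆ U) (hε : 0 < ε) :
    ∃ u : ℝ × ℝ → ℝ, ContDiff ℝ ∞ u ∧ ∀ z ∈ Metric.ball z₀ ρ,
      |u z - v z| ≤ ε ∧ |(Dt u z - c * Dx (Dx u) z) - G z| ≤ ε := by
  obtain ⟨η₁, hη₁, h1⟩ := exists_uniform_modulus h.continuousOn hU hε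
  obtain ⟨η₂, hη₂, h2⟩ := exists_uniform_modulus h.continuousOn_source hU hε
  set η := min ρ (min η₁ η₂) with hη
  have hηpos : 0 < η := by positivity
  have hηρ : η ≤ ρ := min_le_left _ _
  have hη1' : η ≤ η₁ := (min_le_right _ _).trans (min_le_left _ _)
  have hη2' : η ≤ η₂ := (min_le_right _ _).trans (min_le_right _ _)
  let χ : ContDiffBump (0 : ℝ × ℝ) := ⟨η / 2, η, by positivity, by linarith⟩
  set f : ℝ × ℝ → ℝ := χ.normed volume with hf
  have hfs : ContDiff ℝ ∞ f := χ.contDiff_normed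
  have hfc : HasCompactSupport f := χ.hasCompactSupport_normed
  have hfsupp : ∀ y, η < dist y 0 → f y = 0 := fun y hy => by
    by_contra h0
    have : y ∈ tsupport f := subset_tsupport _ h0
    rw [hf, χ.tsupport_normed_eq, Metric.mem_closedBall] at this
    exact absurd this (not_le.2 hy)
  set B := Metric.closedBall z₀ (2 * ρ) with hB
  have hBm : MeasurableSet B := Metric.isClosed_closedBall.measurableSet
  have hint : ∀ w : ℝ × ℝ → ℝ, ContinuousOn w U → Integrable (B.indicator w) := fun w hw =>
    ((hw.mono hU).integrableOn_compact (isCompact_closedBall _ _)).integrable_indicator hBm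
  have hsub : ∀ z ∈ Metric.ball z₀ ρ, ∀ x, dist x z ≤ η → x ∈ B := fun z hz x hx => by
    rw [hB, Metric.mem_closedBall]
    linarith [dist_triangle x z z₀, Metric.mem_ball.1 hz]
  have hdist : ∀ w : ℝ × ℝ → ℝ, ContinuousOn w U → (∀ x ∈ B, ∀ y ∈ B, dist x y < η →
      dist (w x) (w y) ≤ ε) → ∀ z ∈ Metric.ball z₀ ρ, |conv f (B.indicator w) z - w z| ≤ ε :=
    fun w hw hmod z hz => by
      have hzB : z ∈ B := hsub z hz z (by rw [dist_self]; exact hηpos.le)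
      have := χ.dist_normed_convolution_le (μ := volume) (g := B.indicator w) (x₀ := z) (ε := ε)
        (hint w hw).aestronglyMeasurable fun x hx => by
          have hx' : dist x z < η := Metric.mem_ball.1 hx
          have hxB := hsub z hz x hx'.le
          rw [indicator_of_mem hxB, indicator_of_mem hzB]
          exact hmod x hxB z hzB hx'
      rw [indicator_of_mem hzB, Real.dist_eq] at this
      exact this
  have hVl := (hint v h.continuousOn).locallyIntegrable
  refine ⟨conv f (B.indicator v), contDiff_conv hfs hfc hVl, fun z hz => ⟨?_, ?_⟩⟩
  · exact hdist v h.continuousOn (fun x hx y hy hxy => h1 x hx y hy (hxy.trans_le hη1')) z hz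
  have hG := hdist G h.continuousOn_source
    (fun x hx y hy hxy => h2 x hx y hy (hxy.trans_le hη2')) z hz
  convert hG using 3
  set φ : ℝ × ℝ → ℝ := fun y => f (z - y) with hφ
  have hφs : ContDiff ℝ ∞ φ := hfs.comp (contDiff_const.sub contDiff_id)
  have hts : tsupport φ ⊆ Metric.closedBall z η := by
    refine closure_minimal (fun y hy => ?_) Metric.isClosed_closedBall
    by_contra h0
    refine hy (hfsupp _ ?_)
    rw [dist_zero_right, ← dist_eq_norm, dist_comm]
    exact not_le.1 h0
  have hφB : tsupport φ ⊆ B := fun y hy => hsub z hz y (hts hy)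
  have hφc : HasCompactSupport φ :=
    (isCompact_closedBall z η).of_isClosed_subset (isClosed_tsupport _) hts
  rw [Dt_conv hfs hfc hVl, Dx_conv hfs hfc hVl, Dx_conv (contDiff_Dx hfs) (hasCompactSupport_Dx hfc)
    hVl, conv_apply, conv_apply, conv_apply, ← integral_const_mul, ← integral_sub]
  · have e1 := h.eq φ hφs hφc (hφB.trans hU)
    have hDt : Dt φ = fun y => -Dt f (z - y) := Dt_comp_const_sub f z
    have hDxx : Dx (Dx φ) = fun y => Dx (Dx f) (z - y) := by
      rw [hφ, Dx_comp_const_sub, Dx_neg, Dx_comp_const_sub]; simp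
    calc _ = ∫ y, v y * (-Dt φ y - c * Dx (Dx φ) y) := by
          refine integral_congr_ae (ae_of_all _ fun y => ?_)
          by_cases hy : y ∈ B
          · simp only [indicator_of_mem hy, hDt, hDxx]; ring
          · have hy' : y ∉ tsupport φ := fun h => hy (hφB h)
            have z1 : Dt φ y = 0 := image_eq_zero_of_notMem_tsupport fun h =>
              hy' (tsupport_Dt_subset _ h)
            have z2 : Dx (Dx φ) y = 0 := image_eq_zero_of_notMem_tsupport fun h =>
              hy' (tsupport_Dx_subset _ (tsupport_Dx_subset _ h))
            simp [indicator_of_notMem hy, z1, z2]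
      _ = ∫ y, G y * φ y := e1
      _ = _ := by
          refine integral_congr_ae (ae_of_all _ fun y => ?_)
          by_cases hy : y ∈ B
          · simp only [indicator_of_mem hy]; ring
          · have z1 : φ y = 0 := image_eq_zero_of_notMem_tsupport fun h => hy (hφB h)
            simp [indicator_of_notMem hy, z1]
  · exact (hasCompactSupport_Dt hfc).convolutionExists_left (ContinuousLinearMap.lsmul ℝ ℝ)
      (contDiff_Dt hfs).continuous hVl z |>.integrable_swap
  · exact ((hasCompactSupport_Dx (hasCompactSupport_Dx hfc)).convolutionExists_left
      (ContinuousLinearMap.lsmul ℝ ℝ)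
      (contDiff_Dx (contDiff_Dx hfs)).continuous hVl z |>.integrable_swap).const_mul c

theorem exists_ball_subset {U : Set (ℝ × ℝ)} (hU : IsOpen U) {z : ℝ × ℝ} (hz : z ∈ U) :
    ∃ ρ > 0, Metric.closedBall z ρ ⊆ U := by
  obtain ⟨ρ, hρ, h⟩ := Metric.nhds_basis_closedBall.mem_iff.1 (hU.mem_nhds hz)
  exact ⟨ρ, hρ, h⟩

/-- If smooth functions `uₙ` converge at every point of a ball, and their space derivatives are
uniformly Cauchy, the limit has a continuous space derivative. -/
theorem hasDerivAt_snd_of_limit {u : ℕ → ℝ × ℝ → ℝ} {v : ℝ × ℝ → ℝ} {z₀ : ℝ × ℝ} {ρ : ℝ}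
    (hu : ∀ n, ContDiff ℝ ∞ (u n))
    (hv : ∀ z ∈ Metric.ball z₀ ρ, Tendsto (fun n => u n z) atTop (𝓝 (v z)))
    (hc : UniformCauchySeqOn (fun n => Dx (u n)) atTop (Metric.ball z₀ ρ)) :
    ContinuousOn (Dx v) (Metric.ball z₀ ρ) ∧
      ∀ z ∈ Metric.ball z₀ ρ, HasDerivAt (fun y => v (z.1, y)) (Dx v z) z.2 := by
  have hlim : ∀ z ∈ Metric.ball z₀ ρ, ∃ l, Tendsto (fun n => Dx (u n) z) atTop (𝓝 l) :=
    fun z hz => cauchySeq_tendsto_of_complete (hc.cauchySeq hz)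
  choose! g hg using hlim
  have hunif := hc.tendstoUniformlyOn_of_tendsto hg
  have hcont : ContinuousOn g (Metric.ball z₀ ρ) :=
    hunif.continuousOn (Frequently.of_forall fun n => (contDiff_Dx (hu n)).continuous.continuousOn)
  have hder : ∀ z ∈ Metric.ball z₀ ρ, HasDerivAt (fun y => v (z.1, y)) (g z) z.2 := fun z hz => by
    have hopen : IsOpen {y : ℝ | (z.1, y) ∈ Metric.ball z₀ ρ} :=
      Metric.isOpen_ball.preimage (by fun_prop)
    refine hasDerivAt_of_tendstoUniformlyOn (l := atTop) hopen
      (f := fun n y => u n (z.1, y)) (f' := fun n y => Dx (u n) (z.1, y))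
      (g' := fun y => g (z.1, y)) ?_ (Eventually.of_forall fun n y _ => ?_) (fun y hy => hv _ hy) hz
    · exact hunif.comp (fun y => (z.1, y))
    · exact hasDerivAt_Dx (z := (z.1, y)) ((hu n).differentiable (by simp) _)
  have heq : ∀ z ∈ Metric.ball z₀ ρ, Dx v z = g z := fun z hz => (hder z hz).deriv
  exact ⟨hcont.congr heq, fun z hz => by rw [heq z hz]; exact hder z hz⟩

/-- A continuous weak solution with continuous source has a continuous space derivative: the
interior gradient bound, applied to the differences of its mollifications, makes their derivatives
uniformly Cauchy. -/
theorem WeakEq.hasDerivAt_Dx {U : Set (ℝ × ℝ)} {v G : ℝ × ℝ → ℝ} (hU : IsOpen U)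
    (h : WeakEq (1 / 2) U v G) :
    ContinuousOn (Dx v) U ∧ ∀ z ∈ U, HasDerivAt (fun y => v (z.1, y)) (Dx v z) z.2 := by
  have key : ∀ z₀ ∈ U, ∃ ρ > 0, ContinuousOn (Dx v) (Metric.ball z₀ ρ) ∧
      ∀ z ∈ Metric.ball z₀ ρ, HasDerivAt (fun y => v (z.1, y)) (Dx v z) z.2 := fun z₀ hz₀ => by
    obtain ⟨ρ, hρ, hsub⟩ := exists_ball_subset hU hz₀
    set s := ρ / 4 with hs
    have hspos : 0 < s := by positivity
    obtain ⟨C, hC0, hC⟩ := exists_abs_Dx_le (r := s / 2) (by positivity)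
    have hex : ∀ n : ℕ, ∃ u : ℝ × ℝ → ℝ, ContDiff ℝ ∞ u ∧ ∀ z ∈ Metric.ball z₀ (2 * s),
        |u z - v z| ≤ 1 / ((n : ℝ) + 1) ∧
        |(Dt u z - 1 / 2 * Dx (Dx u) z) - G z| ≤ 1 / ((n : ℝ) + 1) := fun n =>
      h.exists_smooth (by positivity) (by convert hsub using 2; rw [hs]; ring) (by positivity)
    choose u hus hub using hex
    refine ⟨s, hspos, hasDerivAt_snd_of_limit hus (fun z hz => ?_) ?_⟩
    · have hz' : z ∈ Metric.ball z₀ (2 * s) := Metric.ball_subset_ball (by linarith) hz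
      refine tendsto_iff_dist_tendsto_zero.2 ?_
      refine squeeze_zero (fun _ => dist_nonneg) (fun n => ?_) tendsto_one_div_add_atTop_nhds_zero_nat
      rw [Real.dist_eq]; exact (hub n z hz').1
    · rw [Metric.uniformCauchySeqOn_iff]
      intro ε hε
      obtain ⟨N, hN⟩ := exists_nat_gt (C * 2 / ε)
      refine ⟨N, fun m hm n hn z hz => ?_⟩
      have hball : ∀ y ∈ Metric.ball z (2 * (s / 2)), y ∈ Metric.ball z₀ (2 * s) := fun y hy => by
        rw [Metric.mem_ball] at hy hz ⊢
        linarith [dist_triangle y z z₀]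
      have hsm : ContDiff ℝ ∞ fun y => u m y - u n y := (hus m).sub (hus n)
      have hdiff : ∀ k y, DifferentiableAt ℝ (u k) y := fun k y => (hus k).differentiable (by simp) y
      have hdiff' : ∀ k y, DifferentiableAt ℝ (Dx (u k)) y := fun k y =>
        (contDiff_Dx (hus k)).differentiable (by simp) y
      have eDx : Dx (fun y => u m y - u n y) = fun y => Dx (u m) y - Dx (u n) y := funext fun y =>
        ((WeakNoise.hasDerivAt_Dx (hdiff m y)).sub (WeakNoise.hasDerivAt_Dx (hdiff n y))).deriv
      have eDxx : Dx (Dx fun y => u m y - u n y) = fun y => Dx (Dx (u m)) y - Dx (Dx (u n)) y := by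
        rw [eDx]
        exact funext fun y => ((WeakNoise.hasDerivAt_Dx (hdiff' m y)).sub
          (WeakNoise.hasDerivAt_Dx (hdiff' n y))).deriv
      have eDt : Dt (fun y => u m y - u n y) = fun y => Dt (u m) y - Dt (u n) y := funext fun y =>
        ((hasDerivAt_Dt (hdiff m y)).sub (hasDerivAt_Dt (hdiff n y))).deriv
      have hb : ∀ k : ℕ, N ≤ k → 1 / ((k : ℝ) + 1) ≤ 1 / ((N : ℝ) + 1) := fun k hk => by
        have : (N : ℝ) ≤ k := by exact_mod_cast hk
        gcongr
      have := hC z (fun y => u m y - u n y) (2 / ((N : ℝ) + 1)) hsm.contDiffOn fun y hy _ => by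
        obtain ⟨a1, a2⟩ := hub m y (hball y hy)
        obtain ⟨b1, b2⟩ := hub n y (hball y hy)
        have hm' := hb m hm
        have hn' := hb n hn
        have e2 : 2 / ((N : ℝ) + 1) = 1 / ((N : ℝ) + 1) + 1 / ((N : ℝ) + 1) := by ring
        rw [e2, heatOp, eDt, eDxx]
        simp only [abs_le] at a1 a2 b1 b2 ⊢
        refine ⟨⟨by linarith, by linarith⟩, ⟨by linarith, by linarith⟩⟩
      rw [eDx] at this
      rw [Real.dist_eq]
      refine this.trans_lt ?_
      rw [div_lt_iff₀ hε] at hN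
      have hN1 : (0 : ℝ) < (N : ℝ) + 1 := by positivity
      rw [mul_div_assoc', div_lt_iff₀ hN1]
      nlinarith
  refine ⟨fun z hz => ?_, fun z hz => ?_⟩
  · obtain ⟨ρ, hρ, hc, -⟩ := key z hz
    exact (hc.continuousAt (Metric.ball_mem_nhds z hρ)).continuousWithinAt
  · obtain ⟨ρ, hρ, -, hd⟩ := key z hz
    exact hd z (Metric.mem_ball_self hρ)

/-- A continuous function with continuous weak time derivative is differentiable in time. -/
theorem WeakEq.hasDerivAt_Dt {U : Set (ℝ × ℝ)} {v G : ℝ × ℝ → ℝ} (hU : IsOpen U)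
    (h : WeakEq 0 U v G) {z₀ : ℝ × ℝ} (hz₀ : z₀ ∈ U) :
    HasDerivAt (fun s => v (s, z₀.2)) (G z₀) z₀.1 := by
  obtain ⟨ρ, hρ, hsub⟩ := exists_ball_subset hU hz₀
  set s := ρ / 2 with hs
  have hspos : 0 < s := by positivity
  have hex : ∀ n : ℕ, ∃ u : ℝ × ℝ → ℝ, ContDiff ℝ ∞ u ∧ ∀ z ∈ Metric.ball z₀ s,
      |u z - v z| ≤ 1 / ((n : ℝ) + 1) ∧
      |(Dt u z - 0 * Dx (Dx u) z) - G z| ≤ 1 / ((n : ℝ) + 1) := fun n =>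
    h.exists_smooth (by positivity) (by convert hsub using 2; rw [hs]; ring) (by positivity)
  choose u hus hub using hex
  have hopen : IsOpen {t : ℝ | (t, z₀.2) ∈ Metric.ball z₀ s} :=
    Metric.isOpen_ball.preimage (by fun_prop)
  refine hasDerivAt_of_tendstoUniformlyOn (l := atTop) hopen
    (f := fun n t => u n (t, z₀.2)) (f' := fun n t => Dt (u n) (t, z₀.2))
    (g' := fun t => G (t, z₀.2)) ?_ (Eventually.of_forall fun n t _ => ?_) (fun t ht => ?_)
    (Metric.mem_ball_self hspos)
  · rw [Metric.tendstoUniformlyOn_iff]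
    intro ε hε
    filter_upwards [(tendsto_one_div_add_atTop_nhds_zero_nat (𝕜 := ℝ)).eventually (gt_mem_nhds hε)]
      with n hn t ht
    have := (hub n _ ht).2
    rw [zero_mul, sub_zero, ← Real.dist_eq, dist_comm] at this
    exact this.trans_lt hn
  · exact WeakNoise.hasDerivAt_Dt (z := (t, z₀.2)) ((hus n).differentiable (by simp) _)
  · refine tendsto_iff_dist_tendsto_zero.2 ?_
    refine squeeze_zero (fun _ => dist_nonneg) (fun n => ?_) tendsto_one_div_add_atTop_nhds_zero_nat
    rw [Real.dist_eq]; exact (hub n _ ht).1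

/-! ### Integration by parts against test functions -/

section

variable {U : Set (ℝ × ℝ)} {v w φ G : ℝ × ℝ → ℝ}

theorem continuous_mul_of_tsupport (hU : IsOpen U) (hv : ContinuousOn v U) (hφ : Continuous φ)
    (hs : tsupport φ ⊆ U) : Continuous fun z => v z * φ z := by
  refine continuous_iff_continuousAt.2 fun z => ?_
  by_cases hz : z ∈ tsupport φ
  · exact (hv.continuousAt (hU.mem_nhds (hs hz))).mul hφ.continuousAt
  · refine (continuousAt_const (y := (0 : ℝ))).congr ?_
    filter_upwards [notMem_tsupport_iff_eventuallyEq.1 hz] with y hy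
    simp [hy]

theorem integrable_mul_of_tsupport (hU : IsOpen U) (hv : ContinuousOn v U) (hφ : Continuous φ)
    (hc : HasCompactSupport φ) (hs : tsupport φ ⊆ U) : Integrable fun z => v z * φ z :=
  (continuous_mul_of_tsupport hU hv hφ hs).integrable_of_hasCompactSupport hc.mul_left

theorem integral_mul_Dx (hU : IsOpen U) (hv : ContinuousOn v U) (hv' : ContinuousOn (Dx v) U)
    (hd : ∀ z ∈ U, HasDerivAt (fun y => v (z.1, y)) (Dx v z) z.2)
    (hφ : ContDiff ℝ ∞ φ) (hc : HasCompactSupport φ) (hs : tsupport φ ⊆ U) :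
    ∫ z, v z * Dx φ z = -∫ z, Dx v z * φ z := by
  have hsx := (tsupport_Dx_subset φ).trans hs
  have c0 := continuous_mul_of_tsupport hU hv hφ.continuous hs
  have c1 := continuous_mul_of_tsupport hU hv (contDiff_Dx hφ).continuous hsx
  have c2 := continuous_mul_of_tsupport hU hv' hφ.continuous hs
  have k0 : HasCompactSupport fun z => v z * φ z := hc.mul_left
  have k1 : HasCompactSupport fun z => v z * Dx φ z := (hasCompactSupport_Dx hc).mul_left
  have k2 : HasCompactSupport fun z => Dx v z * φ z := hc.mul_left
  have i1 := c1.integrable_of_hasCompactSupport k1 (μ := volume)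
  have i2 := c2.integrable_of_hasCompactSupport k2 (μ := volume)
  rw [eq_neg_iff_add_eq_zero, ← integral_add i1 i2, Measure.volume_eq_prod,
    integral_prod _ (by exact i1.add i2)]
  refine integral_eq_zero_of_ae (ae_of_all _ fun s => ?_)
  have cs : Continuous fun y : ℝ => ((s, y) : ℝ × ℝ) := by fun_prop
  refine integral_eq_zero_of_hasDerivAt_of_integrable (f := fun y => v (s, y) * φ (s, y))
    (fun y => ?_)
    (((c1.comp cs).integrable_of_hasCompactSupport (hasCompactSupport_slice k1 s)).add
      ((c2.comp cs).integrable_of_hasCompactSupport (hasCompactSupport_slice k2 s)))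
    ((c0.comp cs).integrable_of_hasCompactSupport (hasCompactSupport_slice k0 s))
  by_cases hz : (s, y) ∈ tsupport φ
  · have h1 := (hd _ (hs hz)).mul (hasDerivAt_Dx (z := (s, y)) (hφ.differentiable (by simp) _))
    exact h1.congr_deriv (by ring)
  · have h0 := notMem_tsupport_iff_eventuallyEq.1 hz
    have e1 : φ (s, y) = 0 := h0.self_of_nhds
    have e2 : Dx φ (s, y) = 0 := by rw [Dx_congr h0, Dx_zero]; rfl
    rw [e1, e2, mul_zero, mul_zero, add_zero]
    refine (hasDerivAt_const y (0 : ℝ)).congr_of_eventuallyEq ?_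
    filter_upwards [eventually_slice_snd (z := (s, y)) h0] with x hx
    simp [hx]

/-- The space derivative of a weak solution is a weak solution. -/
theorem WeakEq.space_derivative (hU : IsOpen U) (h : WeakEq (1 / 2) U v G)
    (hv' : ContinuousOn (Dx v) U) (hvd : ∀ z ∈ U, HasDerivAt (fun y => v (z.1, y)) (Dx v z) z.2)
    (hG' : ContinuousOn (Dx G) U)
    (hGd : ∀ z ∈ U, HasDerivAt (fun y => G (z.1, y)) (Dx G z) z.2) :
    WeakEq (1 / 2) U (Dx v) (Dx G) := by
  refine ⟨hv', hG', fun φ hφ hc hs => ?_⟩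
  have hψ : ContDiff ℝ ∞ fun z => -Dt φ z - 1 / 2 * Dx (Dx φ) z :=
    (contDiff_Dt hφ).neg.sub (contDiff_const.mul (contDiff_Dx (contDiff_Dx hφ)))
  have hψs : tsupport (fun z => -Dt φ z - 1 / 2 * Dx (Dx φ) z) ⊆ tsupport φ := by
    refine closure_minimal (fun z hz => ?_) (isClosed_tsupport _)
    by_contra h0
    have z1 : Dt φ z = 0 := image_eq_zero_of_notMem_tsupport fun h => h0 (tsupport_Dt_subset _ h)
    have z2 : Dx (Dx φ) z = 0 := image_eq_zero_of_notMem_tsupport fun h =>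
      h0 (tsupport_Dx_subset _ (tsupport_Dx_subset _ h))
    exact hz (by simp [z1, z2])
  have h1 := integral_mul_Dx hU h.continuousOn hv' hvd hψ
    (hc.of_isClosed_subset (isClosed_tsupport _) hψs) (hψs.trans hs)
  have h2 := h.eq (Dx φ) (contDiff_Dx hφ) (hasCompactSupport_Dx hc)
    ((tsupport_Dx_subset φ).trans hs)
  have h3 := integral_mul_Dx hU h.continuousOn_source hG' hGd hφ hc hs
  have h4 : Dx (fun z => -Dt φ z - 1 / 2 * Dx (Dx φ) z) =
      fun z => -Dt (Dx φ) z - 1 / 2 * Dx (Dx (Dx φ)) z := by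
    funext z
    rw [← Dx_Dt_comm ((contDiff_infty.1 hφ 2).contDiffAt)]
    exact (((WeakNoise.hasDerivAt_Dx ((contDiff_Dt hφ).differentiable (by simp) z)).neg).sub
      ((WeakNoise.hasDerivAt_Dx
        ((contDiff_Dx (contDiff_Dx hφ)).differentiable (by simp) z)).const_mul _)).deriv
  rw [h4] at h1
  linarith

/-- A weak solution with two continuous space derivatives has a continuous weak time derivative. -/
theorem WeakEq.time_derivative (hU : IsOpen U) (h : WeakEq (1 / 2) U v G)
    (hv' : ContinuousOn (Dx v) U) (hvd : ∀ z ∈ U, HasDerivAt (fun y => v (z.1, y)) (Dx v z) z.2)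
    (hv'' : ContinuousOn (Dx (Dx v)) U)
    (hvd' : ∀ z ∈ U, HasDerivAt (fun y => Dx v (z.1, y)) (Dx (Dx v) z) z.2) :
    WeakEq 0 U v fun z => 1 / 2 * Dx (Dx v) z + G z := by
  refine ⟨h.continuousOn, (continuousOn_const.mul hv'').add h.continuousOn_source,
    fun φ hφ hc hs => ?_⟩
  have h1 := h.eq φ hφ hc hs
  have h2 := integral_mul_Dx hU h.continuousOn hv' hvd (contDiff_Dx hφ) (hasCompactSupport_Dx hc)
    ((tsupport_Dx_subset φ).trans hs)
  have h3 := integral_mul_Dx hU hv' hv'' hvd' hφ hc hs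
  have i1 := integrable_mul_of_tsupport hU h.continuousOn (contDiff_Dt hφ).continuous
    (hasCompactSupport_Dt hc) ((tsupport_Dt_subset φ).trans hs)
  have i2 := integrable_mul_of_tsupport hU h.continuousOn (contDiff_Dx (contDiff_Dx hφ)).continuous
    (hasCompactSupport_Dx (hasCompactSupport_Dx hc))
    ((tsupport_Dx_subset _).trans ((tsupport_Dx_subset φ).trans hs))
  have i3 := integrable_mul_of_tsupport hU hv'' hφ.continuous hc hs
  have i4 := integrable_mul_of_tsupport hU h.continuousOn_source hφ.continuous hc hs
  have e1 : ∫ z, v z * (-Dt φ z - 1 / 2 * Dx (Dx φ) z) =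
      (∫ z, -(v z * Dt φ z)) - 1 / 2 * ∫ z, v z * Dx (Dx φ) z := by
    rw [← integral_const_mul, ← integral_sub (by exact i1.neg) (i2.const_mul _)]
    exact integral_congr_ae (ae_of_all _ fun z => by ring)
  have e2 : ∫ z, v z * (-Dt φ z - 0 * Dx (Dx φ) z) = ∫ z, -(v z * Dt φ z) :=
    integral_congr_ae (ae_of_all _ fun z => by ring)
  have e3 : ∫ z, (1 / 2 * Dx (Dx v) z + G z) * φ z =
      1 / 2 * (∫ z, Dx (Dx v) z * φ z) + ∫ z, G z * φ z := by
    rw [← integral_const_mul, ← integral_add (i3.const_mul _) i4]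
    exact integral_congr_ae (ae_of_all _ fun z => by ring)
  rw [e2, e3]
  linarith

/-! ### Bootstrapping the regularity -/

/-- `v` and its first `j` space derivatives exist and are `n` times continuously differentiable
on `U`. -/
def SpaceDiff (n : ℕ) : ℕ → Set (ℝ × ℝ) → (ℝ × ℝ → ℝ) → Prop
  | 0, U, v => ContDiffOn ℝ n v U
  | j + 1, U, v => ContDiffOn ℝ n v U ∧
      (∀ z ∈ U, HasDerivAt (fun y => v (z.1, y)) (Dx v z) z.2) ∧ SpaceDiff n j U (Dx v)

variable {n j : ℕ}

theorem SpaceDiff.contDiffOn : ∀ {j : ℕ} {v : ℝ × ℝ → ℝ}, SpaceDiff n j U v → ContDiffOn ℝ n v U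
  | 0, _, h => h
  | _ + 1, _, h => h.1

theorem SpaceDiff.continuousOn (h : SpaceDiff n j U v) : ContinuousOn v U :=
  h.contDiffOn.continuousOn

theorem SpaceDiff.of_succ : ∀ {j : ℕ} {v : ℝ × ℝ → ℝ}, SpaceDiff n (j + 1) U v → SpaceDiff n j U v
  | 0, _, h => h.1
  | _ + 1, _, h => ⟨h.1, h.2.1, h.2.2.of_succ⟩

theorem Dx_eqOn (hU : IsOpen U) (h : EqOn v w U) : EqOn (Dx v) (Dx w) U := fun _ hz =>
  Dx_congr (h.eventuallyEq_of_mem (hU.mem_nhds hz))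

theorem SpaceDiff.congr (hU : IsOpen U) : ∀ {j : ℕ} {v w : ℝ × ℝ → ℝ}, SpaceDiff n j U v →
    EqOn w v U → SpaceDiff n j U w
  | 0, _, _, h, he => ContDiffOn.congr h he
  | j + 1, v, w, h, he => by
    refine ⟨h.1.congr he, fun z hz => ?_, h.2.2.congr hU (Dx_eqOn hU he)⟩
    rw [Dx_eqOn hU he hz]
    refine (h.2.1 z hz).congr_of_eventuallyEq ?_
    exact eventually_slice_snd (z := z) (he.eventuallyEq_of_mem (hU.mem_nhds hz))

theorem SpaceDiff.add (hU : IsOpen U) : ∀ {j : ℕ} {v w : ℝ × ℝ → ℝ}, SpaceDiff n j U v →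
    SpaceDiff n j U w → SpaceDiff n j U fun z => v z + w z
  | 0, _, _, hv, hw => ContDiffOn.add hv hw
  | j + 1, v, w, hv, hw => by
    have hd := fun z hz => (hv.2.1 z hz).add (hw.2.1 z hz)
    have he : EqOn (Dx fun z => v z + w z) (fun z => Dx v z + Dx w z) U := fun z hz =>
      (hd z hz).deriv
    refine ⟨hv.1.add hw.1, fun z hz => ?_, (hv.2.2.add hU hw.2.2).congr hU he⟩
    rw [he hz]; exact hd z hz

theorem SpaceDiff.mul (hU : IsOpen U) : ∀ {j : ℕ} {v w : ℝ × ℝ → ℝ}, SpaceDiff n j U v →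
    SpaceDiff n j U w → SpaceDiff n j U fun z => v z * w z
  | 0, _, _, hv, hw => ContDiffOn.mul hv hw
  | j + 1, v, w, hv, hw => by
    have hd := fun z hz => (hv.2.1 z hz).mul (hw.2.1 z hz)
    have he : EqOn (Dx fun z => v z * w z) (fun z => Dx v z * w z + v z * Dx w z) U := fun z hz =>
      (hd z hz).deriv
    refine ⟨hv.1.mul hw.1, fun z hz => ?_,
      ((hv.2.2.mul hU hw.of_succ).add hU (hv.of_succ.mul hU hw.2.2)).congr hU he⟩
    rw [he hz]; exact hd z hz

theorem SpaceDiff.refl (T : ℝ) : ∀ {j : ℕ} {v : ℝ × ℝ → ℝ}, SpaceDiff n j U v →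
    SpaceDiff n j (refl T ⁻¹' U) fun z => v (refl T z)
  | 0, _, h => by
    have : ContDiff ℝ n (WeakNoise.refl T) := (contDiff_const.sub contDiff_fst).prodMk contDiff_snd
    exact ContDiffOn.comp h this.contDiffOn fun _ hz => hz
  | j + 1, _, h => ⟨SpaceDiff.refl T (j := 0) h.1, fun z hz => h.2.1 _ hz, h.2.2.refl T⟩

/-- A weak solution has one space derivative more than its source. -/
theorem WeakEq.spaceDiff (hU : IsOpen U) : ∀ {j : ℕ} {v G : ℝ × ℝ → ℝ}, WeakEq (1 / 2) U v G →
    SpaceDiff 0 j U G → SpaceDiff 0 (j + 1) U v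
  | 0, _, _, h, _ =>
    ⟨contDiffOn_zero.2 h.continuousOn, (h.hasDerivAt_Dx hU).2,
      contDiffOn_zero.2 (h.hasDerivAt_Dx hU).1⟩
  | j + 1, v, G, h, hG => by
    have h1 := h.hasDerivAt_Dx hU
    exact ⟨contDiffOn_zero.2 h.continuousOn, h1.2,
      (h.space_derivative hU h1.1 h1.2 hG.2.2.continuousOn hG.2.1).spaceDiff hU hG.2.2⟩

/-- A function with `Cⁿ` partial derivatives is `Cⁿ⁺¹`. -/
theorem contDiffOn_succ_of_partial (hU : IsOpen U) {D : ℝ × ℝ → ℝ}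
    (hx : ∀ z ∈ U, HasDerivAt (fun y => v (z.1, y)) (Dx v z) z.2)
    (ht : ∀ z ∈ U, HasDerivAt (fun s => v (s, z.2)) (D z) z.1)
    (hxc : ContDiffOn ℝ n (Dx v) U) (htc : ContDiffOn ℝ n D U) : ContDiffOn ℝ (n + 1 : ℕ) v U := by
  have key : ∀ z ∈ U, HasFDerivAt v ((ContinuousLinearMap.toSpanSingleton ℝ (D z)).coprod
      (ContinuousLinearMap.toSpanSingleton ℝ (Dx v z))) z := fun z hz => by
    have hs : Continuous fun c : ℝ => ContinuousLinearMap.toSpanSingleton ℝ c :=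
      (ContinuousLinearMap.toSpanSingletonLE ℝ ℝ ℝ).toLinearMap.continuous_of_finiteDimensional
    refine (hasStrictFDerivAt_uncurry_coprod (𝕜 := ℝ) (u := z) (f := fun s y => v (s, y))
      (f₁ := fun s y => ContinuousLinearMap.toSpanSingleton ℝ (D (s, y)))
      (f₂ := fun s y => ContinuousLinearMap.toSpanSingleton ℝ (Dx v (s, y))) ?_ ?_ ?_ ?_).hasFDerivAt
    · filter_upwards [hU.mem_nhds hz] with y hy
      exact (ht y hy).hasFDerivAt
    · filter_upwards [hU.mem_nhds hz] with y hy
      exact (hx y hy).hasFDerivAt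
    · exact hs.continuousAt.comp (htc.continuousOn.continuousAt (hU.mem_nhds hz))
    · exact hs.continuousAt.comp (hxc.continuousOn.continuousAt (hU.mem_nhds hz))
  rw [Nat.cast_add, Nat.cast_one, contDiffOn_succ_iff_fderiv_of_isOpen hU]
  refine ⟨fun z hz => (key z hz).differentiableAt.differentiableWithinAt, by simp, ?_⟩
  have h1 : ContDiffOn ℝ n (fun z => D z • ContinuousLinearMap.fst ℝ ℝ ℝ +
      Dx v z • ContinuousLinearMap.snd ℝ ℝ ℝ) U :=
    (htc.smul contDiffOn_const).add (hxc.smul contDiffOn_const)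
  refine h1.congr fun z hz => ?_
  rw [(key z hz).fderiv]
  ext <;> simp

/-- A weak solution with two continuous space derivatives satisfies the equation pointwise. -/
theorem WeakEq.hasDerivAt_time (hU : IsOpen U) (h : WeakEq (1 / 2) U v G) (hv : SpaceDiff n 2 U v) :
    ∀ z ∈ U, HasDerivAt (fun s => v (s, z.2)) (1 / 2 * Dx (Dx v) z + G z) z.1 := fun _ hz =>
  (h.time_derivative hU hv.2.2.continuousOn hv.2.1 hv.2.2.2.2.continuousOn
    hv.2.2.2.1).hasDerivAt_Dt hU hz

/-- If all space derivatives of a weak solution and of its source are `Cⁿ`, those of the solution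
are `Cⁿ⁺¹`, because the equation expresses the time derivative by space derivatives. -/
theorem WeakEq.spaceDiff_succ (hU : IsOpen U) : ∀ {j : ℕ} {v G : ℝ × ℝ → ℝ},
    WeakEq (1 / 2) U v G → (∀ j, SpaceDiff n j U G) → (∀ j, SpaceDiff n j U v) →
    SpaceDiff (n + 1) j U v
  | 0, v, G, h, hG, hv =>
    contDiffOn_succ_of_partial hU (hv 1).2.1 (h.hasDerivAt_time hU (hv 2)) (hv 1).2.2
      ((contDiffOn_const.mul (hv 2).2.2.2.2).add (hG 0))
  | j + 1, v, G, h, hG, hv =>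
    ⟨WeakEq.spaceDiff_succ hU (j := 0) h hG hv, (hv 1).2.1,
      (h.space_derivative hU (hv 1).2.2.continuousOn (hv 1).2.1 (hG 1).2.2.continuousOn
        (hG 1).2.1).spaceDiff_succ hU (fun j => (hG (j + 1)).2.2) fun j => (hv (j + 1)).2.2⟩

end

section

variable {U : Set (ℝ × ℝ)} {p q : ℝ × ℝ → ℝ} {T : ℝ}

/-- Continuous weak solutions of the coupled system are smooth and solve it classically. The
second equation runs backward in time, so it is stated for the time reversal of `p`. -/
theorem system_regular (hU : IsOpen U) (hq : WeakEq (1 / 2) U q fun z => p z * q z ^ 2)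
    (hp : WeakEq (1 / 2) (refl T ⁻¹' U) (fun z => p (refl T z))
      fun z => p (refl T z) ^ 2 * q (refl T z)) :
    (ContDiffOn ℝ ∞ q U ∧ ContDiffOn ℝ ∞ p U) ∧ ∀ z ∈ U,
      heatOp q z = p z * q z ^ 2 ∧ -Dt p z - 1 / 2 * Dx (Dx p) z = p z ^ 2 * q z := by
  have hU' : IsOpen (refl T ⁻¹' U) := hU.preimage (continuous_refl T)
  have hback : ∀ {n j}, SpaceDiff n j (refl T ⁻¹' U) (fun z => p (refl T z)) → SpaceDiff n j U p :=
    fun {n j} h => by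
      have := h.refl T
      simpa only [← preimage_comp, Function.comp_def, refl_refl, preimage_id'] using this
  have hF : ∀ {n j}, SpaceDiff n j U q → SpaceDiff n j U p → SpaceDiff n j U fun z => p z * q z ^ 2 :=
    fun {n j} h1 h2 => (h2.mul hU (h1.mul hU h1)).congr hU fun z _ => by simp only [sq]
  have hH : ∀ {n j}, SpaceDiff n j U q → SpaceDiff n j U p →
      SpaceDiff n j (refl T ⁻¹' U) fun z => p (refl T z) ^ 2 * q (refl T z) :=
    fun {n j} h1 h2 => (((h2.mul hU h2).mul hU h1).refl T).congr hU' fun z _ => by simp only [sq]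
  -- the coupling gains space derivatives one by one
  have h0 : ∀ j, SpaceDiff 0 j U q ∧ SpaceDiff 0 j U p := fun j => by
    induction j with
    | zero =>
      exact ⟨contDiffOn_zero.2 hq.continuousOn, hback (j := 0) (contDiffOn_zero.2 hp.continuousOn)⟩
    | succ j ih =>
      exact ⟨hq.spaceDiff hU (hF ih.1 ih.2), hback (hp.spaceDiff hU' (hH ih.1 ih.2))⟩
  -- then the equations trade space derivatives for time derivatives
  have hn : ∀ n j, SpaceDiff n j U q ∧ SpaceDiff n j U p := fun n => by
    induction n with
    | zero => exact h0
    | succ n ih =>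
      exact fun j => ⟨hq.spaceDiff_succ hU (fun j => hF (ih j).1 (ih j).2) fun j => (ih j).1,
        hback (hp.spaceDiff_succ hU' (fun j => hH (ih j).1 (ih j).2) fun j => (ih j).2.refl T)⟩
  refine ⟨⟨contDiffOn_infty.2 fun n => (hn n 0).1.contDiffOn,
    contDiffOn_infty.2 fun n => (hn n 0).2.contDiffOn⟩, fun z hz => ⟨?_, ?_⟩⟩
  · rw [heatOp, Dt, (hq.hasDerivAt_time hU (hn 0 2).1 z hz).deriv]; ring
  · have h1 := hp.hasDerivAt_time hU' ((hn 0 2).2.refl T) (refl T z) (by simpa [refl_refl] using hz)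
    have h2 : Dt (fun z => p (refl T z)) (refl T z) = -Dt p z := by
      have := deriv_comp_const_sub (f := fun s => p (s, z.2)) T (T - z.1)
      rw [sub_sub_cancel] at this
      exact this
    have h3 : 1 / 2 * Dx (Dx p) z + p z ^ 2 * q z = -Dt p z := by
      rw [← h2, Dt, h1.deriv, refl_refl]
      congr 2
      change Dx (Dx p) z = Dx (Dx p) (refl T (refl T z))
      rw [refl_refl]
    linarith

end

/-! ### Duhamel solutions are weak solutions -/

section

variable {φ ψ : ℝ × ℝ → ℝ} {μ : Measure ℝ} {w : ℝ × ℝ → ℝ} {R : ℝ}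

/-- A test function is the backward heat potential of its image under the adjoint heat operator. -/
theorem eq_integral_hk_mul_adjoint (hφ : ContDiff ℝ ∞ φ) (hc : HasCompactSupport φ)
    (hψ : ∀ z, ψ z = -Dt φ z - 1 / 2 * Dx (Dx φ) z) (z : ℝ × ℝ) :
    ∫ a : ℝ × ℝ, hk (a.1 - z.1) (a.2 - z.2) * ψ a = φ z := by
  have hu : ContDiff ℝ ∞ fun y => φ (0 - y) := hφ.comp (contDiff_const.sub contDiff_id)
  have huc : HasCompactSupport fun y => φ (0 - y) := by
    simp only [zero_sub]; exact hc.comp_homeomorph (Homeomorph.neg _)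
  have h := eq_integral_hk_mul_heatOp hu huc (-z)
  have hop : heatOp (fun y => φ (0 - y)) = fun y => ψ (-y) := by
    funext y
    rw [heatOp, Dt_comp_const_sub, Dx_comp_const_sub, Dx_neg, Dx_comp_const_sub, hψ]
    simp
  rw [hop] at h
  simp only [zero_sub, neg_neg] at h
  rw [← h, ← integral_neg_eq_self]
  refine integral_congr_ae (ae_of_all _ fun y => ?_)
  simp only [Prod.fst_neg, Prod.snd_neg]
  congr 2 <;> ring

theorem continuous_adjoint (hφ : ContDiff ℝ ∞ φ)
    (hψ : ∀ z, ψ z = -Dt φ z - 1 / 2 * Dx (Dx φ) z) : Continuous ψ := by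
  rw [show ψ = fun z => -Dt φ z - 1 / 2 * Dx (Dx φ) z from funext hψ]
  exact (contDiff_Dt hφ).continuous.neg.sub
    (continuous_const.mul (contDiff_Dx (contDiff_Dx hφ)).continuous)

theorem adjoint_eq_zero (hψ : ∀ z, ψ z = -Dt φ z - 1 / 2 * Dx (Dx φ) z) {z : ℝ × ℝ}
    (hz : z ∉ tsupport φ) : ψ z = 0 := by
  have z1 : Dt φ z = 0 := image_eq_zero_of_notMem_tsupport fun h => hz (tsupport_Dt_subset _ h)
  have z2 : Dx (Dx φ) z = 0 := image_eq_zero_of_notMem_tsupport fun h =>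
    hz (tsupport_Dx_subset _ (tsupport_Dx_subset _ h))
  rw [hψ, z1, z2]; simp

/-- A function that is integrable on the support of `φ` is integrable against the image `ψ` of `φ`
under the adjoint heat operator. -/
theorem integrable_mul_adjoint (hφ : ContDiff ℝ ∞ φ) (hc : HasCompactSupport φ)
    (hψ : ∀ z, ψ z = -Dt φ z - 1 / 2 * Dx (Dx φ) z) {g : ℝ × ℝ → ℝ}
    (hg : IntegrableOn g (tsupport φ)) : Integrable fun z => g z * ψ z := by
  have hcψ := continuous_adjoint hφ hψ
  have h1 : IntegrableOn (fun z => g z * ψ z) (tsupport φ) :=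
    hg.mul_continuousOn hcψ.continuousOn hc
  rw [← integrable_indicator_iff (isClosed_tsupport φ).measurableSet] at h1
  refine h1.congr (ae_of_all _ fun z => ?_)
  by_cases hz : z ∈ tsupport φ
  · rw [indicator_of_mem hz]
  · simp only [indicator_of_notMem hz, adjoint_eq_zero hψ hz, mul_zero]

/-- The heat flow solves the heat equation weakly, with initial condition `μ`. -/
theorem integral_heatFlow_mul [SFinite μ] (hμ : HeatFinite μ) (hφ : ContDiff ℝ ∞ φ)
    (hc : HasCompactSupport φ) (hψ : ∀ z, ψ z = -Dt φ z - 1 / 2 * Dx (Dx φ) z)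
    (hg : IntegrableOn (heatFlow 0 μ) (tsupport φ)) :
    ∫ a, heatFlow 0 μ a * ψ a = ∫ y, φ (0, y) ∂μ := by
  have hcψ := continuous_adjoint hφ hψ
  have hi := integrable_mul_adjoint hφ hc hψ hg
  have hm : Measurable fun x : (ℝ × ℝ) × ℝ => hk (x.1.1 - 0) (x.1.2 - x.2) * ψ x.1 :=
    (measurable_hk_comp (by fun_prop) (by fun_prop)).mul (hcψ.measurable.comp measurable_fst)
  have hint : Integrable (fun x : (ℝ × ℝ) × ℝ => hk (x.1.1 - 0) (x.1.2 - x.2) * ψ x.1)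
      ((volume : Measure (ℝ × ℝ)).prod μ) := by
    rw [integrable_prod_iff hm.aestronglyMeasurable]
    refine ⟨ae_of_all _ fun a => (hμ.integrable (a.1 - 0) a.2).mul_const (ψ a), ?_⟩
    refine hi.norm.congr (ae_of_all _ fun a => ?_)
    simp only [norm_mul]
    rw [integral_mul_const, Real.norm_of_nonneg (heatFlow_nonneg a), heatFlow]
    congr 1
    exact integral_congr_ae (ae_of_all _ fun y => (Real.norm_of_nonneg (hk_nonneg _ _)).symm)
  calc ∫ a, heatFlow 0 μ a * ψ a = ∫ a : ℝ × ℝ, ∫ y, hk (a.1 - 0) (a.2 - y) * ψ a ∂μ := by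
        refine integral_congr_ae (ae_of_all _ fun a => ?_)
        simp only [heatFlow]; rw [integral_mul_const]
    _ = ∫ y, (∫ a : ℝ × ℝ, hk (a.1 - 0) (a.2 - y) * ψ a) ∂μ :=
        integral_integral_swap (f := fun (a : ℝ × ℝ) y => hk (a.1 - 0) (a.2 - y) * ψ a) hint
    _ = _ := integral_congr_ae (ae_of_all _ fun y => eq_integral_hk_mul_adjoint hφ hc hψ (0, y))

theorem integrableOn_sol {g : ℝ × ℝ → ℝ} (hw : PotBound w R) (hg : FreeSol g)
    (hg0 : ∀ z : ℝ × ℝ, z.1 ≤ 0 → g z = 0) {K : Set (ℝ × ℝ)} (hK : IsCompact K)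
    (hgi : IntegrableOn g K) :
    IntegrableOn (fun z => Real.exp (rate R * z.1) * g z) K ∧ IntegrableOn (sol w g) K := by
  have hc : Continuous fun z : ℝ × ℝ => Real.exp (rate R * z.1) := by fun_prop
  have h1 := hgi.continuousOn_mul hc.continuousOn hK
  refine ⟨h1, (h1.const_mul 2).mono' (aestronglyMeasurable_sol hw hg hg0).restrict
    (ae_of_all _ fun z => abs_sol_le' hw hg hg0 z)⟩

/-- The weak form of the Duhamel equation. -/
theorem integral_sol_mul [SFinite μ] (hμ : HeatFinite μ) (hw : PotBound w R)
    (hφ : ContDiff ℝ ∞ φ) (hc : HasCompactSupport φ)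
    (hψ : ∀ z, ψ z = -Dt φ z - 1 / 2 * Dx (Dx φ) z)
    (hgi : IntegrableOn (heatFlow 0 μ) (tsupport φ)) :
    ∫ a, sol w (heatFlow 0 μ) a * ψ a =
      (∫ y, φ (0, y) ∂μ) + ∫ z, w z * sol w (heatFlow 0 μ) z * φ z := by
  set g := heatFlow 0 μ with hgdef
  have hg : FreeSol g := freeSol_heatFlow hμ
  have hg0 : ∀ z : ℝ × ℝ, z.1 ≤ 0 → g z = 0 := fun z hz => heatFlow_of_le hz
  have hcψ := continuous_adjoint hφ hψ
  have hs := integrableOn_sol hw hg hg0 hc hgi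
  have hsm := aestronglyMeasurable_sol hw hg hg0
  have i1 := integrable_mul_adjoint hφ hc hψ hgi
  have i2 := integrable_mul_adjoint hφ hc hψ hs.2
  have i3 := integrable_mul_adjoint hφ hc hψ hs.1
  have hm : AEStronglyMeasurable (fun x : (ℝ × ℝ) × (ℝ × ℝ) =>
      hk (x.1.1 - x.2.1) (x.1.2 - x.2.2) * (w x.2 * sol w g x.2) * ψ x.1)
      ((volume : Measure (ℝ × ℝ)).prod volume) :=
    ((measurable_hk_comp (by fun_prop) (by fun_prop)).aestronglyMeasurable.mul
      ((hw.aesm.mul hsm).comp_snd)).mul (hcψ.measurable.comp measurable_fst).aestronglyMeasurable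
  have hint : Integrable (fun x : (ℝ × ℝ) × (ℝ × ℝ) =>
      hk (x.1.1 - x.2.1) (x.1.2 - x.2.2) * (w x.2 * sol w g x.2) * ψ x.1)
      ((volume : Measure (ℝ × ℝ)).prod volume) := by
    rw [integrable_prod_iff hm]
    refine ⟨ae_of_all _ fun a => (integrable_hk_mul_sol hw hg hg0 a).mul_const (ψ a), ?_⟩
    refine i3.norm.mono' hm.norm.integral_prod_right' (ae_of_all _ fun a => ?_)
    rw [Real.norm_of_nonneg (integral_nonneg fun _ => norm_nonneg _)]
    simp only [norm_mul _ (ψ a)]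
    rw [integral_mul_const]
    have := integral_abs_hk_mul_le hw hg (rate_pos R) (by norm_num) (rate_le R) hsm zero_le_two
      (abs_sol_le' hw hg hg0) a
    refine mul_le_mul_of_nonneg_right (this.trans (le_of_eq ?_)) (norm_nonneg _)
    rw [Real.norm_of_nonneg (mul_nonneg (Real.exp_pos _).le (hg.nonneg a))]
    norm_num
  have hv : ∀ a, volterra w (sol w g) a * ψ a =
      ∫ z : ℝ × ℝ, hk (a.1 - z.1) (a.2 - z.2) * (w z * sol w g z) * ψ a := fun a => by
    rw [integral_mul_const]; rfl
  have i4 : Integrable fun a => volterra w (sol w g) a * ψ a := by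
    refine (i2.sub i1).congr (ae_of_all _ fun a => ?_)
    simp only [Pi.sub_apply, sol_eq hw hg hg0 a]; ring
  calc ∫ a, sol w g a * ψ a = ∫ a, g a * ψ a + volterra w (sol w g) a * ψ a :=
        integral_congr_ae (ae_of_all _ fun a => by simp only [sol_eq hw hg hg0 a]; ring)
    _ = (∫ a, g a * ψ a) + ∫ a, volterra w (sol w g) a * ψ a := integral_add i1 i4
    _ = _ := by
      rw [integral_heatFlow_mul hμ hφ hc hψ hgi]
      congr 1
      simp_rw [hv]
      rw [integral_integral_swap (f := fun a z : ℝ × ℝ =>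
        hk (a.1 - z.1) (a.2 - z.2) * (w z * sol w g z) * ψ a) hint]
      refine integral_congr_ae (ae_of_all _ fun z => ?_)
      simp only
      rw [← eq_integral_hk_mul_adjoint hφ hc hψ z, ← integral_const_mul]
      exact integral_congr_ae (ae_of_all _ fun a => by ring)

/-- Away from the support of the initial condition, a Duhamel solution is a weak solution. -/
theorem weakEq_sol [SFinite μ] (hμ : HeatFinite μ) (hw : PotBound w R) {U : Set (ℝ × ℝ)}
    (hgc : ∀ z ∈ U, ContinuousAt (heatFlow 0 μ) z)
    (hμU : ∀ᵐ y ∂μ, (0, y) ∉ U) {G : ℝ × ℝ → ℝ} (hG : ContinuousOn G U)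
    (hwG : ∀ᵐ z, z ∈ U → w z * sol w (heatFlow 0 μ) z = G z) :
    WeakEq (1 / 2) U (sol w (heatFlow 0 μ)) G := by
  have hg : FreeSol (heatFlow 0 μ) := freeSol_heatFlow hμ
  have hg0 : ∀ z : ℝ × ℝ, z.1 ≤ 0 → heatFlow 0 μ z = 0 := fun z hz => heatFlow_of_le hz
  refine ⟨fun z hz => (continuousAt_sol hw hg hg0 (hgc z hz)).continuousWithinAt, hG,
    fun φ hφ hc hs => ?_⟩
  have hcon : ContinuousOn (heatFlow 0 μ) (tsupport φ) := fun z hz =>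
    (hgc z (hs hz)).continuousWithinAt
  have hgi : IntegrableOn (heatFlow 0 μ) (tsupport φ) := hcon.integrableOn_compact hc
  rw [integral_sol_mul hμ hw hφ hc (fun _ => rfl) hgi]
  have h0 : ∫ y, φ (0, y) ∂μ = 0 := by
    refine integral_eq_zero_of_ae ?_
    filter_upwards [hμU] with y hy
    exact image_eq_zero_of_notMem_tsupport fun h => hy (hs h)
  rw [h0, zero_add]
  refine integral_congr_ae ?_
  filter_upwards [hwG] with z hz
  by_cases h : z ∈ tsupport φ
  · rw [hz (hs h)]
  · rw [image_eq_zero_of_notMem_tsupport h, mul_zero, mul_zero]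

end

theorem WeakEq.sum {ι : Type*} {s : Finset ι} {U : Set (ℝ × ℝ)} {c : ℝ} (hU : IsOpen U)
    {v G : ι → ℝ × ℝ → ℝ} (γ : ι → ℝ) (h : ∀ i ∈ s, WeakEq c U (v i) (G i)) :
    WeakEq c U (fun z => ∑ i ∈ s, γ i * v i z) fun z => ∑ i ∈ s, γ i * G i z := by
  refine ⟨continuousOn_finsetSum s fun i hi => continuousOn_const.mul (h i hi).continuousOn,
    continuousOn_finsetSum s fun i hi => continuousOn_const.mul (h i hi).continuousOn_source,
    fun φ hφ hc hs => ?_⟩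
  have hψs : Continuous fun z => -Dt φ z - c * Dx (Dx φ) z :=
    (contDiff_Dt hφ).continuous.neg.sub
      (continuous_const.mul (contDiff_Dx (contDiff_Dx hφ)).continuous)
  have hψ : tsupport (fun z => -Dt φ z - c * Dx (Dx φ) z) ⊆ tsupport φ := by
    refine closure_minimal (fun z hz => ?_) (isClosed_tsupport _)
    by_contra h0
    have z1 : Dt φ z = 0 := image_eq_zero_of_notMem_tsupport fun h => h0 (tsupport_Dt_subset _ h)
    have z2 : Dx (Dx φ) z = 0 := image_eq_zero_of_notMem_tsupport fun h =>
      h0 (tsupport_Dx_subset _ (tsupport_Dx_subset _ h))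
    exact hz (by simp [z1, z2])
  simp_rw [Finset.sum_mul, mul_assoc]
  rw [integral_finsetSum s fun i hi => (integrable_mul_of_tsupport hU (h i hi).continuousOn hψs
      (hc.of_isClosed_subset (isClosed_tsupport _) hψ) (hψ.trans hs)).const_mul (γ i),
    integral_finsetSum s fun i hi => (integrable_mul_of_tsupport hU (h i hi).continuousOn_source
      hφ.continuous hc hs).const_mul (γ i)]
  refine Finset.sum_congr rfl fun i hi => ?_
  rw [integral_const_mul, integral_const_mul, (h i hi).eq φ hφ hc hs]

/-! ### Critical pairs are smooth -/

/-- The forward solution started from `μ`. -/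
def fwd (μ : Measure ℝ) (w : ℝ × ℝ → ℝ) : ℝ × ℝ → ℝ := sol w (heatFlow 0 μ)

/-- The backward solution with terminal condition `∑ᵢ γᵢ δ_{ξᵢ}` at time `T`. It vanishes for times
`t ≥ T`. -/
def bwd (T : ℝ) {m : ℕ} (ξ γ : Fin m → ℝ) (w : ℝ × ℝ → ℝ) (z : ℝ × ℝ) : ℝ :=
  ∑ i, γ i * back w (T, ξ i) z

/-- The positive times, without the points that carry the terminal condition. -/
def regularSet (T : ℝ) {m : ℕ} (ξ : Fin m → ℝ) : Set (ℝ × ℝ) :=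
  {z | 0 < z.1 ∧ ∀ i, z ≠ (T, ξ i)}

/-- The potential `w` satisfies the Euler–Lagrange equation `w = p q` with multipliers `γ`, where
`q` and `p` are its forward and backward solutions. The bounds `R` and `Γ` control the norm of `w`
and the multipliers. -/
structure Critical (T : ℝ) (μ : Measure ℝ) {m : ℕ} (ξ : Fin m → ℝ) (R Γ : ℝ) (w : ℝ × ℝ → ℝ)
    (γ : Fin m → ℝ) : Prop where
  potBound : PotBound w R
  abs_le : ∀ i, |γ i| ≤ Γ
  eq_mul : ∀ᵐ z, w z = bwd T ξ γ w z * fwd μ w z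

section

variable {T R Γ : ℝ} {μ : Measure ℝ} {m : ℕ} {ξ γ : Fin m → ℝ} {w : ℝ × ℝ → ℝ}

theorem isOpen_regularSet (T : ℝ) (ξ : Fin m → ℝ) : IsOpen (regularSet T ξ) := by
  have : regularSet T ξ = {z | 0 < z.1} ∩ ⋂ i, {(T, ξ i)}ᶜ := by
    ext z; simp [regularSet]
  rw [this]
  exact (isOpen_lt continuous_const continuous_fst).inter
    (isOpen_iInter_of_finite fun i => isOpen_compl_singleton)

theorem bwd_refl (z : ℝ × ℝ) : bwd T ξ γ w (refl T z) =
    ∑ i, γ i * sol (fun y => w (refl T y)) (kern (ξ i)) z := by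
  simp [bwd, back]

theorem kern_eq_heatFlow (x : ℝ) : kern x = heatFlow 0 (Measure.dirac x) := funext fun z => by
  rw [heatFlow_dirac, sub_zero]; rfl

theorem continuousAt_kern {x : ℝ} {z : ℝ × ℝ} (hz : z ≠ (0, x)) : ContinuousAt (kern x) z := by
  have h1 : (z.1, z.2 - x) ≠ (0 : ℝ × ℝ) := fun h => hz (by
    have h1 := congrArg Prod.fst h
    have h2 := congrArg Prod.snd h
    simp only [Prod.fst_zero, Prod.snd_zero] at h1 h2
    exact Prod.ext h1 (sub_eq_zero.1 h2))
  exact ContinuousAt.comp (f := fun z : ℝ × ℝ => (z.1, z.2 - x)) (continuousAt_hk h1) (by fun_prop)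

theorem continuousAt_fwd [SFinite μ] (hμ : HeatFinite μ) (hw : PotBound w R) {z : ℝ × ℝ}
    (hz : 0 < z.1) : ContinuousAt (fwd μ w) z :=
  continuousAt_sol hw (freeSol_heatFlow hμ) (fun _ h => heatFlow_of_le h)
    (continuousAt_heatFlow hμ hz)

theorem continuousAt_back (hw : PotBound w R) {e z : ℝ × ℝ} (hz : z ≠ e) :
    ContinuousAt (back w e) z := by
  have h : refl e.1 z ≠ (0, e.2) := fun h => hz (by
    have h1 := congrArg Prod.fst h
    have h2 := congrArg Prod.snd h
    simp only [refl] at h1 h2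
    exact Prod.ext (by linarith) h2)
  exact ContinuousAt.comp (f := refl e.1) (continuousAt_sol (hw.refl e.1) (freeSol_kern e.2)
    (kern_of_nonpos e.2) (continuousAt_kern h)) (continuous_refl e.1).continuousAt

theorem continuousAt_bwd (hw : PotBound w R) {z : ℝ × ℝ} (hz : ∀ i, z ≠ (T, ξ i)) :
    ContinuousAt (bwd T ξ γ w) z := by
  have : bwd T ξ γ w = fun z => ∑ i, γ i * back w (T, ξ i) z := rfl
  rw [this]
  exact tendsto_finsetSum _ fun i _ => continuousAt_const.mul (continuousAt_back hw (hz i))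

theorem bwd_of_le (hw : PotBound w R) {z : ℝ × ℝ} (hz : T ≤ z.1) : bwd T ξ γ w z = 0 := by
  refine Finset.sum_eq_zero fun i _ => ?_
  have := abs_back_le hw (T, ξ i) z
  rw [hk_of_nonpos (by simpa using hz), mul_zero, mul_zero] at this
  rw [abs_nonpos_iff.1 this, mul_zero]

/-- The pair of a critical potential is smooth and solves the coupled system classically. -/
theorem Critical.regular [SFinite μ] (hμ : HeatFinite μ) (h : Critical T μ ξ R Γ w γ) :
    (ContDiffOn ℝ ∞ (fwd μ w) (regularSet T ξ) ∧ ContDiffOn ℝ ∞ (bwd T ξ γ w) (regularSet T ξ)) ∧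
    ∀ z ∈ regularSet T ξ,
      heatOp (fwd μ w) z = bwd T ξ γ w z * fwd μ w z ^ 2 ∧
      -Dt (bwd T ξ γ w) z - 1 / 2 * Dx (Dx (bwd T ξ γ w)) z = bwd T ξ γ w z ^ 2 * fwd μ w z := by
  have hw := h.potBound
  have hU := isOpen_regularSet T ξ
  have cq : ContinuousOn (fwd μ w) (regularSet T ξ) := fun z hz =>
    (continuousAt_fwd hμ hw hz.1).continuousWithinAt
  have cp : ContinuousOn (bwd T ξ γ w) (regularSet T ξ) := fun z hz =>
    (continuousAt_bwd hw hz.2).continuousWithinAt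
  have cr : ContinuousOn (refl T) (refl T ⁻¹' regularSet T ξ) := (continuous_refl T).continuousOn
  have hmaps : MapsTo (refl T) (refl T ⁻¹' regularSet T ξ) (regularSet T ξ) := fun _ h => h
  refine system_regular (T := T) hU ?_ ?_
  · refine weakEq_sol hμ hw (fun z hz => continuousAt_heatFlow hμ hz.1)
      (ae_of_all _ fun y hy => lt_irrefl _ hy.1) (cp.mul (cq.pow 2)) ?_
    filter_upwards [h.eq_mul] with z hz _
    rw [hz, fwd]; ring
  · have hsum : WeakEq (1 / 2) (refl T ⁻¹' regularSet T ξ)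
        (fun z => ∑ i, γ i * sol (fun y => w (refl T y)) (kern (ξ i)) z)
        fun z => ∑ i, γ i * (bwd T ξ γ w (refl T z) * fwd μ w (refl T z) *
          sol (fun y => w (refl T y)) (kern (ξ i)) z) := by
      refine WeakEq.sum (hU.preimage (continuous_refl T)) γ fun i _ => ?_
      have hne : ∀ z ∈ refl T ⁻¹' regularSet T ξ, z ≠ (0, ξ i) := fun z hz h0 =>
        hz.2 i (by rw [h0]; simp [refl])
      have ck : ∀ z ∈ refl T ⁻¹' regularSet T ξ, ContinuousAt (kern (ξ i)) z := fun z hz =>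
        continuousAt_kern (hne z hz)
      have hs : ContinuousOn (sol (fun y => w (refl T y)) (kern (ξ i)))
          (refl T ⁻¹' regularSet T ξ) := fun z hz =>
        (continuousAt_sol (hw.refl T) (freeSol_kern _) (kern_of_nonpos _)
          (ck z hz)).continuousWithinAt
      have hG := ((cp.comp cr hmaps).mul (cq.comp cr hmaps)).mul hs
      have hae : ∀ᵐ z, w (refl T z) = bwd T ξ γ w (refl T z) * fwd μ w (refl T z) :=
        (measurePreserving_refl T).quasiMeasurePreserving.ae h.eq_mul
      rw [kern_eq_heatFlow] at ck hG ⊢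
      refine weakEq_sol (heatFinite_dirac _) (hw.refl T) ck ?_ hG ?_
      · rw [ae_dirac_iff]
        · exact fun h0 => hne _ h0 rfl
        · exact ((hU.preimage (continuous_refl T)).measurableSet.compl).preimage (by fun_prop)
      · filter_upwards [hae] with z hz _
        rw [hz]
    have e1 : (fun z => bwd T ξ γ w (refl T z)) =
        fun z => ∑ i, γ i * sol (fun y => w (refl T y)) (kern (ξ i)) z :=
      funext fun z => bwd_refl z
    have e2 : (fun z => bwd T ξ γ w (refl T z) ^ 2 * fwd μ w (refl T z)) =
        fun z => ∑ i, γ i * (bwd T ξ γ w (refl T z) * fwd μ w (refl T z) *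
          sol (fun y => w (refl T y)) (kern (ξ i)) z) := funext fun z => by
      calc _ = (bwd T ξ γ w (refl T z) * fwd μ w (refl T z)) * bwd T ξ γ w (refl T z) := by ring
        _ = (bwd T ξ γ w (refl T z) * fwd μ w (refl T z)) *
            ∑ i, γ i * sol (fun y => w (refl T y)) (kern (ξ i)) z := by
          nth_rw 2 [bwd_refl]
        _ = _ := by
          rw [Finset.mul_sum]
          exact Finset.sum_congr rfl fun i _ => by ring
    rw [e1, e2]
    exact hsum

end

/-! ### Iterated space derivatives -/

section

variable {u v F : ℝ × ℝ → ℝ} {z : ℝ × ℝ} {U : Set (ℝ × ℝ)}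

theorem Dx_iterate_eq (u : ℝ × ℝ → ℝ) (j : ℕ) (z : ℝ × ℝ) :
    Dx^[j] u z = iteratedDeriv j (fun y => u (z.1, y)) z.2 := by
  induction j generalizing z with
  | zero => simp
  | succ j ih =>
    rw [Function.iterate_succ_apply', iteratedDeriv_succ, Dx]
    congr 1
    funext y
    exact ih (z.1, y)

theorem Dx_iterate_refl (T : ℝ) (u : ℝ × ℝ → ℝ) (j : ℕ) (z : ℝ × ℝ) :
    Dx^[j] (fun y => u (refl T y)) z = Dx^[j] u (refl T z) := by
  rw [Dx_iterate_eq, Dx_iterate_eq]; rfl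

theorem contDiffAt_slice (h : ContDiffAt ℝ ∞ u z) : ContDiffAt ℝ ∞ (fun y => u (z.1, y)) z.2 :=
  ContDiffAt.comp (g := u) (f := fun y => (z.1, y)) z.2 h (by fun_prop)

theorem contDiffOn_Dx (hU : IsOpen U) (h : ContDiffOn ℝ ∞ u U) : ContDiffOn ℝ ∞ (Dx u) U :=
  fun _ hz => (contDiffAt_Dx_infty (h.contDiffAt (hU.mem_nhds hz))).contDiffWithinAt

theorem contDiffOn_Dx_iterate (hU : IsOpen U) (h : ContDiffOn ℝ ∞ u U) (j : ℕ) :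
    ContDiffOn ℝ ∞ (Dx^[j] u) U := by
  induction j with
  | zero => exact h
  | succ j ih => rw [Function.iterate_succ']; exact contDiffOn_Dx hU ih

/-- Space derivatives commute with the heat operator. -/
theorem heatOp_Dx_iterate (hU : IsOpen U) (h : ContDiffOn ℝ ∞ u U) (hF : EqOn (heatOp u) F U)
    (j : ℕ) : EqOn (heatOp (Dx^[j] u)) (Dx^[j] F) U := by
  induction j with
  | zero => exact hF
  | succ j ih =>
    intro z hz
    rw [Function.iterate_succ', Function.comp, Function.comp, ← Dx_eqOn hU ih hz]
    refine (Dx_heatOp ?_).symm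
    exact contDiffAt_infty.1 ((contDiffOn_Dx_iterate hU h j).contDiffAt (hU.mem_nhds hz)) 3

theorem abs_Dx_iterate_mul_le (hu : ContDiffAt ℝ ∞ u z) (hv : ContDiffAt ℝ ∞ v z) {n : ℕ}
    {A B : ℝ} (hA : ∀ i ≤ n, |Dx^[i] u z| ≤ A) (hB : ∀ i ≤ n, |Dx^[i] v z| ≤ B) :
    ∀ j ≤ n, |Dx^[j] (fun y => u y * v y) z| ≤ 2 ^ n * (A * B) := fun j hj => by
  have hA0 : 0 ≤ A := (abs_nonneg _).trans (hA 0 (Nat.zero_le _))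
  have hB0 : 0 ≤ B := (abs_nonneg _).trans (hB 0 (Nat.zero_le _))
  have hs := fun w (hw : ContDiffAt ℝ ∞ w z) =>
    (contDiffAt_slice hw).of_le (show ((j : ℕ) : ℕ∞ω) ≤ (∞ : ℕ∞ω) from mod_cast le_top)
  rw [Dx_iterate_eq, iteratedDeriv_fun_mul (hs u hu) (hs v hv)]
  calc _ ≤ ∑ i ∈ Finset.range (j + 1), |(j.choose i : ℝ) *
          iteratedDeriv i (fun y => u (z.1, y)) z.2 *
          iteratedDeriv (j - i) (fun y => v (z.1, y)) z.2| := Finset.abs_sum_le_sum_abs _ _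
    _ ≤ ∑ i ∈ Finset.range (j + 1), (j.choose i : ℝ) * (A * B) := by
      refine Finset.sum_le_sum fun i hi => ?_
      have hi' : i ≤ j := Nat.lt_succ_iff.1 (Finset.mem_range.1 hi)
      rw [← Dx_iterate_eq, ← Dx_iterate_eq, mul_assoc, abs_mul, abs_mul, Nat.abs_cast]
      have := hA i (hi'.trans hj)
      have := hB (j - i) ((Nat.sub_le _ _).trans hj)
      gcongr
    _ = 2 ^ j * (A * B) := by
      rw [← Finset.sum_mul, ← Nat.cast_sum, Nat.sum_range_choose]; push_cast; ring
    _ ≤ 2 ^ n * (A * B) := by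
      have : (2 : ℝ) ^ j ≤ 2 ^ n := pow_le_pow_right₀ (by norm_num) hj
      gcongr

theorem abs_Dx_iterate_mul_sq_le (hu : ContDiffAt ℝ ∞ u z) (hv : ContDiffAt ℝ ∞ v z) {n : ℕ}
    {A B : ℝ} (hA : ∀ i ≤ n, |Dx^[i] u z| ≤ A) (hB : ∀ i ≤ n, |Dx^[i] v z| ≤ B) :
    |Dx^[n] (fun y => u y * v y ^ 2) z| ≤ 4 ^ n * (A * B ^ 2) := by
  have h1 := abs_Dx_iterate_mul_le hv hv hB hB
  have h2 := abs_Dx_iterate_mul_le hu (hv.mul hv) hA h1 n le_rfl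
  simp only [sq]
  refine h2.trans (le_of_eq ?_)
  rw [show (4 : ℝ) = 2 * 2 by norm_num, mul_pow]; ring

end

/-! ### Gaussian weights -/

/-- The weight `∑ᵢ exp(-a (ξᵢ-x)² / (T-t))`, which is `0` for `t ≥ T`. -/
def gaussWeight (a T : ℝ) {m : ℕ} (ξ : Fin m → ℝ) (z : ℝ × ℝ) : ℝ :=
  if z.1 < T then ∑ i, Real.exp (-(a * (ξ i - z.2) ^ 2 / (T - z.1))) else 0

section

variable {a b T : ℝ} {m : ℕ} {ξ : Fin m → ℝ} {z : ℝ × ℝ}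

theorem gaussWeight_nonneg : 0 ≤ gaussWeight a T ξ z := by
  unfold gaussWeight
  split_ifs
  · exact Finset.sum_nonneg fun i _ => (Real.exp_pos _).le
  · exact le_rfl

theorem gaussWeight_anti (hab : a ≤ b) : gaussWeight b T ξ z ≤ gaussWeight a T ξ z := by
  unfold gaussWeight
  split_ifs with h
  · refine Finset.sum_le_sum fun i _ => Real.exp_le_exp.2 (neg_le_neg ?_)
    have : 0 < T - z.1 := by linarith
    gcongr
  · exact le_rfl

theorem gaussWeight_le_card (ha : 0 ≤ a) : gaussWeight a T ξ z ≤ m := by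
  unfold gaussWeight
  split_ifs with h
  · calc _ ≤ ∑ _i : Fin m, (1 : ℝ) := Finset.sum_le_sum fun i _ => Real.exp_le_one_iff.2 (by
          have : 0 < T - z.1 := by linarith
          rw [neg_nonpos]; positivity)
      _ = m := by simp
  · exact Nat.cast_nonneg m

/-- The Gaussian weights absorb exponential growth in space. -/
theorem exists_gaussWeight_mul_exp_le (ha : 0 < a) (T : ℝ) (ξ : Fin m → ℝ) (c : ℝ) (hc : 0 ≤ c) :
    ∃ C, 0 ≤ C ∧ ∀ z : ℝ × ℝ, 0 ≤ z.1 → gaussWeight a T ξ z * Real.exp (c * |z.2|) ≤ C := by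
  refine ⟨∑ i, Real.exp (c ^ 2 * T / (4 * a) + c * |ξ i|),
    Finset.sum_nonneg fun i _ => (Real.exp_pos _).le, fun z hz => ?_⟩
  unfold gaussWeight
  split_ifs with h
  · rw [Finset.sum_mul]
    refine Finset.sum_le_sum fun i _ => ?_
    rw [← Real.exp_add]
    apply Real.exp_le_exp.2
    have hτ : 0 < T - z.1 := by linarith
    have hT : 0 < T := by linarith
    have h1 : a * (ξ i - z.2) ^ 2 / T ≤ a * (ξ i - z.2) ^ 2 / (T - z.1) := by
      gcongr; linarith
    have h2 : |z.2| ≤ |ξ i - z.2| + |ξ i| := by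
      have := abs_sub (ξ i) (ξ i - z.2)
      rw [sub_sub_cancel] at this; linarith
    have h3 : c * |ξ i - z.2| ≤ c ^ 2 * T / (4 * a) + a * (ξ i - z.2) ^ 2 / T := by
      have e : c ^ 2 * T / (4 * a) + a * (ξ i - z.2) ^ 2 / T - c * |ξ i - z.2| =
          (c * T - 2 * a * |ξ i - z.2|) ^ 2 / (4 * a * T) := by
        rw [← sq_abs (ξ i - z.2)]; field_simp; ring
      have : 0 ≤ (c * T - 2 * a * |ξ i - z.2|) ^ 2 / (4 * a * T) := by positivity
      linarith
    have h4 := mul_le_mul_of_nonneg_left h2 hc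
    linarith
  · rw [zero_mul]; exact Finset.sum_nonneg fun i _ => (Real.exp_pos _).le

/-- Away from its singularity the heat kernel is bounded by a slightly wider Gaussian. -/
theorem exists_hk_le_exp {δ : ℝ} (hδ : 0 < δ) (ha0 : 0 ≤ a) (ha : a < 1 / 2) :
    ∃ C, 0 ≤ C ∧ ∀ τ y : ℝ, 0 < τ → (δ ^ 2 ≤ τ ∨ δ ≤ |y|) →
      hk τ y ≤ C * Real.exp (-(a * y ^ 2 / τ)) := by
  set κ := 1 / 2 - a with hκ
  have hκ0 : 0 < κ := by linarith
  refine ⟨1 + 1 / δ ^ 2 + 1 / (κ * δ ^ 2), by positivity, fun τ y hτ h => ?_⟩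
  rw [hk_of_pos hτ]
  have hs : (Real.sqrt (2 * Real.pi * τ))⁻¹ ≤ 1 + 1 / τ := by
    have h1 : Real.sqrt τ ≤ Real.sqrt (2 * Real.pi * τ) := by
      apply Real.sqrt_le_sqrt; nlinarith [Real.pi_gt_three]
    have h2 : 0 < Real.sqrt τ := Real.sqrt_pos.2 hτ
    have h4 : 1 / τ = (Real.sqrt τ)⁻¹ ^ 2 := by rw [inv_pow, Real.sq_sqrt hτ.le, one_div]
    refine (inv_anti₀ h2 h1).trans ?_
    rw [h4]
    nlinarith [sq_nonneg ((Real.sqrt τ)⁻¹ - 1), sq_nonneg ((Real.sqrt τ)⁻¹)]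
  have he : Real.exp (-(y ^ 2) / (2 * τ)) =
      Real.exp (-(κ * y ^ 2 / τ)) * Real.exp (-(a * y ^ 2 / τ)) := by
    rw [← Real.exp_add]; congr 1; rw [hκ]; field_simp; ring
  have hκ1 : Real.exp (-(κ * y ^ 2 / τ)) ≤ 1 := Real.exp_le_one_iff.2 (by
    rw [neg_nonpos]; positivity)
  rw [he, ← mul_assoc]
  refine mul_le_mul_of_nonneg_right ?_ (Real.exp_pos _).le
  have key : 1 / τ * Real.exp (-(κ * y ^ 2 / τ)) ≤ 1 / δ ^ 2 + 1 / (κ * δ ^ 2) := by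
    rcases h with h | h
    · calc _ ≤ 1 / δ ^ 2 * 1 := by gcongr
        _ ≤ _ := by rw [mul_one]; exact le_add_of_nonneg_right (by positivity)
    · have hy : δ ^ 2 ≤ y ^ 2 := by rw [← sq_abs y]; gcongr
      have h1 : 1 / τ * Real.exp (-(κ * y ^ 2 / τ)) ≤ 1 / (κ * y ^ 2) := by
        have hy0 : 0 < y ^ 2 := lt_of_lt_of_le (by positivity) hy
        have hy1 : y ≠ 0 := fun h => by simp [h] at hy0
        rw [Real.exp_neg, ← div_eq_mul_inv, div_le_iff₀ (Real.exp_pos _)]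
        have := Real.add_one_le_exp (κ * y ^ 2 / τ)
        calc 1 / τ = 1 / (κ * y ^ 2) * (κ * y ^ 2 / τ) := by field_simp
          _ ≤ _ := by gcongr; linarith
      calc _ ≤ _ := h1
        _ ≤ 1 / (κ * δ ^ 2) := by gcongr
        _ ≤ _ := le_add_of_nonneg_left (by positivity)
  calc _ ≤ (1 + 1 / τ) * Real.exp (-(κ * y ^ 2 / τ)) := by gcongr
    _ = Real.exp (-(κ * y ^ 2 / τ)) + 1 / τ * Real.exp (-(κ * y ^ 2 / τ)) := by ring
    _ ≤ 1 + (1 / δ ^ 2 + 1 / (κ * δ ^ 2)) := add_le_add hκ1 key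
    _ = _ := by ring

theorem not_mem_boxes_iff {δ : ℝ} {z : ℝ × ℝ} : z ∉ boxes T ξ δ ↔
    ∀ i, T - δ ^ 2 ≤ z.1 → z.1 ≤ T → ¬(ξ i - δ ≤ z.2 ∧ z.2 ≤ ξ i + δ) := by
  simp only [boxes, mem_iUnion, mem_prod, mem_Icc, not_exists, not_and]
  exact ⟨fun h i h1 h2 h3 => h i ⟨h1, h2⟩ h3, fun h i h1 h2 => h i h1.1 h1.2 h2⟩

theorem far_of_not_mem_boxes {δ : ℝ} {z : ℝ × ℝ} (hz : z ∉ boxes T ξ δ)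
    (hT : z.1 ≤ T) (i : Fin m) : δ ^ 2 ≤ T - z.1 ∨ δ ≤ |ξ i - z.2| := by
  by_contra! h
  rw [abs_lt] at h
  exact not_mem_boxes_iff.1 hz i (by linarith [h.1]) hT ⟨by linarith [h.2.2], by linarith [h.2.1]⟩

/-- The Gaussian weight at a point off the boxes controls a weight with a larger exponent at later
points nearby. -/
theorem gaussWeight_le_of_near {δ r : ℝ} (ha : 0 < a) (hab : a < b) (hδ : 0 < δ)
    (hr0 : 0 ≤ r) (hr : 2 * r ≤ δ * ((1 - a / b) / 2)) {z y : ℝ × ℝ} (hz : z ∉ boxes T ξ δ)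
    (hzy : z.1 ≤ y.1) (hy : |y.2 - z.2| ≤ 2 * r) :
    gaussWeight b T ξ y ≤ Real.exp a * gaussWeight a T ξ z := by
  by_cases hyT : y.1 < T
  · have hzT : z.1 < T := hzy.trans_lt hyT
    rw [gaussWeight, gaussWeight, if_pos hyT, if_pos hzT, Finset.mul_sum]
    refine Finset.sum_le_sum fun i _ => ?_
    have hτy : 0 < T - y.1 := by linarith
    have hτz : 0 < T - z.1 := by linarith
    have hb : 0 < b := ha.trans hab
    rw [← Real.exp_add]
    apply Real.exp_le_exp.2
    by_cases hx : δ ≤ |ξ i - z.2|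
    · set s := (1 - a / b) / 2 with hs
      have hs0 : 0 ≤ s := by
        rw [hs]; have : a / b ≤ 1 := by rw [div_le_one hb]; exact hab.le
        linarith
      have hs1 : s ≤ 1 := by
        rw [hs]; have : 0 ≤ a / b := by positivity
        linarith
      have h1 : |ξ i - z.2| * (1 - s) ≤ |ξ i - y.2| := by
        have h2 := abs_sub_abs_le_abs_sub (ξ i - z.2) (y.2 - z.2)
        rw [sub_sub_sub_cancel_right] at h2
        nlinarith
      have h3 : a * (ξ i - z.2) ^ 2 ≤ b * (ξ i - y.2) ^ 2 := by
        have h4 : (|ξ i - z.2| * (1 - s)) ^ 2 ≤ |ξ i - y.2| ^ 2 := by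
          have : 0 ≤ |ξ i - z.2| * (1 - s) := mul_nonneg (abs_nonneg _) (by linarith)
          gcongr
        rw [mul_pow, sq_abs, sq_abs] at h4
        have h5 : a / b ≤ (1 - s) ^ 2 := by
          have : a / b = 1 - 2 * s := by rw [hs]; ring
          rw [this]; nlinarith [sq_nonneg s]
        have h6 : (ξ i - z.2) ^ 2 * (a / b) ≤ (ξ i - y.2) ^ 2 :=
          (mul_le_mul_of_nonneg_left h5 (sq_nonneg _)).trans h4
        calc a * (ξ i - z.2) ^ 2 = b * ((ξ i - z.2) ^ 2 * (a / b)) := by field_simp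
          _ ≤ _ := by gcongr
      have h7 : a * (ξ i - z.2) ^ 2 / (T - z.1) ≤ b * (ξ i - y.2) ^ 2 / (T - y.1) := by
        gcongr
      linarith
    · have h1 : δ ^ 2 ≤ T - z.1 := (far_of_not_mem_boxes hz hzT.le i).resolve_right hx
      have h2 : a * (ξ i - z.2) ^ 2 / (T - z.1) ≤ a := by
        rw [div_le_iff₀ hτz]
        have : (ξ i - z.2) ^ 2 ≤ δ ^ 2 := by
          rw [← sq_abs]; have := (not_le.1 hx).le; gcongr
        gcongr; linarith
      have h3 : 0 ≤ b * (ξ i - y.2) ^ 2 / (T - y.1) := by positivity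
      linarith
  · rw [gaussWeight, if_neg hyT]
    exact mul_nonneg (Real.exp_pos _).le gaussWeight_nonneg

end

/-! ### Bounds on the derivatives of critical pairs -/

/-- The free evolution of `μ` grows at most exponentially in space, away from the initial time. -/
def ExpFlow (T : ℝ) (μ : Measure ℝ) : Prop :=
  ∀ δ > 0, ∃ c, 0 ≤ c ∧ ∀ z : ℝ × ℝ, δ ≤ z.1 → z.1 ≤ T → heatFlow 0 μ z ≤ c * Real.exp (c * |z.2|)

section

variable {T R Γ : ℝ} {μ : Measure ℝ} {m : ℕ} {ξ γ : Fin m → ℝ} {w : ℝ × ℝ → ℝ}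

/-- The forward solution grows at most exponentially in space, with constants that depend on the
potential through its norm only. -/
theorem exists_fwd_le [SFinite μ] (hμ : HeatFinite μ) (hexp : ExpFlow T μ) (R : ℝ) {δ : ℝ}
    (hδ : 0 < δ) :
    ∃ c, 0 ≤ c ∧ ∀ w, PotBound w R → ∀ z : ℝ × ℝ, δ ≤ z.1 → z.1 ≤ T →
      |fwd μ w z| ≤ c * Real.exp (c * |z.2|) := by
  obtain ⟨c, hc0, hc⟩ := hexp δ hδ
  set E := 2 * Real.exp (rate R * T) with hE
  have hE0 : 0 < E := by positivity
  refine ⟨(1 + E) * c, by positivity, fun w hw z h1 h2 => ?_⟩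
  have h3 := abs_sol_le' hw (freeSol_heatFlow hμ) (fun _ h => heatFlow_of_le h) z
  have h4 := heatFlow_nonneg (s := 0) (μ := μ) z
  have hr := rate_pos R
  have h5 : Real.exp ((16 * R ^ 4 + 1) * z.1) ≤ Real.exp (rate R * T) := by
    apply Real.exp_le_exp.2; change rate R * z.1 ≤ _; gcongr
  calc |fwd μ w z| ≤ _ := h3
    _ ≤ 2 * (Real.exp (rate R * T) * (c * Real.exp (c * |z.2|))) := by
      gcongr; exact hc z h1 h2
    _ = E * c * Real.exp (c * |z.2|) := by rw [hE]; ring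
    _ ≤ (1 + E) * c * Real.exp ((1 + E) * c * |z.2|) := by
      gcongr
      · linarith
      · exact le_mul_of_one_le_left hc0 (by linarith)

/-- The backward solution has Gaussian decay off the boxes, with constants that depend on the
potential through its norm only. -/
theorem exists_bwd_le (T : ℝ) (ξ : Fin m → ℝ) (R : ℝ) (hΓ : 0 ≤ Γ) {δ a : ℝ} (hδ : 0 < δ)
    (ha0 : 0 ≤ a) (ha : a < 1 / 2) :
    ∃ c, 0 ≤ c ∧ ∀ w γ, PotBound w R → (∀ i, |γ i| ≤ Γ) → ∀ z : ℝ × ℝ, 0 ≤ z.1 → z.1 ≤ T →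
      z ∉ boxes T ξ δ → |bwd T ξ γ w z| ≤ c * gaussWeight a T ξ z := by
  obtain ⟨C, hC0, hC⟩ := exists_hk_le_exp hδ ha0 ha
  refine ⟨Γ * (2 * (Real.exp (rate R * T) * C)), by positivity, fun w γ hw hγ z h0 hT hz => ?_⟩
  rcases hT.eq_or_lt with h | hT'
  · rw [bwd_of_le hw h.ge, abs_zero]
    exact mul_nonneg (by positivity) gaussWeight_nonneg
  rw [gaussWeight, if_pos hT', Finset.mul_sum]
  refine (Finset.abs_sum_le_sum_abs _ _).trans (Finset.sum_le_sum fun i _ => ?_)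
  have h1 := abs_back_le hw (T, ξ i) z
  have h2 := hC (T - z.1) (ξ i - z.2) (by linarith) (far_of_not_mem_boxes hz hT i)
  have h3 : Real.exp ((16 * R ^ 4 + 1) * (T - z.1)) ≤ Real.exp (rate R * T) := by
    have := rate_pos R
    apply Real.exp_le_exp.2; change rate R * (T - z.1) ≤ _; gcongr; linarith
  have h4 := hk_nonneg (T - z.1) (ξ i - z.2)
  rw [abs_mul]
  calc _ ≤ Γ * (2 * (Real.exp (rate R * T) *
        (C * Real.exp (-(a * (ξ i - z.2) ^ 2 / (T - z.1)))))) := by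
        gcongr
        · exact hγ i
        · refine h1.trans ?_; gcongr
    _ = _ := by ring

theorem Dx_iterate_bwd_of_le (hw : PotBound w R) (j : ℕ) {z : ℝ × ℝ} (hz : T ≤ z.1) :
    Dx^[j] (bwd T ξ γ w) z = 0 := by
  rw [Dx_iterate_eq]
  have : (fun y => bwd T ξ γ w (z.1, y)) = fun _ => 0 := funext fun y => bwd_of_le hw hz
  rw [this, iteratedDeriv_fun_const_zero]

/-- Points with time in `(δ, T]`, off the boxes. -/
def offBoxes (T : ℝ) (ξ : Fin m → ℝ) (δ : ℝ) : Set (ℝ × ℝ) :=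
  (Ioc δ T ×ˢ univ) \ boxes T ξ δ

theorem offBoxes_anti {δ δ' : ℝ} (h0 : 0 < δ') (h : δ' ≤ δ) : offBoxes T ξ δ ⊆ offBoxes T ξ δ' := by
  refine sdiff_subset_sdiff (prod_mono (Ioc_subset_Ioc_left h) subset_rfl) ?_
  refine iUnion_mono fun i => prod_mono (Icc_subset_Icc_left ?_) (Icc_subset_Icc ?_ ?_)
  · gcongr
  · gcongr
  · gcongr

/-- Points near `offBoxes T ξ δ` are regular; they lie in `offBoxes T ξ (δ / 2)` as long as they are
before time `T`. -/
theorem near_offBoxes {δ r : ℝ} (hr1 : 2 * r ≤ δ / 2)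
    (hr2 : 2 * r ≤ δ ^ 2 / 2) {z y : ℝ × ℝ} (hz : z ∈ offBoxes T ξ δ)
    (hy : y ∈ Metric.ball z (2 * r)) :
    y ∈ regularSet T ξ ∧ (y.1 ≤ T → y ∈ offBoxes T ξ (δ / 2)) := by
  obtain ⟨⟨⟨hz1, hzT⟩, -⟩, hzb⟩ := hz
  rw [not_mem_boxes_iff] at hzb
  rw [Metric.mem_ball, Prod.dist_eq, max_lt_iff, Real.dist_eq, Real.dist_eq, abs_lt, abs_lt] at hy
  obtain ⟨⟨a1, a2⟩, a3, a4⟩ := hy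
  refine ⟨⟨by linarith, fun i hi => ?_⟩, fun hyT => ⟨⟨⟨by linarith, hyT⟩, mem_univ _⟩, ?_⟩⟩
  · rw [hi] at a1 a2 a3 a4
    simp only at a1 a2 a3 a4
    exact hzb i (by nlinarith) hzT ⟨by linarith, by linarith⟩
  · rw [not_mem_boxes_iff]
    intro i b1 b2 b3
    exact hzb i (by nlinarith) hzT ⟨by linarith [b3.1], by linarith [b3.2]⟩

/-- One more space derivative of the forward solution: the gradient bound `hC` on balls of radius `2
r`, applied to its `n`-th derivative, whose image under the heat operator is the `n`-th derivative
of `p q²`. -/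
theorem Critical.abs_Dx_iterate_succ_fwd_le [SFinite μ] (hμ : HeatFinite μ)
    (h : Critical T μ ξ R Γ w γ)
    {δ r a c C : ℝ} (hr1 : 2 * r ≤ δ / 2) (hr2 : 2 * r ≤ δ ^ 2 / 2)
    (ha0 : 0 ≤ a) (hc : 0 ≤ c) {n : ℕ}
    (hC : ∀ (a : ℝ × ℝ) (v : ℝ × ℝ → ℝ) (A : ℝ), ContDiffOn ℝ ∞ v (Metric.ball a (2 * r)) →
      (∀ z ∈ Metric.ball a (2 * r), z.1 ≤ a.1 → |v z| ≤ A ∧ |heatOp v z| ≤ A) → |Dx v a| ≤ C * A)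
    (hb : ∀ z ∈ offBoxes T ξ (δ / 2), ∀ i ≤ n,
      |Dx^[i] (fwd μ w) z| ≤ c * Real.exp (c * |z.2|) ∧
      |Dx^[i] (bwd T ξ γ w) z| ≤ c * gaussWeight a T ξ z) {z : ℝ × ℝ} (hz : z ∈ offBoxes T ξ δ) :
    |Dx^[n + 1] (fwd μ w) z| ≤
      C * ((c + 4 ^ n * (c * m * c ^ 2)) * Real.exp (2 * c * (|z.2| + 2 * r))) := by
  have hU := isOpen_regularSet T ξ
  obtain ⟨⟨sq, sp⟩, heq⟩ := h.regular hμ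
  have hnear := fun y (hy : y ∈ Metric.ball z (2 * r)) => near_offBoxes hr1 hr2 hz hy
  rw [Function.iterate_succ', Function.comp]
  refine hC z _ _ ((contDiffOn_Dx_iterate hU sq n).mono fun y hy => (hnear y hy).1)
    fun y hy hyz => ?_
  have hyU := (hnear y hy).1
  have hyT : y.1 ≤ T := hyz.trans hz.1.1.2
  have hyb := hb y ((hnear y hy).2 hyT)
  have hy2 : |y.2| ≤ |z.2| + 2 * r := by
    rw [Metric.mem_ball, Prod.dist_eq, max_lt_iff, Real.dist_eq, Real.dist_eq] at hy
    have := abs_sub_abs_le_abs_sub y.2 z.2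
    linarith [hy.2]
  have hy0 : 0 ≤ |z.2| + 2 * r := (abs_nonneg _).trans hy2
  have hE : Real.exp (c * |y.2|) ≤ Real.exp (2 * c * (|z.2| + 2 * r)) := by
    apply Real.exp_le_exp.2
    nlinarith [mul_le_mul_of_nonneg_left hy2 hc, mul_nonneg hc hy0]
  constructor
  · refine (hyb n le_rfl).1.trans ?_
    gcongr
    exact le_add_of_nonneg_right (by positivity)
  · rw [heatOp_Dx_iterate hU sq (fun x hx => (heq x hx).1) n hyU]
    have h1 := abs_Dx_iterate_mul_sq_le (sp.contDiffAt (hU.mem_nhds hyU))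
      (sq.contDiffAt (hU.mem_nhds hyU)) (n := n) (A := c * m) (B := c * Real.exp (c * |y.2|))
      (fun i hi => (hyb i hi).2.trans (by gcongr; exact gaussWeight_le_card ha0))
      (fun i hi => (hyb i hi).1)
    refine h1.trans ?_
    have e1 : Real.exp (c * |y.2|) ^ 2 ≤ Real.exp (2 * c * (|z.2| + 2 * r)) := by
      rw [← Real.exp_nat_mul]
      apply Real.exp_le_exp.2
      push_cast
      nlinarith [mul_le_mul_of_nonneg_left hy2 hc]
    calc _ = 4 ^ n * (c * m * c ^ 2) * Real.exp (c * |y.2|) ^ 2 := by ring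
      _ ≤ (c + 4 ^ n * (c * m * c ^ 2)) * Real.exp (2 * c * (|z.2| + 2 * r)) := by
        gcongr
        exact le_add_of_nonneg_left hc

/-- One more space derivative of the backward solution: the gradient bound `hC`, applied to the time
reversal of its `n`-th derivative. In the source `p² q` one factor `p` absorbs the growth of `q`,
and the other one keeps the Gaussian weight; passing to the neighbouring points costs a part of its
exponent. -/
theorem Critical.abs_Dx_iterate_succ_bwd_le [SFinite μ] (hμ : HeatFinite μ)
    (h : Critical T μ ξ R Γ w γ)
    {δ r a b c C K : ℝ} (hδ : 0 < δ) (hr1 : 2 * r ≤ δ / 2) (hr2 : 2 * r ≤ δ ^ 2 / 2)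
    (hr0 : 0 ≤ r) (hr3 : 2 * r ≤ δ * ((1 - a / b) / 2))
    (ha0 : 0 < a) (hab : a < b) (hc : 0 ≤ c) {n : ℕ}
    (hC : ∀ (a : ℝ × ℝ) (v : ℝ × ℝ → ℝ) (A : ℝ), ContDiffOn ℝ ∞ v (Metric.ball a (2 * r)) →
      (∀ z ∈ Metric.ball a (2 * r), z.1 ≤ a.1 → |v z| ≤ A ∧ |heatOp v z| ≤ A) → |Dx v a| ≤ C * A)
    (hK0 : 0 ≤ K)
    (hK : ∀ z : ℝ × ℝ, 0 ≤ z.1 → gaussWeight b T ξ z * Real.exp (c * |z.2|) ≤ K)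
    (hb : ∀ z ∈ offBoxes T ξ (δ / 2), ∀ i ≤ n,
      |Dx^[i] (fwd μ w) z| ≤ c * Real.exp (c * |z.2|) ∧
      |Dx^[i] (bwd T ξ γ w) z| ≤ c * gaussWeight b T ξ z) {z : ℝ × ℝ} (hz : z ∈ offBoxes T ξ δ) :
    |Dx^[n + 1] (bwd T ξ γ w) z| ≤
      C * ((c + 4 ^ n * (c ^ 3 * K)) * Real.exp a) * gaussWeight a T ξ z := by
  have hU := isOpen_regularSet T ξ
  have hU' : IsOpen (refl T ⁻¹' regularSet T ξ) := hU.preimage (continuous_refl T)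
  obtain ⟨⟨sq, sp⟩, heq⟩ := h.regular hμ
  have hw := h.potBound
  have hnear := fun y (hy : y ∈ Metric.ball z (2 * r)) => near_offBoxes hr1 hr2 hz hy
  have hball : ∀ y ∈ Metric.ball (refl T z) (2 * r), refl T y ∈ Metric.ball z (2 * r) := fun y hy => by
    rw [Metric.mem_ball, Prod.dist_eq, max_lt_iff] at hy ⊢
    refine ⟨?_, hy.2⟩
    have := hy.1
    simp only [refl, Real.dist_eq] at this ⊢
    rw [abs_sub_comm] at this
    convert this using 2; ring
  have hrefl : ContDiff ℝ ∞ (refl T) := (contDiff_const.sub contDiff_fst).prodMk contDiff_snd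
  have sp' : ContDiffOn ℝ ∞ (fun y => bwd T ξ γ w (refl T y)) (refl T ⁻¹' regularSet T ξ) :=
    sp.comp hrefl.contDiffOn fun _ h => h
  have hF : EqOn (heatOp fun y => bwd T ξ γ w (refl T y))
      (fun y => bwd T ξ γ w (refl T y) ^ 2 * fwd μ w (refl T y)) (refl T ⁻¹' regularSet T ξ) :=
    fun y hy => by
      change _ = bwd T ξ γ w (refl T y) ^ 2 * fwd μ w (refl T y)
      rw [← (heq _ hy).2, heatOp]
      have h2 : Dt (fun z => bwd T ξ γ w (refl T z)) y = -Dt (bwd T ξ γ w) (refl T y) :=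
        deriv_comp_const_sub (f := fun s => bwd T ξ γ w (s, y.2)) T y.1
      rw [h2]; rfl
  have hstep := hC (refl T z) (Dx^[n] fun y => bwd T ξ γ w (refl T y))
    ((c + 4 ^ n * (c ^ 3 * K)) * (Real.exp a * gaussWeight a T ξ z))
    ((contDiffOn_Dx_iterate hU' sp' n).mono fun y hy => (hnear _ (hball y hy)).1) fun y hy hyz => by
      have hy' := hball y hy
      have hyU := (hnear _ hy').1
      have hA0 : 0 ≤ (c + 4 ^ n * (c ^ 3 * K)) * (Real.exp a * gaussWeight a T ξ z) :=
        mul_nonneg (by positivity) (mul_nonneg (Real.exp_pos _).le gaussWeight_nonneg)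
      rw [heatOp_Dx_iterate hU' sp' hF n hyU, Dx_iterate_refl,
        Dx_iterate_refl T (fun y => bwd T ξ γ w y ^ 2 * fwd μ w y)]
      set x := refl T y with hx
      rcases le_or_gt T x.1 with hxT | hxT
      · have e1 : Dx^[n] (fun y => bwd T ξ γ w y ^ 2 * fwd μ w y) x = 0 := by
          rw [Dx_iterate_eq]
          have : (fun y => bwd T ξ γ w (x.1, y) ^ 2 * fwd μ w (x.1, y)) = fun _ => 0 :=
            funext fun y => by rw [bwd_of_le (z := (x.1, y)) hw hxT]; ring
          rw [this, iteratedDeriv_fun_const_zero]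
        rw [Dx_iterate_bwd_of_le hw n hxT, e1, abs_zero]
        exact ⟨hA0, hA0⟩
      have hxo := (hnear _ hy').2 hxT.le
      have hxb := hb x hxo
      have hx0 : 0 ≤ x.1 := (hxo.1.1.1.le.trans' (by positivity))
      have hW : gaussWeight b T ξ x ≤ Real.exp a * gaussWeight a T ξ z := by
        refine gaussWeight_le_of_near ha0 hab hδ hr0 hr3 hz.2 ?_ ?_
        · rw [hx]; simp only [refl] at hyz ⊢; linarith
        · rw [Metric.mem_ball, Prod.dist_eq, max_lt_iff, Real.dist_eq, Real.dist_eq] at hy'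
          exact hy'.2.le
      have hW0 : 0 ≤ gaussWeight b T ξ x := gaussWeight_nonneg
      constructor
      · refine (hxb n le_rfl).2.trans ?_
        calc c * gaussWeight b T ξ x ≤ c * (Real.exp a * gaussWeight a T ξ z) := by gcongr
          _ ≤ _ := by
            refine mul_le_mul_of_nonneg_right (le_add_of_nonneg_right (by positivity)) ?_
            exact hW0.trans hW
      · have h1 := abs_Dx_iterate_mul_sq_le (sq.contDiffAt (hU.mem_nhds hyU))
          (sp.contDiffAt (hU.mem_nhds hyU)) (n := n) (fun i hi => (hxb i hi).1)
          (fun i hi => (hxb i hi).2)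
        rw [show (fun y => bwd T ξ γ w y ^ 2 * fwd μ w y) =
          fun y => fwd μ w y * bwd T ξ γ w y ^ 2 from funext fun y => mul_comm _ _]
        refine h1.trans ?_
        calc _ = 4 ^ n * (c ^ 3 * (gaussWeight b T ξ x * Real.exp (c * |x.2|))) *
              gaussWeight b T ξ x := by ring
          _ ≤ 4 ^ n * (c ^ 3 * K) * (Real.exp a * gaussWeight a T ξ z) := by
            have := hK x hx0
            gcongr
          _ ≤ _ := by
            refine mul_le_mul_of_nonneg_right (le_add_of_nonneg_left hc) ?_
            exact hW0.trans hW
  have e : Dx (Dx^[n] fun y => bwd T ξ γ w (refl T y)) (refl T z) =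
      Dx^[n + 1] (bwd T ξ γ w) z := by
    rw [← Function.iterate_succ_apply' Dx n, Dx_iterate_refl, refl_refl]
  rw [e] at hstep
  calc _ ≤ _ := hstep
    _ = _ := by ring

/-- All space derivatives of critical pairs are bounded on `offBoxes T ξ δ`, uniformly over critical
pairs with given bounds. The exponent of the weight deteriorates with the order of the derivative,
but can be kept as close to `1/2` as desired. -/
theorem exists_Dx_iterate_le [SFinite μ] (hμ : HeatFinite μ) (hexp : ExpFlow T μ)
    (ξ : Fin m → ℝ) (R : ℝ)
    (hΓ : 0 ≤ Γ) (n : ℕ) : ∀ δ > 0, ∀ a, 0 < a → a < 1 / 2 → ∃ c, 0 ≤ c ∧ ∀ w γ,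
      Critical T μ ξ R Γ w γ → ∀ z ∈ offBoxes T ξ δ, ∀ i ≤ n,
        |Dx^[i] (fwd μ w) z| ≤ c * Real.exp (c * |z.2|) ∧
        |Dx^[i] (bwd T ξ γ w) z| ≤ c * gaussWeight a T ξ z := by
  induction n with
  | zero =>
    intro δ hδ a ha0 ha
    obtain ⟨c₁, hc₁, h1⟩ := exists_fwd_le hμ hexp R hδ
    obtain ⟨c₂, hc₂, h2⟩ := exists_bwd_le T ξ R hΓ hδ ha0.le ha
    refine ⟨max c₁ c₂, le_max_of_le_left hc₁, fun w γ h z hz i hi => ?_⟩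
    obtain rfl : i = 0 := Nat.le_zero.1 hi
    constructor
    · refine (h1 w h.potBound z hz.1.1.1.le hz.1.1.2).trans ?_
      have := le_max_left c₁ c₂
      gcongr
    · refine (h2 w γ h.potBound h.abs_le z (hδ.le.trans hz.1.1.1.le) hz.1.1.2 hz.2).trans ?_
      exact mul_le_mul_of_nonneg_right (le_max_right _ _) gaussWeight_nonneg
  | succ n ih =>
    intro δ hδ a ha0 ha
    -- the bounds of lower order are used with an exponent strictly between `a` and `1/2`
    set b := (a + 1 / 2) / 2 with hb
    have hab : a < b := by linarith
    have hb2 : b < 1 / 2 := by linarith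
    have hb0 : 0 < b := by linarith
    obtain ⟨c, hc, hbound⟩ := ih (δ / 2) (by positivity) b hb0 hb2
    have hq : 0 < (1 - a / b) / 2 := by
      have : a / b < 1 := by rw [div_lt_one hb0]; exact hab
      linarith
    set r := min (δ / 4) (min (δ ^ 2 / 4) (δ * ((1 - a / b) / 2) / 2)) with hr
    have hr0 : 0 < r := by positivity
    have hr1 : 2 * r ≤ δ / 2 := by
      have : r ≤ δ / 4 := min_le_left _ _
      linarith
    have hr2 : 2 * r ≤ δ ^ 2 / 2 := by
      have : r ≤ δ ^ 2 / 4 := (min_le_right _ _).trans (min_le_left _ _)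
      linarith
    have hr3 : 2 * r ≤ δ * ((1 - a / b) / 2) := by
      have : r ≤ δ * ((1 - a / b) / 2) / 2 := (min_le_right _ _).trans (min_le_right _ _)
      linarith
    obtain ⟨C, hC0, hC⟩ := exists_abs_Dx_le hr0
    obtain ⟨K, hK0, hK⟩ := exists_gaussWeight_mul_exp_le hb0 T ξ c hc
    set c₁ := C * (c + 4 ^ n * (c * m * c ^ 2)) * Real.exp (2 * c * (2 * r)) with hc₁
    set c₂ := C * ((c + 4 ^ n * (c ^ 3 * K)) * Real.exp a) with hc₂
    have hc₁0 : 0 ≤ c₁ := by positivity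
    have hc₂0 : 0 ≤ c₂ := by positivity
    refine ⟨2 * c + c₁ + c₂, by positivity, fun w γ h z hz i hi => ?_⟩
    have hW0 : 0 ≤ gaussWeight a T ξ z := gaussWeight_nonneg
    rcases Nat.le_succ_iff.1 hi with hi' | rfl
    · obtain ⟨h1, h2⟩ := hbound w γ h z (offBoxes_anti (by positivity) (by linarith) hz) i hi'
      constructor
      · refine h1.trans ?_
        gcongr <;> linarith
      · refine h2.trans ?_
        have := gaussWeight_anti (T := T) (ξ := ξ) (z := z) hab.le
        have h3 : 0 ≤ gaussWeight b T ξ z := gaussWeight_nonneg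
        calc _ ≤ c * gaussWeight a T ξ z := by gcongr
          _ ≤ _ := by gcongr; linarith
    · constructor
      · refine (h.abs_Dx_iterate_succ_fwd_le hμ hr1 hr2 hb0.le hc hC (hbound w γ h) hz).trans ?_
        calc _ = c₁ * Real.exp (2 * c * |z.2|) := by
              rw [hc₁, mul_add (2 * c), Real.exp_add]; ring
          _ ≤ _ := by gcongr <;> linarith
      · refine (h.abs_Dx_iterate_succ_bwd_le hμ hδ hr1 hr2 hr0.le hr3 ha0 hab hc hC hK0 hK
          (hbound w γ h) hz).trans ?_
        gcongr
        linarith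

end

/-! ### The initial condition -/

theorem hk_le_inv_sqrt {t : ℝ} (ht : 0 < t) (x : ℝ) : hk t x ≤ 1 / Real.sqrt t := by
  rw [hk_of_pos ht]
  have h1 : Real.sqrt t ≤ Real.sqrt (2 * Real.pi * t) := by
    apply Real.sqrt_le_sqrt; nlinarith [Real.pi_gt_three]
  have h2 : 0 < Real.sqrt t := Real.sqrt_pos.2 ht
  have h3 : Real.exp (-(x ^ 2) / (2 * t)) ≤ 1 := Real.exp_le_one_iff.2 (by
    rw [neg_div, neg_nonpos]; positivity)
  calc _ ≤ (Real.sqrt t)⁻¹ * 1 := by gcongr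
    _ = _ := by rw [mul_one, one_div]

/-- Completing the square: an exponential tilt shifts the heat kernel. -/
theorem hk_mul_exp {t : ℝ} (ht : 0 < t) (b u : ℝ) :
    hk t u * Real.exp (b * u) = Real.exp (b ^ 2 * t / 2) * hk t (u - b * t) := by
  have e : Real.exp (-(u ^ 2) / (2 * t)) * Real.exp (b * u) =
      Real.exp (b ^ 2 * t / 2) * Real.exp (-((u - b * t) ^ 2) / (2 * t)) := by
    rw [← Real.exp_add, ← Real.exp_add]
    congr 1
    field_simp; ring
  rw [hk_of_pos ht, hk_of_pos ht, mul_assoc, e]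
  ring

/-- The heat flow of an exponential. -/
theorem lintegral_hk_mul_exp_abs_le {t : ℝ} (ht : 0 < t) {b : ℝ} (hb : 0 ≤ b) (x : ℝ) :
    ∫⁻ y, ENNReal.ofReal (hk t (x - y)) * ENNReal.ofReal (Real.exp (b * |y|)) ≤
      ENNReal.ofReal (2 * Real.exp (b ^ 2 * t / 2) * Real.exp (b * |x|)) := by
  set K := Real.exp (b ^ 2 * t / 2) * Real.exp (b * |x|) with hK
  have hpt : ∀ y, ENNReal.ofReal (hk t (x - y)) * ENNReal.ofReal (Real.exp (b * |y|)) ≤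
      ENNReal.ofReal K * (ENNReal.ofReal (hk t (x - b * t - y)) +
        ENNReal.ofReal (hk t (x + b * t - y))) := fun y => by
    rw [← ENNReal.ofReal_mul (hk_nonneg _ _), ← ENNReal.ofReal_add (hk_nonneg _ _) (hk_nonneg _ _),
      ← ENNReal.ofReal_mul (by positivity)]
    apply ENNReal.ofReal_le_ofReal
    have h1 : Real.exp (b * |y|) ≤
        Real.exp (b * |x|) * (Real.exp (b * (x - y)) + Real.exp (-b * (x - y))) := by
      have h2 : |y| ≤ |x| + |x - y| := by
        have := abs_sub x (x - y)
        rwa [sub_sub_cancel] at this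
      calc Real.exp (b * |y|) ≤ Real.exp (b * |x|) * Real.exp (b * |x - y|) := by
            rw [← Real.exp_add, ← mul_add]; gcongr
        _ ≤ _ := by
          gcongr
          rcases abs_cases (x - y) with ⟨h, -⟩ | ⟨h, -⟩
          · rw [h]; exact le_add_of_nonneg_right (Real.exp_pos _).le
          · rw [h, mul_neg, ← neg_mul]; exact le_add_of_nonneg_left (Real.exp_pos _).le
    have h3 := hk_nonneg t (x - y)
    calc _ ≤ hk t (x - y) * (Real.exp (b * |x|) *
          (Real.exp (b * (x - y)) + Real.exp (-b * (x - y)))) := by gcongr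
      _ = Real.exp (b * |x|) * (hk t (x - y) * Real.exp (b * (x - y)) +
          hk t (x - y) * Real.exp (-b * (x - y))) := by ring
      _ = _ := by
        rw [hk_mul_exp ht, hk_mul_exp ht, hK, neg_sq,
          show x - y - b * t = x - b * t - y by ring, show x - y - -b * t = x + b * t - y by ring]
        ring
  refine (lintegral_mono hpt).trans (le_of_eq ?_)
  have hone : ∀ c, ∫⁻ y, ENNReal.ofReal (hk t (c - y)) = 1 := fun c => by
    rw [lintegral_sub_left_eq_self (fun y => ENNReal.ofReal (hk t y)) c]
    simpa using lintegral_hk ht 0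
  have hm : ∀ c, Measurable fun y => ENNReal.ofReal (hk t (c - y)) := fun c =>
    (measurable_hk_sub_right t c).ennreal_ofReal
  have hm2 : Measurable fun y => ENNReal.ofReal (hk t (x - b * t - y)) +
      ENNReal.ofReal (hk t (x + b * t - y)) := (hm _).add (hm _)
  rw [lintegral_const_mul _ hm2, lintegral_add_left (hm _), hone, hone,
    one_add_one_eq_two, ← ENNReal.ofReal_ofNat, ← ENNReal.ofReal_mul (by positivity), hK]
  congr 1; ring

section

variable {n : ℕ} {ζ β : Fin n → ℝ} {f : ℝ → ℝ} {β₀ : WithBot ℝ}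

/-- A bound with a nonnegative rate, also for `β₀ = -∞`. -/
theorem exists_rate (hf : ExpBounded β₀ f) :
    ∃ b C : ℝ, 0 ≤ b ∧ 0 ≤ C ∧ ∀ x, f x ≤ C * Real.exp (b * |x|) := by
  have : ∃ b : ℝ, 0 ≤ b ∧ β₀ < (b : WithBot ℝ) := by
    induction β₀ using WithBot.recBotCoe with
    | bot => exact ⟨0, le_rfl, WithBot.bot_lt_coe 0⟩
    | coe β => exact ⟨max β 0 + 1, by positivity, WithBot.coe_lt_coe.2 (by
        linarith [le_max_left β 0])⟩
  obtain ⟨b, hb, hlt⟩ := this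
  obtain ⟨C, hC⟩ := hf b hlt
  refine ⟨b, max C 0, hb, le_max_right _ _, fun x => (hC x).trans ?_⟩
  gcongr
  exact le_max_left _ _

theorem exists_lintegral_initMeasure_le (hfm : Measurable f) (hf : ExpBounded β₀ f) :
    ∃ D b C : ℝ, 0 ≤ D ∧ 0 ≤ b ∧ 0 ≤ C ∧ ∀ t x, 0 < t →
      ∫⁻ y, ENNReal.ofReal (hk t (x - y)) ∂(initMeasure ζ β f) ≤
        ENNReal.ofReal (D * (1 / Real.sqrt t) +
          C * (2 * Real.exp (b ^ 2 * t / 2) * Real.exp (b * |x|))) := by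
  obtain ⟨b, C, hb, hC0, hC⟩ := exists_rate hf
  have hD : 0 ≤ ∑ j, Real.exp (β j) := Finset.sum_nonneg fun j _ => (Real.exp_pos _).le
  refine ⟨∑ j, Real.exp (β j), b, C, hD, hb, hC0, fun t x ht => ?_⟩
  have hm := (measurable_hk_sub_right t x).ennreal_ofReal
  rw [initMeasure, lintegral_add_measure, lintegral_finsetSum_measure,
    ENNReal.ofReal_add (by positivity) (by positivity)]
  refine add_le_add ?_ ?_
  · rw [Finset.sum_mul, ENNReal.ofReal_sum_of_nonneg fun j _ => by positivity]
    refine Finset.sum_le_sum fun j _ => ?_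
    rw [lintegral_smul_measure, lintegral_dirac' _ hm, smul_eq_mul,
      ← ENNReal.ofReal_mul (Real.exp_pos _).le]
    exact ENNReal.ofReal_le_ofReal (mul_le_mul_of_nonneg_left (hk_le_inv_sqrt ht _)
      (Real.exp_pos _).le)
  · rw [lintegral_withDensity_eq_lintegral_mul _ hfm.ennreal_ofReal hm, ENNReal.ofReal_mul hC0]
    refine le_trans ?_ (mul_le_mul_right (lintegral_hk_mul_exp_abs_le ht hb x) _)
    have hm2 : Measurable fun y => ENNReal.ofReal (hk t (x - y)) *
        ENNReal.ofReal (Real.exp (b * |y|)) := hm.mul (by fun_prop)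
    rw [← lintegral_const_mul _ hm2]
    refine lintegral_mono fun y => ?_
    simp only [Pi.mul_apply]
    calc _ ≤ ENNReal.ofReal (C * Real.exp (b * |y|)) * ENNReal.ofReal (hk t (x - y)) := by
          gcongr; exact hC y
      _ = _ := by rw [ENNReal.ofReal_mul hC0]; ring

instance sFinite_initMeasure : SFinite (initMeasure ζ β f) := by
  unfold initMeasure
  rw [← Measure.sum_fintype]
  infer_instance

theorem heatFinite_initMeasure (hfm : Measurable f) (hf : ExpBounded β₀ f) :
    HeatFinite (initMeasure ζ β f) := fun t x => by
  rcases le_or_gt t 0 with ht | ht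
  · simp [hk_of_nonpos ht]
  · obtain ⟨D, b, C, -, -, -, h⟩ := exists_lintegral_initMeasure_le (ζ := ζ) (β := β) hfm hf
    exact ((h t x ht).trans_lt ENNReal.ofReal_lt_top).ne

theorem expFlow_initMeasure (hfm : Measurable f) (hf : ExpBounded β₀ f) (T : ℝ) :
    ExpFlow T (initMeasure ζ β f) := fun δ hδ => by
  obtain ⟨D, b, C, hD, hb, hC, h⟩ := exists_lintegral_initMeasure_le (ζ := ζ) (β := β) hfm hf
  set K := D * (1 / Real.sqrt δ) + C * (2 * Real.exp (b ^ 2 * T / 2)) with hK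
  have hK0 : 0 ≤ K := by positivity
  refine ⟨K + b, by positivity, fun z hz hT => ?_⟩
  have hz0 : 0 < z.1 := hδ.trans_le hz
  have h1 := h (z.1 - 0) z.2 (by simpa using hz0)
  rw [← ofReal_heatFlow (heatFinite_initMeasure hfm hf), ENNReal.ofReal_le_ofReal_iff (by positivity),
    sub_zero] at h1
  have hs : Real.sqrt δ ≤ Real.sqrt z.1 := Real.sqrt_le_sqrt hz
  have hsδ : 0 < Real.sqrt δ := Real.sqrt_pos.2 hδ
  calc _ ≤ _ := h1
    _ ≤ D * (1 / Real.sqrt δ) * Real.exp (b * |z.2|) +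
        C * (2 * Real.exp (b ^ 2 * T / 2) * Real.exp (b * |z.2|)) := by
      have h2 : D * (1 / Real.sqrt z.1) ≤ D * (1 / Real.sqrt δ) * Real.exp (b * |z.2|) := by
        calc D * (1 / Real.sqrt z.1) ≤ D * (1 / Real.sqrt δ) * 1 := by rw [mul_one]; gcongr
          _ ≤ _ := by gcongr; exact Real.one_le_exp (by positivity)
      gcongr
    _ = K * Real.exp (b * |z.2|) := by rw [hK]; ring
    _ ≤ (K + b) * Real.exp ((K + b) * |z.2|) := by gcongr <;> linarith

end

/-! ### Potentials on the strip -/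

/-- The extension by zero of a potential on the strip. -/
def ext (T : ℝ) (w : ℝ × ℝ → ℝ) : ℝ × ℝ → ℝ := (strip T).indicator w

theorem measurableSet_strip (T : ℝ) : MeasurableSet (strip T) :=
  measurableSet_Icc.prod MeasurableSet.univ

theorem ae_mem_Ioc (T : ℝ) :
    ∀ᵐ z ∂(volume.restrict (strip T)), z ∈ Ioc 0 T ×ˢ (univ : Set ℝ) := by
  have h0 : ∀ᵐ z : ℝ × ℝ, z.1 ≠ 0 := by
    have : (volume : Measure (ℝ × ℝ)) {z : ℝ × ℝ | z.1 = 0} = 0 := by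
      have : {z : ℝ × ℝ | z.1 = 0} = {0} ×ˢ univ := by ext z; simp
      rw [this, Measure.volume_eq_prod, Measure.prod_prod]; simp
    rw [ae_iff]; simpa using this
  rw [ae_restrict_iff' (measurableSet_strip T)]
  filter_upwards [h0] with z hz hs
  exact ⟨⟨lt_of_le_of_ne hs.1.1 (Ne.symm hz), hs.1.2⟩, mem_univ _⟩

section

variable {T : ℝ} {w q : ℝ × ℝ → ℝ} {μ : Measure ℝ}

theorem cost_nonneg (T : ℝ) (w : ℝ × ℝ → ℝ) : 0 ≤ cost T w :=
  mul_nonneg (by norm_num) (integral_nonneg fun _ => sq_nonneg _)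

theorem potBound_ext (hw : InL2 T w) : PotBound (ext T w) (Real.sqrt (2 * cost T w)) := by
  have hs := measurableSet_strip T
  refine ⟨(aestronglyMeasurable_indicator_iff hs).2 hw.1, Real.sqrt_nonneg _, ?_⟩
  have h2 : Integrable (fun z => w z ^ 2) (volume.restrict (strip T)) := hw.integrable_sq
  have e1 : ∀ z, ‖ext T w z‖ₑ ^ 2 = (strip T).indicator (fun z => ENNReal.ofReal (w z ^ 2)) z :=
    fun z => by
      by_cases hz : z ∈ strip T
      · rw [ext, indicator_of_mem hz, indicator_of_mem hz, ← sq_abs, ENNReal.ofReal_pow (abs_nonneg _),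
          Real.enorm_eq_ofReal_abs]
      · rw [ext, indicator_of_notMem hz, indicator_of_notMem hz]; simp
  simp_rw [e1]
  rw [lintegral_indicator hs, ← ofReal_integral_eq_lintegral_ofReal h2
    (ae_of_all _ fun _ => sq_nonneg _), Real.sq_sqrt (by have := cost_nonneg T w; positivity), cost]
  apply ENNReal.ofReal_le_ofReal
  linarith

theorem ext_mul (T : ℝ) (w q κ : ℝ × ℝ → ℝ) (z : ℝ × ℝ) :
    κ z * (ext T w z * q z) = (strip T).indicator (fun z => κ z * (w z * q z)) z := by
  by_cases hz : z ∈ strip T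
  · rw [ext, indicator_of_mem hz, indicator_of_mem hz]
  · rw [ext, indicator_of_notMem hz, indicator_of_notMem hz]; ring

/-- The series solution satisfies the Duhamel equation in the sense of `IsDuhamelForward`. -/
theorem isDuhamelForward_fwd [SFinite μ] (hμ : HeatFinite μ) {R : ℝ} (hw : PotBound (ext T w) R) :
    IsDuhamelForward T μ w (fwd μ (ext T w)) := by
  have hg := freeSol_heatFlow (s := 0) hμ
  have hg0 : ∀ z : ℝ × ℝ, z.1 ≤ 0 → heatFlow 0 μ z = 0 := fun z hz => heatFlow_of_le hz
  have hs := measurableSet_strip T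
  refine ⟨fun z hz => (continuousAt_fwd hμ hw hz.1.1).continuousWithinAt, fun t ht x => ?_,
    fun t ht x => ?_⟩
  · have h := integrable_hk_mul_sol hw hg hg0 (t, x)
    rw [← integrable_indicator_iff hs]
    refine h.congr (ae_of_all _ fun z => ?_)
    exact ext_mul T w (fwd μ (ext T w)) (fun z => hk (t - z.1) (x - z.2)) z
  · rw [fwd, sol_eq hw hg hg0, heatFlow, sub_zero, volterra, ← integral_indicator hs]
    congr 1
    refine integral_congr_ae (ae_of_all _ fun z => ?_)
    exact ext_mul T w (fwd μ (ext T w)) (fun z => hk (t - z.1) (x - z.2)) z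

/-- Uniqueness of Duhamel solutions. -/
theorem IsDuhamelForward.eq_fwd [SFinite μ] (hμ : HeatFinite μ) {R : ℝ}
    (hw : PotBound (ext T w) R) (hq : IsDuhamelForward T μ w q) :
    ∀ z ∈ Ioc 0 T ×ˢ (univ : Set ℝ), q z = fwd μ (ext T w) z := by
  have hs := measurableSet_strip T
  have hS : MeasurableSet (Ioc 0 T ×ˢ (univ : Set ℝ)) := measurableSet_Ioc.prod MeasurableSet.univ
  have hF := isDuhamelForward_fwd hμ hw
  set v := fwd μ (ext T w) with hv
  set d : ℝ × ℝ → ℝ := (Ioc 0 T ×ˢ (univ : Set ℝ)).indicator fun z => q z - v z with hd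
  have hdm : AEStronglyMeasurable d volume := by
    rw [hd, aestronglyMeasurable_indicator_iff hS]
    exact (hq.continuousOn.sub hF.continuousOn).aestronglyMeasurable hS
  -- on the strip the difference of the two integrands is the one of `d`, up to the null set `t = 0`
  have hae : ∀ᵐ z ∂(volume.restrict (strip T)), d z = q z - v z := by
    filter_upwards [ae_mem_Ioc T] with z hz
    exact indicator_of_mem hz _
  have hint : ∀ a ∈ Ioc 0 T ×ˢ (univ : Set ℝ),
      IntegrableOn (fun z : ℝ × ℝ => hk (a.1 - z.1) (a.2 - z.2) * (w z * d z)) (strip T) ∧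
      d a = ∫ z in strip T, hk (a.1 - z.1) (a.2 - z.2) * (w z * d z) := fun a ha => by
    have h1 := hq.integrable a.1 ha.1 a.2
    have h2 := hF.integrable a.1 ha.1 a.2
    have e : (fun z : ℝ × ℝ => hk (a.1 - z.1) (a.2 - z.2) * (w z * q z) -
        hk (a.1 - z.1) (a.2 - z.2) * (w z * v z)) =ᵐ[volume.restrict (strip T)]
        fun z => hk (a.1 - z.1) (a.2 - z.2) * (w z * d z) := by
      filter_upwards [hae] with z hz
      rw [hz]; ring
    refine ⟨(h1.sub h2).congr e, ?_⟩
    rw [← integral_congr_ae e, integral_sub h1 h2, hd, indicator_of_mem ha]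
    have h3 := hq.eq a.1 ha.1 a.2
    have h4 := hF.eq a.1 ha.1 a.2
    simp only [Prod.mk.eta] at h3 h4
    linarith
  have henorm : ∀ a, ∫⁻ z, ehk (a - z) * ‖ext T w z * d z‖ₑ =
      ∫⁻ z in strip T, ‖hk (a.1 - z.1) (a.2 - z.2) * (w z * d z)‖ₑ := fun a => by
    rw [← lintegral_indicator hs]
    refine lintegral_congr fun z => ?_
    by_cases hz : z ∈ strip T
    · rw [indicator_of_mem hz, ext, indicator_of_mem hz, enorm_hk_sub_mul, enorm_mul, mul_assoc]
    · rw [indicator_of_notMem hz, ext, indicator_of_notMem hz]; simp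
  have hmem : ∀ a, d a ≠ 0 → a ∈ Ioc 0 T ×ˢ (univ : Set ℝ) := fun a ha => by
    by_contra h; exact ha (indicator_of_notMem h _)
  have hzero := eq_zero_of_le_lintegral hw hdm (fun z hz => (hmem z hz).1.1.le)
    (fun a ha => by rw [henorm]; exact (hint a (hmem a ha)).1.2.ne) fun a => by
      by_cases ha : d a = 0
      · rw [ha, enorm_zero]; exact bot_le
      · rw [henorm, (hint a (hmem a ha)).2]
        exact enorm_integral_le_lintegral_enorm _
  intro z hz
  have := hzero z
  rw [hd, indicator_of_mem hz] at this
  linarith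

/-- The backward series solution satisfies the Duhamel equation. -/
theorem isDuhamelBackward_bwd {m : ℕ} (ξ γ : Fin m → ℝ) {R : ℝ} (hw : PotBound (ext T w) R) :
    IsDuhamelBackward T ξ γ w (bwd T ξ γ (ext T w)) := by
  have hs := measurableSet_strip T
  have e : ∀ t x, (fun z : ℝ × ℝ => ∑ i, γ i * (hk (z.1 - t) (z.2 - x) *
      (ext T w z * back (ext T w) (T, ξ i) z))) =
      (strip T).indicator fun z => bwd T ξ γ (ext T w) z * w z * hk (z.1 - t) (z.2 - x) :=
    fun t x => funext fun z => by
      by_cases hz : z ∈ strip T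
      · rw [indicator_of_mem hz, bwd, Finset.sum_mul, Finset.sum_mul]
        refine Finset.sum_congr rfl fun i _ => ?_
        nth_rw 1 [ext]
        rw [indicator_of_mem hz]; ring
      · rw [indicator_of_notMem hz]
        refine Finset.sum_eq_zero fun i _ => ?_
        nth_rw 1 [ext]
        rw [indicator_of_notMem hz]; ring
  have hi := fun t x i => (integrable_back hw (T, ξ i) (t, x)).const_mul (γ i)
  refine ⟨fun z hz => (continuousAt_bwd hw fun i h => ?_).continuousWithinAt, fun t ht x => ?_,
    fun t ht x => ?_⟩
  · have := hz.1.2; rw [h] at this; exact lt_irrefl _ this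
  · rw [← integrable_indicator_iff hs, ← e]
    exact integrable_finsetSum _ fun i _ => hi t x i
  · rw [← integral_indicator hs, ← e, integral_finsetSum _ fun i _ => hi t x i,
      ← Finset.sum_add_distrib, bwd]
    refine Finset.sum_congr rfl fun i _ => ?_
    rw [back_eq hw, integral_const_mul, mul_add]

end

/-! ### Differentiability with respect to the potential -/

theorem PotBound.mono {w : ℝ × ℝ → ℝ} {R R' : ℝ} (h : PotBound w R) (hR : R ≤ R') :
    PotBound w R' :=
  ⟨h.aesm, h.nonneg.trans hR, h.lintegral_le.trans (ENNReal.ofReal_le_ofReal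
    (pow_le_pow_left₀ h.nonneg hR 2))⟩

theorem PotBound.congr_ae {w w' : ℝ × ℝ → ℝ} {R : ℝ} (h : PotBound w R) (he : w =ᵐ[volume] w') :
    PotBound w' R := by
  refine ⟨h.aesm.congr he, h.nonneg, (lintegral_congr_ae ?_).trans_le h.lintegral_le⟩
  filter_upwards [he] with z hz
  rw [hz]

/-- The Hilbert space of potentials on the strip. -/
abbrev Pot (T : ℝ) := Lp ℝ 2 (volume.restrict (strip T))

section

variable {T : ℝ} {w w' : ℝ × ℝ → ℝ}

theorem ext_congr_ae (h : w =ᵐ[volume.restrict (strip T)] w') : ext T w =ᵐ[volume] ext T w' := by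
  have := (ae_restrict_iff' (measurableSet_strip T)).1 h
  filter_upwards [this] with z hz
  by_cases hs : z ∈ strip T
  · rw [ext, ext, indicator_of_mem hs, indicator_of_mem hs, hz hs]
  · rw [ext, ext, indicator_of_notMem hs, indicator_of_notMem hs]

theorem inL2_coe (u : Pot T) : InL2 T u := Lp.memLp u

theorem two_mul_cost_coe (u : Pot T) : 2 * cost T u = ‖u‖ ^ 2 := by
  rw [← real_inner_self_eq_norm_sq, L2.inner_def, cost]
  simp only [real_inner_self_eq_norm_sq, Real.norm_eq_abs, sq_abs]
  ring

theorem potBound_coe (u : Pot T) : PotBound (ext T u) ‖u‖ := by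
  have := potBound_ext (inL2_coe u)
  rwa [two_mul_cost_coe, Real.sqrt_sq (norm_nonneg _)] at this

theorem ext_sub_ae (u v : Pot T) : ext T ⇑(v - u) =ᵐ[volume] fun z => ext T v z - ext T u z := by
  refine (ext_congr_ae (Lp.coeFn_sub v u)).trans (ae_of_all _ fun z => ?_)
  by_cases hs : z ∈ strip T
  · simp only [ext, indicator_of_mem hs, Pi.sub_apply]
  · simp only [ext, indicator_of_notMem hs, sub_zero]

theorem potBound_sub (u v : Pot T) : PotBound (fun z => ext T v z - ext T u z) ‖v - u‖ :=
  (potBound_coe (v - u)).congr_ae (ext_sub_ae u v)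

theorem inner_pot {K : ℝ × ℝ → ℝ} (hK : MemLp K 2 (volume.restrict (strip T))) (v : Pot T) :
    inner ℝ (hK.toLp K) v = ∫ z, K z * ext T v z := by
  have e : ∀ z, K z * ext T v z = (strip T).indicator (fun z => K z * v z) z := fun z => by
    by_cases hs : z ∈ strip T
    · rw [ext, indicator_of_mem hs, indicator_of_mem hs]
    · rw [ext, indicator_of_notMem hs, indicator_of_notMem hs, mul_zero]
  simp_rw [e]
  rw [integral_indicator (measurableSet_strip T), L2.inner_def]
  refine integral_congr_ae ?_
  filter_upwards [hK.coeFn_toLp] with z hz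
  rw [hz]
  simp [mul_comm]

end

section

variable {w w' : ℝ × ℝ → ℝ} {R D : ℝ} {g : ℝ × ℝ → ℝ}

theorem memLp_hk_mul (hg : FreeSol g) (hg0 : ∀ z : ℝ × ℝ, z.1 ≤ 0 → g z = 0) (e : ℝ × ℝ) :
    MemLp (fun z : ℝ × ℝ => hk (e.1 - z.1) (e.2 - z.2) * g z) 2 volume := by
  have hm : Measurable fun z : ℝ × ℝ => hk (e.1 - z.1) (e.2 - z.2) * g z :=
    (measurable_hk_sub e).mul hg.measurable
  rw [memLp_two_iff_integrable_sq hm.aestronglyMeasurable]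
  refine ⟨(hm.pow_const 2).aestronglyMeasurable, ?_⟩
  have hle := hg.dominating.lintegral_sq_le e 1 one_pos
  have hpt : ∀ z : ℝ × ℝ, ‖(hk (e.1 - z.1) (e.2 - z.2) * g z) ^ 2‖ₑ ≤
      ENNReal.ofReal (Real.exp e.1) ^ 2 * (ehk (e - z) * ew 1 e z * ENNReal.ofReal (g z)) ^ 2 :=
    fun z => by
      have h1 := hk_nonneg (e.1 - z.1) (e.2 - z.2)
      have h2 := hg.nonneg z
      rw [← mul_pow, enorm_pow, Real.enorm_of_nonneg (by positivity), ehk, ew,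
        ← ENNReal.ofReal_mul (hk_nonneg _ _), ← ENNReal.ofReal_mul (by
          have := hk_nonneg (e - z).1 (e - z).2; positivity),
        ← ENNReal.ofReal_mul (Real.exp_pos _).le]
      refine pow_le_pow_left' (ENNReal.ofReal_le_ofReal ?_) 2
      rcases le_or_gt z.1 0 with hz | hz
      · simp [hg0 z hz]
      · simp only [Prod.fst_sub, Prod.snd_sub]
        have h3 : 1 ≤ Real.exp e.1 * Real.exp (-(1 * (e.1 - z.1))) := by
          rw [← Real.exp_add]; exact Real.one_le_exp (by linarith)
        calc _ ≤ (Real.exp e.1 * Real.exp (-(1 * (e.1 - z.1)))) *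
              (hk (e.1 - z.1) (e.2 - z.2) * g z) := le_mul_of_one_le_left (by positivity) h3
          _ = _ := by ring
  refine (lintegral_mono hpt).trans_lt ?_
  rw [lintegral_const_mul' _ _ (by finiteness)]
  refine ENNReal.mul_lt_top (by finiteness) (hle.trans_lt ?_)
  finiteness

theorem memLp_back_mul_sol (hw : PotBound w R) (hw' : PotBound w' R) (hg : FreeSol g)
    (hg0 : ∀ z : ℝ × ℝ, z.1 ≤ 0 → g z = 0) (e : ℝ × ℝ) :
    MemLp (fun z => back w e z * sol w' g z) 2 volume :=
  ((memLp_hk_mul hg hg0 e).const_mul (4 * Real.exp (rate R * e.1))).mono'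
    ((aestronglyMeasurable_back hw e).mul (aestronglyMeasurable_sol hw' hg hg0))
    (ae_of_all _ fun z => abs_back_mul_sol_le hw hw' hg hg0 e z)

theorem abs_back_sub_back_le (hw : PotBound w R) (hw' : PotBound w' R)
    (hD : PotBound (fun z => w' z - w z) D) (e z : ℝ × ℝ) :
    |back w' e z - back w e z| ≤
      4 * D * (Real.exp (2 * rate R * (e.1 - z.1)) * hk (e.1 - z.1) (e.2 - z.2)) := by
  have := abs_sol_sub_sol_le (hw.refl e.1) (hw'.refl e.1) (hD.refl e.1) (freeSol_kern e.2)
    (kern_of_nonpos e.2) (refl e.1 z)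
  rw [kern_refl] at this
  exact this

/-- The remainder of the first-order expansion of the solution in the potential is quadratic. -/
theorem abs_sol_sub_sol_sub_le {w v u : ℝ × ℝ → ℝ} {Du Dv : ℝ} (hw : PotBound w R)
    (hv : PotBound v R) (hu : PotBound u R) (hDu : PotBound (fun z => u z - w z) Du)
    (hDv : PotBound (fun z => v z - w z) Dv)
    (hD : PotBound (fun z => v z - u z) D) (hg : FreeSol g)
    (hg0 : ∀ z : ℝ × ℝ, z.1 ≤ 0 → g z = 0) (e : ℝ × ℝ) :
    |sol v g e - sol u g e - ∫ z, (back w e z * sol w g z) * (v z - u z)| ≤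
      8 * (Du + Dv) * Real.exp (3 * rate R * e.1) * g e * D := by
  have hr := rate_pos R
  have hi1 := integrable_back_mul_mul_sol hu hv hD hg hg0 e
  have hi2 := integrable_back_mul_mul_sol hw hw hD hg hg0 e
  have e2 : ∫ z, (back w e z * sol w g z) * (v z - u z) =
      ∫ z, back w e z * (v z - u z) * sol w g z := by
    refine integral_congr_ae (ae_of_all _ fun z => ?_); simp only; ring
  rw [sol_sub_sol hu hv hg hg0 e, e2, ← integral_sub hi1 hi2, ← Real.norm_eq_abs]
  refine (norm_integral_le_integral_norm _).trans ?_
  have h1 := integral_abs_hk_mul_free_le hD hg hg0 e R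
  have h0 := integrable_hk_mul hD hg (rate_pos R) hD.nonneg (le_sq_mul_sqrt_rate D R)
    hg.measurable.aestronglyMeasurable zero_le_one (abs_le_exp_mul hg hg0 (rate_pos R)) e
  have hge := hg.nonneg e
  have hDu0 := hDu.nonneg
  have hDv0 := hDv.nonneg
  have hpt : ∀ z, |back u e z * sol v g z - back w e z * sol w g z| ≤
      8 * (Du + Dv) * Real.exp (2 * rate R * e.1) * (hk (e.1 - z.1) (e.2 - z.2) * g z) := fun z => by
    have b1 := abs_back_sub_back_le hw hu hDu e z
    have b2 := abs_sol_le' hv hg hg0 z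
    have b3 := abs_back_le hw e z
    have b4 := abs_sol_sub_sol_le hw hv hDv hg hg0 z
    rw [show (16 * R ^ 4 + 1) = rate R from rfl] at b2 b3
    have h3 := hk_nonneg (e.1 - z.1) (e.2 - z.2)
    have h4 := hg.nonneg z
    rcases le_or_gt z.1 0 with hz | hz
    · rw [hg0 z hz] at b2 ⊢
      rw [sol_of_nonpos hv hg hg0 hz, sol_of_nonpos hw hg hg0 hz]; simp
    rcases le_or_gt (e.1 - z.1) 0 with hz2 | hz2
    · rw [hk_of_nonpos hz2, mul_zero, mul_zero] at b1 b3
      have b5 : back w e z = 0 := abs_nonpos_iff.1 b3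
      rw [b5, sub_zero] at b1
      rw [b5, abs_nonpos_iff.1 b1, hk_of_nonpos hz2]; simp
    calc _ = |(back u e z - back w e z) * sol v g z + back w e z * (sol v g z - sol w g z)| := by
          congr 1; ring
      _ ≤ |back u e z - back w e z| * |sol v g z| + |back w e z| * |sol v g z - sol w g z| := by
          rw [← abs_mul, ← abs_mul]; exact abs_add_le _ _
      _ ≤ (4 * Du * (Real.exp (2 * rate R * (e.1 - z.1)) * hk (e.1 - z.1) (e.2 - z.2))) *
          (2 * (Real.exp (rate R * z.1) * g z)) +
          (2 * (Real.exp (rate R * (e.1 - z.1)) * hk (e.1 - z.1) (e.2 - z.2))) *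
          (4 * Dv * (Real.exp (2 * rate R * z.1) * g z)) := by gcongr
      _ = 8 * Du * (Real.exp (2 * rate R * (e.1 - z.1)) * Real.exp (rate R * z.1)) *
          (hk (e.1 - z.1) (e.2 - z.2) * g z) +
          8 * Dv * (Real.exp (rate R * (e.1 - z.1)) * Real.exp (2 * rate R * z.1)) *
          (hk (e.1 - z.1) (e.2 - z.2) * g z) := by ring
      _ ≤ 8 * Du * Real.exp (2 * rate R * e.1) * (hk (e.1 - z.1) (e.2 - z.2) * g z) +
          8 * Dv * Real.exp (2 * rate R * e.1) * (hk (e.1 - z.1) (e.2 - z.2) * g z) := by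
          rw [← Real.exp_add, ← Real.exp_add]
          gcongr <;> nlinarith
      _ = _ := by ring
  calc _ ≤ ∫ z, (8 * (Du + Dv) * Real.exp (2 * rate R * e.1)) *
        ‖hk (e.1 - z.1) (e.2 - z.2) * ((v z - u z) * g z)‖ := by
        refine integral_mono (hi1.sub hi2).norm (h0.norm.const_mul _) fun z => ?_
        have h3 := hk_nonneg (e.1 - z.1) (e.2 - z.2)
        have h4 := hg.nonneg z
        simp only
        rw [norm_mul, norm_mul, Real.norm_of_nonneg h3, Real.norm_of_nonneg h4,
          show back u e z * (v z - u z) * sol v g z - back w e z * (v z - u z) * sol w g z =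
            (back u e z * sol v g z - back w e z * sol w g z) * (v z - u z) by ring, norm_mul]
        calc _ ≤ 8 * (Du + Dv) * Real.exp (2 * rate R * e.1) *
              (hk (e.1 - z.1) (e.2 - z.2) * g z) * ‖v z - u z‖ := by gcongr; exact hpt z
          _ = _ := by ring
    _ ≤ 8 * (Du + Dv) * Real.exp (2 * rate R * e.1) * (D * (Real.exp (rate R * e.1) * g e)) := by
        rw [integral_const_mul]; gcongr
    _ = 8 * (Du + Dv) * (Real.exp (2 * rate R * e.1) * Real.exp (rate R * e.1)) * g e * D := by ring
    _ = _ := by rw [← Real.exp_add]; congr 4; ring_nf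

/-- The value of the solution at a point is strictly differentiable in the potential; the gradient
is the product of the backward and the forward solution. -/
theorem hasStrictFDerivAt_sol {T : ℝ} (hg : FreeSol g)
    (hg0 : ∀ z : ℝ × ℝ, z.1 ≤ 0 → g z = 0) (e : ℝ × ℝ) (w : Pot T)
    (hK : MemLp (fun z => back (ext T w) e z * sol (ext T w) g z) 2 (volume.restrict (strip T))) :
    HasStrictFDerivAt (fun u : Pot T => sol (ext T u) g e) (innerSL ℝ (hK.toLp _)) w := by
  set R := ‖w‖ + 1 with hR
  set C := 16 * Real.exp (3 * rate R * e.1) * g e with hC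
  have hC0 : 0 ≤ C := by have := hg.nonneg e; positivity
  refine HasStrictFDerivAt.of_isLittleO ?_
  rw [Asymptotics.isLittleO_iff]
  intro c hc
  -- on a ball of radius `r` about `w` the quadratic remainder is at most `c` times the increment
  set r := min 1 (c / (C + 1)) with hr
  have hr0 : 0 < r := by positivity
  have hball : Metric.ball w r ×ˢ Metric.ball w r ∈ 𝓝 (w, w) :=
    prod_mem_nhds (Metric.ball_mem_nhds w hr0) (Metric.ball_mem_nhds w hr0)
  filter_upwards [hball] with p hp
  obtain ⟨hv, hu⟩ := hp
  rw [mem_ball_iff_norm] at hv hu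
  have hbd : ∀ u : Pot T, ‖u - w‖ < r → ‖u‖ ≤ R := fun u hu => by
    have h1 := norm_sub_norm_le u w
    have h2 := hu.trans_le (min_le_left _ _)
    rw [hR]; linarith
  have hsub : inner ℝ (hK.toLp _) (p.1 - p.2) = ∫ z, (back (ext T w) e z * sol (ext T w) g z) *
      (ext T p.1 z - ext T p.2 z) := by
    rw [inner_pot]
    refine integral_congr_ae ?_
    filter_upwards [ext_sub_ae p.2 p.1] with z hz
    rw [hz]
  have h := abs_sol_sub_sol_sub_le ((potBound_coe w).mono (by rw [hR]; linarith))
    ((potBound_coe p.1).mono (hbd _ hv)) ((potBound_coe p.2).mono (hbd _ hu))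
    (potBound_sub w p.2) (potBound_sub w p.1) (potBound_sub p.2 p.1) hg hg0 e
  rw [innerSL_apply_apply, hsub, Real.norm_eq_abs]
  refine h.trans ?_
  gcongr
  have h5 : r * (C + 1) ≤ c := by
    rw [← le_div_iff₀ (by positivity)]; exact min_le_right _ _
  have hge := hg.nonneg e
  calc _ ≤ 8 * (r + r) * Real.exp (3 * rate R * e.1) * g e := by gcongr
    _ = r * C := by rw [hC]; ring
    _ ≤ c := by nlinarith

end

/-! ### The multipliers -/

section

variable {T R : ℝ} {μ : Measure ℝ} {m : ℕ} {ξ γ : Fin m → ℝ} {w : ℝ × ℝ → ℝ}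

theorem memLp_bwd_mul_fwd [SFinite μ] (hμ : HeatFinite μ) (hw : PotBound w R) :
    MemLp (fun z => bwd T ξ γ w z * fwd μ w z) 2 volume := by
  have : (fun z => bwd T ξ γ w z * fwd μ w z) =
      fun z => ∑ i, γ i * (back w (T, ξ i) z * fwd μ w z) := funext fun z => by
    rw [bwd, Finset.sum_mul]
    exact Finset.sum_congr rfl fun i _ => by ring
  rw [this]
  exact memLp_finsetSum _ fun i _ => (memLp_back_mul_sol hw hw (freeSol_heatFlow hμ)
    (fun z hz => heatFlow_of_le hz) (T, ξ i)).const_mul (γ i)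

/-- For a short time the fundamental solution is close to the heat kernel, uniformly in the
potential. -/
theorem exists_abs_back_sub_hk_le (R : ℝ) : ∃ ε, 0 < ε ∧ ∀ w, PotBound w R → ∀ e z : ℝ × ℝ,
    e.1 - z.1 ≤ ε → |back w e z - hk (e.1 - z.1) (e.2 - z.2)| ≤
      1 / 2 * hk (e.1 - z.1) (e.2 - z.2) := by
  -- this rate yields the contraction factor `1/12`; over a time of length `1/l` the weights differ
  -- by at most `e < 3`, so that the correction is at most `2 · 3 / 12 = 1/2` of the free part
  set l := (144 * R ^ 2) ^ 2 + 1 with hl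
  have hlpos : 0 < l := by positivity
  have hRθ : R ^ 2 ≤ (1 / 12) ^ 2 * Real.sqrt l := by
    have : 144 * R ^ 2 ≤ Real.sqrt l := Real.le_sqrt_of_sq_le (by rw [hl]; linarith)
    linarith
  refine ⟨1 / l, by positivity, fun w hw e z hz => ?_⟩
  have h := abs_sol_sub_le (hw.refl e.1) (freeSol_kern e.2) (kern_of_nonpos e.2) hlpos
    (by norm_num) (by norm_num) hRθ (refl e.1 z)
  rw [kern_refl] at h
  refine h.trans ?_
  have h1 := hk_nonneg (e.1 - z.1) (e.2 - z.2)
  have h2 : Real.exp (l * (refl e.1 z).1) ≤ 3 := by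
    refine le_trans (Real.exp_le_exp.2 (?_ : _ ≤ (1 : ℝ))) Real.exp_one_lt_three.le
    rw [le_div_iff₀ hlpos] at hz
    simp only [refl]; linarith
  calc _ ≤ 2 * (1 / 12) * (3 * hk (e.1 - z.1) (e.2 - z.2)) := by gcongr
    _ = _ := by ring

/-- Just below a terminal point its heat kernel dominates those of the other terminal points. -/
theorem exists_hk_dominates (hξ : Function.Injective ξ) (i₀ : Fin m) {ε : ℝ} (hε : 0 < ε) :
    ∃ τ, 0 < τ ∧ τ < ε ∧
      0 < 1 / 2 * hk τ 0 - 3 / 2 * ∑ i ∈ Finset.univ.erase i₀, hk τ (ξ i - ξ i₀) := by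
  set S := ∑ i ∈ Finset.univ.erase i₀, 1 / (ξ i - ξ i₀) ^ 2 with hS
  have hS0 : 0 ≤ S := Finset.sum_nonneg fun i _ => by positivity
  set τ := min (ε / 2) (1 / (9 * S + 1)) with hτ
  have hτ0 : 0 < τ := by positivity
  refine ⟨τ, hτ0, (min_le_left _ _).trans_lt (by linarith), ?_⟩
  have hs : 0 < Real.sqrt τ := Real.sqrt_pos.2 hτ0
  have h1 : 1 / (3 * Real.sqrt τ) ≤ hk τ 0 := by
    rw [hk_of_pos hτ0]
    simp only [ne_eq, OfNat.ofNat_ne_zero, not_false_eq_true, zero_pow, neg_zero, zero_div,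
      Real.exp_zero, mul_one, one_div]
    gcongr
    rw [Real.sqrt_le_left (by positivity), mul_pow, Real.sq_sqrt hτ0.le]
    nlinarith [Real.pi_lt_four]
  have h2 : ∑ i ∈ Finset.univ.erase i₀, hk τ (ξ i - ξ i₀) ≤ Real.sqrt τ * S := by
    rw [hS, Finset.mul_sum]
    refine Finset.sum_le_sum fun i hi => ?_
    have hne : ξ i - ξ i₀ ≠ 0 := sub_ne_zero.2 fun h => (Finset.ne_of_mem_erase hi) (hξ h)
    calc _ ≤ _ := hk_le_sqrt_div τ hne
      _ = _ := by ring
  have h3 : τ * (9 * S + 1) ≤ 1 := by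
    rw [← le_div_iff₀ (by positivity)]; exact min_le_right _ _
  have h4 : 3 / 2 * (Real.sqrt τ * S) < 1 / 2 * (1 / (3 * Real.sqrt τ)) := by
    rw [show 1 / 2 * (1 / (3 * Real.sqrt τ)) = 1 / (6 * Real.sqrt τ) by field_simp; norm_num,
      lt_div_iff₀ (by positivity)]
    have h5 : Real.sqrt τ * Real.sqrt τ = τ := Real.mul_self_sqrt hτ0.le
    calc 3 / 2 * (Real.sqrt τ * S) * (6 * Real.sqrt τ) = 9 * S * (Real.sqrt τ * Real.sqrt τ) := by
          ring
      _ < 1 := by rw [h5]; nlinarith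
  linarith

/-- The gradients of the constraints are independent, tested in the direction whose largest
coefficient is the one of `i₀`: shortly before the time `T`, near `ξ i₀`, the corresponding term
dominates. -/
theorem exists_sq_le_integral_of_max [SFinite μ] (hT : 0 < T) (hμ : HeatFinite μ) (h0 : μ ≠ 0)
    (hξ : Function.Injective ξ) (R : ℝ) (i₀ : Fin m) :
    ∃ c, 0 < c ∧ ∀ w (γ : Fin m → ℝ), PotBound w R → (∀ i, |γ i| ≤ |γ i₀|) →
      c * |γ i₀| ^ 2 ≤ ∫ z in strip T, (bwd T ξ γ w z * fwd μ w z) ^ 2 := by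
  obtain ⟨ε, hε, hback⟩ := exists_abs_back_sub_hk_le R
  obtain ⟨τ, hτ, hτε, hdom⟩ := exists_hk_dominates hξ i₀ (lt_min hε hT)
  obtain ⟨κ, hκ, hlow⟩ := sol_lower_bound R T
  set z₀ : ℝ × ℝ := (T - τ, ξ i₀) with hz₀
  have hτT : τ < T := hτε.trans_le (min_le_right _ _)
  set F : ℝ × ℝ → ℝ := fun z => 1 / 2 * hk (T - z.1) (ξ i₀ - z.2) -
    3 / 2 * ∑ i ∈ Finset.univ.erase i₀, hk (T - z.1) (ξ i - z.2) with hF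
  have hF0 : 0 < F z₀ := by
    simpa only [hF, hz₀, sub_sub_cancel, sub_self] using hdom
  have hkc : ∀ x, ContinuousAt (fun z : ℝ × ℝ => hk (T - z.1) (x - z.2)) z₀ := fun x =>
    ContinuousAt.comp (f := fun z : ℝ × ℝ => (T - z.1, x - z.2)) (g := fun z : ℝ × ℝ => hk z.1 z.2)
      (continuousAt_hk fun h => hτ.ne' (by simpa [hz₀] using congrArg Prod.fst h)) (by fun_prop)
  have hFc : ContinuousAt F z₀ := (continuousAt_const.mul (hkc _)).sub
    (continuousAt_const.mul (tendsto_finsetSum _ fun i _ => hkc _))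
  have hz0pos : 0 < z₀.1 := sub_pos.2 hτT
  have hq0 : 0 < heatFlow 0 μ z₀ := heatFlow_pos hμ h0 hz0pos
  have hev : ∀ᶠ z in 𝓝 z₀, F z₀ / 2 < F z ∧ heatFlow 0 μ z₀ / 2 < heatFlow 0 μ z ∧
      0 < z.1 ∧ z.1 < T ∧ T - z.1 < ε := by
    refine (hFc.eventually_const_lt (by linarith)).and
      (((continuousAt_heatFlow hμ hz0pos).eventually_const_lt (by linarith)).and
      ((continuousAt_fst.eventually_const_lt hz0pos).and
      ((continuousAt_fst.eventually_lt_const (by simp [hz₀, hτ])).and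
      (Tendsto.eventually_lt_const (f := fun z : ℝ × ℝ => T - z.1) (v := T - z₀.1) (by
        have := hτε.trans_le (min_le_left _ _)
        simpa [hz₀] using this) (ContinuousAt.tendsto (by fun_prop))))))
  obtain ⟨r, hr, hball⟩ := Metric.eventually_nhds_iff_ball.1 hev
  set B := Metric.ball z₀ r with hB
  set a := F z₀ / 2 * (κ * (heatFlow 0 μ z₀ / 2)) with ha
  have ha0 : 0 < a := by positivity
  have hvol : 0 < (volume B).toReal := ENNReal.toReal_pos
    (Metric.measure_ball_pos volume z₀ hr).ne' measure_ball_lt_top.ne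
  refine ⟨a ^ 2 * (volume B).toReal, by positivity, fun w γ hw hγ => ?_⟩
  have hint : Integrable fun z => (bwd T ξ γ w z * fwd μ w z) ^ 2 :=
    (memLp_bwd_mul_fwd hμ hw).integrable_sq
  have hBs : B ⊆ strip T := fun z hz =>
    ⟨⟨(hball z hz).2.2.1.le, (hball z hz).2.2.2.1.le⟩, mem_univ _⟩
  have hpt : ∀ z ∈ B, (|γ i₀| * a) ^ 2 ≤ (bwd T ξ γ w z * fwd μ w z) ^ 2 := fun z hz => by
    obtain ⟨h1, h2, h3, h4, h5⟩ := hball z hz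
    have hclose := fun i => hback w hw (T, ξ i) z h5.le
    simp only at hclose
    have hq : κ * (heatFlow 0 μ z₀ / 2) ≤ fwd μ w z :=
      le_trans (by gcongr) (hlow w μ hw hμ z h4.le)
    -- the term of the largest multiplier cannot be cancelled by the others
    have hp : |γ i₀| * (F z₀ / 2) ≤ |bwd T ξ γ w z| := by
      rw [bwd, ← Finset.add_sum_erase _ _ (Finset.mem_univ i₀)]
      have b1 : |γ i₀| * (1 / 2 * hk (T - z.1) (ξ i₀ - z.2)) ≤ |γ i₀ * back w (T, ξ i₀) z| := by
        rw [abs_mul]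
        gcongr
        have := neg_le_of_abs_le (hclose i₀)
        exact le_trans (by linarith) (le_abs_self _)
      have b2 : |∑ i ∈ Finset.univ.erase i₀, γ i * back w (T, ξ i) z| ≤
          |γ i₀| * (3 / 2 * ∑ i ∈ Finset.univ.erase i₀, hk (T - z.1) (ξ i - z.2)) := by
        refine (Finset.abs_sum_le_sum_abs _ _).trans ?_
        rw [Finset.mul_sum, Finset.mul_sum]
        refine Finset.sum_le_sum fun i _ => ?_
        rw [abs_mul]
        have b3 : |back w (T, ξ i) z| ≤ 3 / 2 * hk (T - z.1) (ξ i - z.2) := by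
          have b4 := abs_sub_abs_le_abs_sub (back w (T, ξ i) z) (hk (T - z.1) (ξ i - z.2))
          rw [abs_of_nonneg (hk_nonneg _ _)] at b4
          linarith [hclose i]
        exact mul_le_mul (hγ i) b3 (abs_nonneg _) (abs_nonneg _)
      have b5 := abs_sub_abs_le_abs_sub (γ i₀ * back w (T, ξ i₀) z)
        (-∑ i ∈ Finset.univ.erase i₀, γ i * back w (T, ξ i) z)
      rw [abs_neg, sub_neg_eq_add] at b5
      calc _ ≤ |γ i₀| * F z := by gcongr
        _ ≤ _ := by rw [hF, mul_sub]; linarith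
    have hab : |γ i₀| * a ≤ |bwd T ξ γ w z * fwd μ w z| := by
      have hκ0 : 0 ≤ κ * (heatFlow 0 μ z₀ / 2) := by positivity
      rw [abs_mul, ha, ← mul_assoc]
      exact mul_le_mul hp (hq.trans (le_abs_self _)) hκ0 (abs_nonneg _)
    rw [← sq_abs (bwd T ξ γ w z * fwd μ w z)]
    gcongr
  calc a ^ 2 * (volume B).toReal * |γ i₀| ^ 2 = ∫ _ in B, (|γ i₀| * a) ^ 2 := by
        rw [setIntegral_const, smul_eq_mul, Measure.real]; ring
    _ ≤ ∫ z in B, (bwd T ξ γ w z * fwd μ w z) ^ 2 :=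
        setIntegral_mono_on (integrableOn_const (hs := measure_ball_lt_top.ne)) hint.integrableOn
          measurableSet_ball hpt
    _ ≤ _ := setIntegral_mono_set hint.integrableOn (ae_of_all _ fun z => sq_nonneg _)
        hBs.eventuallyLE

/-- The gradients of the constraints are linearly independent, uniformly over bounded sets of
potentials. -/
theorem exists_sq_le_integral [SFinite μ] (hT : 0 < T) (hμ : HeatFinite μ) (h0 : μ ≠ 0)
    (hξ : Function.Injective ξ) (R : ℝ) :
    ∃ c, 0 < c ∧ ∀ w (γ : Fin m → ℝ), PotBound w R → ∀ i,
      c * |γ i| ^ 2 ≤ ∫ z in strip T, (bwd T ξ γ w z * fwd μ w z) ^ 2 := by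
  choose c hc h using fun i => exists_sq_le_integral_of_max (T := T) hT hμ h0 hξ R i
  have hev : ∀ᶠ x in 𝓝[>] (0 : ℝ), 0 < x ∧ ∀ i, x ≤ c i :=
    (eventually_mem_nhdsWithin).and (eventually_all.2 fun i =>
      mem_of_superset (Ioc_mem_nhdsGT (hc i)) fun x hx => hx.2)
  obtain ⟨x, hx, hxc⟩ := hev.exists
  refine ⟨x, hx, fun w γ hw i => ?_⟩
  have : Nonempty (Fin m) := ⟨i⟩
  obtain ⟨i₀, hi₀⟩ := Finite.exists_max fun i => |γ i|
  refine le_trans ?_ (h i₀ w γ hw hi₀)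
  exact mul_le_mul (hxc i₀) (pow_le_pow_left₀ (abs_nonneg _) (hi₀ i) 2) (sq_nonneg _) (hc i₀).le

end

section

variable {T R : ℝ} {μ : Measure ℝ} {m : ℕ} {ξ α : Fin m → ℝ} {w : ℝ × ℝ → ℝ}

/-- Admissibility in terms of the series solution, by uniqueness of Duhamel solutions. -/
theorem mem_admissible_iff [SFinite μ] (hT : 0 < T) (hμ : HeatFinite μ) :
    w ∈ admissible T μ ξ α ↔
      InL2 T w ∧ ∀ i, fwd μ (ext T w) (T, ξ i) = Real.exp (α i) := by
  constructor
  · rintro ⟨hw, q, hq, hval⟩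
    refine ⟨hw, fun i => ?_⟩
    have : (T, ξ i) ∈ Ioc 0 T ×ˢ (univ : Set ℝ) := ⟨⟨hT, le_rfl⟩, mem_univ _⟩
    rw [← hval i, hq.eq_fwd hμ (potBound_ext hw) _ this]
  · rintro ⟨hw, hval⟩
    exact ⟨hw, _, isDuhamelForward_fwd hμ (potBound_ext hw), hval⟩

theorem ext_toLp (hw : InL2 T w) : ext T ⇑(MemLp.toLp w hw) =ᵐ[volume] ext T w :=
  ext_congr_ae (MemLp.coeFn_toLp hw)

theorem fwd_toLp (hw : InL2 T w) : fwd μ (ext T ⇑(MemLp.toLp w hw)) = fwd μ (ext T w) := by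
  rw [fwd, fwd, sol_congr_ae (ext_toLp hw)]

theorem cost_congr_ae {w' : ℝ × ℝ → ℝ} (h : w =ᵐ[volume.restrict (strip T)] w') :
    cost T w = cost T w' := by
  rw [cost, cost]
  congr 1
  refine integral_congr_ae ?_
  filter_upwards [h] with z hz
  rw [hz]

/-- The Lagrange multiplier rule: every minimizer solves the Euler–Lagrange equation. The
multipliers are bounded in terms of the minimal cost. -/
theorem exists_critical [SFinite μ] (hT : 0 < T) (hμ : HeatFinite μ) (h0 : μ ≠ 0)
    (hξ : Function.Injective ξ) (R : ℝ) :
    ∃ Γ, 0 ≤ Γ ∧ ∀ w, IsMinimizer T μ ξ α w → Real.sqrt (2 * cost T w) ≤ R →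
      ∃ γ, Critical T μ ξ R Γ (ext T w) γ := by
  obtain ⟨c, hc, hlow⟩ := exists_sq_le_integral (T := T) hT hμ h0 hξ R
  refine ⟨Real.sqrt (R ^ 2 / c), Real.sqrt_nonneg _, fun w hmin hR => ?_⟩
  obtain ⟨hw, hval⟩ := (mem_admissible_iff hT hμ).1 hmin.1
  set u : Pot T := MemLp.toLp w hw with hu
  have hue : ext T u =ᵐ[volume] ext T w := ext_toLp hw
  have huf : fwd μ (ext T u) = fwd μ (ext T w) := fwd_toLp hw
  have hpot : PotBound (ext T w) R := (potBound_ext hw).mono hR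
  have hg := freeSol_heatFlow (s := 0) hμ
  have hg0 : ∀ z : ℝ × ℝ, z.1 ≤ 0 → heatFlow 0 μ z = 0 := fun z hz => heatFlow_of_le hz
  have hK := fun i => (memLp_back_mul_sol (potBound_coe u) (potBound_coe u) hg hg0
    (T, ξ i)).restrict (strip T)
  have hextr : IsLocalExtrOn (fun v : Pot T => ‖v‖ ^ 2)
      {v | ∀ i, fwd μ (ext T v) (T, ξ i) = fwd μ (ext T u) (T, ξ i)} u := by
    refine Or.inl (IsMinOn.localize fun v hv => ?_)
    have hadm : (v : ℝ × ℝ → ℝ) ∈ admissible T μ ξ α :=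
      (mem_admissible_iff hT hμ).2 ⟨inL2_coe v, fun i => by rw [hv i, huf, hval i]⟩
    have h1 := hmin.2 v hadm
    rw [mem_ofPred_eq, ← two_mul_cost_coe, ← two_mul_cost_coe, hu,
      cost_congr_ae (MemLp.coeFn_toLp hw)]
    linarith
  obtain ⟨Λ, Λ₀, hne, hsum⟩ := hextr.exists_multipliers_of_hasStrictFDerivAt
    (fun i => hasStrictFDerivAt_sol hg hg0 (T, ξ i) u (hK i)) (hasStrictFDerivAt_norm_sq u)
  -- the stationarity condition as an identity of potentials
  have hbf : ∀ γ : Fin m → ℝ, (∑ i, γ i • MemLp.toLp _ (hK i) : Pot T) =ᵐ[volume.restrict (strip T)]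
      fun z => bwd T ξ γ (ext T w) z * fwd μ (ext T w) z := fun γ => by
    have h1 : ∀ᵐ z ∂(volume.restrict (strip T)), ∀ i, (γ i • MemLp.toLp _ (hK i) : Pot T) z =
        γ i * (back (ext T w) (T, ξ i) z * fwd μ (ext T w) z) := by
      rw [ae_all_iff]
      intro i
      filter_upwards [Lp.coeFn_smul (γ i) (MemLp.toLp _ (hK i)), (hK i).coeFn_toLp] with z h1 h2
      rw [h1, Pi.smul_apply, h2, smul_eq_mul, back_congr_ae hue, ← huf, fwd]
    filter_upwards [h1, Lp.coeFn_finsetSum Finset.univ fun i => (γ i • MemLp.toLp _ (hK i) : Pot T)]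
      with z h1 h2
    rw [h2, Finset.sum_apply, bwd, Finset.sum_mul]
    exact Finset.sum_congr rfl fun i _ => by rw [h1 i]; ring
  have hlin : (∑ i, Λ i • MemLp.toLp _ (hK i) : Pot T) + (2 * Λ₀) • u = 0 := by
    refine ext_inner_right ℝ fun v => ?_
    have h1 := congrArg (fun L : Pot T →L[ℝ] ℝ => L v) hsum
    simp only [add_apply, sum_apply,
      smul_apply, innerSL_apply_apply, zero_apply] at h1
    rw [inner_add_left, sum_inner, inner_zero_left]
    refine Eq.trans ?_ h1
    simp only [inner_smul_left, smul_eq_mul, nsmul_eq_mul]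
    simp; ring
  have hnorm : ∀ γ : Fin m → ℝ, ∀ i, c * |γ i| ^ 2 ≤
      ‖(∑ i, γ i • MemLp.toLp _ (hK i) : Pot T)‖ ^ 2 := fun γ i => by
    refine (hlow _ γ hpot i).trans (le_of_eq ?_)
    rw [← two_mul_cost_coe, cost_congr_ae (hbf γ), cost]; ring
  -- the constraints are regular, so that the multiplier of the cost does not vanish
  have hΛ₀ : Λ₀ ≠ 0 := fun h => hne (by
    rw [h, mul_zero, zero_smul, add_zero] at hlin
    have : Λ = 0 := funext fun i => by
      have h1 := hnorm Λ i
      rw [hlin, norm_zero, zero_pow two_ne_zero] at h1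
      have h2 : |Λ i| ^ 2 ≤ 0 := by nlinarith [sq_nonneg |Λ i|]
      exact abs_eq_zero.1 (pow_eq_zero_iff two_ne_zero |>.1 (le_antisymm h2 (sq_nonneg _)))
    rw [this, h]; rfl)
  set γ : Fin m → ℝ := fun i => -(2 * Λ₀)⁻¹ * Λ i with hγ
  have hγu : (∑ i, γ i • MemLp.toLp _ (hK i) : Pot T) = u := by
    have h1 : (∑ i, γ i • MemLp.toLp _ (hK i) : Pot T) =
        -(2 * Λ₀)⁻¹ • ∑ i, Λ i • MemLp.toLp _ (hK i) := by
      rw [Finset.smul_sum]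
      exact Finset.sum_congr rfl fun i _ => by rw [smul_smul]
    rw [h1, eq_neg_of_add_eq_zero_left hlin, neg_smul, smul_neg, neg_neg, smul_smul,
      inv_mul_cancel₀ (by simpa using hΛ₀), one_smul]
  refine ⟨γ, hpot, fun i => Real.le_sqrt_of_sq_le ?_, ?_⟩
  · rw [le_div_iff₀ hc, mul_comm]
    refine (hnorm γ i).trans ?_
    rw [hγu]
    have h1 : ‖u‖ ≤ R := by
      rw [← Real.sqrt_sq (norm_nonneg u), ← two_mul_cost_coe, hu,
        cost_congr_ae (MemLp.coeFn_toLp hw)]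
      exact hR
    gcongr
  · have h1 : (u : ℝ × ℝ → ℝ) =ᵐ[volume.restrict (strip T)] w := MemLp.coeFn_toLp hw
    have h2 := hbf γ
    rw [hγu] at h2
    have h3 := (ae_restrict_iff' (measurableSet_strip T)).1 (h1.symm.trans h2)
    filter_upwards [h3] with z hz
    by_cases hs : z ∈ strip T
    · rw [← hz hs, ext, indicator_of_mem hs]
    · -- off the strip one of the two factors vanishes
      nth_rw 1 [ext]
      rw [indicator_of_notMem hs]
      rcases le_or_gt T z.1 with h | h
      · rw [bwd_of_le hpot h, zero_mul]
      · have : z.1 ≤ 0 := by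
          by_contra hc
          exact hs ⟨⟨(not_le.1 hc).le, h.le⟩, mem_univ _⟩
        rw [fwd, sol_of_nonpos hpot hg hg0 this, mul_zero]

end

/-! ### An admissible potential -/

section

variable {T : ℝ} {μ : Measure ℝ} {m : ℕ} {ξ : Fin m → ℝ}

/-- The potential that drives a compactly supported perturbation `u` of the free solution. -/
theorem isDuhamelForward_heatOp_div [SFinite μ] (hμ : HeatFinite μ) {u : ℝ × ℝ → ℝ}
    (hu : ContDiff ℝ ∞ u) {K : Set (ℝ × ℝ)} (hK : IsCompact K) (huK : tsupport u ⊆ K)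
    (hK0 : ∀ z ∈ K, 0 < z.1) (hpos : ∀ z ∈ K, 0 < heatFlow 0 μ z + u z) :
    InL2 T (fun z => heatOp u z / (heatFlow 0 μ z + u z)) ∧
      IsDuhamelForward T μ (fun z => heatOp u z / (heatFlow 0 μ z + u z))
        (fun z => heatFlow 0 μ z + u z) := by
  have hc : HasCompactSupport u := hK.of_isClosed_subset (isClosed_tsupport _) huK
  have hL := contDiff_heatOp hu
  have hL0 : ∀ z ∉ K, heatOp u z = 0 := fun z hz =>
    image_eq_zero_of_notMem_tsupport fun h => hz (huK (tsupport_heatOp_subset u h))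
  have hcont : ∀ z : ℝ × ℝ, 0 < z.1 → ContinuousAt (fun z => heatFlow 0 μ z + u z) z :=
    fun z hz => (continuousAt_heatFlow hμ hz).add hu.continuous.continuousAt
  have hmul : ∀ z, heatOp u z / (heatFlow 0 μ z + u z) * (heatFlow 0 μ z + u z) = heatOp u z :=
    fun z => by
      by_cases hz : z ∈ K
      · exact div_mul_cancel₀ _ (hpos z hz).ne'
      · rw [hL0 z hz, zero_div, zero_mul]
  have hint : ∀ a : ℝ × ℝ, Integrable fun z : ℝ × ℝ =>
      hk (a.1 - z.1) (a.2 - z.2) * heatOp u z := fun a =>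
    shortKernel_hk.integrable_mul_of_compact hL.continuous (hasCompactSupport_heatOp hc) a
  refine ⟨?_, fun z hz => (hcont z hz.1.1).continuousWithinAt, fun t ht x => ?_, fun t ht x => ?_⟩
  · set W : ℝ × ℝ → ℝ := fun z => heatOp u z / (heatFlow 0 μ z + u z) with hW
    have hWc : ContinuousOn W K := fun z hz =>
      (hL.continuous.continuousAt.div (hcont z (hK0 z hz)) (hpos z hz).ne').continuousWithinAt
    have hWi : K.indicator W = W := by
      rw [indicator_eq_self]
      intro z hz
      by_contra h
      exact hz (by simp [hW, hL0 z h])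
    obtain ⟨C, hC⟩ := hK.exists_bound_of_continuousOn hWc
    have : IsFiniteMeasure (volume.restrict K) := ⟨by
      rw [Measure.restrict_apply_univ]; exact hK.measure_lt_top⟩
    have h1 : MemLp W 2 (volume.restrict K) :=
      MemLp.of_bound (hWc.aestronglyMeasurable hK.measurableSet) C
        ((ae_restrict_iff' hK.measurableSet).2 (ae_of_all _ hC))
    have h2 : MemLp W 2 volume := by
      rw [← hWi]; exact (memLp_indicator_iff_restrict hK.measurableSet).2 h1
    exact h2.restrict _
  · simp_rw [hmul]
    exact (hint (t, x)).integrableOn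
  · simp_rw [hmul]
    have h1 : heatFlow 0 μ (t, x) = ∫ y, hk t (x - y) ∂μ := by rw [heatFlow, sub_zero]
    have h2 : ∫ z in strip T, hk (t - z.1) (x - z.2) * heatOp u z =
        ∫ z : ℝ × ℝ, hk (t - z.1) (x - z.2) * heatOp u z := by
      refine setIntegral_eq_integral_of_forall_compl_eq_zero fun z hz => ?_
      by_cases hzK : z ∈ K
      · have : T < z.1 := by
          by_contra h
          exact hz ⟨⟨(hK0 z hzK).le, not_lt.1 h⟩, mem_univ _⟩
        rw [hk_of_nonpos (by linarith [ht.2]), zero_mul]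
      · rw [hL0 z hzK, mul_zero]
    rw [h2, h1, eq_integral_hk_mul_heatOp hu hc (t, x)]

/-- There are admissible potentials: bumps at the terminal points change the values of the free
solution there into the prescribed ones and keep it positive, and the potential is read off the
equation. -/
theorem admissible_nonempty [SFinite μ] (hT : 0 < T) (hμ : HeatFinite μ) (h0 : μ ≠ 0)
    (hξ : Function.Injective ξ) (α : Fin m → ℝ) : (admissible T μ ξ α).Nonempty := by
  set c : Fin m → ℝ := fun i => Real.exp (α i) - heatFlow 0 μ (T, ξ i) with hc
  -- disjoint neighbourhoods on which the correction of the free solution keeps it positive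
  set s : Fin m → Set (ℝ × ℝ) := fun i => {z | (0 < z.1 ∧ 0 < heatFlow 0 μ z + min (c i) 0) ∧
    ∀ j, j ≠ i → |z.2 - ξ i| < |z.2 - ξ j|} with hs
  have hs_nhds : ∀ i, s i ∈ 𝓝 (T, ξ i) := fun i => by
    have hq := heatFlow_pos (z := (T, ξ i)) hμ h0 hT
    have hcq := (continuousAt_heatFlow (z := (T, ξ i)) hμ hT).add
      (continuousAt_const (y := min (c i) 0))
    have hpos : 0 < heatFlow 0 μ (T, ξ i) + min (c i) 0 := by
      rcases le_total (c i) 0 with h | h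
      · rw [min_eq_left h, hc]; simp [Real.exp_pos]
      · rw [min_eq_right h, add_zero]; exact hq
    have h1 : ∀ᶠ z : ℝ × ℝ in 𝓝 (T, ξ i), 0 < z.1 := continuousAt_fst.eventually_const_lt hT
    have h2 := hcq.eventually_const_lt hpos
    refine (h1.and h2).and (eventually_all.2 fun j => ?_)
    by_cases hj : j = i
    · exact Eventually.of_forall fun z h => absurd hj h
    · have hne : 0 < |ξ i - ξ j| := abs_pos.2 (sub_ne_zero.2 fun h => hj (hξ h.symm))
      have h3 : ContinuousAt (fun z : ℝ × ℝ => |z.2 - ξ j| - |z.2 - ξ i|) (T, ξ i) := by fun_prop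
      have h4 := h3.eventually_const_lt (u := 0) (by simpa using hne)
      filter_upwards [h4] with z hz _
      linarith
  choose χ hχs hχc hχd hχr hχ1 using fun i =>
    exists_contDiff_tsupport_subset (n := (⊤ : ℕ∞)) (hs_nhds i)
  have hdisj : ∀ i j z, z ∈ s i → j ≠ i → χ j z = 0 := fun i j z hz hj => by
    refine image_eq_zero_of_notMem_tsupport fun h => ?_
    exact lt_asymm (hz.2 j hj) ((hχs j h).2 i hj.symm)
  set u : ℝ × ℝ → ℝ := fun z => ∑ i, c i * χ i z with hu
  have hus : ∀ i, ∀ z ∈ s i, u z = c i * χ i z := fun i z hz =>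
    Finset.sum_eq_single i (fun j _ hj => by rw [hdisj i j z hz hj, mul_zero])
      fun h => absurd (Finset.mem_univ i) h
  set K : Set (ℝ × ℝ) := ⋃ i, tsupport (χ i) with hK
  have hKc : IsCompact K := isCompact_iUnion hχc
  have hud : ContDiff ℝ ∞ u := ContDiff.sum fun i _ => contDiff_const.mul (hχd i)
  have huK : tsupport u ⊆ K := by
    refine closure_minimal (fun z hz => ?_) hKc.isClosed
    by_contra h
    rw [hK, mem_iUnion, not_exists] at h
    exact hz (Finset.sum_eq_zero fun i _ => by
      rw [image_eq_zero_of_notMem_tsupport (h i), mul_zero])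
  have hKs : ∀ z ∈ K, ∃ i, z ∈ s i := fun z hz => by
    obtain ⟨i, hi⟩ := mem_iUnion.1 hz
    exact ⟨i, hχs i hi⟩
  obtain ⟨hL2, hF⟩ := isDuhamelForward_heatOp_div (T := T) hμ hud hKc huK
    (fun z hz => by obtain ⟨i, hi⟩ := hKs z hz; exact hi.1.1) fun z hz => by
      obtain ⟨i, hi⟩ := hKs z hz
      have hχ01 := hχr i (mem_range_self z)
      rw [hus i z hi]
      refine hi.1.2.trans_le ?_
      gcongr
      rcases le_total (c i) 0 with h | h
      · exact (min_le_left _ _).trans (by nlinarith [hχ01.2])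
      · exact (min_le_right _ _).trans (mul_nonneg h hχ01.1)
  refine ⟨_, hL2, _, hF, fun i => ?_⟩
  rw [hus i _ (mem_of_mem_nhds (hs_nhds i)), hχ1 i, hc]
  ring

end

/-! ### Weak continuity and existence of a minimizer -/

section

variable {T R : ℝ} {g : ℝ × ℝ → ℝ} {u : Pot T} {v : ℕ → Pot T}

/-- A strongly convergent sequence paired with a weakly convergent one. -/
theorem tendsto_integral_mul_ext (hR : ∀ n, ‖v n‖ ≤ R)
    (hv : ∀ K : Pot T, Tendsto (fun n => inner ℝ K (v n)) atTop (𝓝 (inner ℝ K u)))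
    {F : ℕ → ℝ × ℝ → ℝ} {F₀ G : ℝ × ℝ → ℝ} (hm : ∀ n, AEStronglyMeasurable (F n) volume)
    (hG : MemLp G 2 volume) (hle : ∀ n z, |F n z| ≤ G z)
    (hF : ∀ z, Tendsto (fun n => F n z) atTop (𝓝 (F₀ z))) :
    Tendsto (fun n => ∫ z, F n z * ext T (v n) z) atTop (𝓝 (∫ z, F₀ z * ext T u z)) := by
  have hm0 : AEStronglyMeasurable F₀ volume :=
    aestronglyMeasurable_of_tendsto_ae atTop hm (ae_of_all _ hF)
  have hle0 : ∀ z, |F₀ z| ≤ G z := fun z =>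
    le_of_tendsto (hF z).abs (Eventually.of_forall fun n => hle n z)
  have hFL : ∀ n, MemLp (F n) 2 (volume.restrict (strip T)) := fun n =>
    (hG.mono' (hm n) (ae_of_all _ (hle n))).restrict _
  have hFL0 : MemLp F₀ 2 (volume.restrict (strip T)) :=
    (hG.mono' hm0 (ae_of_all _ hle0)).restrict _
  have hstrong : Tendsto (fun n => ‖(hFL n).toLp - hFL0.toLp‖) atTop (𝓝 0) := by
    have h1 : ∀ n, ‖(hFL n).toLp - hFL0.toLp‖ ^ 2 = ∫ z in strip T, (F n z - F₀ z) ^ 2 := fun n => by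
      rw [← MemLp.toLp_sub, ← two_mul_cost_coe, cost_congr_ae (MemLp.coeFn_toLp _), cost]
      simp only [Pi.sub_apply]; ring
    have h2 : Tendsto (fun n => ∫ z in strip T, (F n z - F₀ z) ^ 2) atTop
        (𝓝 (∫ z in strip T, (0 : ℝ))) := by
      refine tendsto_integral_of_dominated_convergence (fun z => 4 * G z ^ 2)
        (fun n => (((hm n).sub hm0).pow 2).restrict) ((hG.integrable_sq.const_mul 4).restrict)
        (fun n => ae_of_all _ fun z => ?_) (ae_of_all _ fun z => ?_)
      · have h3 : |F n z - F₀ z| ≤ 2 * G z := by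
          have := abs_sub (F n z) (F₀ z)
          linarith [hle n z, hle0 z]
        rw [Real.norm_of_nonneg (sq_nonneg _), ← sq_abs]
        calc _ ≤ (2 * G z) ^ 2 := pow_le_pow_left₀ (abs_nonneg _) h3 2
          _ = _ := by ring
      · have := ((hF z).sub_const (F₀ z)).pow 2
        simpa using this
    simp_rw [← h1, integral_zero] at h2
    have h3 := h2.sqrt
    simpa [Real.sqrt_sq] using h3
  have h1 : ∀ n, ∫ z, F n z * ext T (v n) z =
      inner ℝ ((hFL n).toLp - hFL0.toLp) (v n) + inner ℝ (hFL0.toLp F₀) (v n) := fun n => by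
    rw [← inner_add_left, sub_add_cancel, inner_pot]
  simp_rw [h1]
  rw [← inner_pot hFL0, ← zero_add (inner ℝ (hFL0.toLp F₀) u)]
  refine Tendsto.add ?_ (hv _)
  refine squeeze_zero_norm (fun n => (norm_inner_le_norm _ _).trans
    (mul_le_mul_of_nonneg_left (hR n) (norm_nonneg _))) ?_
  simpa using hstrong.mul_const R

/-- Each term of the series solution is weakly continuous in the potential. -/
theorem tendsto_iterate (hR : ∀ n, ‖v n‖ ≤ R)
    (hv : ∀ K : Pot T, Tendsto (fun n => inner ℝ K (v n)) atTop (𝓝 (inner ℝ K u)))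
    (hg : FreeSol g) (hg0 : ∀ z : ℝ × ℝ, z.1 ≤ 0 → g z = 0) (k : ℕ) :
    ∀ a, Tendsto (fun n => (volterra (ext T (v n)))^[k] g a) atTop
      (𝓝 ((volterra (ext T u))^[k] g a)) := by
  have hw := fun n => (potBound_coe (v n)).mono (hR n)
  induction k with
  | zero => exact fun a => tendsto_const_nhds
  | succ k ih =>
    intro a
    simp_rw [Function.iterate_succ_apply']
    have e : ∀ (w h : ℝ × ℝ → ℝ), volterra w h a =
        ∫ z, (hk (a.1 - z.1) (a.2 - z.2) * h z) * w z := fun w h => by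
      rw [volterra]
      refine integral_congr_ae (ae_of_all _ fun z => ?_)
      simp only; ring
    simp_rw [e]
    have hr := rate_pos R
    refine tendsto_integral_mul_ext hR hv (G := fun z => Real.exp (rate R * a.1) *
      (hk (a.1 - z.1) (a.2 - z.2) * g z))
      (fun n => (measurable_hk_sub a).aestronglyMeasurable.mul
        (aestronglyMeasurable_iterate (hw n).aesm hg.measurable.aestronglyMeasurable k))
      ((memLp_hk_mul hg hg0 a).const_mul _) (fun n z => ?_) fun z => (ih z).const_mul _
    have h1 := abs_iterate_le' (hw n) hg hg0 hr (by norm_num) (rate_le R) k z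
    have h2 : (1 / 2 : ℝ) ^ k ≤ 1 := pow_le_one₀ (by norm_num) (by norm_num)
    have h3 := hk_nonneg (a.1 - z.1) (a.2 - z.2)
    have h4 := hg.nonneg z
    rw [abs_mul, abs_of_nonneg h3]
    rcases le_or_gt (a.1 - z.1) 0 with hz | hz
    · simp [hk_of_nonpos hz]
    · calc _ ≤ hk (a.1 - z.1) (a.2 - z.2) * (1 * (Real.exp (rate R * a.1) * g z)) := by
            gcongr
            refine h1.trans ?_
            gcongr
            linarith
        _ = _ := by ring

/-- The solution is weakly continuous in the potential on bounded sets. -/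
theorem tendsto_sol (hR : ∀ n, ‖v n‖ ≤ R)
    (hv : ∀ K : Pot T, Tendsto (fun n => inner ℝ K (v n)) atTop (𝓝 (inner ℝ K u)))
    (hg : FreeSol g) (hg0 : ∀ z : ℝ × ℝ, z.1 ≤ 0 → g z = 0) (a : ℝ × ℝ) :
    Tendsto (fun n => sol (ext T (v n)) g a) atTop (𝓝 (sol (ext T u) g a)) := by
  refine tendsto_tsum_of_dominated_convergence
    (bound := fun k : ℕ => (1 / 2 : ℝ) ^ k * (Real.exp (rate R * a.1) * g a))
    ((summable_geometric_of_lt_one (by norm_num) (by norm_num)).mul_right _)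
    (fun k => tendsto_iterate hR hv hg hg0 k a) (Eventually.of_forall fun n k => ?_)
  exact abs_iterate_le' ((potBound_coe (v n)).mono (hR n)) hg hg0 (rate_pos R) (by norm_num)
    (rate_le R) k a

end

/-- Bounded sequences in a separable Hilbert space have weakly convergent subsequences. -/
theorem exists_weak_limit {E : Type*} [NormedAddCommGroup E] [InnerProductSpace ℝ E]
    [CompleteSpace E] [TopologicalSpace.SeparableSpace E] {R : ℝ} {v : ℕ → E}
    (hv : ∀ n, ‖v n‖ ≤ R) :
    ∃ (u : E) (φ : ℕ → ℕ), StrictMono φ ∧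
      ∀ K, Tendsto (fun n => inner ℝ K (v (φ n))) atTop (𝓝 (inner ℝ K u)) := by
  have hc := WeakDual.isSeqCompact_closedBall ℝ E (0 : StrongDual ℝ E) R
  obtain ⟨a, -, φ, hφ, ha⟩ := hc
    (x := fun n => StrongDual.toWeakDual (InnerProductSpace.toDual ℝ E (v n))) fun n => by
      simpa using hv n
  refine ⟨(InnerProductSpace.toDual ℝ E).symm (WeakDual.toStrongDual a), φ, hφ, fun K => ?_⟩
  have h := ((WeakDual.eval_continuous K).tendsto a).comp ha
  rw [real_inner_comm, InnerProductSpace.toDual_symm_apply]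
  refine h.congr fun n => ?_
  rw [real_inner_comm]; rfl

/-- The direct method: a minimizing sequence has a weak limit, which satisfies the constraints by
the weak continuity of the solution and has minimal norm. -/
theorem exists_isMinimizer {T : ℝ} {μ : Measure ℝ} {m : ℕ} {ξ : Fin m → ℝ} [SFinite μ] (hT : 0 < T)
    (hμ : HeatFinite μ) (h0 : μ ≠ 0) (hξ : Function.Injective ξ) (α : Fin m → ℝ) :
    ∃ w, IsMinimizer T μ ξ α w := by
  set A : Set (Pot T) := {u | ∀ i, fwd μ (ext T u) (T, ξ i) = Real.exp (α i)} with hA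
  have hmem : ∀ w (hw : w ∈ admissible T μ ξ α), ∃ u ∈ A, ‖u‖ ^ 2 = 2 * cost T w := fun w hw => by
    obtain ⟨h1, h2⟩ := (mem_admissible_iff hT hμ).1 hw
    refine ⟨MemLp.toLp w h1, fun i => by rw [fwd_toLp h1, h2 i], ?_⟩
    rw [← two_mul_cost_coe, cost_congr_ae (MemLp.coeFn_toLp h1)]
  obtain ⟨w₀, hw₀⟩ := admissible_nonempty hT hμ h0 hξ α
  obtain ⟨u₀, hu₀, -⟩ := hmem w₀ hw₀
  set S : Set ℝ := (fun u => ‖u‖) '' A with hS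
  have hSb : BddBelow S := ⟨0, by rintro _ ⟨u, -, rfl⟩; exact norm_nonneg u⟩
  obtain ⟨x, -, hx, hxS⟩ := exists_seq_tendsto_sInf (⟨_, u₀, hu₀, rfl⟩ : S.Nonempty) hSb
  choose v hvA hvx using hxS
  obtain ⟨R, hR⟩ := hx.bddAbove_range
  have hvR : ∀ n, ‖v n‖ ≤ R := fun n => (hvx n).trans_le (hR (mem_range_self n))
  have : Fact ((2 : ℝ≥0∞) ≠ ⊤) := ⟨ENNReal.ofNat_ne_top⟩
  obtain ⟨u, φ, hφ, hu⟩ := exists_weak_limit hvR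
  have huA : u ∈ A := fun i => by
    have h1 := tendsto_sol (fun n => hvR (φ n)) hu (freeSol_heatFlow (s := 0) hμ)
      (fun z hz => heatFlow_of_le hz) (T, ξ i)
    have h2 : (fun n => sol (ext T (v (φ n))) (heatFlow 0 μ) (T, ξ i)) =
        fun _ => Real.exp (α i) := funext fun n => hvA (φ n) i
    rw [h2] at h1
    exact tendsto_nhds_unique h1 tendsto_const_nhds
  have hle : ‖u‖ ≤ sInf S := by
    have h1 : ‖u‖ ^ 2 ≤ ‖u‖ * sInf S := by
      rw [← real_inner_self_eq_norm_sq]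
      refine le_of_tendsto_of_tendsto' (hu u) ((hx.comp hφ.tendsto_atTop).const_mul ‖u‖) fun n => ?_
      rw [Function.comp, ← hvx]
      exact real_inner_le_norm _ _
    rcases (norm_nonneg u).eq_or_lt with h | h
    · rw [← h]
      exact le_csInf ⟨_, u₀, hu₀, rfl⟩ (by rintro _ ⟨u, -, rfl⟩; exact norm_nonneg u)
    · rw [sq] at h1; exact le_of_mul_le_mul_left h1 h
  refine ⟨u, (mem_admissible_iff hT hμ).2 ⟨inL2_coe u, huA⟩, fun w' hw' => ?_⟩
  obtain ⟨u', hu', hn⟩ := hmem w' hw'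
  have h1 : ‖u‖ ^ 2 ≤ ‖u'‖ ^ 2 := by
    gcongr
    exact hle.trans (csInf_le hSb ⟨u', hu', rfl⟩)
  rw [hn, ← two_mul_cost_coe] at h1
  linarith

/-! ### The derivative bounds and the Duhamel equations of a critical pair -/

section

variable {T R Γ : ℝ} {μ : Measure ℝ} {m : ℕ} {ξ γ : Fin m → ℝ} {w w' q p : ℝ × ℝ → ℝ}

theorem weightP_eq (t x : ℝ) : weightP T ξ t x = gaussWeight (1 / 12) T ξ (t, x) := by
  rw [weightP, gaussWeight]
  congr 1
  refine Finset.sum_congr rfl fun i _ => ?_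
  congr 1
  simp only
  rw [neg_div, mul_comm (12 : ℝ), ← div_div]
  ring

theorem continuous_bwd_slice (hw : PotBound w R) (t : ℝ) :
    Continuous fun y => bwd T ξ γ w (t, y) := by
  rcases lt_or_ge t T with h | h
  · refine continuous_iff_continuousAt.2 fun y => ?_
    refine ContinuousAt.comp (f := fun y => (t, y)) (continuousAt_bwd hw fun i hi => ?_)
      (by fun_prop)
    exact h.ne (congrArg Prod.fst hi)
  · have : (fun y => bwd T ξ γ w (t, y)) = fun _ => 0 := funext fun y => bwd_of_le hw h
    rw [this]; exact continuous_const

theorem offBoxes_subset_regularSet {δ : ℝ} (hδ : 0 < δ) : offBoxes T ξ δ ⊆ regularSet T ξ :=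
  fun z hz => ⟨hδ.trans hz.1.1.1, fun i hi => hz.2 (by
    rw [hi, boxes, mem_iUnion]
    exact ⟨i, ⟨⟨by have := sq_nonneg δ; simp only; linarith, le_rfl⟩,
      ⟨by simp only; linarith, by simp only; linarith⟩⟩⟩)⟩

/-- The derivative bounds at one scale and order, uniformly over the critical pairs. -/
theorem exists_dx_le [SFinite μ] (hμ : HeatFinite μ) (hexp : ExpFlow T μ)
    (hΓ : 0 ≤ Γ) (ξ : Fin m → ℝ) (R δ : ℝ) (k : ℕ) :
    ∃ c : ℝ, 0 < δ → ∀ w γ, Critical T μ ξ R Γ w γ →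
      (∀ t x : ℝ, (t, x) ∈ domP T ξ δ k → ContDiffAt ℝ k (fun y => bwd T ξ γ w (t, y)) x ∧
        |dx k (bwd T ξ γ w) t x| ≤ c * weightP T ξ t x) ∧
      ∀ t x : ℝ, (t, x) ∈ domQ T ξ δ k → ContDiffAt ℝ k (fun y => fwd μ w (t, y)) x ∧
        |dx k (fwd μ w) t x| ≤ c * Real.exp (c * |x|) := by
  by_cases hδ : 0 < δ
  swap
  · exact ⟨0, fun h => absurd h hδ⟩
  rcases Nat.eq_zero_or_pos k with rfl | hk
  · obtain ⟨c₁, hc₁, h1⟩ := exists_fwd_le hμ hexp R hδ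
    obtain ⟨c₂, hc₂, h2⟩ := exists_bwd_le T ξ R hΓ hδ (a := 1 / 12) (by norm_num) (by norm_num)
    refine ⟨max c₁ c₂, fun _ w γ h => ⟨fun t x hz => ?_, fun t x hz => ?_⟩⟩
    · rw [domP, if_pos rfl] at hz
      refine ⟨?_, ?_⟩
      · rw [Nat.cast_zero]
        exact (contDiff_zero.2 (continuous_bwd_slice h.potBound t)).contDiffAt
      · rw [dx, iteratedDeriv_zero, weightP_eq]
        refine (h2 w γ h.potBound h.abs_le (t, x) hz.1.1.1 hz.1.1.2 hz.2).trans ?_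
        gcongr
        · exact gaussWeight_nonneg
        · exact le_max_right _ _
    · rw [domQ, if_pos rfl] at hz
      refine ⟨?_, ?_⟩
      · rw [Nat.cast_zero]
        exact (contDiff_zero.2 (continuous_sol_slice h.potBound hμ (hδ.trans hz.1.1))).contDiffAt
      · rw [dx, iteratedDeriv_zero]
        refine (h1 w h.potBound (t, x) hz.1.1.le hz.1.2).trans ?_
        have := le_max_left c₁ c₂
        gcongr
  · obtain ⟨c, hc, h⟩ := exists_Dx_iterate_le hμ hexp ξ R hΓ k δ hδ (1 / 12) (by norm_num)
      (by norm_num)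
    refine ⟨c, fun _ w γ hcr => ⟨fun t x hz => ?_, fun t x hz => ?_⟩⟩
    · rw [domP, if_neg hk.ne'] at hz
      have hreg := offBoxes_subset_regularSet hδ hz
      refine ⟨?_, ?_⟩
      · exact (contDiffAt_slice ((hcr.regular hμ).1.2.contDiffAt
          ((isOpen_regularSet T ξ).mem_nhds hreg))).of_le (mod_cast le_top)
      · rw [weightP_eq]
        have := (h w γ hcr _ hz k le_rfl).2
        rwa [Dx_iterate_eq] at this
    · rw [domQ, if_neg hk.ne'] at hz
      have hreg := offBoxes_subset_regularSet hδ hz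
      refine ⟨?_, ?_⟩
      · exact (contDiffAt_slice ((hcr.regular hμ).1.1.contDiffAt
          ((isOpen_regularSet T ξ).mem_nhds hreg))).of_le (mod_cast le_top)
      · have := (h w γ hcr _ hz k le_rfl).1
        rwa [Dx_iterate_eq] at this

theorem IsDuhamelForward.congr_ae (h : IsDuhamelForward T μ w q)
    (he : w =ᵐ[volume.restrict (strip T)] w') : IsDuhamelForward T μ w' q := by
  have e : ∀ t x, (fun z : ℝ × ℝ => hk (t - z.1) (x - z.2) * (w z * q z))
      =ᵐ[volume.restrict (strip T)] fun z => hk (t - z.1) (x - z.2) * (w' z * q z) := fun t x => by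
    filter_upwards [he] with z hz
    rw [hz]
  exact ⟨h.continuousOn, fun t ht x => (h.integrable t ht x).congr (e t x), fun t ht x => by
    rw [h.eq t ht x, integral_congr_ae (e t x)]⟩

theorem IsDuhamelBackward.congr_ae (h : IsDuhamelBackward T ξ γ w p)
    (he : w =ᵐ[volume.restrict (strip T)] w') : IsDuhamelBackward T ξ γ w' p := by
  have e : ∀ t x, (fun z : ℝ × ℝ => p z * w z * hk (z.1 - t) (z.2 - x))
      =ᵐ[volume.restrict (strip T)] fun z => p z * w' z * hk (z.1 - t) (z.2 - x) := fun t x => by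
    filter_upwards [he] with z hz
    rw [hz]
  exact ⟨h.continuousOn, fun t ht x => (h.integrable t ht x).congr (e t x), fun t ht x => by
    rw [h.eq t ht x, integral_congr_ae (e t x)]⟩

end

end

end WeakNoise

theorem theorem2p1 (T : ℝ) (hT : 0 < T)
    -- initial condition
    {n : ℕ} (ζ β : Fin n → ℝ) (hζ : StrictMono ζ)
    (f : ℝ → ℝ) (hf_meas : Measurable f) (hf_nonneg : ∀ x, 0 ≤ f x)
    (β₀ : WithBot ℝ) (hf_exp : WeakNoise.ExpBounded β₀ f)
    (hpos : 0 < WeakNoise.initMeasure ζ β f univ)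
    -- terminal condition
    {m : ℕ} (ξ α : Fin m → ℝ) (hξ : StrictMono ξ) :
    (∃ w : ℝ × ℝ → ℝ, WeakNoise.IsMinimizer T (WeakNoise.initMeasure ζ β f) ξ α w) ∧
    -- the constants in the bounds are common to all minimizers (which share the same norm)
    ∃ c : ℝ → ℕ → ℝ, ∀ w q : ℝ × ℝ → ℝ,
      WeakNoise.IsMinimizer T (WeakNoise.initMeasure ζ β f) ξ α w →
      WeakNoise.IsDuhamelForward T (WeakNoise.initMeasure ζ β f) w q →
      -- `q` is positive, so that the quotient `w / q` makes sense
      (∀ t ∈ Ioc 0 T, ∀ x : ℝ, 0 < q (t, x)) ∧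
      -- `p` is `w / q`, after a modification on a null set
      ∃ (p : ℝ × ℝ → ℝ) (γ : Fin m → ℝ),
        (∀ᵐ z ∂(volume.restrict (WeakNoise.strip T)), p z = w z / q z) ∧
        ContDiffOn ℝ ∞ q (Ioo 0 T ×ˢ univ) ∧
        ContDiffOn ℝ ∞ p (Ioo 0 T ×ˢ univ) ∧
        WeakNoise.DerivBounds T ξ c q p ∧
        -- the equations in the Duhamel sense
        WeakNoise.IsDuhamelForward T (WeakNoise.initMeasure ζ β f) (fun z => p z * q z) q ∧
        WeakNoise.IsDuhamelBackward T ξ γ w p ∧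
        WeakNoise.IsDuhamelBackward T ξ γ (fun z => p z * q z) p ∧
        -- the equations in the classical sense
        (∀ t ∈ Ioo 0 T, ∀ x : ℝ,
          WeakNoise.dt q t x =
            (1 / 2) * WeakNoise.dx 2 q t x + p (t, x) * q (t, x) ^ 2) ∧
        (∀ t ∈ Ioo 0 T, ∀ x : ℝ,
          -WeakNoise.dt p t x =
            (1 / 2) * WeakNoise.dx 2 p t x + p (t, x) ^ 2 * q (t, x)) := by
  set μ := WeakNoise.initMeasure ζ β f with hμdef
  have h0 : μ ≠ 0 := fun h => by rw [h] at hpos; simp at hpos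
  have hμ : WeakNoise.HeatFinite μ := WeakNoise.heatFinite_initMeasure hf_meas hf_exp
  have hexp : WeakNoise.ExpFlow T μ := WeakNoise.expFlow_initMeasure hf_meas hf_exp T
  obtain ⟨w₀, hw₀⟩ := WeakNoise.exists_isMinimizer hT hμ h0 hξ.injective α
  -- all minimizers have the same norm `R`, so that the bounds on `Γ` and `c` apply to all of them
  set R := Real.sqrt (2 * WeakNoise.cost T w₀) with hR
  obtain ⟨Γ, hΓ, hcrit⟩ := WeakNoise.exists_critical (α := α) hT hμ h0 hξ.injective R
  choose c hc using fun δ k => WeakNoise.exists_dx_le hμ hexp hΓ ξ R δ k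
  refine ⟨⟨w₀, hw₀⟩, c, fun w q hw hq => ?_⟩
  have hRw : Real.sqrt (2 * WeakNoise.cost T w) ≤ R :=
    Real.sqrt_le_sqrt (by linarith [hw.2 w₀ hw₀.1])
  obtain ⟨γ, hγ⟩ := hcrit w hw hRw
  have hpot := hγ.potBound
  have hqe := hq.eq_fwd hμ hpot
  have hslice : ∀ t ∈ Ioc 0 T, (fun y => q (t, y)) =
      fun y => WeakNoise.fwd μ (WeakNoise.ext T w) (t, y) :=
    fun t ht => funext fun y => hqe (t, y) ⟨ht, mem_univ _⟩
  have hqpos : ∀ t ∈ Ioc 0 T, ∀ x : ℝ, 0 < q (t, x) := fun t ht x => by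
    rw [hqe (t, x) ⟨ht, mem_univ _⟩]
    exact WeakNoise.sol_pos hpot hμ h0 ht.1
  set p := WeakNoise.bwd T ξ γ (WeakNoise.ext T w) with hp
  have hwpq : w =ᵐ[volume.restrict (WeakNoise.strip T)] fun z => p z * q z := by
    filter_upwards [ae_restrict_of_ae hγ.eq_mul, WeakNoise.ae_mem_Ioc T,
      ae_restrict_mem (WeakNoise.measurableSet_strip T)] with z h1 h2 h3
    rw [hqe z h2, ← h1, WeakNoise.ext, indicator_of_mem h3]
  have hsub : Ioo 0 T ×ˢ (univ : Set ℝ) ⊆ WeakNoise.regularSet T ξ := fun z hz =>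
    ⟨hz.1.1, fun i hi => by have := hz.1.2; rw [hi] at this; exact lt_irrefl _ this⟩
  obtain ⟨⟨hqs, hps⟩, heq⟩ := hγ.regular hμ
  have hback := WeakNoise.isDuhamelBackward_bwd ξ γ hpot
  refine ⟨hqpos, p, γ, ?_, ?_, hps.mono hsub, fun δ hδ k => ⟨fun t x hz => ?_, fun t x hz => ?_⟩,
    hq.congr_ae hwpq, hback, hback.congr_ae hwpq, fun t ht x => ?_, fun t ht x => ?_⟩
  · filter_upwards [hwpq, WeakNoise.ae_mem_Ioc T] with z h1 h2
    rw [h1, mul_div_cancel_right₀ _ (hqpos z.1 h2.1 z.2).ne']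
  · exact (hqs.mono hsub).congr fun z hz => hqe z ⟨Ioo_subset_Ioc_self hz.1, hz.2⟩
  · exact (hc δ k hδ _ γ hγ).1 t x hz
  · have ht : t ∈ Ioc 0 T := by
      have : (t, x) ∈ Ioc δ T ×ˢ (univ : Set ℝ) := by
        rw [WeakNoise.domQ] at hz
        split_ifs at hz
        exacts [hz, hz.1]
      exact ⟨hδ.trans this.1.1, this.1.2⟩
    rw [WeakNoise.dx, hslice t ht]
    exact (hc δ k hδ _ γ hγ).2 t x hz
  · have ht' := Ioo_subset_Ioc_self ht
    have h1 := (heq (t, x) (hsub ⟨ht, mem_univ _⟩)).1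
    have h2 : WeakNoise.dt q t x = WeakNoise.Dt (WeakNoise.fwd μ (WeakNoise.ext T w)) (t, x) := by
      refine Filter.EventuallyEq.deriv_eq ?_
      filter_upwards [Ioo_mem_nhds ht.1 ht.2] with s hs
      exact hqe (s, x) ⟨Ioo_subset_Ioc_self hs, mem_univ _⟩
    have h3 : WeakNoise.dx 2 q t x =
        WeakNoise.Dx (WeakNoise.Dx (WeakNoise.fwd μ (WeakNoise.ext T w))) (t, x) := by
      rw [WeakNoise.dx, hslice t ht']
      exact (WeakNoise.Dx_iterate_eq _ 2 (t, x)).symm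
    rw [WeakNoise.heatOp] at h1
    rw [h2, h3, hqe (t, x) ⟨ht', mem_univ _⟩, hp]
    linarith
  · have ht' := Ioo_subset_Ioc_self ht
    have h1 := (heq (t, x) (hsub ⟨ht, mem_univ _⟩)).2
    have h2 : WeakNoise.dx 2 p t x = WeakNoise.Dx (WeakNoise.Dx p) (t, x) :=
      (WeakNoise.Dx_iterate_eq _ 2 (t, x)).symm
    rw [h2, hqe (t, x) ⟨ht', mem_univ _⟩]
    change -WeakNoise.Dt p (t, x) = _
    linarith
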